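/- **Setting.** Let $(\Omega,\mathcal F,\mathbb F=(\mathcal F_t)_{t\ge 0},\mathsf P)$ be a filtered probability space satisfying the standard assumptions ($\mathcal F$ is $\mathsf P$-complete, $\mathbb F$ is right-continuous, $\mathcal F_0$ contains all $\mathsf P$-null sets). Let $h>0$, $\mathbb Z_h=h\mathbb Z$, $\mathbb Z_h^+=\{0,h,2h,\dots\}$, $\mathbb N=\{1,2,\dots\}$. Let $X$ be an upwards skip-free Lévy chain: an $\mathbb F$-adapted Lévy process with increments independent relative to $\mathbb F$ and with all paths càdlàg, which is a compound Poisson process, $\mathsf E[e^{iuX_t}]=\exp\{t\int(e^{iux}-1)\lambda(dx)\}$, with finite Lévy measure $\lambda$, $\lambda(\{0\})=0$, such that $\mathrm{supp}(\lambda)\subset\mathbb Z_h$ and $\mathrm{supp}(\lambda|_{(0,\infty)})=\{h\}$. Put $\overline X_t=\sup_{s\le t}X_s$, $Y=\overline X-X$, $\psi(\beta)=\int(e^{\beta x}-1)\lambda(dx)$ ($\beta\ge 0$); let $\psi'(0+)\in[-\infty,\infty)$ be the right derivative at $0$ and $\Phi(0)$ the largest root of $\psi$ on $[0,\infty)$.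 An excursion (from the maximum) starts immediately when $X$ leaves its running maximum and ends immediately when it returns to it; its length, in $(0,\infty]$, is the time in between. Put $q_n=\lambda(\{-nh\})/\lambda(\mathbb R)$ ($n\in\mathbb N$), $p=\lambda(\{h\})/\lambda(\mathbb R)$, and $a/0=\infty$ for $a\in(0,\infty]$. **Theorem (Reflected process; (inverse) local time; excursions).** (i) $Y$ is a Markov process on $\mathbb Z_h^+$ (started at $0$; more generally $(s\vee\overline X)-X$ is one started at $s\in\mathbb Z_h^+$, with the same transition function), and its generator matrix is $\tilde Q_{ss'}=\lambda(\{s-s'\})-\delta_{ss'}\lambda(\mathbb R)$, $s,s'\in\mathbb Z_h^+$, unless $s=s'=0$, in which case $\tilde Q_{00}=-\lambda((-\infty,0))$. (ii) For $Y$, $0$ is a holding point: a.s. $Y$ starts at $0$ and takes a strictly positive time to leave it. The actual time $L_t$ spent at $0$ by $Y$ up to time $t$ is a local time at the maximum, i.e. $L$ is continuous, nondecreasing, $[0,\infty)$-valued and adapted; a.s. the support of $dL$ is the closure of $\{t:\overline X_t=X_t\}$; and for every stopping time $T$ with $\overline X_T=X_T$ a.s. on $\{T<\infty\}$, the process $(X_{T+t}-X_T,\,Y_{T+t},\,L_{T+t}-L_T)_{t\ge0}$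 is, on $\{T<\infty\}$, independent of $\mathcal F_T$ with the law of $(X_t,Y_t,L_t)_{t\ge0}$. Its right-continuous inverse $L^{-1}_t=\inf\{s\ge0:L_s>t\}$ ($\inf\emptyset=\infty$) is a (possibly killed) compound Poisson subordinator with unit positive drift (with Lévy measure possibly zero). (iii) Assume $\lambda((-\infty,0))>0$. Then $X$ leaves its running maximum with probability $1$, for each $n$ there is an $n$-th excursion with positive probability, and, conditionally on its existence, its expected length is $$\frac{\lambda(\{h\})h-\psi'(0+)}{(\psi'(0+)\vee0)\,\lambda((-\infty,0))}\in(0,\infty],$$ and the probability that it is infinite is $p^*:=\frac{\lambda(\{h\})}{\lambda((-\infty,0))}\left(e^{\Phi(0)h}-1\right)$. (iv) Assume $\lambda((-\infty,0))>0$. Let $N\in\mathbb N\cup\{\infty\}$ be the number of jumps that $X$ makes after having first left its running maximum (not counting the jump by which it leaves) until it returns to it (counting the jump by which it returns). Then for $\theta\ge0$ $$-\log\mathsf E\left[e^{-\theta L^{-1}_1}\mathbf 1_{\{L^{-1}_1<\infty\}}\right]=\theta+\lambda((-\infty,0))\left(1-\sum_{k=1}^\infty\mathsf P(N=k)\left(\frac{\lambda(\mathbb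 R)}{\lambda(\mathbb R)+\theta}\right)^k\right).$$ In particular $p^*<1$, and $L^{-1}$ has killing rate $\lambda((-\infty,0))p^*$, Lévy mass $\lambda((-\infty,0))(1-p^*)$, and its jumps have the law on $(0,\infty)$ of the length of a generic (i.e. of each $n$-th) excursion conditional on its being finite, which is the law of the sum of $N$ independent $\mathrm{Exp}(\lambda(\mathbb R))$ random variables independent of $N$, conditional on $N<\infty$. Moreover, let $p_{l,k}$ be the probability that $X$, started from $-lh$, reaches level $0$ for the first time on precisely the $k$-th jump ($l,k\in\mathbb N$). Then for $k\in\mathbb N$ $$\mathsf P(N=k)=\sum_{l=1}^k\frac{q_l}{1-p}\,p_{l,k},$$ and the $p_{l,k}$ satisfy $p_{l,1}=p\,\delta_{l1}$ ($l\in\mathbb N$) and, for $l,k\in\mathbb N$, $$p_{l,k+1}=\begin{cases}0&\text{if }l=k\text{ or }l>k+1,\\ \sum_{m=1}^{k-1}q_m\,p_{m+1,k}&\text{if }l=1,\\ p^{k+1}&\text{if }l=k+1,\\ p\,p_{l-1,k}+\sum_{m=1}^{k-l}q_m\,p_{m+l,k}&\text{if }1<l<k.\end{cases}$$ -/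

import Mathlib

open MeasureTheory ProbabilityTheory Filter Topology
open scoped NNReal ENNReal

noncomputable section

namespace SkipFree

/-! ### The setting -/

/-- The standard assumptions on a filtered probability space. -/
structure UsualConditions {Ω : Type*} [mΩ : MeasurableSpace Ω] (μ : Measure Ω)
    (ℱ : Filtration ℝ≥0 mΩ) : Prop where
  complete : μ.IsComplete
  rightCont : ℱ.IsRightContinuous
  null_mem : ∀ A : Set Ω, μ A = 0 → MeasurableSet[ℱ 0] A

/-- A path `[0, ∞) → ℝ` which is right-continuous with left limits. -/
def IsCadlagPath (f : ℝ≥0 → ℝ) : Prop :=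
  ∀ t, ContinuousWithinAt f (Set.Ici t) t ∧ ∃ l : ℝ, Tendsto f (𝓝[<] t) (𝓝 l)

/-- A real Lévy process relative to the filtration `ℱ`, all of whose paths are càdlàg. -/
structure IsLevyProcess {Ω : Type*} [mΩ : MeasurableSpace Ω] (μ : Measure Ω)
    (ℱ : Filtration ℝ≥0 mΩ) (X : ℝ≥0 → Ω → ℝ) : Prop where
  adapted : Adapted ℱ X
  cadlag : ∀ ω, IsCadlagPath (fun t => X t ω)
  zero : ∀ᵐ ω ∂μ, X 0 ω = 0
  stationary : ∀ s t : ℝ≥0, s ≤ t →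
    IdentDistrib (fun ω => X t ω - X s ω) (X (t - s)) μ μ
  indep : ∀ s t : ℝ≥0, s ≤ t →
    Indep (MeasurableSpace.comap (fun ω => X t ω - X s ω) inferInstance) (ℱ s) μ

/-- The lattice `h ℤ`. -/
def Zh (h : ℝ) : Set ℝ := {x | ∃ k : ℤ, x = k * h}

/-- The nonnegative part `{0, h, 2h, …}` of the lattice `h ℤ`, for `h > 0`. -/
def ZhPlus (h : ℝ) : Set ℝ := {x | ∃ k : ℕ, x = k * h}

/-- `X` is an upwards skip-free Lévy chain with Lévy measure `lam` and lattice span `h`: a compound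
Poisson process (a Lévy process whose characteristic function is
`exp (t ∫ (e^{iux} - 1) lam(dx))` with `lam` finite, nonzero and without mass at the origin) such
that `lam` is supported by `h ℤ` and its restriction to `(0, ∞)` has support `{h}`.
(That `lam` is nonzero follows from the last condition.) -/
structure IsUpwardsSkipFreeLevyChain {Ω : Type*} [mΩ : MeasurableSpace Ω] (μ : Measure Ω)
    (ℱ : Filtration ℝ≥0 mΩ) (X : ℝ≥0 → Ω → ℝ) (lam : Measure ℝ) (h : ℝ) : Prop where
  levy : IsLevyProcess μ ℱ X
  finite : IsFiniteMeasure lam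
  no_zero : lam {0} = 0
  charFun_eq : ∀ (t : ℝ≥0) (u : ℝ), charFun (μ.map (X t)) u =
    Complex.exp ((t : ℂ) * ∫ x, (Complex.exp (Complex.I * u * x) - 1) ∂lam)
  h_pos : 0 < h
  support_subset : lam.support ⊆ Zh h
  support_pos : (lam.restrict (Set.Ioi 0)).support = {h}

/-! ### Running maximum, reflected process, time at the maximum -/

/-- The running maximum. -/
def runMax {Ω : Type*} (X : ℝ≥0 → Ω → ℝ) (t : ℝ≥0) (ω : Ω) : ℝ :=
  sSup ((fun s => X s ω) '' Set.Icc 0 t)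

/-- The reflected process: running maximum minus the process. -/
def reflected {Ω : Type*} (X : ℝ≥0 → Ω → ℝ) (t : ℝ≥0) (ω : Ω) : ℝ :=
  runMax X t ω - X t ω

/-- The reflected process issued from the level `s ≥ 0` instead of `0`. -/
def reflectedFrom {Ω : Type*} (X : ℝ≥0 → Ω → ℝ) (s : ℝ) (t : ℝ≥0) (ω : Ω) : ℝ :=
  max s (runMax X t ω) - X t ω

/-- The (Lebesgue) time spent at `0` up to time `t` by the process `Y`. -/
def timeAtZero {Ω : Type*} (Y : ℝ≥0 → Ω → ℝ) (t : ℝ≥0) (ω : Ω) : ℝ :=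
  volume.real {s : ℝ | 0 ≤ s ∧ s ≤ t ∧ Y s.toNNReal ω = 0}

/-- The right-continuous inverse `inf {s ≥ 0 : L s > t}`, equal to `∞` if there is no such `s`. -/
def rightInverse {Ω : Type*} (L : ℝ≥0 → Ω → ℝ) (t : ℝ≥0) (ω : Ω) : ℝ≥0∞ :=
  ⨅ (s : ℝ≥0) (_ : (t : ℝ) < L s ω), (s : ℝ≥0∞)

/-! ### Markov chains in continuous time and their generator matrices -/

/-- An honest transition function on the countable state space `S`. -/
structure IsTransitionFunction (S : Set ℝ) (P : ℝ≥0 → S → S → ℝ) : Prop where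
  nonneg : ∀ t x y, 0 ≤ P t x y
  row_sum : ∀ t x, HasSum (P t x) 1
  initial_same : ∀ x, P 0 x x = 1
  semigroup : ∀ s t x y, HasSum (fun z => P s x z * P t z y) (P (s + t) x y)

/-- `Y` is a Markov process relative to `ℱ` on the countable state space `S`, with transition
function `P` and initial state `x₀`. -/
structure IsMarkovChain {Ω : Type*} [mΩ : MeasurableSpace Ω] (μ : Measure Ω)
    (ℱ : Filtration ℝ≥0 mΩ) (S : Set ℝ) (P : ℝ≥0 → S → S → ℝ) (x₀ : ℝ)
    (Y : ℝ≥0 → Ω → ℝ) : Prop where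
  adapted : Adapted ℱ Y
  mem : ∀ᵐ ω ∂μ, ∀ t, Y t ω ∈ S
  initial : ∀ᵐ ω ∂μ, Y 0 ω = x₀
  markov : ∀ (s t : ℝ≥0) (A : Set Ω), MeasurableSet[ℱ s] A → ∀ x y : S,
    μ.real (A ∩ {ω | Y s ω = x} ∩ {ω | Y (s + t) ω = y}) =
      μ.real (A ∩ {ω | Y s ω = x}) * P t x y

/-- `Q` is the generator matrix of the transition function `P`: its entrywise derivative at `0`. -/
def IsGeneratorMatrix (S : Set ℝ) (P : ℝ≥0 → S → S → ℝ) (Q : S → S → ℝ) : Prop :=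
  ∀ x y, HasDerivWithinAt (fun t : ℝ => P t.toNNReal x y) (Q x y) (Set.Ici 0) 0

/-- The matrix `lam {s - s'} - δ_{s s'} lam ℝ`, except for the entry `- lam (-∞, 0)` at
`s = s' = 0`. -/
def reflectedGenerator (lam : Measure ℝ) (h : ℝ) (s s' : ZhPlus h) : ℝ :=
  if (s : ℝ) = 0 ∧ (s' : ℝ) = 0 then - lam.real (Set.Iio 0)
  else lam.real {(s : ℝ) - (s' : ℝ)} - (if (s : ℝ) = (s' : ℝ) then lam.real Set.univ else 0)

/-! ### First entrances and excursions -/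

/-- The infimum of the times in `A` that are at least `a` (`∞` if there is no such time). -/
def firstTime (a : ℝ≥0∞) (A : Set ℝ≥0) : ℝ≥0∞ :=
  ⨅ (t : ℝ≥0) (_ : t ∈ A ∧ a ≤ (t : ℝ≥0∞)), (t : ℝ≥0∞)

/-- `0` is a holding point of `Y`: almost surely `Y` starts from `0` and needs a strictly positive
amount of time to leave it. -/
def IsHoldingPointZero {Ω : Type*} [MeasurableSpace Ω] (μ : Measure Ω)
    (Y : ℝ≥0 → Ω → ℝ) : Prop :=
  ∀ᵐ ω ∂μ, Y 0 ω = 0 ∧ 0 < firstTime 0 {t | Y t ω ≠ 0}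

/-- The starting time of the `n`-th excursion of `Y` away from `0`, `n = 0, 1, …`: the first time
after the end of the preceding excursion at which `Y` is not at `0`
(`∞` if there is no `n`-th excursion). -/
def excursionStart {Ω : Type*} (Y : ℝ≥0 → Ω → ℝ) : ℕ → Ω → ℝ≥0∞
  | 0, ω => firstTime 0 {t | Y t ω ≠ 0}
  | n + 1, ω => firstTime (firstTime (excursionStart Y n ω) {t | Y t ω = 0}) {t | Y t ω ≠ 0}

/-- The end of the `n`-th excursion of `Y` away from `0`: the first return to `0`
(`∞` if there is none). -/
def excursionEnd {Ω : Type*} (Y : ℝ≥0 → Ω → ℝ) (n : ℕ) (ω : Ω) : ℝ≥0∞ :=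
  firstTime (excursionStart Y n ω) {t | Y t ω = 0}

/-- The length of the `n`-th excursion (meaningful where that excursion starts). -/
def excursionLength {Ω : Type*} (Y : ℝ≥0 → Ω → ℝ) (n : ℕ) (ω : Ω) : ℝ≥0∞ :=
  excursionEnd Y n ω - excursionStart Y n ω

/-- The event that there is an `n`-th excursion. -/
def excursionExists {Ω : Type*} (Y : ℝ≥0 → Ω → ℝ) (n : ℕ) : Set Ω :=
  {ω | excursionStart Y n ω < ∞}

/-- The number of jump times of the path `X · ω` in the time interval `(a, b]`. -/
def jumpCount {Ω : Type*} (X : ℝ≥0 → Ω → ℝ) (a b : ℝ≥0∞) (ω : Ω) : ℕ∞ :=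
  Set.encard {t : ℝ≥0 | a < (t : ℝ≥0∞) ∧ (t : ℝ≥0∞) ≤ b ∧ ¬ ContinuousAt (fun s => X s ω) t}

/-- The number `N` of jumps that `X` makes after it has first left its running maximum, up to and
including the jump by which it returns to it. The jump by which it leaves is not counted. -/
def returnJumps {Ω : Type*} (X : ℝ≥0 → Ω → ℝ) (ω : Ω) : ℕ∞ :=
  jumpCount X (excursionStart (reflected X) 0 ω) (excursionEnd (reflected X) 0 ω) ω

/-- The probability `p_{l,k}` that `X`, started at `- l h`, reaches the level `0` for the first time
on precisely its `k`-th jump. -/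
def hitProb {Ω : Type*} [MeasurableSpace Ω] (μ : Measure Ω) (X : ℝ≥0 → Ω → ℝ) (h : ℝ)
    (l k : ℕ) : ℝ :=
  μ.real {ω | firstTime 0 {t | -(l * h) + X t ω = 0} < ∞ ∧
    jumpCount X 0 (firstTime 0 {t | -(l * h) + X t ω = 0}) ω = k}

/-! ### Local time at the maximum and killed compound Poisson subordinators -/

/-- `L` is a local time at the maximum for `X`: a continuous, nondecreasing, `[0, ∞)`-valued,
adapted process such that
* almost surely, the support of the Stieltjes measure `dL` is the closure of the set of times at
  which `X` is at its running maximum;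
* for every stopping time `T` with `X` at its maximum at time `T` almost surely on `{T < ∞}`, the
  process `(X_{T+t} - X_T, reflected X_{T+t}, L_{T+t} - L_T)`, `t ≥ 0`, is on `{T < ∞}`
  independent of `ℱ_T` and has the same law as `(X_t, reflected X_t, L_t)`, `t ≥ 0`. -/
structure IsLocalTimeAtMax {Ω : Type*} [mΩ : MeasurableSpace Ω] (μ : Measure Ω)
    (ℱ : Filtration ℝ≥0 mΩ) (X : ℝ≥0 → Ω → ℝ) (L : ℝ≥0 → Ω → ℝ) : Prop where
  continuous : ∀ ω, Continuous fun t => L t ω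
  monotone : ∀ ω, Monotone fun t => L t ω
  nonneg : ∀ t ω, 0 ≤ L t ω
  adapted : Adapted ℱ L
  support_eq : ∀ᵐ ω ∂μ, ∃ F : StieltjesFunction ℝ, (∀ t : ℝ, F t = L t.toNNReal ω) ∧
    F.measure.support = closure {t : ℝ | 0 ≤ t ∧ runMax X t.toNNReal ω = X t.toNNReal ω}
  regenerative : ∀ (T : Ω → WithTop ℝ≥0) (hT : IsStoppingTime ℱ T),
    (∀ᵐ ω ∂μ, T ω < ⊤ → runMax X ((T ω).untopD 0) ω = X ((T ω).untopD 0) ω) →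
    ∀ (A : Set Ω), MeasurableSet[hT.measurableSpace] A →
    ∀ B : Set (ℝ≥0 → ℝ × ℝ × ℝ), MeasurableSet B →
      μ (A ∩ {ω | T ω < ⊤} ∩
        {ω | (fun t : ℝ≥0 =>
          (X ((T ω).untopD 0 + t) ω - X ((T ω).untopD 0) ω,
            reflected X ((T ω).untopD 0 + t) ω,
            L ((T ω).untopD 0 + t) ω - L ((T ω).untopD 0) ω)) ∈ B}) =
      μ (A ∩ {ω | T ω < ⊤}) *
        μ {ω | (fun t : ℝ≥0 => (X t ω, reflected X t ω, L t ω)) ∈ B}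

/-- `Z` is a (possibly killed) compound Poisson subordinator with drift `d`, killing rate `q` and
finite Lévy measure `Pi` on `(0, ∞)`: a nondecreasing right-continuous `[0, ∞]`-valued process
started at `0` (the value `∞` being the cemetery), with independent stationary increments up to its
lifetime, and with Laplace exponent `q + d θ + ∫ (1 - e^{-θ x}) Pi(dx)`. -/
structure IsKilledCompoundPoissonSubordinator {Ω : Type*} [MeasurableSpace Ω] (μ : Measure Ω)
    (Z : ℝ≥0 → Ω → ℝ≥0∞) (q d : ℝ) (Pi : Measure ℝ) : Prop where
  measurable : ∀ t, Measurable (Z t)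
  zero : ∀ᵐ ω ∂μ, Z 0 ω = 0
  monotone : ∀ ω, Monotone fun t => Z t ω
  rightCont : ∀ ω t, ContinuousWithinAt (fun t => Z t ω) (Set.Ici t) t
  increments : ∀ (s t : ℝ≥0) (A : Set Ω),
    MeasurableSet[⨆ r : Set.Iic s, MeasurableSpace.comap (Z r) inferInstance] A →
    ∀ B : Set ℝ≥0∞, MeasurableSet B →
      μ (A ∩ {ω | Z s ω < ∞} ∩ {ω | Z (s + t) ω - Z s ω ∈ B}) =
        μ (A ∩ {ω | Z s ω < ∞}) * μ {ω | Z t ω ∈ B}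
  killing_nonneg : 0 ≤ q
  drift_nonneg : 0 ≤ d
  finite : IsFiniteMeasure Pi
  positive : Pi (Set.Iic 0) = 0
  laplace : ∀ (t : ℝ≥0) (θ : ℝ), 0 ≤ θ →
    ∫ ω in {ω | Z t ω < ∞}, Real.exp (-θ * (Z t ω).toReal) ∂μ =
      Real.exp (-(t * (q + d * θ + ∫ x, (1 - Real.exp (-θ * x)) ∂Pi)))

/-! ### Characteristics of the chain -/

/-- The Laplace exponent `ψ(β) = ∫ (e^{β x} - 1) lam(dx)`, for real `β ≥ 0`. -/
def psi (lam : Measure ℝ) (β : ℝ) : ℝ := ∫ x, (Real.exp (β * x) - 1) ∂lam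

/-- The right derivative `ψ'(0+)`, as an extended real number (it may be `-∞`). -/
def psiDerivZero (lam : Measure ℝ) : EReal :=
  limUnder (𝓝[>] (0 : ℝ)) fun β : ℝ => (((psi lam β - psi lam 0) / β : ℝ) : EReal)

/-- `Φ(0)`, the largest root of `ψ` on `[0, ∞)`. -/
def phiZero (lam : Measure ℝ) : ℝ := sSup {β | 0 ≤ β ∧ psi lam β = 0}

/-- The quantity `p* = (lam {h} / lam (-∞, 0)) (e^{Φ(0) h} - 1)`. -/
def pStar (lam : Measure ℝ) (h : ℝ) : ℝ :=
  lam.real {h} / lam.real (Set.Iio 0) * (Real.exp (phiZero lam * h) - 1)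

/-- The value `(lam {h} h - ψ'(0+)) / ((ψ'(0+) ∨ 0) lam (-∞, 0))` in `[0, ∞]`, with `a / 0 = ∞` for
`a > 0` (and the numerator being `+∞` if `ψ'(0+) = -∞`). -/
def meanExcursionLength (lam : Measure ℝ) (h : ℝ) : ℝ≥0∞ :=
  (((lam.real {h} * h : ℝ) : EReal) - psiDerivZero lam).toENNReal /
    ((max (psiDerivZero lam) 0).toENNReal * lam (Set.Iio 0))

/-- `q_n = lam {-n h} / lam ℝ`. -/
def qCoef (lam : Measure ℝ) (h : ℝ) (n : ℕ) : ℝ := lam.real {-(n * h)} / lam.real Set.univ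

/-- `p = lam {h} / lam ℝ`. -/
def pCoef (lam : Measure ℝ) (h : ℝ) : ℝ := lam.real {h} / lam.real Set.univ

/-- The law of the sum of `k` independent exponential random variables of rate `r`. -/
def expSumLaw (r : ℝ) (k : ℕ) : Measure ℝ :=
  (Measure.pi fun _ : Fin k => expMeasure r).map fun x => ∑ i, x i

/-- The law of the sum of `N` independent exponential random variables of rate `r`, independent of
`N`, conditionally on `N < ∞` (for `N ≥ 1`). -/
def randomExpSumLaw {Ω : Type*} [MeasurableSpace Ω] (μ : Measure Ω) (N : Ω → ℕ∞) (r : ℝ) :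
    Measure ℝ :=
  Measure.sum fun k : ℕ => (μ[|{ω | N ω < ⊤}] {ω | N ω = (k + 1 : ℕ)}) • expSumLaw r (k + 1)

end SkipFree

end

open SkipFree

/-! The argument reduces the chain to deterministic path functionals plus a strong Markov property.
The characteristic function identifies the law of `X t` as a Poisson mixture of convolution powers
of `lam`. This gives values in `h ℤ` and `P(X t ≥ 2h) = o(t)`. A union bound over fine grids then
excludes upward jumps of more than one lattice step, so off a null set `X = U * h` with `U` a random
element of `SkipFreePath` (`exists_latticeWalk`). From there on, running maximum, reflection, local
time, inverse local time, excursions and jump counts are functionals of an integer path. They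
restart under `pathShift`, and the law of `U` satisfies the strong Markov property
(`IsLatticeWalk.strongMarkov`).

Infinitesimal information comes from one principle (`deriv_of_iff`): two jumps separated by at most
`t`, the first of them before `t`, have probability `O(t²)`, so an event determined by the value at
time `t` outside that exceptional event inherits the derivative at zero of the marginals. Applied to
the reflected path this gives the generator in (i), the Markov property being the flow identity
`reflFrom_add`. Applied to a shift-compatible random time with a mark, it gives an exponential time,
independent of the mark and of the future (`MarkedTime.law`). The first jump and the beginning of
the first excursion are the two instances.

By skip-freeness, an excursion that starts at depth `l` ends exactly when the path after its start
first hits `l` (`exEnd_eq_add`). First-step analysis gives the joint law of hitting time and number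
of jumps (`hit_law`): given `k` jumps, the time is a sum of `k` exponentials. The hitting
probabilities form an `IsHitArray`. Since every level in between must be visited, they convolve, and
the probability of ever hitting `l` is `u ^ l`, with `u` the smallest fixed point of the step
equation. Comparing that equation with `psi = 0` yields `u = e^{-Φ(0)h}` (`exp_phiZero`), hence
`pStar`. Additivity of mean hitting times yields the mean excursion length.

At an inverse local time the path is at its maximum and regenerates, so the Laplace transform of the
inverse is multiplicative in `t`, hence exponential. Its rate is found by squeezing the derivative
at zero between two bounds that involve only the first excursion (`invLaplace_eq`). Splitting that
rate according to whether an excursion is finite gives the killing rate and the Lévy measure.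
Regeneration at the end of the first excursion transfers its law to every later one. -/

noncomputable section

namespace SkipFree

/-! ### First entrance times into right-open sets -/

/-- A set of times that contains a right neighbourhood of each of its points. -/
def RightOpen (A : Set ℝ≥0) : Prop := ∀ t ∈ A, ∃ u, t < u ∧ Set.Ico t u ⊆ A

/-- A countable dense set of times. -/
def denseTime (n : ℕ) : ℝ≥0 := TopologicalSpace.denseSeq ℝ≥0 n

lemma exists_denseTime_between {a b : ℝ≥0} (h : a < b) :
    ∃ n, a < denseTime n ∧ denseTime n < b := by
  obtain ⟨z, ⟨n, rfl⟩, hz⟩ := (TopologicalSpace.denseRange_denseSeq ℝ≥0).exists_between h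
  exact ⟨n, hz.1, hz.2⟩

lemma RightOpen.exists_denseTime {A : Set ℝ≥0} (hA : RightOpen A) {t b : ℝ≥0} (ht : t ∈ A)
    (htb : t < b) : ∃ n, denseTime n ∈ A ∧ t < denseTime n ∧ denseTime n < b := by
  obtain ⟨u, htu, hu⟩ := hA t ht
  obtain ⟨n, h1, h2⟩ := exists_denseTime_between (lt_min htu htb)
  exact ⟨n, hu ⟨h1.le, h2.trans_le (min_le_left _ _)⟩, h1, h2.trans_le (min_le_right _ _)⟩

lemma exists_coe_eq {a : ℝ≥0∞} (h : a ≠ ∞) : ∃ r : ℝ≥0, a = r :=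
  ⟨a.toNNReal, (ENNReal.coe_toNNReal h).symm⟩

lemma firstTime_le {a : ℝ≥0∞} {A : Set ℝ≥0} {t : ℝ≥0} (ht : t ∈ A) (hat : a ≤ t) :
    firstTime a A ≤ t := iInf₂_le t ⟨ht, hat⟩

lemma le_firstTime_iff {a b : ℝ≥0∞} {A : Set ℝ≥0} :
    b ≤ firstTime a A ↔ ∀ t ∈ A, a ≤ (t : ℝ≥0∞) → b ≤ t := by
  simp only [firstTime, le_iInf_iff, and_imp]

lemma le_firstTime (a : ℝ≥0∞) (A : Set ℝ≥0) : a ≤ firstTime a A :=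
  le_firstTime_iff.2 fun _ _ h => h

lemma firstTime_lt_iff {a b : ℝ≥0∞} {A : Set ℝ≥0} :
    firstTime a A < b ↔ ∃ t ∈ A, a ≤ (t : ℝ≥0∞) ∧ (t : ℝ≥0∞) < b := by
  simp only [firstTime, iInf_lt_iff, exists_prop, and_assoc]

lemma notMem_of_lt_firstTime {a : ℝ≥0∞} {A : Set ℝ≥0} {t : ℝ≥0} (hat : a ≤ t)
    (ht : (t : ℝ≥0∞) < firstTime a A) : t ∉ A := fun h =>
  (firstTime_le h hat).not_gt ht

lemma firstTime_top (A : Set ℝ≥0) : firstTime ∞ A = ∞ := top_le_iff.1 (le_firstTime _ _)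

/-- A point of a right-open set can be pushed slightly to the right into a fixed countable dense
set, so entrance times are decided by countably many observations. All measurability of entrance
times rests on this. -/
lemma firstTime_lt_iff_denseTime {a : ℝ≥0∞} {b : ℝ≥0∞} {A : Set ℝ≥0} (hA : RightOpen A) :
    firstTime a A < b ↔ ∃ n, denseTime n ∈ A ∧ a ≤ (denseTime n : ℝ≥0∞) ∧
      (denseTime n : ℝ≥0∞) < b := by
  rw [firstTime_lt_iff]
  refine ⟨?_, fun ⟨n, h⟩ => ⟨_, h⟩⟩
  rintro ⟨t, htA, hat, htb⟩
  obtain ⟨c, htc, hcb⟩ := ENNReal.lt_iff_exists_nnreal_btwn.1 htb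
  obtain ⟨n, h1, h2, h3⟩ := hA.exists_denseTime htA (by exact_mod_cast htc)
  exact ⟨n, h1, hat.trans (by exact_mod_cast h2.le), lt_trans (by exact_mod_cast h3) hcb⟩

/-- If the infimum were outside `A`, a whole right neighbourhood of it would be too, and the infimum
would be larger. -/
lemma mem_of_firstTime_eq {a : ℝ≥0∞} {A : Set ℝ≥0} (hA : RightOpen Aᶜ) {r : ℝ≥0}
    (hr : firstTime a A = r) : r ∈ A := by
  by_contra h
  obtain ⟨u, hru, hu⟩ := hA r h
  have : (u : ℝ≥0∞) ≤ firstTime a A := le_firstTime_iff.2 fun t ht hat => by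
    have h1 : r ≤ t := by exact_mod_cast hr ▸ firstTime_le ht hat
    by_contra h2
    exact hu ⟨h1, by exact_mod_cast not_le.1 h2⟩ ht
  rw [hr] at this
  exact hru.not_ge (by exact_mod_cast this)

lemma firstTime_add (r : ℝ≥0) (a : ℝ≥0∞) (A : Set ℝ≥0) :
    firstTime (r + a) A = r + firstTime a {t | r + t ∈ A} := by
  apply le_antisymm
  · rw [firstTime, firstTime, ENNReal.add_iInf]
    refine le_iInf fun t => ?_
    by_cases h : t ∈ {t | r + t ∈ A} ∧ a ≤ (t : ℝ≥0∞)
    · rw [iInf_pos h]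
      refine (iInf₂_le (r + t) ⟨h.1, ?_⟩).trans (by simp)
      rw [ENNReal.coe_add]
      exact add_le_add le_rfl h.2
    · have : (⨅ (_ : t ∈ {t | r + t ∈ A} ∧ a ≤ (t : ℝ≥0∞)), (t : ℝ≥0∞)) = ∞ := by
        simp only [h, iInf_false]
      rw [this]; simp
  · refine le_firstTime_iff.2 fun t ht hat => ?_
    have hrt : r ≤ t := by
      have : (r : ℝ≥0∞) ≤ t := le_trans le_self_add hat
      exact_mod_cast this
    obtain ⟨s, rfl⟩ := exists_add_of_le hrt
    push_cast at hat ⊢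
    gcongr
    exact firstTime_le ht ((ENNReal.add_le_add_iff_left ENNReal.coe_ne_top).1 hat)

lemma firstTime_coe (r : ℝ≥0) (A : Set ℝ≥0) :
    firstTime r A = r + firstTime 0 {t | r + t ∈ A} := by
  simpa using firstTime_add r 0 A

lemma firstTime_congr_start {a b : ℝ≥0∞} {A : Set ℝ≥0} (hab : a ≤ b)
    (h : ∀ t ∈ A, a ≤ (t : ℝ≥0∞) → b ≤ t) : firstTime a A = firstTime b A :=
  le_antisymm (le_firstTime_iff.2 fun _ ht hbt => firstTime_le ht (hab.trans hbt))
    (le_firstTime_iff.2 fun t ht hat => firstTime_le ht (h t ht hat))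

/-! ### Skip-free lattice paths -/

/-- An integer-valued path started at `0`, which is a right-continuous step function without
accumulation of jumps, with jumps of height at most `1`. -/
structure IsSkipFreePath (w : ℝ≥0 → ℤ) : Prop where
  zero : w 0 = 0
  right : ∀ t, ∃ u, t < u ∧ ∀ s ∈ Set.Ico t u, w s = w t
  left : ∀ t, 0 < t → ∃ k : ℤ, w t ≤ k + 1 ∧ ∃ u < t, ∀ s ∈ Set.Ioo u t, w s = k

/-- The space of skip-free lattice paths. -/
abbrev SkipFreePath := {w : ℝ≥0 → ℤ // IsSkipFreePath w}

/-- The running maximum of an integer path. -/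
def pathMax (w : ℝ≥0 → ℤ) (t : ℝ≥0) : ℤ := sSup (w '' Set.Icc 0 t)

/-- The integer path reflected at its running maximum. -/
def pathRefl (w : ℝ≥0 → ℤ) (t : ℝ≥0) : ℤ := pathMax w t - w t

/-- The increments of the path after time `r`. -/
def pathShift (r : ℝ≥0) (w : ℝ≥0 → ℤ) (t : ℝ≥0) : ℤ := w (r + t) - w r

namespace IsSkipFreePath
variable {w : ℝ≥0 → ℤ}

lemma rightOpen (hw : IsSkipFreePath w) (C : Set ℤ) : RightOpen {t | w t ∈ C} := fun t ht => by
  obtain ⟨u, htu, hu⟩ := hw.right t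
  exact ⟨u, htu, fun s hs => by simpa [hu s hs] using ht⟩

lemma shift (hw : IsSkipFreePath w) (r : ℝ≥0) : IsSkipFreePath (pathShift r w) where
  zero := by simp [pathShift]
  right t := by
    obtain ⟨u, htu, hu⟩ := hw.right (r + t)
    refine ⟨u - r, lt_tsub_iff_left.2 htu, fun s hs => ?_⟩
    simp only [pathShift]
    rw [hu (r + s) ⟨by gcongr; exact hs.1, lt_tsub_iff_left.1 hs.2⟩]
  left t ht := by
    obtain ⟨k, hk, u, hut, hu⟩ := hw.left (r + t) (by positivity)
    refine ⟨k - w r, by simp only [pathShift]; omega, u - r, ?_, fun s hs => ?_⟩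
    · rcases le_or_gt u r with h | h
      · rwa [tsub_eq_zero_of_le h]
      · rw [tsub_lt_iff_left h.le]; exact hut
    · simp only [pathShift]
      rw [hu (r + s) ⟨lt_of_le_of_lt le_add_tsub (by gcongr; exact hs.1), by gcongr; exact hs.2⟩]

/-- Compactness: near each time the path takes at most two values, one on the left and one on the
right. -/
lemma finite_image (hw : IsSkipFreePath w) (t : ℝ≥0) : (w '' Set.Icc 0 t).Finite := by
  refine isCompact_Icc.induction_on (p := fun s => (w '' s).Finite) (by simp)
    (fun s t hst h => h.subset (Set.image_mono hst))
    (fun s t hs ht => by rw [Set.image_union]; exact hs.union ht) fun x _ => ?_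
  suffices ∃ t ∈ 𝓝 x, (w '' t).Finite by
    obtain ⟨t, ht, h⟩ := this
    exact ⟨t, mem_nhdsWithin_of_mem_nhds ht, h⟩
  obtain ⟨u, hxu, hu⟩ := hw.right x
  rcases eq_or_lt_of_le (zero_le : 0 ≤ x) with rfl | hx
  · refine ⟨Set.Iio u, Iio_mem_nhds hxu, (Set.finite_singleton (w 0)).subset ?_⟩
    rintro _ ⟨s, hs, rfl⟩
    exact hu s ⟨zero_le, hs⟩
  · obtain ⟨k, -, v, hvx, hv⟩ := hw.left x hx
    refine ⟨Set.Ioo v u, Ioo_mem_nhds hvx hxu, (Set.toFinite {k, w x}).subset ?_⟩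
    rintro _ ⟨s, hs, rfl⟩
    rcases lt_or_ge s x with h | h
    · left; exact hv s ⟨hs.1, h⟩
    · right; exact hu s ⟨h, hs.2⟩

lemma exists_eq_pathMax (hw : IsSkipFreePath w) (t : ℝ≥0) : ∃ s ≤ t, w s = pathMax w t := by
  obtain ⟨s, hs, h⟩ := Int.csSup_mem (s := w '' Set.Icc 0 t)
    ((Set.nonempty_Icc.2 zero_le).image w) (hw.finite_image t).bddAbove
  exact ⟨s, hs.2, h⟩

lemma le_pathMax (hw : IsSkipFreePath w) {s t : ℝ≥0} (h : s ≤ t) : w s ≤ pathMax w t :=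
  le_csSup (hw.finite_image t).bddAbove ⟨s, ⟨zero_le, h⟩, rfl⟩

lemma pathMax_le (hw : IsSkipFreePath w) {t : ℝ≥0} {m : ℤ} (h : ∀ s ≤ t, w s ≤ m) :
    pathMax w t ≤ m := by
  obtain ⟨s, hs, h'⟩ := hw.exists_eq_pathMax t
  exact h' ▸ h s hs

lemma le_pathMax_iff (hw : IsSkipFreePath w) {t : ℝ≥0} {m : ℤ} :
    m ≤ pathMax w t ↔ ∃ s ≤ t, m ≤ w s := by
  refine ⟨fun h => ?_, fun ⟨s, hs, h⟩ => h.trans (hw.le_pathMax hs)⟩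
  obtain ⟨s, hs, h'⟩ := hw.exists_eq_pathMax t
  exact ⟨s, hs, h' ▸ h⟩

lemma pathMax_mono (hw : IsSkipFreePath w) : Monotone (pathMax w) := fun _ _ hst =>
  hw.pathMax_le fun _ hr => hw.le_pathMax (hr.trans hst)

lemma pathMax_nonneg (hw : IsSkipFreePath w) (t : ℝ≥0) : 0 ≤ pathMax w t :=
  hw.zero ▸ hw.le_pathMax zero_le

lemma pathRefl_nonneg (hw : IsSkipFreePath w) (t : ℝ≥0) : 0 ≤ pathRefl w t :=
  sub_nonneg.2 (hw.le_pathMax le_rfl)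

lemma pathMax_zero (hw : IsSkipFreePath w) : pathMax w 0 = 0 :=
  le_antisymm (hw.pathMax_le fun s hs => by rw [nonpos_iff_eq_zero.1 hs, hw.zero])
    (hw.pathMax_nonneg 0)

lemma pathRefl_zero (hw : IsSkipFreePath w) : pathRefl w 0 = 0 := by
  simp [pathRefl, hw.pathMax_zero, hw.zero]

/-- Measured from the current position `w r`, the old maximum stands at height `pathRefl w r`, and
the new maximum is the larger of this and of the maximum of the shifted path. The Markov property of
the reflected process comes from here. -/
lemma pathMax_add (hw : IsSkipFreePath w) (r t : ℝ≥0) :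
    pathMax w (r + t) = w r + max (pathRefl w r) (pathMax (pathShift r w) t) := by
  apply le_antisymm
  · refine hw.pathMax_le fun s hs => ?_
    rcases le_total s r with h | h
    · have := hw.le_pathMax h
      have := le_max_left (pathRefl w r) (pathMax (pathShift r w) t)
      simp only [pathRefl] at *
      omega
    · obtain ⟨u, rfl⟩ := exists_add_of_le h
      have := (hw.shift r).le_pathMax (le_of_add_le_add_left hs)
      have := le_max_right (pathRefl w r) (pathMax (pathShift r w) t)
      simp only [pathShift] at *
      omega
  · rcases le_total (pathRefl w r) (pathMax (pathShift r w) t) with h | h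
    · rw [max_eq_right h]
      obtain ⟨s, hs, h'⟩ := (hw.shift r).exists_eq_pathMax t
      rw [← h', pathShift, add_sub_cancel]
      exact hw.le_pathMax (by gcongr)
    · rw [max_eq_left h, pathRefl, add_sub_cancel]
      exact hw.pathMax_mono le_self_add

lemma pathRefl_add (hw : IsSkipFreePath w) (r t : ℝ≥0) :
    pathRefl w (r + t) =
      max (pathRefl w r) (pathMax (pathShift r w) t) - pathShift r w t := by
  rw [pathRefl, hw.pathMax_add r t, pathShift]; ring

/-- Regeneration on the level of paths: at a time at the maximum the past leaves no trace in the
reflected path. -/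
lemma pathRefl_add_of_eq_zero (hw : IsSkipFreePath w) {r : ℝ≥0} (hr : pathRefl w r = 0)
    (t : ℝ≥0) : pathRefl w (r + t) = pathRefl (pathShift r w) t := by
  rw [hw.pathRefl_add, hr, max_eq_right ((hw.shift r).pathMax_nonneg t), pathRefl]

lemma pathRefl_right (hw : IsSkipFreePath w) (t : ℝ≥0) :
    ∃ u, t < u ∧ ∀ s ∈ Set.Ico t u, pathRefl w s = pathRefl w t := by
  obtain ⟨u, htu, hu⟩ := hw.right t
  refine ⟨u, htu, fun s hs => ?_⟩
  rw [pathRefl, pathRefl, hu s hs, sub_left_inj]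
  refine le_antisymm (hw.pathMax_le fun r hr => ?_) (hw.pathMax_mono hs.1)
  rcases le_total r t with h | h
  · exact hw.le_pathMax h
  · rw [hu r ⟨h, hr.trans_lt hs.2⟩]
    exact hw.le_pathMax le_rfl

lemma rightOpen_pathRefl (hw : IsSkipFreePath w) (C : Set ℤ) :
    RightOpen {t | pathRefl w t ∈ C} := fun t ht => by
  obtain ⟨u, htu, hu⟩ := hw.pathRefl_right t
  exact ⟨u, htu, fun s hs => by simpa [hu s hs] using ht⟩

/-- A skip-free path visits all levels between an earlier and a later, higher one. -/
lemma exists_eq_of_le (hw : IsSkipFreePath w) {s t : ℝ≥0} (hst : s ≤ t) {l : ℤ} (hs : w s ≤ l)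
    (ht : l ≤ w t) : ∃ u, s ≤ u ∧ u ≤ t ∧ w u = l := by
  have hlt : firstTime s {u | l ≤ w u} ≤ t := firstTime_le ht (by exact_mod_cast hst)
  obtain ⟨r, hr⟩ := exists_coe_eq (ne_top_of_le_ne_top ENNReal.coe_ne_top hlt)
  have hrl : l ≤ w r := mem_of_firstTime_eq (A := {u | l ≤ w u})
    (hw.rightOpen {k | ¬ l ≤ k}) hr
  have hsr : s ≤ r := by exact_mod_cast hr ▸ le_firstTime s {u | l ≤ w u}
  have hrt : r ≤ t := by exact_mod_cast hr ▸ hlt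
  refine ⟨r, hsr, hrt, le_antisymm ?_ hrl⟩
  rcases eq_or_lt_of_le hsr with rfl | hsr
  · exact hs
  -- Just before the first entrance into `[l, ∞)` the path is below `l`, and a jump of height at
  -- most one cannot overshoot `l`.
  · obtain ⟨k, hk, v, hvr, hv⟩ := hw.left r (hsr.trans_le' zero_le)
    obtain ⟨u, h1, h2⟩ := exists_between (max_lt hsr hvr)
    have hu : u ∉ {u | l ≤ w u} := notMem_of_lt_firstTime (a := s)
      (by exact_mod_cast ((le_max_left _ _).trans h1.le)) (by rw [hr]; exact_mod_cast h2)
    have := hv u ⟨(le_max_right _ _).trans_lt h1, h2⟩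
    simp only [Set.mem_ofPred_eq, not_le] at hu
    omega

end IsSkipFreePath

/-! ### First jump, hitting times, number of jumps, first excursion of a path -/

/-- The first time at which the path is not at `0`. -/
def firstJump (w : ℝ≥0 → ℤ) : ℝ≥0∞ := firstTime 0 {t | w t ≠ 0}

/-- The first time at which the path is at the level `l`. -/
def hitTime (w : ℝ≥0 → ℤ) (l : ℤ) : ℝ≥0∞ := firstTime 0 {t | w t = l}

/-- The number of jumps of the path in the time interval `(a, b]`. -/
def pathJumps (w : ℝ≥0 → ℤ) (a b : ℝ≥0∞) : ℕ∞ :=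
  Set.encard {t : ℝ≥0 | a < (t : ℝ≥0∞) ∧ (t : ℝ≥0∞) ≤ b ∧ ¬ ContinuousAt w t}

/-- The number of jumps of the path until it hits the level `l`. -/
def hitJumps (w : ℝ≥0 → ℤ) (l : ℤ) : ℕ∞ := pathJumps w 0 (hitTime w l)

/-- The first time at which the path is away from its running maximum. -/
def exStart (w : ℝ≥0 → ℤ) : ℝ≥0∞ := firstTime 0 {t | pathRefl w t ≠ 0}

/-- The end of the first excursion of the path away from its running maximum. -/
def exEnd (w : ℝ≥0 → ℤ) : ℝ≥0∞ := firstTime (exStart w) {t | pathRefl w t = 0}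

/-- The time must be positive: at time `0` the shifted path no longer sees what lies to the left of
`r`. -/
lemma continuousAt_pathShift_iff {w : ℝ≥0 → ℤ} {r t : ℝ≥0} (ht : 0 < t) :
    ContinuousAt (pathShift r w) t ↔ ContinuousAt w (r + t) := by
  constructor
  · intro h
    have h1 : ContinuousAt (fun s => pathShift r w (s - r) + w r) (r + t) := by
      refine ContinuousAt.add ?_ continuousAt_const
      have : ContinuousAt (pathShift r w) ((r + t) - r) := by rwa [add_tsub_cancel_left]
      exact this.comp (f := fun s => s - r) (by fun_prop)
    refine h1.congr ?_
    filter_upwards [Ioi_mem_nhds (show r < r + t from lt_add_of_pos_right r ht)] with s hs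
    simp only [pathShift]
    rw [add_tsub_cancel_of_le (le_of_lt hs), sub_add_cancel]
  · intro h
    exact ContinuousAt.sub (h.comp (f := fun s => r + s) (by fun_prop)) continuousAt_const

lemma pathJumps_add (w : ℝ≥0 → ℤ) (r : ℝ≥0) (a b : ℝ≥0∞) :
    pathJumps w (r + a) (r + b) = pathJumps (pathShift r w) a b := by
  rw [pathJumps, pathJumps, ← (add_right_injective r).encard_image
    {t : ℝ≥0 | a < (t : ℝ≥0∞) ∧ (t : ℝ≥0∞) ≤ b ∧ ¬ ContinuousAt (pathShift r w) t}]
  congr 1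
  refine Set.ext fun t => ?_
  simp only [Set.mem_ofPred_eq, Set.mem_image]
  constructor
  · rintro ⟨h1, h2, h3⟩
    have hrt : r < t := by
      have : (r : ℝ≥0∞) < t := lt_of_le_of_lt le_self_add h1
      exact_mod_cast this
    obtain ⟨s, rfl⟩ := exists_add_of_le hrt.le
    push_cast at h1 h2
    have h1 := (ENNReal.add_lt_add_iff_left ENNReal.coe_ne_top).1 h1
    refine ⟨s, ⟨h1, (ENNReal.add_le_add_iff_left ENNReal.coe_ne_top).1 h2, ?_⟩, rfl⟩
    rwa [continuousAt_pathShift_iff (pos_of_lt_add_right hrt)]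
  · rintro ⟨s, ⟨h1, h2, h3⟩, rfl⟩
    have hs : 0 < s := by exact_mod_cast lt_of_le_of_lt zero_le h1
    rw [continuousAt_pathShift_iff hs] at h3
    refine ⟨?_, ?_, h3⟩
    · push_cast; exact ENNReal.add_lt_add_left ENNReal.coe_ne_top h1
    · push_cast; gcongr

/-! ### Decomposition of a path at its first jump -/

namespace IsSkipFreePath
variable {w : ℝ≥0 → ℤ}

lemma firstJump_pos (hw : IsSkipFreePath w) : 0 < firstJump w := by
  obtain ⟨u, hu, h⟩ := hw.right 0
  refine lt_of_lt_of_le (show (0 : ℝ≥0∞) < u by exact_mod_cast hu)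
    (le_firstTime_iff.2 fun t ht _ => ?_)
  by_contra htu
  exact ht ((h t ⟨zero_le, by exact_mod_cast not_le.1 htu⟩).trans hw.zero)

lemma eq_zero_of_lt_firstJump {t : ℝ≥0} (ht : (t : ℝ≥0∞) < firstJump w) : w t = 0 := by
  simpa using notMem_of_lt_firstTime zero_le ht

lemma ne_zero_of_firstJump_eq (hw : IsSkipFreePath w) {r : ℝ≥0} (hr : firstJump w = r) :
    w r ≠ 0 :=
  mem_of_firstTime_eq (A := {t | w t ≠ 0}) (hw.rightOpen {k | ¬ k ≠ 0}) hr

lemma lt_firstJump_iff (hw : IsSkipFreePath w) {t : ℝ≥0} :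
    (t : ℝ≥0∞) < firstJump w ↔ ∀ s ≤ t, w s = 0 := by
  refine ⟨fun h s hs => eq_zero_of_lt_firstJump (lt_of_le_of_lt (by exact_mod_cast hs) h),
    fun h => ?_⟩
  by_contra hlt
  obtain ⟨r, hr⟩ := exists_coe_eq (ne_top_of_le_ne_top ENNReal.coe_ne_top (not_lt.1 hlt))
  refine hw.ne_zero_of_firstJump_eq hr (h r ?_)
  rw [hr] at hlt
  exact_mod_cast not_lt.1 hlt

lemma le_one_of_firstJump_eq (hw : IsSkipFreePath w) {r : ℝ≥0} (hr : firstJump w = r) :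
    w r ≤ 1 := by
  have hr0 : 0 < r := by exact_mod_cast hr ▸ hw.firstJump_pos
  obtain ⟨k, hk, u, hu, h⟩ := hw.left r hr0
  obtain ⟨v, h1, h2⟩ := exists_between hu
  have := h v ⟨h1, h2⟩
  rw [eq_zero_of_lt_firstJump (w := w) (by rw [hr]; exact_mod_cast h2)] at this
  omega

lemma hitTime_zero (hw : IsSkipFreePath w) : hitTime w 0 = 0 :=
  nonpos_iff_eq_zero.1 (firstTime_le (A := {t | w t = 0}) hw.zero zero_le)

/-- Before the first jump the path sits at `0 ≠ l`, so the search for `l` may as well begin at the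
jump, with the target displaced by its height. -/
lemma hitTime_eq_add {r : ℝ≥0} (hr : firstJump w = r) {l : ℤ} (hl : l ≠ 0) :
    hitTime w l = r + hitTime (pathShift r w) (l - w r) := by
  rw [hitTime, firstTime_congr_start (b := r) zero_le, firstTime_coe, hitTime]
  · congr 2
    refine Set.ext fun t => ?_
    simp only [pathShift, Set.mem_ofPred_eq]
    omega
  · rintro t ht -
    rw [← hr]
    refine firstTime_le ?_ zero_le
    rw [Set.mem_ofPred_eq] at ht ⊢
    rwa [ht]

lemma hitJumps_zero (hw : IsSkipFreePath w) : hitJumps w 0 = 0 := by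
  rw [hitJumps, hw.hitTime_zero, pathJumps, Set.encard_eq_zero]
  ext t
  simp only [Set.mem_ofPred_eq, Set.mem_empty_iff_false, iff_false]
  rintro ⟨h1, h2, -⟩
  exact h1.not_ge h2

lemma continuousAt_of_lt_firstJump {t : ℝ≥0} (ht : (t : ℝ≥0∞) < firstJump w) :
    ContinuousAt w t := by
  obtain ⟨u, h1, h2⟩ := ENNReal.lt_iff_exists_nnreal_btwn.1 ht
  refine (continuousAt_const (y := (0 : ℤ))).congr ?_
  filter_upwards [Iio_mem_nhds (show t < u by exact_mod_cast h1)] with s hs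
  exact (eq_zero_of_lt_firstJump (lt_trans (by exact_mod_cast hs) h2)).symm

lemma not_continuousAt_firstJump (hw : IsSkipFreePath w) {r : ℝ≥0} (hr : firstJump w = r) :
    ¬ ContinuousAt w r := by
  intro h
  have hr0 : 0 < r := by exact_mod_cast hr ▸ hw.firstJump_pos
  have h1 : ∀ᶠ s in 𝓝 r, w s = w r := h (IsOpen.mem_nhds (isOpen_discrete {w r}) rfl)
  obtain ⟨l, hl, hu⟩ := exists_Ioc_subset_of_mem_nhds h1 ⟨0, hr0⟩
  obtain ⟨v, h3, h4⟩ := exists_between hl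
  have h5 : w v = w r := hu ⟨h3, h4.le⟩
  rw [eq_zero_of_lt_firstJump (w := w) (by rw [hr]; exact_mod_cast h4)] at h5
  exact hw.ne_zero_of_firstJump_eq hr h5.symm

lemma pathJumps_eq_one_add (hw : IsSkipFreePath w) {r : ℝ≥0} (hr : firstJump w = r) (b : ℝ≥0∞) :
    pathJumps w 0 (r + b) = 1 + pathJumps (pathShift r w) 0 b := by
  have hr0 : 0 < r := by exact_mod_cast hr ▸ hw.firstJump_pos
  have h := pathJumps_add w r 0 b
  rw [add_zero] at h
  rw [← h, pathJumps, pathJumps, add_comm 1, ← Set.encard_insert_of_notMem (a := r) (by simp)]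
  congr 1
  refine Set.ext fun t => ?_
  simp only [Set.mem_ofPred_eq, Set.mem_insert_iff]
  constructor
  · rintro ⟨h1, h2, h3⟩
    rcases lt_trichotomy t r with h4 | h4 | h4
    · exact absurd (continuousAt_of_lt_firstJump (by rw [hr]; exact_mod_cast h4)) h3
    · exact Or.inl h4
    · exact Or.inr ⟨by exact_mod_cast h4, h2, h3⟩
  · rintro (rfl | ⟨h1, h2, h3⟩)
    · exact ⟨by exact_mod_cast hr0, le_self_add, hw.not_continuousAt_firstJump hr⟩
    · exact ⟨lt_of_le_of_lt zero_le h1, h2, h3⟩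

lemma hitJumps_eq_one_add (hw : IsSkipFreePath w) {r : ℝ≥0} (hr : firstJump w = r) {l : ℤ}
    (hl : l ≠ 0) : hitJumps w l = 1 + hitJumps (pathShift r w) (l - w r) := by
  rw [hitJumps, hitTime_eq_add hr hl, hw.pathJumps_eq_one_add hr, hitJumps]

lemma firstJump_eq_add {t : ℝ≥0} (ht : (t : ℝ≥0∞) < firstJump w) :
    firstJump w = t + firstJump (pathShift t w) := by
  rw [firstJump, firstTime_congr_start (b := t) zero_le, firstTime_coe, firstJump]
  · simp only [pathShift, eq_zero_of_lt_firstJump ht, sub_zero]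
    rfl
  · exact fun s hs _ => ht.le.trans (firstTime_le hs zero_le)

/-! ### The first excursion -/

lemma pathRefl_eq_zero_of_lt_exStart {t : ℝ≥0} (ht : (t : ℝ≥0∞) < exStart w) :
    pathRefl w t = 0 := by
  simpa using notMem_of_lt_firstTime zero_le ht

lemma exStart_pos (hw : IsSkipFreePath w) : 0 < exStart w := by
  obtain ⟨u, hu, h⟩ := hw.pathRefl_right 0
  refine lt_of_lt_of_le (show (0 : ℝ≥0∞) < u by exact_mod_cast hu)
    (le_firstTime_iff.2 fun t ht _ => ?_)
  by_contra htu
  exact ht ((h t ⟨zero_le, by exact_mod_cast not_le.1 htu⟩).trans hw.pathRefl_zero)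

lemma pathRefl_exStart_pos (hw : IsSkipFreePath w) {r : ℝ≥0} (hr : exStart w = r) :
    0 < pathRefl w r :=
  lt_of_le_of_ne (hw.pathRefl_nonneg r) (Ne.symm <| mem_of_firstTime_eq
    (A := {t | pathRefl w t ≠ 0}) (hw.rightOpen_pathRefl {k | ¬ k ≠ 0}) hr)

lemma exStart_eq_add (hw : IsSkipFreePath w) {t : ℝ≥0} (ht : ∀ s ≤ t, pathRefl w s = 0) :
    exStart w = t + exStart (pathShift t w) := by
  rw [exStart, firstTime_congr_start (b := t) zero_le, firstTime_coe, exStart]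
  · congr 2
    refine Set.ext fun s => ?_
    simp only [Set.mem_ofPred_eq, hw.pathRefl_add_of_eq_zero (ht t le_rfl)]
  · intro s hs _
    by_contra h
    exact hs (ht s (by exact_mod_cast (not_le.1 h).le))

lemma exStart_eq_of_firstJump_neg (hw : IsSkipFreePath w) {r : ℝ≥0} (hr : firstJump w = r)
    (hneg : w r < 0) : exStart w = r ∧ pathRefl w r = - w r := by
  have hm : pathMax w r = 0 := le_antisymm (hw.pathMax_le fun s hs => by
    rcases eq_or_lt_of_le hs with rfl | h
    · exact hneg.le
    · exact (eq_zero_of_lt_firstJump (by rw [hr]; exact_mod_cast h)).le) (hw.pathMax_nonneg r)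
  have hy : pathRefl w r = - w r := by rw [pathRefl, hm, zero_sub]
  refine ⟨le_antisymm (firstTime_le (by rw [Set.mem_ofPred_eq, hy]; omega) zero_le)
    (le_firstTime_iff.2 fun t ht _ => ?_), hy⟩
  by_contra h
  rw [← hr, not_le] at h
  refine ht (le_antisymm (sub_nonpos.2 ?_) (hw.pathRefl_nonneg t))
  rw [eq_zero_of_lt_firstJump h]
  exact hw.pathMax_le fun s hs => (eq_zero_of_lt_firstJump
    (lt_of_le_of_lt (by exact_mod_cast hs) h)).le

/-- Until the shifted path reaches the initial depth the running maximum is still the old one, and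
since upward jumps have height one the depth cannot be jumped over. Return to the maximum is
therefore a first hitting of a level. -/
lemma exEnd_eq_add (hw : IsSkipFreePath w) {r : ℝ≥0} (hr : exStart w = r) :
    exEnd w = r + hitTime (pathShift r w) (pathRefl w r) := by
  rw [exEnd, hr, firstTime_coe, hitTime]
  congr 1
  have hv := hw.shift r
  set v := pathShift r w
  have hl := hw.pathRefl_exStart_pos hr
  have hset : {t | r + t ∈ {t | pathRefl w t = 0}} =
      {t | max (pathRefl w r) (pathMax v t) - v t = 0} :=
    Set.ext fun t => by simp only [Set.mem_ofPred_eq, hw.pathRefl_add]; rfl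
  rw [hset]
  set l := pathRefl w r
  apply le_antisymm
  · rcases eq_or_ne (firstTime 0 {t | v t = l}) ∞ with h | h
    · rw [h]; exact le_top
    · obtain ⟨s, hs⟩ := exists_coe_eq h
      rw [hs]
      refine firstTime_le ?_ zero_le
      have hsl : v s = l := mem_of_firstTime_eq (A := {t | v t = l})
        (hv.rightOpen {k | ¬ k = l}) hs
      -- A value above `l` at some `u ≤ s` would force a visit to `l` no later than `u`. By
      -- minimality of `s` this gives `u = s`, where the value is exactly `l`.
      have : pathMax v s ≤ l := hv.pathMax_le fun u hu => by
        by_contra hlt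
        obtain ⟨x, -, h2, h3⟩ := hv.exists_eq_of_le (s := 0) (t := u) (l := l) zero_le
          (by rw [hv.zero]; exact hl.le) (not_le.1 hlt).le
        have h4 : firstTime 0 {t | v t = l} ≤ x := firstTime_le h3 zero_le
        rw [hs] at h4
        have h5 : x = s := le_antisymm (h2.trans hu) (by exact_mod_cast h4)
        have h6 : u = s := le_antisymm hu (h5 ▸ h2)
        rw [h6, hsl] at hlt
        exact hlt le_rfl
      change max l (pathMax v s) - v s = 0
      rw [max_eq_left this, hsl, sub_self]
  · refine le_firstTime_iff.2 fun t ht _ => ?_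
    have : l ≤ v t := by
      have h1 : max l (pathMax v t) - v t = 0 := ht
      have := le_max_left l (pathMax v t)
      omega
    obtain ⟨x, -, h2, h3⟩ := hv.exists_eq_of_le (s := 0) (t := t) (l := l) zero_le
      (by rw [hv.zero]; exact hl.le) this
    exact (firstTime_le (A := {t | v t = l}) h3 zero_le).trans (by exact_mod_cast h2)

lemma pathJumps_excursion (hw : IsSkipFreePath w) {r : ℝ≥0} (hr : exStart w = r) :
    pathJumps w (exStart w) (exEnd w) = hitJumps (pathShift r w) (pathRefl w r) := by
  rw [hw.exEnd_eq_add hr, hr, hitJumps, ← pathJumps_add, add_zero]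

lemma pathRefl_exEnd (hw : IsSkipFreePath w) {e : ℝ≥0} (he : exEnd w = e) : pathRefl w e = 0 :=
  mem_of_firstTime_eq (A := {t | pathRefl w t = 0}) (hw.rightOpen_pathRefl {k | ¬ k = 0}) he

end IsSkipFreePath

/-! ### Joint measurability of right-continuous step processes -/

/-- The smallest point of the grid `2⁻ⁿ ℕ` strictly above `s`. -/
def dyadicAbove (n : ℕ) (s : ℝ≥0) : ℝ≥0 := (⌊2 ^ n * s⌋₊ + 1 : ℕ) / 2 ^ n

lemma lt_dyadicAbove (n : ℕ) (s : ℝ≥0) : s < dyadicAbove n s := by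
  rw [dyadicAbove, lt_div_iff₀ (by positivity), mul_comm]
  exact_mod_cast Nat.lt_floor_add_one (2 ^ n * s)

lemma dyadicAbove_le (n : ℕ) (s : ℝ≥0) : dyadicAbove n s ≤ s + (1 / 2) ^ n := by
  rw [dyadicAbove, div_le_iff₀ (by positivity), add_mul, ← mul_pow]
  push_cast
  have := Nat.floor_le (a := 2 ^ n * s) zero_le
  norm_num
  rwa [mul_comm s]

lemma tendsto_dyadicAbove (s : ℝ≥0) : Tendsto (fun n => dyadicAbove n s) atTop (𝓝 s) := by
  refine tendsto_of_tendsto_of_tendsto_of_le_of_le tendsto_const_nhds ?_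
    (fun n => (lt_dyadicAbove n s).le) (fun n => dyadicAbove_le n s)
  simpa using tendsto_const_nhds.add
    (NNReal.tendsto_pow_atTop_nhds_zero_of_lt_one (r := 1 / 2) (by
      rw [div_lt_one (by norm_num)]; norm_num))

lemma eventually_dyadicAbove_mem {s u : ℝ≥0} (h : s < u) :
    ∀ᶠ n in atTop, dyadicAbove n s ∈ Set.Ico s u := by
  filter_upwards [(tendsto_dyadicAbove s).eventually_lt_const h] with n hn
  exact ⟨(lt_dyadicAbove n s).le, hn⟩

/-- Evaluating at grid points just to the right of the time gives measurable approximations, which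
are eventually equal to the true value because paths are constant on the right of each time. -/
lemma measurable_uncurry_of_rightStep {α : Type*} [MeasurableSpace α] {V : ℝ≥0 → α → ℤ}
    (hV : ∀ t, Measurable (V t))
    (hr : ∀ a t, ∃ u, t < u ∧ ∀ s ∈ Set.Ico t u, V s a = V t a) :
    Measurable (fun p : ℝ≥0 × α => V p.1 p.2) := by
  refine measurable_of_tendsto_metrizable (f := fun n (p : ℝ≥0 × α) => V (dyadicAbove n p.1) p.2)
    (fun n => ?_) (tendsto_pi_nhds.2 fun p => ?_)
  · have h1 (g : ℕ → ℝ≥0) : Measurable fun q : ℕ × α => V (g q.1) q.2 :=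
      measurable_from_prod_countable_right fun k => hV (g k)
    have h2 : Measurable fun p : ℝ≥0 × α => (⌊2 ^ n * p.1⌋₊, p.2) :=
      (Nat.measurable_floor.comp (measurable_fst.const_mul _)).prodMk measurable_snd
    have h3 := (h1 fun k => (k + 1 : ℕ) / 2 ^ n).comp h2
    simp only [Function.comp_def] at h3
    simpa only [dyadicAbove] using h3
  · obtain ⟨u, hu, h⟩ := hr p.2 p.1
    refine tendsto_const_nhds.congr' ?_
    filter_upwards [eventually_dyadicAbove_mem hu] with n hn
    exact (h _ hn).symm

/-! ### Occupation times -/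

/-- The time spent in `A` up to time `t`. -/
def occTime (A : Set ℝ≥0) (t : ℝ≥0) : ℝ := volume.real {s : ℝ | 0 ≤ s ∧ s ≤ t ∧ s.toNNReal ∈ A}

lemma occTime_set_subset (A : Set ℝ≥0) (t : ℝ≥0) :
    {s : ℝ | 0 ≤ s ∧ s ≤ t ∧ s.toNNReal ∈ A} ⊆ Set.Icc 0 (t : ℝ) := fun _ hs => ⟨hs.1, hs.2.1⟩

lemma occTime_set_ne_top (A : Set ℝ≥0) (t : ℝ≥0) :
    volume {s : ℝ | 0 ≤ s ∧ s ≤ t ∧ s.toNNReal ∈ A} ≠ ∞ :=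
  ne_top_of_le_ne_top (by simp) (measure_mono (occTime_set_subset A t))

lemma occTime_mono (A : Set ℝ≥0) : Monotone (occTime A) := fun s t hst =>
  measureReal_mono (fun x hx => ⟨hx.1, hx.2.1.trans (by exact_mod_cast hst), hx.2.2⟩)
    (occTime_set_ne_top A t)

lemma occTime_add_le (A : Set ℝ≥0) (r t : ℝ≥0) : occTime A (r + t) ≤ occTime A r + t := by
  have h : volume.real (Set.Ioc (r : ℝ) (r + t)) = t := by simp
  rw [← h]
  refine (measureReal_mono ?_ ?_).trans (measureReal_union_le _ _)
  · intro x hx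
    rcases le_or_gt x r with h | h
    · exact Or.inl ⟨hx.1, h, hx.2.2⟩
    · exact Or.inr ⟨h, by exact_mod_cast hx.2.1⟩
  · exact (measure_union_lt_top (occTime_set_ne_top A r).lt_top (by simp)).ne

lemma occTime_le (A : Set ℝ≥0) (t : ℝ≥0) : occTime A t ≤ t := by
  refine (measureReal_mono (occTime_set_subset A t) (by simp)).trans ?_
  simp

/-- Occupation times are 1-Lipschitz, whatever the set. -/
lemma continuous_occTime (A : Set ℝ≥0) : Continuous (occTime A) := by
  refine LipschitzWith.continuous (K := 1) (LipschitzWith.of_le_add fun s t => ?_)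
  rcases le_total s t with h | h
  · exact (occTime_mono A h).trans (le_add_of_nonneg_right dist_nonneg)
  · obtain ⟨u, rfl⟩ := exists_add_of_le h
    refine (occTime_add_le A t u).trans ?_
    gcongr
    rw [NNReal.dist_eq]
    push_cast
    rw [add_sub_cancel_left]
    exact le_abs_self _

lemma occTime_add {A : Set ℝ≥0} (hA : MeasurableSet A) (r t : ℝ≥0) :
    occTime A (r + t) = occTime A r + occTime {s | r + s ∈ A} t := by
  have h1 : {s : ℝ | 0 ≤ s ∧ s ≤ (r + t : ℝ≥0) ∧ s.toNNReal ∈ A} =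
      {s : ℝ | 0 ≤ s ∧ s ≤ r ∧ s.toNNReal ∈ A} ∪
        {s : ℝ | (r : ℝ) < s ∧ s ≤ (r + t : ℝ≥0) ∧ s.toNNReal ∈ A} := by
    ext s
    simp only [Set.mem_ofPred_eq, Set.mem_union]
    push_cast
    have := r.2
    have := t.2
    constructor
    · rintro ⟨h1, h2, h3⟩
      rcases le_or_gt s r with h | h
      · exact Or.inl ⟨h1, h, h3⟩
      · exact Or.inr ⟨h, h2, h3⟩
    · rintro (⟨h1, h2, h3⟩ | ⟨h1, h2, h3⟩)
      · exact ⟨h1, h2.trans (by simp), h3⟩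
      · exact ⟨r.2.trans h1.le, h2, h3⟩
  have hm : MeasurableSet {s : ℝ | (r : ℝ) < s ∧ s ≤ (r + t : ℝ≥0) ∧ s.toNNReal ∈ A} :=
    (measurableSet_lt measurable_const measurable_id).inter
      ((measurableSet_le measurable_id measurable_const).inter (measurable_real_toNNReal hA))
  have hfin : volume {s : ℝ | (r : ℝ) < s ∧ s ≤ (r + t : ℝ≥0) ∧ s.toNNReal ∈ A} ≠ ∞ :=
    ne_top_of_le_ne_top (b := volume (Set.Icc (r : ℝ) (r + t : ℝ≥0))) (by simp)
      (measure_mono fun s hs => ⟨hs.1.le, hs.2.1⟩)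
  rw [occTime, h1, measureReal_union (Set.disjoint_left.2 fun s hs hs' => hs.2.1.not_gt hs'.1) hm
    (occTime_set_ne_top A r) hfin]
  congr 1
  -- Translation by `r` produces the open condition `0 < s`, whereas `occTime` uses `0 ≤ s`; the
  -- difference is a null set.
  have h2 : volume {s : ℝ | 0 ≤ s ∧ s ≤ t ∧ s.toNNReal ∈ {s | r + s ∈ A}} =
      volume {s : ℝ | 0 < s ∧ s ≤ t ∧ s.toNNReal ∈ {s | r + s ∈ A}} := by
    apply le_antisymm
    · refine (measure_mono (t := {0} ∪
        {s : ℝ | 0 < s ∧ s ≤ t ∧ s.toNNReal ∈ {s | r + s ∈ A}}) fun s hs => ?_).trans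
        ((measure_union_le _ _).trans (by simp))
      rcases eq_or_lt_of_le hs.1 with h | h
      · exact Or.inl h.symm
      · exact Or.inr ⟨h, hs.2⟩
    · exact measure_mono fun s hs => ⟨hs.1.le, hs.2⟩
  rw [occTime, measureReal_def, measureReal_def, h2,
    ← measure_preimage_add volume (r : ℝ)
      {s : ℝ | (r : ℝ) < s ∧ s ≤ (r + t : ℝ≥0) ∧ s.toNNReal ∈ A}]
  congr 2
  ext s
  simp only [Set.mem_preimage, Set.mem_ofPred_eq]
  push_cast
  rw [lt_add_iff_pos_right, add_le_add_iff_left]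
  refine and_congr_right fun h => and_congr_right fun _ => ?_
  rw [Real.toNNReal_add r.coe_nonneg h.le, Real.toNNReal_coe]

lemma occTime_eq_self {A : Set ℝ≥0} {t : ℝ≥0} (h : ∀ s < t, s ∈ A) : occTime A t = t := by
  refine le_antisymm (occTime_le A t) ?_
  have h1 : volume.real (Set.Ico (0 : ℝ) t) = t := by simp
  rw [← h1]
  refine measureReal_mono (fun s hs => ⟨hs.1, hs.2.le, h _ ?_⟩) (occTime_set_ne_top A t)
  rw [Real.toNNReal_lt_iff_lt_coe hs.1]
  exact hs.2

lemma occTime_eq_zero {A : Set ℝ≥0} {t : ℝ≥0} (h : ∀ s < t, s ∉ A) : occTime A t = 0 := by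
  have h1 : volume {s : ℝ | 0 ≤ s ∧ s ≤ t ∧ s.toNNReal ∈ A} = 0 := by
    refine measure_mono_null (t := {(t : ℝ)}) (fun s hs => ?_) (by simp)
    by_contra hne
    refine h _ ?_ hs.2.2
    rw [Real.toNNReal_lt_iff_lt_coe hs.1]
    exact lt_of_le_of_ne hs.2.1 hne
  rw [occTime, measureReal_def, h1, ENNReal.toReal_zero]

/-! ### The local time of a path and its inverse -/

/-- The time spent by the path at its running maximum. -/
def pathLoc (w : ℝ≥0 → ℤ) (t : ℝ≥0) : ℝ := occTime {s | pathRefl w s = 0} t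

/-- The right-continuous inverse of the time spent by the path at its running maximum. -/
def pathInv (w : ℝ≥0 → ℤ) (t : ℝ≥0) : ℝ≥0∞ := firstTime 0 {s | (t : ℝ) < pathLoc w s}

namespace IsSkipFreePath
variable {w : ℝ≥0 → ℤ}

lemma measurable_pathRefl (hw : IsSkipFreePath w) : Measurable (pathRefl w) := by
  have := measurable_uncurry_of_rightStep (α := Unit) (V := fun t _ => pathRefl w t)
    (fun t => measurable_const) (fun _ t => hw.pathRefl_right t)
  have h2 := this.comp (measurable_id.prodMk (measurable_const (a := ())))
  simpa only [Function.comp_def, id] using h2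

lemma measurableSet_pathRefl_eq_zero (hw : IsSkipFreePath w) :
    MeasurableSet {s | pathRefl w s = 0} :=
  hw.measurable_pathRefl (measurableSet_singleton 0)

lemma pathLoc_add (hw : IsSkipFreePath w) {r : ℝ≥0} (hr : pathRefl w r = 0) (t : ℝ≥0) :
    pathLoc w (r + t) = pathLoc w r + pathLoc (pathShift r w) t := by
  rw [pathLoc, occTime_add hw.measurableSet_pathRefl_eq_zero, pathLoc, pathLoc]
  congr 2
  refine Set.ext fun s => ?_
  simp only [Set.mem_ofPred_eq, hw.pathRefl_add_of_eq_zero hr]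

lemma pathLoc_of_le_exStart {t : ℝ≥0} (ht : (t : ℝ≥0∞) ≤ exStart w) : pathLoc w t = t :=
  occTime_eq_self fun s hs => pathRefl_eq_zero_of_lt_exStart
    (lt_of_lt_of_le (by exact_mod_cast hs) ht)

lemma pathLoc_of_le_exEnd (hw : IsSkipFreePath w) {r t : ℝ≥0} (hr : exStart w = r) (hrt : r ≤ t)
    (ht : (t : ℝ≥0∞) ≤ exEnd w) : pathLoc w t = r := by
  obtain ⟨s, rfl⟩ := exists_add_of_le hrt
  rw [pathLoc, occTime_add hw.measurableSet_pathRefl_eq_zero,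
    occTime_eq_zero (t := s), add_zero]
  · exact pathLoc_of_le_exStart (w := w) hr.ge
  · intro u hu
    have h1 : exStart w ≤ (r + u : ℝ≥0) := hr ▸ by exact_mod_cast (le_self_add : r ≤ r + u)
    have h2 : ((r + u : ℝ≥0) : ℝ≥0∞) < (r + s : ℝ≥0) := by
      exact_mod_cast add_lt_add_right hu r
    exact notMem_of_lt_firstTime (A := {t | pathRefl w t = 0}) h1 (h2.trans_le ht)

lemma lt_pathInv (w : ℝ≥0 → ℤ) {s t : ℝ≥0} (h : (s : ℝ≥0∞) < pathInv w t) :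
    pathLoc w s ≤ t := not_lt.1 fun h' => notMem_of_lt_firstTime zero_le h h'

lemma rightOpen_lt_pathLoc (w : ℝ≥0 → ℤ) (c : ℝ) : RightOpen {s | c < pathLoc w s} :=
  fun t ht => ⟨t + 1, by simp, fun _ hs => lt_of_lt_of_le ht (occTime_mono _ hs.1)⟩

/-- By continuity of the local time, the bounds that hold on the left and on the right of `r` both
pass to `r`. -/
lemma pathLoc_pathInv {r t : ℝ≥0} (h : pathInv w t = r) : pathLoc w r = t := by
  apply le_antisymm
  · rcases eq_or_lt_of_le (zero_le : 0 ≤ r) with rfl | hr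
    · exact (occTime_le _ _).trans (by simp)
    · have hc : Tendsto (pathLoc w) (𝓝[<] r) (𝓝 (pathLoc w r)) :=
        ((continuous_occTime _).tendsto r).mono_left nhdsWithin_le_nhds
      have : (𝓝[<] r).NeBot := nhdsLT_neBot_of_exists_lt ⟨0, hr⟩
      refine le_of_tendsto hc ?_
      filter_upwards [self_mem_nhdsWithin] with s hs
      exact lt_pathInv w (by rw [h]; exact_mod_cast hs)
  · have hc : Tendsto (pathLoc w) (𝓝[>] r) (𝓝 (pathLoc w r)) :=
        ((continuous_occTime _).tendsto r).mono_left nhdsWithin_le_nhds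
    refine ge_of_tendsto hc ?_
    filter_upwards [self_mem_nhdsWithin] with s hs
    have : pathInv w t < s := by rw [h]; exact_mod_cast hs
    obtain ⟨u, hu, -, hus⟩ := firstTime_lt_iff.1 this
    exact (le_of_lt hu).trans (occTime_mono _ (by exact_mod_cast hus.le))

/-- Away from the maximum the path would remain so for a while, the local time would be flat on the
right of `r`, and the level `t` would be exceeded only later. -/
lemma pathRefl_pathInv (hw : IsSkipFreePath w) {r t : ℝ≥0} (h : pathInv w t = r) :
    pathRefl w r = 0 := by
  by_contra hne
  obtain ⟨u, hru, hu⟩ := hw.pathRefl_right r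
  have : pathInv w t < u := by rw [h]; exact_mod_cast hru
  obtain ⟨s, hs, -, hsu⟩ := firstTime_lt_iff.1 this
  have hsu : s < u := by exact_mod_cast hsu
  have hrs : r ≤ s := by
    have : pathInv w t ≤ s := firstTime_le hs zero_le
    rw [h] at this
    exact_mod_cast this
  obtain ⟨v, rfl⟩ := exists_add_of_le hrs
  have h1 : pathLoc w (r + v) = pathLoc w r := by
    rw [pathLoc, occTime_add hw.measurableSet_pathRefl_eq_zero,
      occTime_eq_zero (t := v), add_zero, pathLoc]
    intro x hx
    simp only [Set.mem_ofPred_eq]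
    rwa [hu _ ⟨le_self_add, lt_trans (by gcongr) hsu⟩]
  rw [Set.mem_ofPred_eq, h1, pathLoc_pathInv h] at hs
  exact lt_irrefl _ hs

/-- At a time `r` at the maximum the local time splits additively, and no time up to `r` has
accumulated more than `a`; hence the search for local time beyond `a + t` starts afresh at `r`. -/
lemma pathInv_add (hw : IsSkipFreePath w) {r a : ℝ≥0} (hr : pathRefl w r = 0)
    (ha : pathLoc w r = a) (t : ℝ≥0) :
    pathInv w (a + t) = r + pathInv (pathShift r w) t := by
  rw [pathInv, firstTime_congr_start (b := r) zero_le, firstTime_coe, pathInv]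
  · congr 2
    refine Set.ext fun s => ?_
    simp only [Set.mem_ofPred_eq, hw.pathLoc_add hr, ha]
    push_cast
    rw [add_lt_add_iff_left]
  · intro s hs _
    by_contra h
    have h1 : s ≤ r := by exact_mod_cast (not_le.1 h).le
    have h2 : pathLoc w s ≤ a := ha ▸ occTime_mono _ h1
    rw [Set.mem_ofPred_eq] at hs
    push_cast at hs
    have := t.2
    exact absurd hs (not_lt.2 (h2.trans (by simp)))

lemma pathInv_add_pathInv (hw : IsSkipFreePath w) {r s : ℝ≥0} (h : pathInv w s = r) (t : ℝ≥0) :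
    pathInv w (s + t) = r + pathInv (pathShift r w) t :=
  hw.pathInv_add (hw.pathRefl_pathInv h) (pathLoc_pathInv h) t

lemma le_pathInv (w : ℝ≥0 → ℤ) (t : ℝ≥0) : (t : ℝ≥0∞) ≤ pathInv w t :=
  le_firstTime_iff.2 fun s hs _ => by
    have h1 : (t : ℝ) < s := lt_of_lt_of_le hs (occTime_le _ s)
    exact_mod_cast h1.le

lemma pathInv_of_lt_exStart {t : ℝ≥0} (ht : (t : ℝ≥0∞) < exStart w) : pathInv w t = t := by
  refine le_antisymm (le_of_forall_gt fun b hb => ?_) (le_pathInv w t)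
  obtain ⟨s, h1, h2⟩ := ENNReal.lt_iff_exists_nnreal_btwn.1 (lt_min hb ht)
  refine firstTime_lt_iff.2 ⟨s, ?_, zero_le, h2.trans_le (min_le_left _ _)⟩
  rw [Set.mem_ofPred_eq, pathLoc_of_le_exStart (h2.trans_le (min_le_right _ _)).le]
  exact_mod_cast h1

/-- During the first excursion the local time stays equal to `r`, so the inverse skips the whole
excursion and continues from its end. -/
lemma pathInv_of_exStart_le (hw : IsSkipFreePath w) {r t e : ℝ≥0} (hr : exStart w = r)
    (hrt : r ≤ t) (he : exEnd w = e) :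
    pathInv w t = e + pathInv (pathShift e w) (t - r) := by
  have hre : r ≤ e := by
    have : exStart w ≤ exEnd w := le_firstTime _ _
    rw [hr, he] at this
    exact_mod_cast this
  rw [← hw.pathInv_add (hw.pathRefl_exEnd he) (hw.pathLoc_of_le_exEnd hr hre he.ge),
    add_tsub_cancel_of_le hrt]

lemma pathInv_of_exEnd_eq_top (hw : IsSkipFreePath w) {r t : ℝ≥0} (hr : exStart w = r)
    (hrt : r ≤ t) (he : exEnd w = ∞) : pathInv w t = ∞ := by
  refine top_le_iff.1 (le_firstTime_iff.2 fun s hs _ => ?_)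
  exfalso
  rw [Set.mem_ofPred_eq] at hs
  rcases le_total r s with h | h
  · rw [hw.pathLoc_of_le_exEnd hr h (by rw [he]; exact le_top)] at hs
    exact hrt.not_gt (by exact_mod_cast hs)
  · have := hs.trans_le (occTime_le _ s)
    exact (h.trans hrt).not_gt (by exact_mod_cast this)

lemma pathInv_zero (hw : IsSkipFreePath w) : pathInv w 0 = 0 :=
  pathInv_of_lt_exStart (by simpa using hw.exStart_pos)

end IsSkipFreePath

lemma pathInv_mono (w : ℝ≥0 → ℤ) : Monotone (pathInv w) := fun _ _ h =>
  le_firstTime_iff.2 fun _ hs _ =>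
    firstTime_le (lt_of_le_of_lt (by exact_mod_cast h) hs) zero_le

/-! ### Measurability of path functionals -/

section Measurability
variable {α : Type*} [MeasurableSpace α]

lemma measurable_firstTime {a : α → ℝ≥0∞} (ha : Measurable a) {A : α → Set ℝ≥0}
    (hA : ∀ x, RightOpen (A x)) (hm : ∀ t, MeasurableSet {x | t ∈ A x}) :
    Measurable fun x => firstTime (a x) (A x) := by
  refine measurable_of_Iio fun b => ?_
  have : (fun x => firstTime (a x) (A x)) ⁻¹' Set.Iio b = ⋃ n, {x | denseTime n ∈ A x ∧
      a x ≤ (denseTime n : ℝ≥0∞) ∧ (denseTime n : ℝ≥0∞) < b} := by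
    ext x
    simp only [Set.mem_preimage, Set.mem_Iio, firstTime_lt_iff_denseTime (hA x), Set.mem_iUnion,
      Set.mem_ofPred_eq]
  rw [this]
  exact MeasurableSet.iUnion fun n => (hm _).inter
    ((measurableSet_le ha measurable_const).inter (MeasurableSet.const _))

lemma measurable_pathMax_comp {U : α → SkipFreePath} {t : ℝ≥0}
    (hU : ∀ s ≤ t, Measurable fun x => (U x).1 s) : Measurable fun x => pathMax (U x).1 t := by
  refine measurable_of_Ici fun m => ?_
  have : (fun x => pathMax (U x).1 t) ⁻¹' Set.Ici m = {x | m ≤ (U x).1 t} ∪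
      ⋃ n, {x | denseTime n ≤ t ∧ m ≤ (U x).1 (denseTime n)} := by
    ext x
    simp only [Set.mem_preimage, Set.mem_Ici, (U x).2.le_pathMax_iff, Set.mem_union,
      Set.mem_iUnion, Set.mem_ofPred_eq]
    constructor
    · rintro ⟨s, hs, h⟩
      rcases eq_or_lt_of_le hs with rfl | hs
      · exact Or.inl h
      · obtain ⟨n, h1, -, h2⟩ := ((U x).2.rightOpen {k | m ≤ k}).exists_denseTime h hs
        exact Or.inr ⟨n, h2.le, h1⟩
    · rintro (h | ⟨n, h1, h2⟩)
      · exact ⟨t, le_rfl, h⟩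
      · exact ⟨_, h1, h2⟩
  rw [this]
  refine MeasurableSet.union (hU t le_rfl measurableSet_Ici) (MeasurableSet.iUnion fun n => ?_)
  by_cases hn : denseTime n ≤ t
  · simp only [hn, true_and]
    exact hU _ hn measurableSet_Ici
  · simp only [hn, false_and]
    exact MeasurableSet.const _

lemma measurable_pathRefl_comp {U : α → SkipFreePath} {t : ℝ≥0}
    (hU : ∀ s ≤ t, Measurable fun x => (U x).1 s) : Measurable fun x => pathRefl (U x).1 t :=
  (measurable_pathMax_comp hU).sub (hU t le_rfl)

lemma measurable_pathLoc_comp {U : α → SkipFreePath} {t : ℝ≥0}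
    (hU : ∀ s ≤ t, Measurable fun x => (U x).1 s) : Measurable fun x => pathLoc (U x).1 t := by
  -- Capping the time at `t` ensures that only values of the path up to `t` are used; the result
  -- thereby also serves for adaptedness.
  have h1 : Measurable fun p : ℝ≥0 × α => pathRefl (U p.2).1 (min p.1 t) := by
    refine measurable_uncurry_of_rightStep (V := fun s x => pathRefl (U x).1 (min s t))
      (fun s => measurable_pathRefl_comp fun r hr => hU r (hr.trans (min_le_right _ _)))
      fun x s => ?_
    rcases le_or_gt t s with h | h
    · refine ⟨s + 1, by simp, fun r hr => ?_⟩
      rw [min_eq_right h, min_eq_right (h.trans hr.1)]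
    · obtain ⟨u, hu, h'⟩ := (U x).2.pathRefl_right s
      refine ⟨min u t, lt_min hu h, fun r hr => ?_⟩
      rw [min_eq_left h.le, min_eq_left (hr.2.trans_le (min_le_right _ _)).le]
      exact h' r ⟨hr.1, hr.2.trans_le (min_le_left _ _)⟩
  have h2 : Measurable fun p : α × ℝ => pathRefl (U p.1).1 (min p.2.toNNReal t) := by
    have h := h1.comp ((measurable_real_toNNReal.comp (measurable_snd (α := α))).prodMk
      measurable_fst)
    simpa only [Function.comp_def] using h
  have h3 : MeasurableSet {p : α × ℝ | 0 ≤ p.2 ∧ p.2 ≤ t ∧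
      pathRefl (U p.1).1 (min p.2.toNNReal t) = 0} :=
    (measurableSet_le measurable_const measurable_snd).inter
      ((measurableSet_le measurable_snd measurable_const).inter (h2 (measurableSet_singleton 0)))
  have h4 := (measurable_measure_prodMk_left (ν := (volume : Measure ℝ)) h3).ennreal_toReal
  convert h4 using 2 with x
  rw [pathLoc, occTime, measureReal_def]
  congr 2
  ext s
  simp only [Set.mem_ofPred_eq, Set.mem_preimage]
  refine and_congr_right fun hs => and_congr_right fun hst => ?_
  rw [min_eq_left (Real.toNNReal_le_iff_le_coe.2 hst)]

variable {U : α → SkipFreePath} (hU : Measurable U)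
include hU

lemma measurable_path_eval (t : ℝ≥0) : Measurable fun x => (U x).1 t :=
  (measurable_pi_apply t).comp (measurable_subtype_coe.comp hU)

lemma measurable_path_eval_random {r : α → ℝ≥0} (hr : Measurable r) :
    Measurable fun x => (U x).1 (r x) := by
  have h := (measurable_uncurry_of_rightStep (V := fun t x => (U x).1 t)
    (measurable_path_eval hU) fun x t => (U x).2.right t).comp (hr.prodMk measurable_id)
  simpa only [Function.comp_def, id] using h

lemma measurable_pathRefl_random {r : α → ℝ≥0} (hr : Measurable r) :
    Measurable fun x => pathRefl (U x).1 (r x) := by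
  have h := (measurable_uncurry_of_rightStep (V := fun t x => pathRefl (U x).1 t)
    (fun t => measurable_pathRefl_comp fun s _ => measurable_path_eval hU s)
    fun x t => (U x).2.pathRefl_right t).comp (hr.prodMk measurable_id)
  simpa only [Function.comp_def, id] using h

lemma measurable_firstJump_comp : Measurable fun x => firstJump (U x).1 :=
  measurable_firstTime measurable_const (fun x => (U x).2.rightOpen {k | k ≠ 0})
    fun t => measurable_path_eval hU t (measurableSet_singleton 0).compl

lemma measurable_hitTime_comp (l : ℤ) : Measurable fun x => hitTime (U x).1 l :=
  measurable_firstTime measurable_const (fun x => (U x).2.rightOpen {l})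
    fun t => measurable_path_eval hU t (measurableSet_singleton l)

lemma measurable_exStart_comp : Measurable fun x => exStart (U x).1 :=
  measurable_firstTime measurable_const (fun x => (U x).2.rightOpen_pathRefl {k | k ≠ 0})
    fun t => measurable_pathRefl_comp (t := t) (fun s _ => measurable_path_eval hU s)
      (measurableSet_singleton 0).compl

lemma measurable_exEnd_comp : Measurable fun x => exEnd (U x).1 :=
  measurable_firstTime (measurable_exStart_comp hU) (fun x => (U x).2.rightOpen_pathRefl {0})
    fun t => measurable_pathRefl_comp (t := t) (fun s _ => measurable_path_eval hU s)
      (measurableSet_singleton 0)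

lemma measurable_pathInv_comp (t : ℝ≥0) : Measurable fun x => pathInv (U x).1 t :=
  measurable_firstTime measurable_const (fun _ => IsSkipFreePath.rightOpen_lt_pathLoc _ _)
    fun s => measurable_pathLoc_comp (t := s) (fun s _ => measurable_path_eval hU s)
      measurableSet_Ioi

end Measurability

/-- The increments of a skip-free path after time `r`, as a skip-free path. -/
def shiftPath (r : ℝ≥0) (p : SkipFreePath) : SkipFreePath := ⟨pathShift r p.1, p.2.shift r⟩

lemma measurable_skipFreePath {α : Type*} [MeasurableSpace α] {U : α → SkipFreePath}
    (h : ∀ t, Measurable fun x => (U x).1 t) : Measurable U :=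
  Measurable.subtype_mk (f := fun x => (U x).1) (measurable_pi_lambda _ h)

lemma measurable_shiftPath_comp {α : Type*} [MeasurableSpace α] {U : α → SkipFreePath}
    (hU : Measurable U) {r : α → ℝ≥0} (hr : Measurable r) :
    Measurable fun x => shiftPath (r x) (U x) :=
  measurable_skipFreePath fun _ =>
    (measurable_path_eval_random hU (hr.add_const _)).sub (measurable_path_eval_random hU hr)

/-- The skip-free path observed after its first jump. -/
def tailPath (p : SkipFreePath) : SkipFreePath := shiftPath (firstJump p.1).toNNReal p

/-- The height of the first jump of a skip-free path. -/
def firstHeight (p : SkipFreePath) : ℤ := p.1 (firstJump p.1).toNNReal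

lemma measurable_firstJump : Measurable fun p : SkipFreePath => firstJump p.1 :=
  measurable_firstJump_comp measurable_id

lemma measurable_tailPath : Measurable tailPath :=
  measurable_shiftPath_comp measurable_id measurable_firstJump.ennreal_toNNReal

lemma measurable_firstHeight : Measurable firstHeight :=
  measurable_path_eval_random measurable_id measurable_firstJump.ennreal_toNNReal

lemma hitJumps_of_firstJump_eq_top {w : ℝ≥0 → ℤ} (h : firstJump w = ∞) (l : ℤ) :
    hitJumps w l = 0 := by
  rw [hitJumps, pathJumps, Set.encard_eq_zero]
  ext t
  simp only [Set.mem_ofPred_eq, Set.mem_empty_iff_false, iff_false]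
  rintro ⟨-, -, h3⟩
  exact h3 (IsSkipFreePath.continuousAt_of_lt_firstJump (by rw [h]; exact ENNReal.coe_lt_top))

/-- Counting discontinuities is not visibly measurable. Peeling off the first jump reduces `k + 1`
jumps to `k` jumps of `tailPath` with a displaced target, as a countable union over the height of
the first jump. -/
lemma measurableSet_hitJumps (l : ℤ) (k : ℕ) :
    MeasurableSet {p : SkipFreePath | hitJumps p.1 l = k} := by
  have key (p : SkipFreePath) (hp : firstJump p.1 ≠ ∞) (l : ℤ) (hl : l ≠ 0) :
      hitJumps p.1 l = 1 + hitJumps (tailPath p).1 (l - firstHeight p) := by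
    obtain ⟨r, hr⟩ := exists_coe_eq hp
    rw [p.2.hitJumps_eq_one_add hr hl]
    simp only [tailPath, firstHeight, hr, ENNReal.toNNReal_coe, shiftPath]
  induction k generalizing l with
  | zero =>
    rcases eq_or_ne l 0 with rfl | hl
    · convert MeasurableSet.univ
      exact Set.eq_univ_of_forall fun p => p.2.hitJumps_zero
    · have : {p : SkipFreePath | hitJumps p.1 l = (0 : ℕ)} = {p | firstJump p.1 = ∞} := by
        ext p
        simp only [Set.mem_ofPred_eq]
        refine ⟨fun h => ?_, fun h => by simp [hitJumps_of_firstJump_eq_top h]⟩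
        by_contra h'
        rw [key p h' l hl] at h
        simp at h
      rw [this]
      exact measurable_firstJump (measurableSet_singleton _)
  | succ k ih =>
    rcases eq_or_ne l 0 with rfl | hl
    · convert MeasurableSet.empty
      refine Set.eq_empty_of_forall_notMem fun p h => ?_
      rw [Set.mem_ofPred_eq, p.2.hitJumps_zero] at h
      norm_cast at h
    · have : {p : SkipFreePath | hitJumps p.1 l = (k + 1 : ℕ)} = ⋃ x : ℤ,
          {p | firstJump p.1 ≠ ∞} ∩ firstHeight ⁻¹' {x} ∩
            tailPath ⁻¹' {p | hitJumps p.1 (l - x) = k} := by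
        ext p
        simp only [Set.mem_ofPred_eq, Set.mem_iUnion, Set.mem_inter_iff, Set.mem_preimage,
          Set.mem_singleton_iff]
        have hadd (n : ℕ∞) : 1 + n = ((k + 1 : ℕ) : ℕ∞) ↔ n = k := by
          rw [Nat.cast_add, Nat.cast_one, add_comm (k : ℕ∞)]
          exact WithTop.add_left_inj WithTop.one_ne_top
        constructor
        · intro h
          have h' : firstJump p.1 ≠ ∞ := fun h' => by
            rw [hitJumps_of_firstJump_eq_top h'] at h
            norm_cast at h
          rw [key p h' l hl, hadd] at h
          exact ⟨_, ⟨h', rfl⟩, h⟩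
        · rintro ⟨x, ⟨h', rfl⟩, h⟩
          rw [key p h' l hl, hadd]
          exact h
      rw [this]
      exact MeasurableSet.iUnion fun x =>
        ((measurable_firstJump (measurableSet_singleton _).compl).inter
          (measurable_firstHeight (measurableSet_singleton x))).inter (measurable_tailPath (ih _))

/-! ### Uniqueness of laws on path space -/

/-- Two laws with the same finite-dimensional marginals are projective limits of the same family;
since the marginals live on countable spaces, it is enough to compare them on points. -/
lemma skipFreePath_measure_ext {ν₁ ν₂ : Measure SkipFreePath} [IsFiniteMeasure ν₁]
    [IsFiniteMeasure ν₂] (h : ∀ (I : Finset ℝ≥0) (x : ℝ≥0 → ℤ),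
      ν₁ {p | ∀ i ∈ I, p.1 i = x i} = ν₂ {p | ∀ i ∈ I, p.1 i = x i}) : ν₁ = ν₂ := by
  have hval : Measurable (Subtype.val : SkipFreePath → ℝ≥0 → ℤ) := measurable_subtype_coe
  suffices hs : ν₁.map Subtype.val = ν₂.map Subtype.val by
    ext S hS
    obtain ⟨T, hT, rfl⟩ := hS
    rw [← Measure.map_apply hval hT, hs, Measure.map_apply hval hT]
  have hp (ν : Measure SkipFreePath) [IsFiniteMeasure ν] : IsProjectiveLimit (ν.map Subtype.val)
      fun I : Finset ℝ≥0 => (ν.map Subtype.val).map I.restrict := fun I => rfl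
  refine (hp ν₁).unique ?_
  convert hp ν₂ using 2 with I
  refine Measure.ext_of_singleton fun x => ?_
  have hI : Measurable (I.restrict : (ℝ≥0 → ℤ) → _) := Finset.measurable_restrict I
  rw [Measure.map_apply hI (measurableSet_singleton x),
    Measure.map_apply hI (measurableSet_singleton x),
    Measure.map_apply hval (hI (measurableSet_singleton x)),
    Measure.map_apply hval (hI (measurableSet_singleton x))]
  classical
  convert h I (fun i => if hi : i ∈ I then x ⟨i, hi⟩ else 0) using 2 <;>
  · ext p
    simp only [Set.mem_preimage, Set.mem_singleton_iff, Set.mem_ofPred_eq, funext_iff,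
      Subtype.forall, Finset.restrict]
    refine forall₂_congr fun i hi => ?_
    rw [dif_pos hi]

/-! ### Skip-free random walks in continuous time and the strong Markov property -/

/-- A random skip-free path with increments that are stationary and independent relative to the
filtration. -/
structure IsLatticeWalk {Ω : Type*} [mΩ : MeasurableSpace Ω] (μ : Measure Ω)
    (ℱ : Filtration ℝ≥0 mΩ) (U : Ω → SkipFreePath) : Prop where
  adapted : ∀ t, Measurable[ℱ t] fun ω => (U ω).1 t
  increments : ∀ (s t : ℝ≥0) (A : Set Ω), MeasurableSet[ℱ s] A → ∀ x : ℤ,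
    μ (A ∩ {ω | pathShift s (U ω).1 t = x}) = μ A * μ {ω | (U ω).1 t = x}

namespace IsLatticeWalk

variable {Ω : Type*} [mΩ : MeasurableSpace Ω] {μ : Measure Ω}
  {ℱ : Filtration ℝ≥0 mΩ} {U : Ω → SkipFreePath}

lemma measurable (hU : IsLatticeWalk μ ℱ U) : Measurable U :=
  measurable_skipFreePath fun t => (hU.adapted t).mono (ℱ.le t) le_rfl

lemma adapted_le (hU : IsLatticeWalk μ ℱ U) {s t : ℝ≥0} (h : s ≤ t) :
    Measurable[ℱ t] fun ω => (U ω).1 s := (hU.adapted s).mono (ℱ.mono h) le_rfl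

variable [IsProbabilityMeasure μ]

/-- Induction that removes the largest time: the last increment is independent of everything known
at the time before it. -/
lemma increments_finset (hU : IsLatticeWalk μ ℱ U) (I : Finset ℝ≥0) (s : ℝ≥0) (A : Set Ω)
    (hA : MeasurableSet[ℱ s] A) (x : ℝ≥0 → ℤ) :
    μ (A ∩ {ω | ∀ i ∈ I, pathShift s (U ω).1 i = x i}) =
      μ A * μ {ω | ∀ i ∈ I, (U ω).1 i = x i} := by
  induction I using Finset.induction_on_max generalizing s A with
  | empty => simp
  | insert t I hI ih =>
    rcases I.eq_empty_or_nonempty with rfl | hne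
    · simpa using hU.increments s t A hA (x t)
    · set m := I.max' hne with hm
      have hmI : m ∈ I := I.max'_mem hne
      have hmt : m < t := hI m hmI
      obtain ⟨d, rfl⟩ := exists_add_of_le hmt.le
      -- The last increment, over `[s + m, s + m + d]`, is independent of `ℱ (s + m)`. The case `s =
      -- 0`, `A = univ` computes the right-hand side of the claim.
      have key (s : ℝ≥0) (A : Set Ω) (hA : MeasurableSet[ℱ s] A) :
          μ (A ∩ {ω | ∀ i ∈ insert (m + d) I, pathShift s (U ω).1 i = x i}) =
          μ (A ∩ {ω | ∀ i ∈ I, pathShift s (U ω).1 i = x i}) *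
            μ {ω | (U ω).1 d = x (m + d) - x m} := by
        rw [← hU.increments (s + m) d]
        · congr 1
          ext ω
          simp only [Set.mem_inter_iff, Set.mem_ofPred_eq, Finset.forall_mem_insert, pathShift,
            and_assoc, and_congr_right_iff]
          intro _
          rw [and_comm, and_congr_right_iff]
          intro h
          have := h m hmI
          rw [← add_assoc]
          omega
        · refine MeasurableSet.inter (ℱ.mono le_self_add _ hA) ?_
          rw [show {ω | ∀ i ∈ I, pathShift s (U ω).1 i = x i} =
            ⋂ i ∈ I, {ω | pathShift s (U ω).1 i = x i} by ext; simp]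
          refine MeasurableSet.biInter I.countable_toSet fun i hi => ?_
          have h1 := hU.adapted_le (show s + i ≤ s + m by gcongr; exact I.le_max' i hi)
          have h2 := hU.adapted_le (show s ≤ s + m from le_self_add)
          exact (h1.sub h2) (measurableSet_singleton (x i))
      have key0 : μ {ω | ∀ i ∈ insert (m + d) I, (U ω).1 i = x i} =
          μ {ω | ∀ i ∈ I, (U ω).1 i = x i} * μ {ω | (U ω).1 d = x (m + d) - x m} := by
        have h := key 0 Set.univ MeasurableSet.univ
        simpa [pathShift, (U _).2.zero] using h
      rw [key s A hA, ih s A hA, key0, mul_assoc]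

/-- The Markov property at a deterministic time. -/
lemma markov (hU : IsLatticeWalk μ ℱ U) (s : ℝ≥0) {A : Set Ω} (hA : MeasurableSet[ℱ s] A)
    {B : Set SkipFreePath} (hB : MeasurableSet B) :
    μ (A ∩ {ω | shiftPath s (U ω) ∈ B}) = μ A * (μ.map U) B := by
  have hs : Measurable fun ω => shiftPath s (U ω) :=
    measurable_shiftPath_comp hU.measurable measurable_const
  have hA' := ℱ.le s _ hA
  have := Measure.isProbabilityMeasure_map (μ := μ) hU.measurable.aemeasurable
  have h : (μ.restrict A).map (fun ω => shiftPath s (U ω)) = μ A • μ.map U := by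
    -- Both sides are finite measures on path space, so agreement on finite-dimensional events
    -- suffices.
    have : IsFiniteMeasure (μ A • μ.map U) := Measure.smul_finite _ (measure_ne_top _ _)
    refine skipFreePath_measure_ext fun I x => ?_
    have hm : MeasurableSet {p : SkipFreePath | ∀ i ∈ I, p.1 i = x i} := by
      rw [show {p : SkipFreePath | ∀ i ∈ I, p.1 i = x i} = ⋂ i ∈ I, {p | p.1 i = x i} by ext; simp]
      exact MeasurableSet.biInter I.countable_toSet fun i _ =>
        measurable_path_eval measurable_id i (measurableSet_singleton (x i))
    rw [Measure.map_apply hs hm, Measure.restrict_apply (hs hm), Measure.smul_apply,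
      Measure.map_apply hU.measurable hm, Set.inter_comm, smul_eq_mul]
    exact hU.increments_finset I s A hA x
  have h2 := congrArg (fun ν => ν B) h
  rw [Measure.map_apply hs hB, Measure.restrict_apply (hs hB), Measure.smul_apply, smul_eq_mul,
    Set.inter_comm] at h2
  exact h2

/-- The grid time `dyadicAbove n T` has countably many values. Because it lies strictly above `T`,
the event that it takes the value `g k` is known at time `g k`, and the Markov property at
deterministic times applies cell by cell. -/
lemma strongMarkov_finset (hU : IsLatticeWalk μ ℱ U) {T : Ω → ℝ≥0∞} {A : Set Ω}
    (hA : ∀ i : ℝ≥0, MeasurableSet[ℱ i] (A ∩ {ω | T ω ≤ i})) (hAT : ∀ ω ∈ A, T ω ≠ ∞)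
    {B : Set SkipFreePath} (hB : MeasurableSet B) (n : ℕ) :
    μ (A ∩ {ω | shiftPath (dyadicAbove n (T ω).toNNReal) (U ω) ∈ B}) = μ A * (μ.map U) B := by
  have hlt (i : ℝ≥0) : MeasurableSet[ℱ i] (A ∩ {ω | T ω < i}) := by
    have : A ∩ {ω | T ω < i} = ⋃ m, ⋃ (_ : denseTime m ≤ i),
        (A ∩ {ω | T ω ≤ denseTime m}) ∩ {ω | denseTime m < i} := by
      ext ω
      simp only [Set.mem_inter_iff, Set.mem_ofPred_eq, Set.mem_iUnion, exists_prop]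
      constructor
      · rintro ⟨h1, h2⟩
        obtain ⟨c, hc1, hc2⟩ := ENNReal.lt_iff_exists_nnreal_btwn.1 h2
        obtain ⟨m, h3, h4⟩ := exists_denseTime_between (show c < i by exact_mod_cast hc2)
        exact ⟨m, h4.le, ⟨h1, hc1.le.trans (by exact_mod_cast h3.le)⟩, h4⟩
      · rintro ⟨m, -, ⟨h1, h2⟩, h3⟩
        exact ⟨h1, h2.trans_lt (by exact_mod_cast h3)⟩
    rw [this]
    exact MeasurableSet.iUnion fun m => MeasurableSet.iUnion fun hm =>
      (ℱ.mono hm _ (hA _)).inter (MeasurableSet.const _)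
  let g : ℕ → ℝ≥0 := fun k => (k + 1 : ℕ) / 2 ^ n
  let D : ℕ → Set Ω := fun k => A ∩ {ω | ⌊2 ^ n * (T ω).toNNReal⌋₊ = k}
  -- A grid cell is a difference of two events of the form `T < i`, both known by the right endpoint
  -- of the cell.
  have hD (k : ℕ) : D k = (A ∩ {ω | T ω < g k}) \ (A ∩ {ω | T ω < (k / 2 ^ n : ℝ≥0)}) := by
    ext ω
    simp only [D, Set.mem_inter_iff, Set.mem_ofPred_eq, Set.mem_sdiff, not_and, not_lt]
    constructor
    · rintro ⟨h1, h2⟩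
      obtain ⟨r, hr⟩ := exists_coe_eq (hAT ω h1)
      rw [hr, ENNReal.toNNReal_coe, Nat.floor_eq_iff zero_le] at h2
      refine ⟨⟨h1, ?_⟩, fun _ => ?_⟩ <;> rw [hr] <;> norm_cast
      · simp only [g]
        rw [lt_div_iff₀ (by positivity), mul_comm]
        exact_mod_cast h2.2
      · rw [div_le_iff₀ (by positivity), mul_comm]
        exact_mod_cast h2.1
    · rintro ⟨⟨h1, h2⟩, h3⟩
      refine ⟨h1, ?_⟩
      have h3 := h3 h1
      obtain ⟨r, hr⟩ := exists_coe_eq (hAT ω h1)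
      rw [hr] at h2 h3 ⊢
      rw [ENNReal.toNNReal_coe, Nat.floor_eq_iff zero_le]
      norm_cast at h2 h3
      simp only [g] at h2
      rw [lt_div_iff₀ (by positivity), mul_comm] at h2
      rw [div_le_iff₀ (by positivity), mul_comm] at h3
      exact ⟨by exact_mod_cast h3, by exact_mod_cast h2⟩
  have hDm (k : ℕ) : MeasurableSet[ℱ (g k)] (D k) := by
    rw [hD]
    refine (hlt _).diff (ℱ.mono ?_ _ (hlt _))
    simp only [g]
    gcongr
    simp
  have hDU : A = ⋃ k, D k := by
    ext ω
    simp [D]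
  have hdisj : Pairwise (Function.onFun Disjoint D) := fun i j hij =>
    Set.disjoint_left.2 fun ω hi hj => hij (hi.2.symm.trans hj.2)
  have hs (k : ℕ) : MeasurableSet {ω | shiftPath (g k) (U ω) ∈ B} :=
    measurable_shiftPath_comp hU.measurable measurable_const hB
  have h1 : A ∩ {ω | shiftPath (dyadicAbove n (T ω).toNNReal) (U ω) ∈ B} =
      ⋃ k, (D k ∩ {ω | shiftPath (g k) (U ω) ∈ B}) := by
    ext ω
    simp only [D, Set.mem_inter_iff, Set.mem_ofPred_eq, Set.mem_iUnion, g]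
    constructor
    · rintro ⟨ha, hb⟩
      exact ⟨_, ⟨ha, rfl⟩, hb⟩
    · rintro ⟨k, ⟨ha, rfl⟩, hb⟩
      exact ⟨ha, hb⟩
  rw [h1, measure_iUnion (fun i j hij => (hdisj hij).mono Set.inter_subset_left
    Set.inter_subset_left) (fun k => (ℱ.le _ _ (hDm k)).inter (hs k))]
  simp_rw [fun k => hU.markov (g k) (hDm k) hB]
  rw [ENNReal.tsum_mul_right, ← measure_iUnion hdisj fun k => ℱ.le _ _ (hDm k), ← hDU]

/-- The strong Markov property. -/
theorem strongMarkov (hU : IsLatticeWalk μ ℱ U) {T : Ω → ℝ≥0∞} {A : Set Ω}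
    (hA : ∀ i : ℝ≥0, MeasurableSet[ℱ i] (A ∩ {ω | T ω ≤ i})) (hAT : ∀ ω ∈ A, T ω ≠ ∞)
    {B : Set SkipFreePath} (hB : MeasurableSet B) :
    μ (A ∩ {ω | shiftPath (T ω).toNNReal (U ω) ∈ B}) = μ A * (μ.map U) B := by
  have hAm : MeasurableSet A := by
    have : A = ⋃ n : ℕ, A ∩ {ω | T ω ≤ (n : ℝ≥0)} := by
      ext ω
      simp only [Set.mem_iUnion, Set.mem_inter_iff, Set.mem_ofPred_eq]
      refine ⟨fun h => ?_, fun ⟨_, h, _⟩ => h⟩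
      obtain ⟨n, hn⟩ := ENNReal.exists_nat_gt (hAT ω h)
      exact ⟨n, h, by exact_mod_cast hn.le⟩
    rw [this]
    exact MeasurableSet.iUnion fun n => ℱ.le _ _ (hA n)
  have := Measure.isProbabilityMeasure_map (μ := μ) hU.measurable.aemeasurable
  -- Nothing is assumed about `T` off `A`, so it is replaced by zero there.
  have hTm : Measurable fun ω => (A.indicator T ω).toNNReal := by
    refine Measurable.ennreal_toNNReal (measurable_of_Iic fun b => ?_)
    rcases eq_or_ne b ∞ with rfl | hb
    · simp
    · obtain ⟨i, rfl⟩ := exists_coe_eq hb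
      have : A.indicator T ⁻¹' Set.Iic (i : ℝ≥0∞) = (A ∩ {ω | T ω ≤ i}) ∪ Aᶜ := by
        ext ω
        by_cases h : ω ∈ A <;> simp [h]
      rw [this]
      exact (ℱ.le _ _ (hA i)).union hAm.compl
  have hs : Measurable fun ω => shiftPath (A.indicator T ω).toNNReal (U ω) :=
    measurable_shiftPath_comp hU.measurable hTm
  have hrw (C : Set SkipFreePath) : A ∩ {ω | shiftPath (T ω).toNNReal (U ω) ∈ C} =
      A ∩ {ω | shiftPath (A.indicator T ω).toNNReal (U ω) ∈ C} := by
    ext ω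
    simp only [Set.mem_inter_iff, Set.mem_ofPred_eq, and_congr_right_iff]
    intro h
    rw [Set.indicator_of_mem h]
  have h : (μ.restrict A).map (fun ω => shiftPath (A.indicator T ω).toNNReal (U ω)) =
      μ A • μ.map U := by
    have : IsFiniteMeasure (μ A • μ.map U) := Measure.smul_finite _ (measure_ne_top _ _)
    refine skipFreePath_measure_ext fun I x => ?_
    have hm : MeasurableSet {p : SkipFreePath | ∀ i ∈ I, p.1 i = x i} := by
      rw [show {p : SkipFreePath | ∀ i ∈ I, p.1 i = x i} = ⋂ i ∈ I, {p | p.1 i = x i} by ext; simp]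
      exact MeasurableSet.biInter I.countable_toSet fun i _ =>
        measurable_path_eval measurable_id i (measurableSet_singleton (x i))
    rw [Measure.map_apply hs hm, Measure.restrict_apply (hs hm), Measure.smul_apply, smul_eq_mul,
      Set.inter_comm]
    change μ (A ∩ {ω | shiftPath (A.indicator T ω).toNNReal (U ω) ∈ _}) = _
    rw [← hrw]
    set C := {p : SkipFreePath | ∀ i ∈ I, p.1 i = x i}
    -- As the grids refine, each of the finitely many observed values becomes constant by
    -- right-continuity of step paths, so the indicators converge pointwise and so do the
    -- probabilities.
    have hlim : Tendsto (fun n => μ (A ∩ {ω | shiftPath (dyadicAbove n (T ω).toNNReal) (U ω) ∈ C}))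
        atTop (𝓝 (μ (A ∩ {ω | shiftPath (T ω).toNNReal (U ω) ∈ C}))) := by
      refine tendsto_measure_of_tendsto_indicator_of_isFiniteMeasure _ μ (fun n => ?_) ?_
      · have : A ∩ {ω | shiftPath (dyadicAbove n (T ω).toNNReal) (U ω) ∈ C} =
            A ∩ {ω | shiftPath (dyadicAbove n (A.indicator T ω).toNNReal) (U ω) ∈ C} := by
          ext ω
          simp only [Set.mem_inter_iff, Set.mem_ofPred_eq, and_congr_right_iff]
          intro h
          rw [Set.indicator_of_mem h]
        rw [this]
        refine hAm.inter (measurable_shiftPath_comp hU.measurable ?_ hm)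
        have hdy : Measurable (dyadicAbove n) := by
          have hg : Measurable fun k : ℕ => ((k + 1 : ℕ) / 2 ^ n : ℝ≥0) :=
            measurable_from_top
          have h2 := hg.comp (Nat.measurable_floor.comp (measurable_id.const_mul (2 ^ n : ℝ≥0)))
          exact h2
        have h3 := hdy.comp hTm
        simpa only [Function.comp_def] using h3
      · intro ω
        have hev (t : ℝ≥0) : ∀ᶠ n in atTop,
            (U ω).1 (dyadicAbove n (T ω).toNNReal + t) = (U ω).1 ((T ω).toNNReal + t) := by
          obtain ⟨u, hu, h⟩ := (U ω).2.right ((T ω).toNNReal + t)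
          filter_upwards [eventually_dyadicAbove_mem (lt_tsub_iff_right.2 hu)] with n hn
          exact h _ ⟨by gcongr; exact hn.1, lt_tsub_iff_right.1 hn.2⟩
        have h0 := hev 0
        have hI := (Finset.eventually_all I).2 fun i _ => hev i
        filter_upwards [h0, hI] with n h1 h2
        simp only [Set.mem_inter_iff, Set.mem_ofPred_eq, and_congr_right_iff, C]
        intro _
        refine forall₂_congr fun i hi => ?_
        simp only [add_zero] at h1
        simp only [shiftPath, pathShift, h1, h2 i hi]
    refine tendsto_nhds_unique hlim ?_
    simp_rw [fun n => hU.strongMarkov_finset hA hAT hm n]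
    exact tendsto_const_nhds
  have h2 := congrArg (fun ν => ν B) h
  rw [Measure.map_apply hs hB, Measure.restrict_apply (hs hB), Measure.smul_apply, smul_eq_mul,
    Set.inter_comm] at h2
  rw [hrw]
  exact h2

end IsLatticeWalk

/-! ### Compound Poisson laws -/

/-- The `n`-fold convolution power of a measure. -/
def convPow (lam : Measure ℝ) : ℕ → Measure ℝ
  | 0 => Measure.dirac 0
  | n + 1 => convPow lam n ∗ lam

/-- The law at time `t` of the compound Poisson process with Lévy measure `lam`. -/
def compoundPoissonLaw (lam : Measure ℝ) (t : ℝ≥0) : Measure ℝ :=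
  Measure.sum fun n => ENNReal.ofReal (Real.exp (-(lam.real Set.univ * t)) *
    ((t : ℝ) ^ n / n.factorial)) • convPow lam n

lemma convPow_mem_addSubgroup (lam : Measure ℝ) (G : AddSubgroup ℝ) (hG : MeasurableSet (G : Set ℝ))
    (h : ∀ᵐ x ∂lam, x ∈ G) (n : ℕ) : ∀ᵐ x ∂(convPow lam n), x ∈ G := by
  induction n with
  | zero =>
    rw [convPow]
    exact (ae_dirac_iff (p := fun x => x ∈ G) hG).2 G.zero_mem
  | succ n ih =>
    rw [convPow, Measure.conv]
    refine (ae_map_iff (p := fun x => x ∈ G) (by fun_prop) hG).2 ?_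
    have h1 : ∀ᵐ x ∂((convPow lam n).prod lam), x.1 ∈ G :=
      Measure.quasiMeasurePreserving_fst.ae ih
    have h2 : ∀ᵐ x ∂((convPow lam n).prod lam), x.2 ∈ G :=
      Measure.quasiMeasurePreserving_snd.ae h
    filter_upwards [h1, h2] with x hx hy using G.add_mem hx hy

lemma compoundPoissonLaw_mem_addSubgroup (lam : Measure ℝ) (G : AddSubgroup ℝ) (hG : MeasurableSet (G : Set ℝ))
    (h : ∀ᵐ x ∂lam, x ∈ G) (t : ℝ≥0) : ∀ᵐ x ∂(compoundPoissonLaw lam t), x ∈ G := by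
  rw [compoundPoissonLaw, Measure.ae_sum_iff]
  exact fun n => (convPow_mem_addSubgroup lam G hG h n).filter_mono
    (Measure.ae_smul_measure_le _)

/-! ### Compound Poisson laws: characteristic function and derivative at time zero -/

section CompoundPoisson
variable (lam : Measure ℝ) [IsFiniteMeasure lam]

instance isFiniteMeasure_convPow (n : ℕ) : IsFiniteMeasure (convPow lam n) := by
  induction n with
  | zero => rw [convPow]; infer_instance
  | succ n ih => rw [convPow]; infer_instance

lemma charFun_convPow (n : ℕ) (u : ℝ) : charFun (convPow lam n) u = charFun lam u ^ n := by
  induction n with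
  | zero => simp [convPow]
  | succ n ih => rw [convPow, charFun_conv, ih, pow_succ]

lemma convPow_univ (n : ℕ) : (convPow lam n).real Set.univ = lam.real Set.univ ^ n := by
  have h := charFun_convPow lam n 0
  simp only [charFun_zero] at h
  exact_mod_cast h

lemma convPow_one : convPow lam 1 = lam := by
  rw [convPow, convPow, Measure.dirac_zero_conv]

lemma hasSum_poisson_weight (c : ℝ) (t : ℝ) :
    HasSum (fun n : ℕ => Real.exp (-(c * t)) * (t ^ n / n.factorial) * c ^ n) 1 := by
  have h := (NormedSpace.expSeries_div_hasSum_exp (c * t)).mul_left (Real.exp (-(c * t)))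
  rw [← Real.exp_eq_exp_ℝ, ← Real.exp_add, neg_add_cancel, Real.exp_zero] at h
  refine h.congr_fun fun n => ?_
  rw [mul_pow]
  ring

lemma poisson_weight_nonneg (c : ℝ) (t : ℝ≥0) (n : ℕ) :
    0 ≤ Real.exp (-(c * t)) * ((t : ℝ) ^ n / n.factorial) := by positivity

lemma compoundPoissonLaw_apply (t : ℝ≥0) {B : Set ℝ} (hB : MeasurableSet B) :
    compoundPoissonLaw lam t B = ∑' n : ℕ, ENNReal.ofReal (Real.exp (-(lam.real Set.univ * t)) *
      ((t : ℝ) ^ n / n.factorial) * (convPow lam n).real B) := by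
  rw [compoundPoissonLaw, Measure.sum_apply _ hB]
  refine tsum_congr fun n => ?_
  rw [Measure.smul_apply, smul_eq_mul, ENNReal.ofReal_mul (poisson_weight_nonneg _ t n),
    ofReal_measureReal]

instance isProbabilityMeasure_compoundPoissonLaw (t : ℝ≥0) :
    IsProbabilityMeasure (compoundPoissonLaw lam t) := by
  constructor
  rw [compoundPoissonLaw_apply lam t MeasurableSet.univ]
  simp_rw [convPow_univ]
  have h := hasSum_poisson_weight (lam.real Set.univ) t
  rw [← ENNReal.ofReal_tsum_of_nonneg (fun n => by positivity) h.summable, h.tsum_eq,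
    ENNReal.ofReal_one]

lemma compoundPoissonLaw_real (t : ℝ≥0) {B : Set ℝ} (hB : MeasurableSet B) :
    HasSum (fun n : ℕ => Real.exp (-(lam.real Set.univ * t)) * ((t : ℝ) ^ n / n.factorial) *
      (convPow lam n).real B) ((compoundPoissonLaw lam t).real B) := by
  have h := compoundPoissonLaw_apply lam t hB
  have hne : (∑' n : ℕ, ENNReal.ofReal (Real.exp (-(lam.real Set.univ * t)) *
      ((t : ℝ) ^ n / n.factorial) * (convPow lam n).real B)) ≠ ∞ := h ▸ measure_ne_top _ _
  have h2 := ENNReal.hasSum_toReal hne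
  rw [← ENNReal.tsum_toReal_eq fun n => ENNReal.ofReal_ne_top, ← h] at h2
  refine h2.congr_fun fun n => ?_
  rw [ENNReal.toReal_ofReal (by positivity)]

/-- Convolution powers turn into powers of `charFun lam`, and the Poisson weights sum them to an
exponential series. Uniqueness of characteristic functions then yields the law of `X t`. -/
lemma charFun_compoundPoissonLaw (t : ℝ≥0) (u : ℝ) :
    charFun (compoundPoissonLaw lam t) u =
      Complex.exp ((t : ℂ) * ∫ x, (Complex.exp (Complex.I * u * x) - 1) ∂lam) := by
  have hint : Integrable (fun x : ℝ => Complex.exp (u * x * Complex.I))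
      (compoundPoissonLaw lam t) := by
    refine (integrable_const (1 : ℝ)).mono (by fun_prop) (Eventually.of_forall fun x => ?_)
    rw [← Complex.ofReal_mul, Complex.norm_exp_ofReal_mul_I]
    simp
  have h1 := hasSum_integral_measure (μ := fun n : ℕ => ENNReal.ofReal
    (Real.exp (-(lam.real Set.univ * t)) * ((t : ℝ) ^ n / n.factorial)) • convPow lam n) hint
  rw [← compoundPoissonLaw, ← charFun_apply_real] at h1
  have h2 : (∫ x, (Complex.exp (Complex.I * u * x) - 1) ∂lam) =
      charFun lam u - lam.real Set.univ := by
    rw [integral_sub _ (integrable_const _), charFun_apply_real]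
    · simp only [integral_const, Complex.real_smul, mul_one]
      congr 1
      refine integral_congr_ae (Eventually.of_forall fun x => ?_)
      ring_nf
    · refine (integrable_const (1 : ℝ)).mono (by fun_prop) (Eventually.of_forall fun x => ?_)
      rw [mul_assoc, mul_comm, ← Complex.ofReal_mul, Complex.norm_exp_ofReal_mul_I]
      simp
  have h3 := (NormedSpace.expSeries_div_hasSum_exp ((t : ℂ) * charFun lam u)).mul_left
    (Complex.exp (-(lam.real Set.univ * t)))
  rw [← Complex.exp_eq_exp_ℂ, ← Complex.exp_add] at h3
  rw [h2, show (t : ℂ) * (charFun lam u - lam.real Set.univ) =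
    -(lam.real Set.univ * t) + t * charFun lam u by ring]
  refine h1.unique (h3.congr_fun fun n => ?_)
  rw [integral_smul_measure, ← charFun_apply_real, charFun_convPow,
    ENNReal.toReal_ofReal (poisson_weight_nonneg _ t n), Complex.real_smul]
  push_cast
  rw [mul_pow]
  ring

lemma hasDerivWithinAt_zero_of_abs_le {f g : ℝ → ℝ} (h : ∀ t, 0 ≤ t → |f t| ≤ g t)
    (hg0 : g 0 = 0) (hg : HasDerivWithinAt g 0 (Set.Ici 0) 0) :
    HasDerivWithinAt f 0 (Set.Ici 0) 0 := by
  have hf0 : f 0 = 0 := abs_nonpos_iff.1 ((h 0 le_rfl).trans hg0.le)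
  rw [hasDerivWithinAt_iff_isLittleO] at hg ⊢
  simp only [hf0, hg0, smul_zero, sub_zero] at hg ⊢
  refine Asymptotics.IsBigO.trans_isLittleO (Asymptotics.IsBigO.of_bound 1 ?_) hg
  filter_upwards [self_mem_nhdsWithin] with t ht
  rw [Real.norm_eq_abs, Real.norm_eq_abs, one_mul]
  exact (h t ht).trans (le_abs_self _)

/-- Only the terms with zero or one Poisson point matter to first order in `t`. -/
lemma compoundPoissonLaw_deriv {B : Set ℝ} (hB : MeasurableSet B) :
    HasDerivWithinAt (fun t : ℝ => (compoundPoissonLaw lam t.toNNReal).real B)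
      (lam.real B - lam.real Set.univ * B.indicator 1 0) (Set.Ici 0) 0 := by
  set c := lam.real Set.univ
  set b : ℝ := B.indicator 1 0
  have hb : (convPow lam 0).real B = b := by
    rw [convPow, measureReal_def, Measure.dirac_apply' _ hB]
    by_cases h : (0 : ℝ) ∈ B <;> simp [b, h]
  have hexp : HasDerivAt (fun t : ℝ => Real.exp (-(c * t))) (-c) 0 := by
    have := ((hasDerivAt_id (0 : ℝ)).const_mul c).neg.exp
    simpa using this
  have hmain : HasDerivWithinAt (fun t : ℝ => Real.exp (-(c * t)) * (b + t * lam.real B))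
      (lam.real B - c * b) (Set.Ici 0) 0 := by
    have h2 : HasDerivAt (fun t : ℝ => b + t * lam.real B) (lam.real B) 0 := by
      simpa using ((hasDerivAt_id (0 : ℝ)).mul_const (lam.real B)).const_add b
    refine (hexp.mul h2).hasDerivWithinAt.congr_deriv ?_
    simp
    ring
  have hrem : HasDerivWithinAt (fun t : ℝ => (compoundPoissonLaw lam t.toNNReal).real B -
      Real.exp (-(c * t)) * (b + t * lam.real B)) 0 (Set.Ici 0) 0 := by
    -- The bound `g t` is the probability of at least two Poisson points of rate `c` by time `t`;
    -- its value and its derivative at zero vanish.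
    refine hasDerivWithinAt_zero_of_abs_le
      (g := fun t => 1 - Real.exp (-(c * t)) * (1 + t * c)) (fun t ht => ?_) (by simp) ?_
    · lift t to ℝ≥0 using ht
      rw [Real.toNNReal_coe]
      have h1 := compoundPoissonLaw_real lam t hB
      have h2 := hasSum_poisson_weight c t
      have h1' := (hasSum_nat_add_iff' 2).2 h1
      have h2' := (hasSum_nat_add_iff' 2).2 h2
      simp only [Finset.sum_range_succ, Finset.range_zero, Finset.sum_empty, hb, convPow_one,
        pow_zero, pow_one, Nat.factorial, Nat.cast_one, div_one, mul_one, zero_add] at h1' h2'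
      have hle : ∀ n : ℕ, (convPow lam n).real B ≤ c ^ n := fun n => by
        rw [← convPow_univ]
        exact measureReal_mono (Set.subset_univ _)
      have h3 := hasSum_le (fun n => mul_le_mul_of_nonneg_left (hle (n + 2))
        (poisson_weight_nonneg c t (n + 2))) h1' h2'
      have h4 := h1'.nonneg fun n => mul_nonneg (poisson_weight_nonneg c t (n + 2))
        measureReal_nonneg
      rw [abs_le]
      constructor <;> linarith
    · have h2 : HasDerivAt (fun t : ℝ => 1 + t * c) c 0 := by
        simpa using ((hasDerivAt_id (0 : ℝ)).mul_const c).const_add 1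
      refine ((hexp.mul h2).const_sub 1).hasDerivWithinAt.congr_deriv ?_
      simp
  exact ((hmain.add hrem).congr_deriv (add_zero _)).congr (fun t _ => by simp) (by simp)

end CompoundPoisson

/-! ### From the Lévy chain to a random skip-free path -/

/-- The subgroup `h ℤ` of the real line. -/
def latticeSubgroup (h : ℝ) : AddSubgroup ℝ := AddSubgroup.zmultiples h

lemma coe_latticeSubgroup (h : ℝ) : (latticeSubgroup h : Set ℝ) = Zh h := by
  ext x
  simp [latticeSubgroup, Zh, AddSubgroup.mem_zmultiples_iff, eq_comm]

lemma isClosed_Zh (h : ℝ) : IsClosed (Zh h) := by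
  rw [← coe_latticeSubgroup]
  have : DiscreteTopology (latticeSubgroup h) :=
    inferInstanceAs (DiscreteTopology (AddSubgroup.zmultiples h))
  exact AddSubgroup.isClosed_of_discrete

/-- The Lévy measure carried over to the integers. -/
def jumpMeasure (lam : Measure ℝ) (h : ℝ) : Measure ℤ := lam.map fun x => round (x / h)

lemma measurable_latticeIndex (h : ℝ) : Measurable fun x : ℝ => round (x / h) := by
  simp only [round_eq]
  exact Int.measurable_floor.comp ((measurable_id.div_const h).add_const _)

lemma round_mul_div {h : ℝ} (hh : 0 < h) (k : ℤ) : round ((k : ℝ) * h / h) = k := by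
  rw [mul_div_cancel_right₀ _ hh.ne', round_intCast]

lemma tendsto_mul_sub_of_deriv {f : ℝ → ℝ} {f' : ℝ} (hf : HasDerivWithinAt f f' (Set.Ici 0) 0)
    {t : ℝ} (ht : 0 ≤ t) :
    Tendsto (fun n : ℕ => ((n + 1 : ℕ) : ℝ) * (f (t / (n + 1 : ℕ)) - f 0)) atTop
      (𝓝 (t * f')) := by
  have h1 : HasDerivWithinAt (fun x => f (t * x)) (t * f') (Set.Ici 0) 0 := by
    have h2 : HasDerivWithinAt (fun x : ℝ => t * x) t (Set.Ici 0) 0 := by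
      simpa using ((hasDerivAt_id (0 : ℝ)).const_mul t).hasDerivWithinAt
    have h3 : HasDerivWithinAt f f' (Set.Ici 0) (t * 0) := by simpa using hf
    have h4 := h3.comp (0 : ℝ) h2 fun x (hx : 0 ≤ x) => mul_nonneg ht hx
    rw [mul_comm] at h4
    exact h4
  rw [hasDerivWithinAt_iff_tendsto_slope] at h1
  have h5 : Tendsto (fun n : ℕ => 1 / ((n + 1 : ℕ) : ℝ)) atTop (𝓝[Set.Ici 0 \ {0}] 0) := by
    refine tendsto_nhdsWithin_iff.2 ⟨?_, Eventually.of_forall fun n => ?_⟩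
    · simpa using tendsto_one_div_add_atTop_nhds_zero_nat (𝕜 := ℝ)
    · have : (0 : ℝ) < 1 / ((n + 1 : ℕ) : ℝ) := by positivity
      exact ⟨this.le, this.ne'⟩
  refine (h1.comp h5).congr fun n => ?_
  simp only [Function.comp_apply, slope_def_field, mul_zero, sub_zero, mul_one_div]
  rw [div_eq_mul_inv, one_div, inv_inv, mul_comm]

/-- Two lattice points at distance less than `h` coincide, so right-continuity forces local
constancy on the right. -/
lemma step_right_of_isCadlagPath {h : ℝ} (hh : 0 < h) {f : ℝ≥0 → ℝ} (hf : IsCadlagPath f)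
    {w : ℝ≥0 → ℤ} (hw : ∀ t, f t = w t * h) (t : ℝ≥0) :
    ∃ u, t < u ∧ ∀ s ∈ Set.Ico t u, w s = w t := by
  have h1 := Metric.tendsto_nhds.1 (hf t).1 h hh
  obtain ⟨u, hu, h2⟩ := mem_nhdsGE_iff_exists_Ico_subset.1 h1
  refine ⟨u, hu, fun s hs => ?_⟩
  have h3 := h2 hs
  rw [Set.mem_ofPred_eq, hw s, hw t, Real.dist_eq, ← sub_mul, abs_mul, abs_of_pos hh,
    mul_lt_iff_lt_one_left hh] at h3
  have h4 : |w s - w t| < 1 := by exact_mod_cast h3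
  have := Int.abs_lt_one_iff.1 h4
  omega

/-- A lattice-valued càdlàg path with jumps of height at most `h` is a skip-free path. -/
lemma isSkipFreePath_of_isCadlagPath {h : ℝ} (hh : 0 < h) {f : ℝ≥0 → ℝ} (hf : IsCadlagPath f)
    {w : ℝ≥0 → ℤ} (hw : ∀ t, f t = w t * h) (h0 : f 0 = 0)
    (hup : ∀ t, 0 < t → ∀ (k : ℤ) (u : ℝ≥0), u < t → (∀ s ∈ Set.Ioo u t, w s = k) →
      w t ≤ k + 1) : IsSkipFreePath w where
  zero := by
    rw [hw, mul_eq_zero] at h0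
    exact_mod_cast h0.resolve_right hh.ne'
  right := step_right_of_isCadlagPath hh hf hw
  left t ht := by
    obtain ⟨l, hl⟩ := (hf t).2
    -- With radius `h / 2`, any two values near the left limit are less than `h` apart and hence
    -- equal.
    have h1 := Metric.tendsto_nhds.1 hl (h / 2) (by positivity)
    obtain ⟨u, hu, h2⟩ := (mem_nhdsLT_iff_exists_Ioo_subset' ht).1 h1
    obtain ⟨v, hv1, hv2⟩ := exists_between (show u < t from hu)
    have h3 : ∀ s ∈ Set.Ioo u t, w s = w v := fun s hs => by
      have h4 : dist (f s) l < h / 2 := h2 hs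
      have h5 : dist (f v) l < h / 2 := h2 ⟨hv1, hv2⟩
      have h6 : dist (f s) (f v) < h := by
        have := dist_triangle_right (f s) (f v) l
        linarith
      rw [hw s, hw v, Real.dist_eq, ← sub_mul, abs_mul, abs_of_pos hh,
        mul_lt_iff_lt_one_left hh] at h6
      have h4 : |w s - w v| < 1 := by exact_mod_cast h6
      have := Int.abs_lt_one_iff.1 h4
      omega
    exact ⟨w v, hup t ht (w v) u hu h3, u, hu, h3⟩

section Chain
variable {Ω : Type*} [mΩ : MeasurableSpace Ω] {μ : Measure Ω}
  {ℱ : Filtration ℝ≥0 mΩ} {X : ℝ≥0 → Ω → ℝ} {lam : Measure ℝ} {h : ℝ}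

namespace IsUpwardsSkipFreeLevyChain

lemma measurable (hX : IsUpwardsSkipFreeLevyChain μ ℱ X lam h) (t : ℝ≥0) : Measurable (X t) :=
  (hX.levy.adapted t).mono (ℱ.le t) le_rfl

lemma ae_mem_Zh (hX : IsUpwardsSkipFreeLevyChain μ ℱ X lam h) : ∀ᵐ x ∂lam, x ∈ Zh h := by
  filter_upwards [lam.support_mem_ae] with x hx using hX.support_subset hx

lemma ae_le (hX : IsUpwardsSkipFreeLevyChain μ ℱ X lam h) : ∀ᵐ x ∂lam, x ≤ 0 ∨ x = h := by
  have h1 := (lam.restrict (Set.Ioi 0)).support_mem_ae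
  rw [hX.support_pos, mem_ae_iff, Measure.restrict_apply (measurableSet_singleton h).compl] at h1
  filter_upwards [measure_eq_zero_iff_ae_notMem.1 h1] with x hx
  by_contra hc
  push Not at hc
  exact hx ⟨hc.2, hc.1⟩

lemma jumpMeasure_apply (hX : IsUpwardsSkipFreeLevyChain μ ℱ X lam h) (B : Set ℤ) :
    jumpMeasure lam h B = lam {x | ∃ k ∈ B, x = k * h} := by
  rw [jumpMeasure, Measure.map_apply (measurable_latticeIndex h) (MeasurableSet.of_discrete)]
  refine measure_congr ?_
  filter_upwards [hX.ae_mem_Zh] with x hx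
  obtain ⟨k, rfl⟩ := hx
  refine propext ⟨fun hk => ⟨k, ?_, rfl⟩, fun ⟨m, hm, hmk⟩ => ?_⟩
  · have hk : round ((k : ℝ) * h / h) ∈ B := hk
    rwa [round_mul_div hX.h_pos] at hk
  · change round ((k : ℝ) * h / h) ∈ B
    rw [hmk, round_mul_div hX.h_pos]
    exact hm

lemma jumpMeasure_singleton (hX : IsUpwardsSkipFreeLevyChain μ ℱ X lam h) (k : ℤ) :
    jumpMeasure lam h {k} = lam {(k : ℝ) * h} := by
  rw [hX.jumpMeasure_apply]
  congr 1
  ext x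
  simp

lemma jumpMeasure_univ (lam : Measure ℝ) (h : ℝ) :
    jumpMeasure lam h Set.univ = lam Set.univ := by
  rw [jumpMeasure, Measure.map_apply (measurable_latticeIndex h) MeasurableSet.univ,
    Set.preimage_univ]

lemma jumpMeasure_zero (hX : IsUpwardsSkipFreeLevyChain μ ℱ X lam h) :
    jumpMeasure lam h {0} = 0 := by
  rw [hX.jumpMeasure_singleton]
  simpa using hX.no_zero

lemma jumpMeasure_Ici_two (hX : IsUpwardsSkipFreeLevyChain μ ℱ X lam h) :
    jumpMeasure lam h (Set.Ici 2) = 0 := by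
  rw [hX.jumpMeasure_apply]
  refine measure_mono_null ?_ (mem_ae_iff.1 hX.ae_le)
  rintro _ ⟨k, hk, rfl⟩ (h1 | h1)
  · have hk : (0 : ℝ) < k := by
      have : (0 : ℤ) < k := lt_of_lt_of_le (by norm_num) hk
      exact_mod_cast this
    exact absurd h1 (not_le.2 (mul_pos hk hX.h_pos))
  · have h2 : (k : ℝ) = 1 := by
      have := hX.h_pos
      field_simp at h1
      exact h1
    have h3 : k = 1 := by exact_mod_cast h2
    rw [h3, Set.mem_Ici] at hk
    omega

/-- Without an atom at `h`, the restriction of `lam` to the positive half-line would vanish and have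
empty support. -/
lemma jumpMeasure_one_ne_zero (hX : IsUpwardsSkipFreeLevyChain μ ℱ X lam h) :
    jumpMeasure lam h {1} ≠ 0 := by
  rw [hX.jumpMeasure_singleton, Int.cast_one, one_mul]
  intro h0
  have h1 : lam.restrict (Set.Ioi 0) = 0 := by
    rw [Measure.restrict_eq_zero]
    refine measure_mono_null (t := {x | ¬ (x ≤ 0 ∨ x = h)} ∪ {h}) (fun x hx => ?_)
      (measure_union_null (mem_ae_iff.1 hX.ae_le) h0)
    by_cases hxh : x = h
    · exact Or.inr hxh
    · refine Or.inl ?_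
      simp only [Set.mem_ofPred_eq, hxh, or_false, not_le]
      exact hx
  have h2 := hX.support_pos
  rw [h1, Measure.support_zero] at h2
  exact (Set.singleton_ne_empty h h2.symm)

lemma map_eq (hX : IsUpwardsSkipFreeLevyChain μ ℱ X lam h) [IsProbabilityMeasure μ] (t : ℝ≥0) :
    μ.map (X t) = compoundPoissonLaw lam t := by
  have := hX.finite
  have := Measure.isProbabilityMeasure_map (μ := μ) (hX.measurable t).aemeasurable
  refine Measure.ext_of_charFun (funext fun u => ?_)
  rw [hX.charFun_eq, charFun_compoundPoissonLaw]

lemma deriv_prob (hX : IsUpwardsSkipFreeLevyChain μ ℱ X lam h) [IsProbabilityMeasure μ]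
    (B : Set ℤ) :
    HasDerivWithinAt (fun t : ℝ => μ.real {ω | round (X t.toNNReal ω / h) ∈ B})
      ((jumpMeasure lam h).real B - (jumpMeasure lam h).real Set.univ * B.indicator 1 0)
      (Set.Ici 0) 0 := by
  have := hX.finite
  have hB : MeasurableSet ((fun x : ℝ => round (x / h)) ⁻¹' B) :=
    measurable_latticeIndex h MeasurableSet.of_discrete
  have h1 := compoundPoissonLaw_deriv lam hB
  have h2 (t : ℝ) : μ.real {ω | round (X t.toNNReal ω / h) ∈ B} =
      (compoundPoissonLaw lam t.toNNReal).real ((fun x : ℝ => round (x / h)) ⁻¹' B) := by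
    rw [← hX.map_eq, measureReal_def, measureReal_def, Measure.map_apply (hX.measurable _) hB]
    rfl
  simp only [h2]
  refine h1.congr_deriv ?_
  rw [jumpMeasure, measureReal_def, measureReal_def, measureReal_def, measureReal_def,
    Measure.map_apply (measurable_latticeIndex h) MeasurableSet.of_discrete,
    Measure.map_apply (measurable_latticeIndex h) MeasurableSet.univ, Set.preimage_univ]
  congr 2
  by_cases h0 : (0 : ℤ) ∈ B <;> simp [Set.indicator, h0]

/-- The law of each `X t` is carried by the lattice; a countable dense set of times gives a common
null set, and right-continuity with closedness of the lattice extends this to all times. -/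
lemma ae_forall_mem_Zh (hX : IsUpwardsSkipFreeLevyChain μ ℱ X lam h) [IsProbabilityMeasure μ] :
    ∀ᵐ ω ∂μ, ∀ t, X t ω ∈ Zh h := by
  have := hX.finite
  have h1 : ∀ᵐ ω ∂μ, ∀ n, X (denseTime n) ω ∈ Zh h := ae_all_iff.2 fun n => by
    have hm : MeasurableSet (latticeSubgroup h : Set ℝ) := by
      rw [coe_latticeSubgroup]; exact (isClosed_Zh h).measurableSet
    have h2 : ∀ᵐ x ∂(μ.map (X (denseTime n))), x ∈ latticeSubgroup h := by
      rw [hX.map_eq]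
      refine compoundPoissonLaw_mem_addSubgroup lam _ hm ?_ _
      filter_upwards [hX.ae_mem_Zh] with x hx
      rwa [← SetLike.mem_coe, coe_latticeSubgroup]
    filter_upwards [ae_of_ae_map (hX.measurable _).aemeasurable h2] with ω hω
    rwa [← SetLike.mem_coe, coe_latticeSubgroup] at hω
  filter_upwards [h1] with ω hω t
  by_contra ht
  have h3 : ∀ᶠ s in 𝓝[≥] t, X s ω ∈ (Zh h)ᶜ :=
    (hX.levy.cadlag ω t).1.eventually ((isClosed_Zh h).isOpen_compl.mem_nhds ht)
  obtain ⟨u, hu, h4⟩ := mem_nhdsGE_iff_exists_Ico_subset.1 h3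
  obtain ⟨n, h5, h6⟩ := exists_denseTime_between (show t < u from hu)
  exact h4 ⟨h5.le, h6⟩ (hω n)

/-- Almost surely, there is no increment of at least two lattice steps over arbitrarily fine grids,
on bounded time intervals. -/
lemma ae_frequently_small_increments (hX : IsUpwardsSkipFreeLevyChain μ ℱ X lam h)
    [IsProbabilityMeasure μ] (M : ℕ) :
    ∀ᵐ ω ∂μ, ∃ᶠ n : ℕ in atTop, ∀ i < M * (n + 1),
      round ((X ((i + 1 : ℕ) / (n + 1 : ℕ)) ω - X (i / (n + 1 : ℕ)) ω) / h) < 2 := by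
  let F : ℕ → Set Ω := fun n => {ω | ∃ i < M * (n + 1),
      2 ≤ round ((X ((i + 1 : ℕ) / (n + 1 : ℕ)) ω - X (i / (n + 1 : ℕ)) ω) / h)}
  have hstep (n i : ℕ) : μ {ω | 2 ≤ round ((X ((i + 1 : ℕ) / (n + 1 : ℕ)) ω -
      X (i / (n + 1 : ℕ)) ω) / h)} =
      ENNReal.ofReal (μ.real {ω | round (X (1 / (n + 1 : ℕ)) ω / h) ∈ Set.Ici 2}) := by
    have hd : ((i + 1 : ℕ) / (n + 1 : ℕ) : ℝ≥0) = i / (n + 1 : ℕ) + 1 / (n + 1 : ℕ) := by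
      push_cast; ring
    have h1 := (hX.levy.stationary (i / (n + 1 : ℕ)) ((i + 1 : ℕ) / (n + 1 : ℕ))
      (by rw [hd]; exact le_self_add)).measure_mem_eq
      (s := (fun x : ℝ => round (x / h)) ⁻¹' Set.Ici 2)
      (measurable_latticeIndex h MeasurableSet.of_discrete)
    rw [ofReal_measureReal]
    have h2 : ((i + 1 : ℕ) / (n + 1 : ℕ) : ℝ≥0) - i / (n + 1 : ℕ) = 1 / (n + 1 : ℕ) := by
      rw [hd, add_tsub_cancel_left]
    rw [h2] at h1
    exact h1
  -- There are `M (n + 1)` grid cells, each with a large increment with probability `o(1 / n)`,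
  -- because the Lévy measure puts no mass on upward jumps of two or more steps.
  have hF : Tendsto (fun n => μ (F n)) atTop (𝓝 0) := by
    have hd := hX.deriv_prob (Set.Ici 2)
    rw [measureReal_def, hX.jumpMeasure_Ici_two] at hd
    have h0 : (Set.Ici (2 : ℤ)).indicator (1 : ℤ → ℝ) 0 = 0 := by simp
    rw [ENNReal.toReal_zero, h0, mul_zero, sub_zero] at hd
    have hzero : μ.real {ω | round (X (0 : ℝ).toNNReal ω / h) ∈ Set.Ici 2} = 0 := by
      rw [measureReal_def, measure_mono_null _ (ae_iff.1 hX.levy.zero), ENNReal.toReal_zero]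
      intro ω hω hω0
      rw [Set.mem_ofPred_eq, Real.toNNReal_zero, hω0] at hω
      simp at hω
    have h1 := (tendsto_mul_sub_of_deriv hd zero_le_one).const_mul (M : ℝ)
    rw [mul_zero, mul_zero, hzero] at h1
    have h2 := ENNReal.tendsto_ofReal h1
    rw [ENNReal.ofReal_zero] at h2
    refine tendsto_of_tendsto_of_tendsto_of_le_of_le tendsto_const_nhds h2 (fun _ => zero_le)
      fun n => ?_
    have hFn : F n ⊆ ⋃ i ∈ Finset.range (M * (n + 1)), {ω | 2 ≤ round
        ((X ((i + 1 : ℕ) / (n + 1 : ℕ)) ω - X (i / (n + 1 : ℕ)) ω) / h)} := by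
      rintro ω ⟨i, hi, h⟩
      exact Set.mem_biUnion (Finset.mem_coe.2 (Finset.mem_range.2 hi)) h
    refine (measure_mono hFn).trans ((measure_biUnion_finset_le _ _).trans ?_)
    simp only [hstep, Finset.sum_const, Finset.card_range, nsmul_eq_mul, sub_zero]
    rw [← ENNReal.ofReal_natCast, ← ENNReal.ofReal_mul (by positivity)]
    have h3 : (1 / ((n + 1 : ℕ) : ℝ)).toNNReal = 1 / ((n + 1 : ℕ) : ℝ≥0) := by
      rw [Real.toNNReal_div zero_le_one, Real.toNNReal_one, Real.toNNReal_natCast]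
    rw [h3]
    refine ENNReal.ofReal_le_ofReal (le_of_eq ?_)
    push_cast
    ring
  -- Convergence to zero without a rate only shows that `F n` cannot occur for all large `n`.
  -- Infinitely many good grids are all that is needed.
  have h1 : μ {ω | ∀ᶠ n in atTop, ω ∈ F n} = 0 := by
    have : {ω | ∀ᶠ n in atTop, ω ∈ F n} = ⋃ N, ⋂ n ≥ N, F n := by
      ext ω; simp [eventually_atTop]
    rw [this]
    refine measure_iUnion_null fun N => nonpos_iff_eq_zero.1 (ge_of_tendsto hF ?_)
    filter_upwards [eventually_ge_atTop N] with n hn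
    exact measure_mono (Set.biInter_subset_of_mem hn)
  filter_upwards [measure_eq_zero_iff_ae_notMem.1 h1] with ω hω
  intro hev
  refine hω (hev.mono fun n hn => ?_)
  simp only [not_forall, not_lt] at hn
  obtain ⟨i, hi, h⟩ := hn
  exact ⟨i, hi, h⟩

/-- An upward jump of two or more steps at `t` would appear, on every sufficiently fine grid, as the
increment over the cell containing `t`. -/
lemma ae_isSkipFreePath (hX : IsUpwardsSkipFreeLevyChain μ ℱ X lam h) [IsProbabilityMeasure μ] :
    ∀ᵐ ω ∂μ, IsSkipFreePath (fun t => round (X t ω / h)) ∧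
      ∀ t, X t ω = (round (X t ω / h) : ℤ) * h := by
  filter_upwards [hX.ae_forall_mem_Zh, hX.levy.zero,
    ae_all_iff.2 hX.ae_frequently_small_increments] with ω h1 h2 h3
  have hw : ∀ t, X t ω = (round (X t ω / h) : ℤ) * h := fun t => by
    obtain ⟨k, hk⟩ := h1 t
    rw [hk, round_mul_div hX.h_pos]
  refine ⟨isSkipFreePath_of_isCadlagPath hX.h_pos (hX.levy.cadlag ω) hw h2 ?_, hw⟩
  intro t ht k u hut hk
  by_contra hlt
  obtain ⟨v, htv, hv⟩ := step_right_of_isCadlagPath hX.h_pos (hX.levy.cadlag ω) hw t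
  have hδ : 0 < min (t - u) (v - t) := lt_min (tsub_pos_of_lt hut) (tsub_pos_of_lt htv)
  have h4 : Tendsto (fun n : ℕ => 1 / ((n : ℝ≥0) + 1)) atTop (𝓝 0) :=
    tendsto_one_div_add_atTop_nhds_zero_nat
  obtain ⟨M, hM⟩ := exists_nat_ge t
  obtain ⟨n, hn, h5⟩ := ((h3 M).and_eventually (h4.eventually_lt_const hδ)).exists
  have hN : (0 : ℝ≥0) < (n + 1 : ℕ) := by positivity
  have htn : 0 < t * (n + 1 : ℕ) := mul_pos ht hN
  -- The index is chosen so that `i / (n + 1) < t ≤ (i + 1) / (n + 1)`: the left endpoint still sees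
  -- the left limit and the right endpoint the value at `t`.
  obtain ⟨i, hi⟩ : ∃ i, ⌈t * (n + 1 : ℕ)⌉₊ = i + 1 :=
    ⟨_, (Nat.succ_pred_eq_of_pos (Nat.ceil_pos.2 htn)).symm⟩
  have hi1 : t * (n + 1 : ℕ) ≤ (i + 1 : ℕ) := hi ▸ Nat.le_ceil _
  have hi2 : (i : ℝ≥0) < t * (n + 1 : ℕ) := Nat.lt_ceil.1 (by omega)
  have hiM : i < M * (n + 1) := by
    have : (i : ℝ≥0) < (M * (n + 1) : ℕ) := hi2.trans_le (by push_cast; gcongr)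
    exact_mod_cast this
  have e1 : t ≤ (i + 1 : ℕ) / (n + 1 : ℕ) := (le_div_iff₀ hN).2 hi1
  have e2 : (i : ℝ≥0) / (n + 1 : ℕ) < t := (div_lt_iff₀ hN).2 hi2
  have e3 : ((i + 1 : ℕ) / (n + 1 : ℕ) : ℝ≥0) = i / (n + 1 : ℕ) + 1 / ((n : ℝ≥0) + 1) := by
    push_cast; ring
  have e4 : ((i + 1 : ℕ) / (n + 1 : ℕ) : ℝ≥0) < v := by
    rw [e3]
    calc _ < t + (v - t) := add_lt_add e2 (h5.trans_le (min_le_right _ _))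
      _ = v := add_tsub_cancel_of_le htv.le
  have e5 : u < (i : ℝ≥0) / (n + 1 : ℕ) := by
    have h6 : t < (i : ℝ≥0) / (n + 1 : ℕ) + (t - u) := by
      refine (e1.trans e3.le).trans_lt ?_
      gcongr
      exact h5.trans_le (min_le_left _ _)
    by_contra hc
    refine absurd h6 (not_lt.2 ?_)
    calc _ ≤ u + (t - u) := by gcongr; exact not_lt.1 hc
      _ = t := add_tsub_cancel_of_le hut.le
  have h6 := hn i hiM
  have h7 := hk _ ⟨e5, e2⟩
  have h8 := hv _ ⟨e1, e4⟩
  rw [hw ((i + 1 : ℕ) / (n + 1 : ℕ)), hw (i / (n + 1 : ℕ)), h7, h8, ← sub_mul, ← Int.cast_sub,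
    round_mul_div hX.h_pos] at h6
  omega

/-- The chain is, up to indistinguishability and a scaling, a skip-free lattice walk. -/
theorem exists_latticeWalk (hX : IsUpwardsSkipFreeLevyChain μ ℱ X lam h) [IsProbabilityMeasure μ]
    (hℱ : UsualConditions μ ℱ) : ∃ U : Ω → SkipFreePath, IsLatticeWalk μ ℱ U ∧
      (∀ᵐ ω ∂μ, ∀ t, X t ω = (U ω).1 t * h) ∧
      ∀ B : Set ℤ, HasDerivWithinAt (fun t : ℝ => μ.real {ω | (U ω).1 t.toNNReal ∈ B})
        ((jumpMeasure lam h).real B - (jumpMeasure lam h).real Set.univ * B.indicator 1 0)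
        (Set.Ici 0) 0 := by
  classical
  set G : Set Ω := {ω | IsSkipFreePath (fun t => round (X t ω / h)) ∧
      ∀ t, X t ω = (round (X t ω / h) : ℤ) * h} with hG
  have hGc : μ Gᶜ = 0 := ae_iff.1 hX.ae_isSkipFreePath
  -- Null sets belong to `ℱ 0`, so replacing the bad paths by the zero path keeps `U` adapted.
  have hGm (t : ℝ≥0) : MeasurableSet[ℱ t] G :=
    ℱ.mono zero_le _ ((hℱ.null_mem _ hGc).of_compl)
  let zeroPath : SkipFreePath := ⟨fun _ => 0, ⟨rfl, fun t => ⟨t + 1, by simp, fun _ _ => rfl⟩,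
    fun t ht => ⟨0, by norm_num, 0, ht, fun _ _ => rfl⟩⟩⟩
  let U : Ω → SkipFreePath := fun ω =>
    if hω : ω ∈ G then ⟨fun t => round (X t ω / h), hω.1⟩ else zeroPath
  have hU1 (ω : Ω) (hω : ω ∈ G) (t : ℝ≥0) : (U ω).1 t = round (X t ω / h) := by
    simp only [U, dif_pos hω]
  have hU2 (t : ℝ≥0) : (fun ω => (U ω).1 t) = G.piecewise (fun ω => round (X t ω / h)) 0 := by
    ext ω
    by_cases hω : ω ∈ G
    · rw [hU1 ω hω, Set.piecewise_eq_of_mem _ _ _ hω]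
    · simp only [U, dif_neg hω, Set.piecewise_eq_of_notMem _ _ _ hω]
      rfl
  have hae : ∀ᵐ ω ∂μ, ω ∈ G := hX.ae_isSkipFreePath
  refine ⟨U, ⟨fun t => ?_, fun s t A hA x => ?_⟩, ?_, fun B => ?_⟩
  · rw [hU2]
    exact Measurable.piecewise (hGm t) ((measurable_latticeIndex h).comp (hX.levy.adapted t))
      measurable_const
  · have e1 : μ (A ∩ {ω | pathShift s (U ω).1 t = x}) =
        μ (A ∩ {ω | X (s + t) ω - X s ω ∈ ({x * h} : Set ℝ)}) := by
      refine measure_congr ?_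
      filter_upwards [hae] with ω hω
      refine propext (and_congr_right fun _ => ?_)
      change (U ω).1 (s + t) - (U ω).1 s = x ↔ X (s + t) ω - X s ω = x * h
      rw [hU1 ω hω, hU1 ω hω, hω.2 (s + t), hω.2 s, ← sub_mul, mul_left_inj' hX.h_pos.ne',
        round_mul_div hX.h_pos, round_mul_div hX.h_pos]
      norm_cast
    have e2 : μ {ω | (U ω).1 t = x} = μ {ω | X t ω ∈ ({x * h} : Set ℝ)} := by
      refine measure_congr ?_
      filter_upwards [hae] with ω hω
      refine propext ?_
      change (U ω).1 t = x ↔ X t ω = x * h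
      rw [hU1 ω hω, hω.2 t, mul_left_inj' hX.h_pos.ne', round_mul_div hX.h_pos]
      norm_cast
    have h3 := (hX.levy.stationary s (s + t) le_self_add).measure_mem_eq
      (measurableSet_singleton (x * h))
    rw [add_tsub_cancel_left] at h3
    rw [e1, e2, ← show _ = μ {ω | X t ω ∈ ({x * h} : Set ℝ)} from h3, mul_comm (μ A), Set.inter_comm]
    have h4 := (Indep_iff _ _ _).1 (hX.levy.indep s (s + t) le_self_add)
      {ω | X (s + t) ω - X s ω ∈ ({x * h} : Set ℝ)} A
      ⟨{x * h}, measurableSet_singleton _, rfl⟩ hA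
    exact h4
  · filter_upwards [hae] with ω hω t
    rw [hU1 ω hω]
    exact hω.2 t
  · convert hX.deriv_prob B using 2 with t
    rw [measureReal_def, measureReal_def]
    congr 1
    refine measure_congr ?_
    filter_upwards [hae] with ω hω
    change ((U ω).1 t.toNNReal ∈ B) = (round (X t.toNNReal ω / h) ∈ B)
    rw [hU1 ω hω]

end IsUpwardsSkipFreeLevyChain
end Chain

/-! ### Marked terminal times and their laws -/

/-- The path stopped at the time `t`. -/
def stopPath (t : ℝ≥0) (p : SkipFreePath) : SkipFreePath :=
  ⟨fun s => p.1 (min s t),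
    { zero := by rw [min_eq_left zero_le]; exact p.2.zero
      right := fun s => by
        rcases lt_or_ge s t with hst | hst
        · obtain ⟨u, hu, h⟩ := p.2.right s
          refine ⟨min u t, lt_min hu hst, fun r hr => ?_⟩
          rw [min_eq_left (hr.2.le.trans (min_le_right _ _)), min_eq_left hst.le]
          exact h r ⟨hr.1, hr.2.trans_le (min_le_left _ _)⟩
        · exact ⟨s + 1, by simp, fun r hr => by
            rw [min_eq_right hst, min_eq_right (hst.trans hr.1)]⟩
      left := fun s hs => by
        rcases le_or_gt s t with hst | hst
        · obtain ⟨k, hk, u, hu, h⟩ := p.2.left s hs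
          refine ⟨k, by rwa [min_eq_left hst], u, hu, fun r hr => ?_⟩
          rw [min_eq_left (hr.2.le.trans hst)]
          exact h r hr
        · refine ⟨p.1 t, by rw [min_eq_right hst.le]; omega, t, hst, fun r hr => ?_⟩
          rw [min_eq_right hr.1.le] }⟩

lemma stopPath_apply {t s : ℝ≥0} (h : s ≤ t) (p : SkipFreePath) : (stopPath t p).1 s = p.1 s := by
  change p.1 (min s t) = p.1 s
  rw [min_eq_left h]

lemma pathMax_stopPath {t s : ℝ≥0} (h : s ≤ t) (p : SkipFreePath) :
    pathMax (stopPath t p).1 s = pathMax p.1 s := by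
  rw [pathMax, pathMax]
  congr 1
  exact Set.image_congr fun r hr => stopPath_apply (hr.2.trans h) p

lemma pathRefl_stopPath {t s : ℝ≥0} (h : s ≤ t) (p : SkipFreePath) :
    pathRefl (stopPath t p).1 s = pathRefl p.1 s := by
  rw [pathRefl, pathRefl, pathMax_stopPath h, stopPath_apply h]

/-- Agreement up to time `t` fixes an entrance time below `t`. At `t` itself this needs the infimum
to be attained, since otherwise it would depend on the future. -/
lemma firstTime_eq_of_agree {A B : Set ℝ≥0} {t : ℝ≥0} (h : ∀ s ≤ t, (s ∈ A ↔ s ∈ B)) {a : ℝ≥0∞}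
    (hle : firstTime a A < t ∨ ∃ r ≤ t, firstTime a A = r ∧ r ∈ A) :
    firstTime a B = firstTime a A := by
  have key {A B : Set ℝ≥0} (h : ∀ s ≤ t, (s ∈ A ↔ s ∈ B)) (hle : firstTime a A ≤ t) :
      firstTime a A ≤ firstTime a B := le_firstTime_iff.2 fun s hs has => by
    rcases le_or_gt s t with hst | hst
    · exact firstTime_le ((h s hst).2 hs) has
    · exact hle.trans (by exact_mod_cast hst.le)
  have hle' : firstTime a A ≤ t := by
    rcases hle with h | ⟨r, hr, h, -⟩
    · exact h.le
    · rw [h]; exact_mod_cast hr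
  refine le_antisymm (key (fun s hs => (h s hs).symm) ?_) (key h hle')
  rcases hle with h1 | ⟨r, hr, h1, h2⟩
  · obtain ⟨s, hs, has, hst⟩ := firstTime_lt_iff.1 h1
    exact (firstTime_le ((h s (by exact_mod_cast hst.le)).1 hs) has).trans hst.le
  · exact (firstTime_le ((h r hr).1 h2) (by rw [← h1]; exact le_firstTime _ _)).trans
      (by exact_mod_cast hr)

/-- A stopping time `T` of skip-free paths, together with a mark which is known at time `T`. -/
structure MarkedStop {α : Type*} [MeasurableSpace α] (T : SkipFreePath → ℝ≥0∞)
    (ξ : SkipFreePath → α) : Prop where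
  measurable_time : Measurable T
  measurable_mark : Measurable ξ
  le_of_stop : ∀ (t : ℝ≥0) p, T (stopPath t p) ≤ t → T p ≤ t
  eq_of_stop : ∀ (t : ℝ≥0) p, T p ≤ t → T (stopPath t p) = T p ∧ ξ (stopPath t p) = ξ p

/-- A positive stopping time `T` of skip-free paths which is compatible with the shifts before
`T`, together with an integer mark which is known at time `T`. -/
structure MarkedTime (T : SkipFreePath → ℝ≥0∞) (ξ : SkipFreePath → ℤ) : Prop
    extends MarkedStop T ξ where
  pos : ∀ p, 0 < T p
  shift : ∀ (t : ℝ≥0) p, (t : ℝ≥0∞) < T p →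
    T p = t + T (shiftPath t p) ∧ (T p ≠ ∞ → ξ p = ξ (shiftPath t p))

lemma markedTime_firstJump : MarkedTime (fun p => firstJump p.1) firstHeight where
  measurable_time := measurable_firstJump
  measurable_mark := measurable_firstHeight
  pos p := p.2.firstJump_pos
  le_of_stop t p h := by
    obtain ⟨r, hr⟩ := exists_coe_eq (ne_top_of_le_ne_top ENNReal.coe_ne_top h)
    have hrt : r ≤ t := by rw [hr] at h; exact_mod_cast h
    refine le_of_eq_of_le (b := firstJump (stopPath t p).1) ?_ h
    refine firstTime_eq_of_agree (t := t) (fun s hs => ?_)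
      (Or.inr ⟨r, hrt, hr, (stopPath t p).2.ne_zero_of_firstJump_eq hr⟩)
    rw [Set.mem_ofPred_eq, stopPath_apply hs, Set.mem_ofPred_eq]
  eq_of_stop t p h := by
    obtain ⟨r, hr⟩ := exists_coe_eq (ne_top_of_le_ne_top ENNReal.coe_ne_top h)
    have hrt : r ≤ t := by rw [hr] at h; exact_mod_cast h
    have h1 : firstJump (stopPath t p).1 = firstJump p.1 := by
      refine firstTime_eq_of_agree (t := t) (fun s hs => ?_)
        (Or.inr ⟨r, hrt, hr, p.2.ne_zero_of_firstJump_eq hr⟩)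
      rw [Set.mem_ofPred_eq, Set.mem_ofPred_eq, stopPath_apply hs]
    refine ⟨h1, ?_⟩
    rw [firstHeight, h1, stopPath_apply, firstHeight]
    rwa [hr, ENNReal.toNNReal_coe]
  shift t p h := by
    have h1 := IsSkipFreePath.firstJump_eq_add h
    refine ⟨h1, fun hne => ?_⟩
    have h2 : firstJump (pathShift t p.1) ≠ ∞ := fun h3 => hne (by rw [h1, h3, add_top])
    rw [firstHeight, firstHeight, h1, ENNReal.toNNReal_add ENNReal.coe_ne_top h2]
    change _ = p.1 (t + _) - p.1 t
    rw [IsSkipFreePath.eq_zero_of_lt_firstJump h, sub_zero]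
    rfl

/-- The distance to the maximum at the beginning of the first excursion. -/
def exDepth (p : SkipFreePath) : ℤ := pathRefl p.1 (exStart p.1).toNNReal

lemma markedTime_exStart : MarkedTime (fun p => exStart p.1) exDepth where
  measurable_time := measurable_exStart_comp measurable_id
  measurable_mark := measurable_pathRefl_random measurable_id
    (measurable_exStart_comp measurable_id).ennreal_toNNReal
  pos p := p.2.exStart_pos
  le_of_stop t p h := by
    obtain ⟨r, hr⟩ := exists_coe_eq (ne_top_of_le_ne_top ENNReal.coe_ne_top h)
    have hrt : r ≤ t := by rw [hr] at h; exact_mod_cast h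
    refine le_of_eq_of_le (b := exStart (stopPath t p).1) ?_ h
    refine firstTime_eq_of_agree (t := t) (fun s hs => ?_)
      (Or.inr ⟨r, hrt, hr, ((stopPath t p).2.pathRefl_exStart_pos hr).ne'⟩)
    rw [Set.mem_ofPred_eq, pathRefl_stopPath hs, Set.mem_ofPred_eq]
  eq_of_stop t p h := by
    obtain ⟨r, hr⟩ := exists_coe_eq (ne_top_of_le_ne_top ENNReal.coe_ne_top h)
    have hrt : r ≤ t := by rw [hr] at h; exact_mod_cast h
    have h1 : exStart (stopPath t p).1 = exStart p.1 := by
      refine firstTime_eq_of_agree (t := t) (fun s hs => ?_)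
        (Or.inr ⟨r, hrt, hr, (p.2.pathRefl_exStart_pos hr).ne'⟩)
      rw [Set.mem_ofPred_eq, Set.mem_ofPred_eq, pathRefl_stopPath hs]
    refine ⟨h1, ?_⟩
    rw [exDepth, h1, pathRefl_stopPath, exDepth]
    rwa [hr, ENNReal.toNNReal_coe]
  shift t p h := by
    have h1 := p.2.exStart_eq_add (t := t) fun s hs =>
      IsSkipFreePath.pathRefl_eq_zero_of_lt_exStart (lt_of_le_of_lt (by exact_mod_cast hs) h)
    refine ⟨h1, fun hne => ?_⟩
    have h2 : exStart (pathShift t p.1) ≠ ∞ := fun h3 => hne (by rw [h1, h3, add_top])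
    rw [exDepth, exDepth, h1, ENNReal.toNNReal_add ENNReal.coe_ne_top h2, ENNReal.toNNReal_coe,
      p.2.pathRefl_add_of_eq_zero (IsSkipFreePath.pathRefl_eq_zero_of_lt_exStart h)]
    rfl

/-- A multiplicative function on `[0, ∞)` which is differentiable at `0` is an exponential. -/
lemma eq_exp_of_multiplicative {G : ℝ≥0 → ℝ} {κ : ℝ} (hG : ∀ s t, G (s + t) = G s * G t)
    (h0 : G 0 = 1) (hd : HasDerivWithinAt (fun t : ℝ => G t.toNNReal) (-κ) (Set.Ici 0) 0)
    (t : ℝ≥0) : G t = Real.exp (-(κ * t)) := by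
  have hpow (n : ℕ) (s : ℝ≥0) : G (n * s) = G s ^ n := by
    induction n with
    | zero => simp [h0]
    | succ n ih => rw [Nat.cast_succ, add_mul, one_mul, hG, ih, pow_succ]
  have h1 := tendsto_mul_sub_of_deriv hd t.coe_nonneg
  have h2 : Tendsto (fun n : ℕ => (n : ℝ) * (G (t / n) - 1)) atTop (𝓝 (-(κ * t))) := by
    rw [← tendsto_add_atTop_iff_nat 1]
    refine (h1.congr fun n => ?_).trans_eq ?_
    · rw [Real.toNNReal_zero, h0, Real.toNNReal_div t.coe_nonneg, Real.toNNReal_coe, Real.toNNReal_natCast]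
    · congr 1; ring
  -- Multiplicativity gives `G t = G (t / n) ^ n`, and `n (G (t / n) - 1)` tends to `-κ t`.
  have h3 := Real.tendsto_one_add_pow_exp_of_tendsto h2
  refine tendsto_nhds_unique (tendsto_const_nhds.congr' ?_) h3
  filter_upwards [eventually_gt_atTop 0] with n hn
  rw [add_sub_cancel, ← hpow, mul_div_cancel₀]
  exact_mod_cast hn.ne'

/-- The marginal distribution functions of a marked exponential time. -/
lemma eq_mul_one_sub_of_renewal {G F : ℝ≥0 → ℝ} {κ f : ℝ} (hκ : 0 < κ)
    (hG : ∀ t, G t = Real.exp (-(κ * t))) (hF : ∀ s t, F (s + t) = F s + G s * F t)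
    (hd : HasDerivWithinAt (fun t : ℝ => F t.toNNReal) f (Set.Ici 0) 0) (t : ℝ≥0) :
    F t = f / κ * (1 - Real.exp (-(κ * t))) := by
  have h0 : F 0 = 0 := by
    have h1 := hF 0 0
    rw [add_zero, hG] at h1
    simpa using h1
  -- Exchanging `s` and `t` in the renewal equation gives an identity in which `s` and `t` separate.
  -- Differentiating it in `s` at zero determines `F t`.
  have hsymm (s : ℝ≥0) : F t * (1 - G s) = F s * (1 - G t) := by
    have h1 := hF s t
    rw [add_comm, hF t s] at h1
    linarith
  have h1 : HasDerivWithinAt (fun s : ℝ => F t * (1 - G s.toNNReal)) (F t * κ) (Set.Ici 0) 0 := by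
    have h2 : HasDerivAt (fun s : ℝ => F t * (1 - Real.exp (-(κ * s)))) (F t * κ) 0 := by
      have h3 := ((((hasDerivAt_id (0 : ℝ)).const_mul κ).neg.exp).const_sub 1).const_mul (F t)
      refine h3.congr_deriv ?_
      simp
    refine h2.hasDerivWithinAt.congr (fun s hs => ?_) ?_
    · rw [hG, Real.coe_toNNReal s hs]
    · simp [hG]
  have h2 : HasDerivWithinAt (fun s : ℝ => F s.toNNReal * (1 - G t)) (f * (1 - G t))
      (Set.Ici 0) 0 := hd.mul_const _
  have h3 : F t * κ = f * (1 - G t) := by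
    refine (uniqueDiffOn_Ici (0 : ℝ) 0 Set.self_mem_Ici).eq_deriv _ h1 ?_
    refine h2.congr_of_eventuallyEq (Eventually.of_forall fun s => hsymm _) (hsymm _)
  rw [← hG, div_mul_eq_mul_div, eq_div_iff hκ.ne', h3]

namespace MarkedStop

variable {Ω : Type*} [mΩ : MeasurableSpace Ω] {μ : Measure Ω} {ℱ : Filtration ℝ≥0 mΩ}
  {U : Ω → SkipFreePath} {T : SkipFreePath → ℝ≥0∞} {α : Type*} [MeasurableSpace α] {ξ : SkipFreePath → α}

lemma le_iff_stop (hT : MarkedStop T ξ) {t : ℝ≥0} {p : SkipFreePath} :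
    T p ≤ t ↔ T (stopPath t p) ≤ t :=
  ⟨fun h => (hT.eq_of_stop t p h).1.trans_le h, hT.le_of_stop t p⟩

lemma measurable_stop (hU : IsLatticeWalk μ ℱ U) (t : ℝ≥0) :
    Measurable[ℱ t] fun ω => stopPath t (U ω) :=
  @measurable_skipFreePath Ω (ℱ t) _ fun s => hU.adapted_le (min_le_right s t)

lemma measurableSet_time_le (hT : MarkedStop T ξ) (hU : IsLatticeWalk μ ℱ U) (t : ℝ≥0)
    {S : Set (ℝ≥0∞ × α)} (hS : MeasurableSet S) :
    MeasurableSet[ℱ t] {ω | T (U ω) ≤ t ∧ (T (U ω), ξ (U ω)) ∈ S} := by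
  have h1 : {ω | T (U ω) ≤ t ∧ (T (U ω), ξ (U ω)) ∈ S} = (fun ω => stopPath t (U ω)) ⁻¹'
      ({p | T p ≤ t} ∩ {p | (T p, ξ p) ∈ S}) := by
    refine Set.ext fun ω => ?_
    simp only [Set.mem_ofPred_eq, Set.mem_preimage, Set.mem_inter_iff, ← hT.le_iff_stop]
    refine and_congr_right fun h => ?_
    rw [(hT.eq_of_stop t _ h).1, (hT.eq_of_stop t _ h).2]
  rw [h1]
  exact measurable_stop hU t ((measurableSet_le hT.measurable_time measurable_const).inter
    ((hT.measurable_time.prodMk hT.measurable_mark) hS))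

variable [IsProbabilityMeasure μ]

lemma strongMarkov (hT : MarkedStop T ξ) (hU : IsLatticeWalk μ ℱ U) {S : Set (ℝ≥0∞ × α)}
    (hS : MeasurableSet S) {B : Set SkipFreePath} (hB : MeasurableSet B) :
    (μ.map U) {p | T p ≠ ∞ ∧ (T p, ξ p) ∈ S ∧ shiftPath (T p).toNNReal p ∈ B} =
      (μ.map U) {p | T p ≠ ∞ ∧ (T p, ξ p) ∈ S} * (μ.map U) B := by
  have h := hU.strongMarkov (T := fun ω => T (U ω))
    (A := {ω | T (U ω) ≠ ∞ ∧ (T (U ω), ξ (U ω)) ∈ S}) (fun i => ?_) (fun ω h => h.1) hB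
  · have h1 : MeasurableSet {p | T p ≠ ∞ ∧ (T p, ξ p) ∈ S} :=
      (hT.measurable_time (measurableSet_singleton ∞).compl).inter
        ((hT.measurable_time.prodMk hT.measurable_mark) hS)
    have h2 : MeasurableSet {p | shiftPath (T p).toNNReal p ∈ B} :=
      measurable_shiftPath_comp measurable_id hT.measurable_time.ennreal_toNNReal hB
    simp only [← and_assoc]
    exact (Measure.map_apply hU.measurable (h1.inter h2)).trans
      (h.trans (congrArg (· * _) (Measure.map_apply hU.measurable h1).symm))
  · convert hT.measurableSet_time_le hU i hS using 1
    refine Set.ext fun ω => ?_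
    simp only [Set.mem_inter_iff, Set.mem_ofPred_eq]
    exact ⟨fun h => ⟨h.2, h.1.2⟩,
      fun h => ⟨⟨ne_top_of_le_ne_top ENNReal.coe_ne_top h.1, h.2⟩, h.1⟩⟩

end MarkedStop

/-! ### Shift-compatible marked times are exponential and independent of mark and future -/

namespace MarkedTime

variable {Ω : Type*} [mΩ : MeasurableSpace Ω] {μ : Measure Ω} {ℱ : Filtration ℝ≥0 mΩ}
  {U : Ω → SkipFreePath} {T : SkipFreePath → ℝ≥0∞} {ξ : SkipFreePath → ℤ}
  [IsProbabilityMeasure μ]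

lemma survival_add (hT : MarkedTime T ξ) (hU : IsLatticeWalk μ ℱ U) (s : ℝ≥0)
    {B : Set SkipFreePath} (hB : MeasurableSet B) :
    (μ.map U).real {p | (s : ℝ≥0∞) < T p ∧ shiftPath s p ∈ B} =
      (μ.map U).real {p | (s : ℝ≥0∞) < T p} * (μ.map U).real B := by
  have hm := measurableSet_lt (measurable_const (a := (s : ℝ≥0∞))) hT.measurable_time
  have h := hU.markov s (A := {ω | (s : ℝ≥0∞) < T (U ω)}) ?_ hB
  · simp only [measureReal_def]
    rw [← ENNReal.toReal_mul]
    refine congrArg _ ((Measure.map_apply hU.measurable (hm.inter ?_)).trans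
      (h.trans (congrArg (· * _) (Measure.map_apply hU.measurable hm).symm)))
    exact measurable_shiftPath_comp measurable_id measurable_const hB
  · have h1 := (hT.measurableSet_time_le hU s MeasurableSet.univ).compl
    convert h1 using 1
    refine Set.ext fun ω => ?_
    simp

variable {κ : ℝ} {ρ : Measure ℤ} [IsProbabilityMeasure ρ]

/-- Shift compatibility and the Markov property make the survival function multiplicative. -/
lemma survival_eq (hT : MarkedTime T ξ) (hU : IsLatticeWalk μ ℱ U)
    (hd : HasDerivWithinAt (fun t : ℝ => (μ.map U).real {p | T p ≤ t.toNNReal}) κ (Set.Ici 0) 0)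
    (t : ℝ≥0) : (μ.map U).real {p | (t : ℝ≥0∞) < T p} = Real.exp (-(κ * t)) := by
  have := Measure.isProbabilityMeasure_map (μ := μ) hU.measurable.aemeasurable
  have hm (t : ℝ≥0) := measurableSet_lt (measurable_const (a := (t : ℝ≥0∞))) hT.measurable_time
  refine eq_exp_of_multiplicative (G := fun t => (μ.map U).real {p | (t : ℝ≥0∞) < T p})
    (fun s t => ?_) ?_ ?_ t
  · rw [← hT.survival_add hU s (hm t)]
    congr 1
    refine Set.ext fun p => ?_
    simp only [Set.mem_ofPred_eq]
    constructor
    · intro h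
      have h1 : (s : ℝ≥0∞) < T p := lt_of_le_of_lt (by push_cast; exact le_self_add) h
      refine ⟨h1, ?_⟩
      rw [(hT.shift s p h1).1, ENNReal.coe_add] at h
      exact (ENNReal.add_lt_add_iff_left ENNReal.coe_ne_top).1 h
    · rintro ⟨h1, h2⟩
      rw [(hT.shift s p h1).1, ENNReal.coe_add]
      exact (ENNReal.add_lt_add_iff_left ENNReal.coe_ne_top).2 h2
  · rw [show {p | ((0 : ℝ≥0) : ℝ≥0∞) < T p} = Set.univ from
      Set.eq_univ_of_forall fun p => by simpa using hT.pos p, probReal_univ]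
  · have h1 := hd.const_sub 1
    refine h1.congr_of_eventuallyEq (Eventually.of_forall fun t => ?_) ?_
    all_goals
      beta_reduce
      rw [← probReal_compl_eq_one_sub (measurableSet_le hT.measurable_time measurable_const)]
      congr 1
      refine Set.ext fun p => ?_
      simp [pos_iff_ne_zero]

lemma markedSurvival_eq (hT : MarkedTime T ξ) (hU : IsLatticeWalk μ ℱ U) (hκ : 0 < κ)
    (hd : HasDerivWithinAt (fun t : ℝ => (μ.map U).real {p | T p ≤ t.toNNReal}) κ (Set.Ici 0) 0)
    {f : ℝ} {x : ℤ} (hx : HasDerivWithinAt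
      (fun t : ℝ => (μ.map U).real {p | T p ≤ t.toNNReal ∧ ξ p = x}) f (Set.Ici 0) 0)
    (t : ℝ≥0) : (μ.map U).real {p | T p ≤ t ∧ ξ p = x} =
      f / κ * (1 - Real.exp (-(κ * t))) := by
  have := Measure.isProbabilityMeasure_map (μ := μ) hU.measurable.aemeasurable
  refine eq_mul_one_sub_of_renewal (F := fun t => (μ.map U).real {p | T p ≤ t ∧ ξ p = x}) hκ
    (hT.survival_eq hU hd) (fun s t => ?_) hx t
  have hm : MeasurableSet {p | T p ≤ t ∧ ξ p = x} :=
    (measurableSet_le hT.measurable_time measurable_const).inter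
      (hT.measurable_mark (measurableSet_singleton x))
  -- Splitting according to `T ≤ s` or `s < T` is the renewal equation: in the second case time and
  -- mark are those of the path shifted by `s`.
  rw [← hT.survival_add hU s hm, ← measureReal_union]
  · congr 1
    refine Set.ext fun p => ?_
    simp only [Set.mem_ofPred_eq, Set.mem_union]
    rcases le_or_gt (T p) s with h | h
    · simp only [h, true_and, h.not_gt, false_and, or_false]
      exact and_iff_right (h.trans (by push_cast; exact le_self_add))
    · simp only [h, true_and, h.not_ge, false_and, false_or]
      have h2 : T p ≤ ((s + t : ℝ≥0) : ℝ≥0∞) ↔ T (shiftPath s p) ≤ t := by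
        rw [(hT.shift s p h).1, ENNReal.coe_add, ENNReal.add_le_add_iff_left ENNReal.coe_ne_top]
      rw [← h2]
      refine and_congr_right fun h3 => ?_
      rw [(hT.shift s p h).2 (ne_top_of_le_ne_top ENNReal.coe_ne_top h3)]
  · rw [Set.disjoint_left]
    rintro p ⟨h1, -⟩ ⟨h2, -⟩
    exact h1.not_gt h2
  · exact (measurableSet_lt measurable_const hT.measurable_time).inter
      (measurable_shiftPath_comp measurable_id measurable_const hm)

lemma ae_ne_top (hT : MarkedTime T ξ) (hU : IsLatticeWalk μ ℱ U) (hκ : 0 < κ)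
    (hd : HasDerivWithinAt (fun t : ℝ => (μ.map U).real {p | T p ≤ t.toNNReal}) κ (Set.Ici 0) 0) :
    ∀ᵐ p ∂(μ.map U), T p ≠ ∞ := by
  have := Measure.isProbabilityMeasure_map (μ := μ) hU.measurable.aemeasurable
  have h1 : Tendsto (fun n : ℕ => Real.exp (-(κ * (n : ℝ≥0)))) atTop (𝓝 0) := by
    refine Real.tendsto_exp_neg_atTop_nhds_zero.comp ?_
    simpa using tendsto_natCast_atTop_atTop.const_mul_atTop hκ
  have h2 : (μ.map U).real {p | T p = ∞} ≤ 0 := ge_of_tendsto h1 <| .of_forall fun n => by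
    rw [← hT.survival_eq hU hd]
    exact measureReal_mono fun p (hp : T p = ∞) => by simp [hp]
  rw [ae_iff]
  simp only [not_not]
  have h3 := le_antisymm h2 measureReal_nonneg
  rwa [measureReal_eq_zero_iff] at h3

/-- The law of a marked time, its mark and the path thereafter. -/
theorem law (hT : MarkedTime T ξ) (hU : IsLatticeWalk μ ℱ U) (hκ : 0 < κ)
    (hd : HasDerivWithinAt (fun t : ℝ => (μ.map U).real {p | T p ≤ t.toNNReal}) κ (Set.Ici 0) 0)
    (hx : ∀ x, HasDerivWithinAt (fun t : ℝ => (μ.map U).real {p | T p ≤ t.toNNReal ∧ ξ p = x})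
      (κ * ρ.real {x}) (Set.Ici 0) 0) :
    (μ.map U).map (fun p => (((T p).toReal, ξ p), shiftPath (T p).toNNReal p)) =
      ((expMeasure κ).prod ρ).prod (μ.map U) := by
  have := Measure.isProbabilityMeasure_map (μ := μ) hU.measurable.aemeasurable
  have := isProbabilityMeasure_expMeasure hκ
  set P := μ.map U with hP
  have hne := hT.ae_ne_top hU hκ hd
  have hTr : Measurable fun p => (T p).toReal := hT.measurable_time.ennreal_toReal
  have hpair : Measurable fun p => ((T p).toReal, ξ p) := hTr.prodMk hT.measurable_mark
  have hsh : Measurable fun p => shiftPath (T p).toNNReal p :=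
    measurable_shiftPath_comp measurable_id hT.measurable_time.ennreal_toNNReal
  -- On each value of the mark the distribution function is that mark's probability times the
  -- exponential one, which is independence of time and mark.
  have h1 (x : ℤ) : (P.restrict {p | ξ p = x}).map (fun p => (T p).toReal) =
      ρ {x} • expMeasure κ := by
    have : IsFiniteMeasure (ρ {x} • expMeasure κ) :=
      Measure.smul_finite _ (measure_ne_top _ _)
    refine Measure.ext_of_Iic _ _ fun a => ?_
    rw [Measure.map_apply hTr measurableSet_Iic, Measure.restrict_apply (hTr measurableSet_Iic),
      Measure.smul_apply, smul_eq_mul, ← ENNReal.toReal_eq_toReal_iff' (measure_ne_top _ _)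
      (ENNReal.mul_ne_top (measure_ne_top _ _) (measure_ne_top _ _)), ENNReal.toReal_mul]
    change P.real _ = ρ.real {x} * (expMeasure κ).real (Set.Iic a)
    rw [← cdf_eq_real, cdf_expMeasure_eq hκ]
    split_ifs with ha
    · have h2 := hT.markedSurvival_eq hU hκ hd (hx x) a.toNNReal
      rw [mul_div_cancel_left₀ _ hκ.ne', Real.coe_toNNReal a ha] at h2
      rw [← h2]
      refine measureReal_congr ?_
      filter_upwards [hne] with p hp
      refine propext (and_congr_left fun _ => ?_)
      change (T p).toReal ≤ a ↔ T p ≤ ENNReal.ofReal a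
      rw [ENNReal.le_ofReal_iff_toReal_le hp ha]
    · rw [mul_zero, measureReal_eq_zero_iff]
      refine measure_mono_null (fun p hp => ?_) measure_empty
      exact ha (ENNReal.toReal_nonneg.trans hp.1)
  have h2 : P.map (fun p => ((T p).toReal, ξ p)) = (expMeasure κ).prod ρ := by
    refine (Measure.prod_eq fun s t hs _ => ?_).symm
    have h3 : ((P.restrict ((fun p => (T p).toReal) ⁻¹' s)).map ξ) = expMeasure κ s • ρ := by
      refine Measure.ext_of_singleton fun x => ?_
      rw [Measure.map_apply hT.measurable_mark (measurableSet_singleton x),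
        Measure.restrict_apply (hT.measurable_mark (measurableSet_singleton x)),
        Measure.smul_apply, smul_eq_mul, mul_comm, ← smul_eq_mul, ← Measure.smul_apply, ← h1,
        Measure.map_apply hTr hs, Measure.restrict_apply (hTr hs), Set.inter_comm]
      rfl
    rw [← smul_eq_mul, ← Measure.smul_apply, ← h3,
      Measure.map_apply hpair (hs.prod MeasurableSet.of_discrete),
      Measure.map_apply hT.measurable_mark MeasurableSet.of_discrete,
      Measure.restrict_apply (hT.measurable_mark MeasurableSet.of_discrete), Set.inter_comm]
    rfl
  -- Independence from the path after `T` is the strong Markov property.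
  refine (Measure.prod_eq fun S B hS hB => ?_).symm
  rw [← h2, Measure.map_apply hpair hS, Measure.map_apply (hpair.prodMk hsh) (hS.prod hB)]
  have hS' : MeasurableSet ((fun q : ℝ≥0∞ × ℤ => (q.1.toReal, q.2)) ⁻¹' S) :=
    (measurable_fst.ennreal_toReal.prodMk measurable_snd) hS
  have h3 := hT.strongMarkov hU hS' hB
  have e1 : P {p | T p ≠ ∞ ∧ (T p, ξ p) ∈ (fun q : ℝ≥0∞ × ℤ => (q.1.toReal, q.2)) ⁻¹' S ∧
      shiftPath (T p).toNNReal p ∈ B} =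
      P ((fun p => (((T p).toReal, ξ p), shiftPath (T p).toNNReal p)) ⁻¹' S ×ˢ B) := by
    refine measure_congr ?_
    filter_upwards [hne] with p hp
    exact propext ⟨fun h => ⟨h.2.1, h.2.2⟩, fun h => ⟨hp, h.1, h.2⟩⟩
  have e2 : P {p | T p ≠ ∞ ∧ (T p, ξ p) ∈ (fun q : ℝ≥0∞ × ℤ => (q.1.toReal, q.2)) ⁻¹' S} =
      P ((fun p => ((T p).toReal, ξ p)) ⁻¹' S) := by
    refine measure_congr ?_
    filter_upwards [hne] with p hp
    exact propext ⟨fun h => h.2, fun h => ⟨hp, h⟩⟩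
  rw [← e1, ← e2]
  exact h3

end MarkedTime

/-! ### The laws of the first jump and of the beginning of the first excursion -/

/-- `P` is a law of skip-free paths with jump intensities `Λ`. -/
structure HasJumpIntensity (P : Measure SkipFreePath) (Λ : Measure ℤ) : Prop where
  zero : Λ {0} = 0
  two_le : Λ (Set.Ici 2) = 0
  one : Λ {1} ≠ 0
  deriv : ∀ B : Set ℤ, HasDerivWithinAt (fun t : ℝ => P.real {p | p.1 t.toNNReal ∈ B})
    (Λ.real B - Λ.real Set.univ * B.indicator 1 0) (Set.Ici 0) 0

/-- The event that the path has at least two jumps, separated by at most `t`, the first of them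
until time `t`. -/
def twoJumps (t : ℝ≥0) : Set SkipFreePath :=
  {p | firstJump p.1 ≤ t ∧ firstJump (tailPath p).1 ≤ t}

/-- If the waiting time after the first jump exceeds `t`, no further jump falls into `[0, t]`: the
path has at most one jump there. -/
lemma eq_zero_or_of_notMem_twoJumps {t : ℝ≥0} {p : SkipFreePath} (h : p ∉ twoJumps t) :
    ((t : ℝ≥0∞) < firstJump p.1 ∧ ∀ s ≤ t, p.1 s = 0) ∨
    ∃ r ≤ t, firstJump p.1 = r ∧ p.1 r ≠ 0 ∧ ∀ s, r ≤ s → s ≤ t → p.1 s = p.1 r := by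
  rcases lt_or_ge (t : ℝ≥0∞) (firstJump p.1) with h1 | h1
  · exact Or.inl ⟨h1, p.2.lt_firstJump_iff.1 h1⟩
  · obtain ⟨r, hr⟩ := exists_coe_eq (ne_top_of_le_ne_top ENNReal.coe_ne_top h1)
    have hrt : r ≤ t := by rw [hr] at h1; exact_mod_cast h1
    refine Or.inr ⟨r, hrt, hr, p.2.ne_zero_of_firstJump_eq hr, fun s hrs hst => ?_⟩
    have h2 : (t : ℝ≥0∞) < firstJump (tailPath p).1 := by
      by_contra hc
      exact h ⟨h1, not_lt.1 hc⟩
    have h3 := (tailPath p).2.lt_firstJump_iff.1 h2 (s - r) (tsub_le_self.trans hst)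
    rw [tailPath, hr, ENNReal.toNNReal_coe] at h3
    change p.1 (r + (s - r)) - p.1 r = 0 at h3
    rw [add_tsub_cancel_of_le hrs] at h3
    omega

lemma firstJump_le_iff_of_notMem_twoJumps {t : ℝ≥0} {p : SkipFreePath} (h : p ∉ twoJumps t) :
    firstJump p.1 ≤ t ↔ p.1 t ∈ ({0} : Set ℤ)ᶜ := by
  rcases eq_zero_or_of_notMem_twoJumps h with ⟨h1, h2⟩ | ⟨r, hrt, hr, h0, h2⟩
  · simp [h1.not_ge, h2 t le_rfl]
  · rw [hr, h2 t hrt le_rfl]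
    simpa [h0] using hrt

lemma firstHeight_iff_of_notMem_twoJumps {t : ℝ≥0} {p : SkipFreePath} (h : p ∉ twoJumps t)
    {x : ℤ} (hx : x ≠ 0) : firstJump p.1 ≤ t ∧ firstHeight p = x ↔ p.1 t ∈ ({x} : Set ℤ) := by
  rcases eq_zero_or_of_notMem_twoJumps h with ⟨h1, h2⟩ | ⟨r, hrt, hr, h0, h2⟩
  · simp [h1.not_ge, h2 t le_rfl, hx.symm]
  · rw [firstHeight, hr, h2 t hrt le_rfl, ENNReal.toNNReal_coe]
    simpa using fun _ => hrt

/-- With at most one jump, the path has left its maximum exactly when that jump was downward, and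
its depth is then the size of the jump. -/
lemma exStart_of_notMem_twoJumps {t : ℝ≥0} {p : SkipFreePath} (h : p ∉ twoJumps t) :
    (exStart p.1 ≤ t ∧ p.1 t < 0 ∧ exDepth p = - p.1 t) ∨ ((t : ℝ≥0∞) < exStart p.1 ∧ 0 ≤ p.1 t) := by
  have key (h1 : ∀ s ≤ t, ∀ r ≤ s, p.1 r ≤ p.1 s) : (t : ℝ≥0∞) < exStart p.1 := by
    by_contra hc
    obtain ⟨r, hr⟩ := exists_coe_eq (ne_top_of_le_ne_top ENNReal.coe_ne_top (not_lt.1 hc))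
    have hrt : r ≤ t := by rw [hr] at hc; exact_mod_cast not_lt.1 hc
    have h2 := p.2.pathRefl_exStart_pos hr
    have h3 := p.2.pathMax_le (h1 r hrt)
    rw [pathRefl] at h2
    omega
  rcases eq_zero_or_of_notMem_twoJumps h with ⟨h1, h2⟩ | ⟨r, hrt, hr, h0, h2⟩
  · exact Or.inr ⟨key fun s hs r hr => by rw [h2 s hs, h2 r (hr.trans hs)], (h2 t le_rfl).ge⟩
  · rcases lt_or_gt_of_ne h0 with hneg | hpos
    · obtain ⟨h3, h4⟩ := p.2.exStart_eq_of_firstJump_neg hr hneg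
      refine Or.inl ⟨by rw [h3]; exact_mod_cast hrt, by rw [h2 t hrt le_rfl]; exact hneg, ?_⟩
      rw [exDepth, h3, h2 t hrt le_rfl, ENNReal.toNNReal_coe, h4]
    · refine Or.inr ⟨key fun s hs r' hr' => ?_, by rw [h2 t hrt le_rfl]; exact hpos.le⟩
      have hz {u : ℝ≥0} (hu : u < r) : p.1 u = 0 :=
        IsSkipFreePath.eq_zero_of_lt_firstJump (by rw [hr]; exact_mod_cast hu)
      rcases lt_or_ge r' r with h5 | h5
      · rw [hz h5]
        rcases lt_or_ge s r with h6 | h6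
        · rw [hz h6]
        · rw [h2 s h6 hs]; exact hpos.le
      · rw [h2 r' h5 (hr'.trans hs), h2 s (h5.trans hr') hs]

lemma abs_measureReal_sub_le {α : Type*} [MeasurableSpace α] {P : Measure α} [IsFiniteMeasure P]
    {A B E : Set α} (h : ∀ x ∉ E, (x ∈ A ↔ x ∈ B)) : |P.real A - P.real B| ≤ P.real E := by
  have key {A B : Set α} (h : ∀ x ∉ E, (x ∈ A ↔ x ∈ B)) : P.real A ≤ P.real B + P.real E :=
    (measureReal_mono fun x hx => by
      by_cases hE : x ∈ E
      · exact Or.inr hE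
      · exact Or.inl ((h x hE).1 hx)).trans (measureReal_union_le B E)
  have h1 := key h
  have h2 := key fun x hx => (h x hx).symm
  rw [abs_le]
  constructor <;> linarith

/-- The square of a function that vanishes and is differentiable at zero is `o(t)`, so it does not
affect the derivative. -/
lemma hasDerivWithinAt_of_abs_sub_le_sq {f g k : ℝ → ℝ} {f' k' C : ℝ}
    (hf : HasDerivWithinAt f f' (Set.Ici 0) 0) (hk : HasDerivWithinAt k k' (Set.Ici 0) 0)
    (hk0 : k 0 = 0) (h : ∀ᶠ t in 𝓝[≥] 0, |g t - f t| ≤ C * k t ^ 2) :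
    HasDerivWithinAt g f' (Set.Ici 0) 0 := by
  have h0 : g 0 = f 0 := by
    have := h.self_of_nhdsWithin (Set.self_mem_Ici)
    rw [hk0, zero_pow two_ne_zero, mul_zero] at this
    linarith [abs_nonpos_iff.1 this]
  have h1 : HasDerivWithinAt (fun t => g t - f t) 0 (Set.Ici 0) 0 := by
    have h2 : HasDerivWithinAt (fun t => C * k t ^ 2) 0 (Set.Ici 0) 0 := by
      have h3 := (hk.pow 2).const_mul C
      refine h3.congr_deriv ?_
      simp [hk0]
    rw [hasDerivWithinAt_iff_isLittleO] at h2 ⊢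
    simp only [hk0, h0, smul_zero, sub_zero, sub_self, ne_eq, OfNat.ofNat_ne_zero,
      not_false_eq_true, zero_pow, mul_zero] at h2 ⊢
    refine Asymptotics.IsBigO.trans_isLittleO (Asymptotics.IsBigO.of_bound 1 ?_) h2
    filter_upwards [h] with t ht
    rw [Real.norm_eq_abs, Real.norm_eq_abs, one_mul]
    exact ht.trans (le_abs_self _)
  have h2 := h1.add hf
  refine (h2.congr_deriv (zero_add _)).congr_of_eventuallyEq
    (Eventually.of_forall fun t => ?_) ?_ <;> simp

/-! ### Small-time asymptotics and the laws of the first jump and of the first excursion's start -/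

namespace IsLatticeWalk

variable {Ω : Type*} [mΩ : MeasurableSpace Ω] {μ : Measure Ω} [IsProbabilityMeasure μ]
  {ℱ : Filtration ℝ≥0 mΩ} {U : Ω → SkipFreePath} {Λ : Measure ℤ}

lemma isProbabilityMeasure (hU : IsLatticeWalk μ ℱ U) : IsProbabilityMeasure (μ.map U) :=
  Measure.isProbabilityMeasure_map hU.measurable.aemeasurable

/-- By the strong Markov property at the first jump, the two waiting times are independent with the
same law. -/
lemma measureReal_twoJumps (hU : IsLatticeWalk μ ℱ U) (t : ℝ≥0) :
    (μ.map U).real (twoJumps t) = (μ.map U).real {p | firstJump p.1 ≤ t} ^ 2 := by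
  have hm : MeasurableSet {p : SkipFreePath | firstJump p.1 ≤ t} :=
    measurableSet_le measurable_firstJump measurable_const
  have h := markedTime_firstJump.toMarkedStop.strongMarkov hU (S := Set.Iic (t : ℝ≥0∞) ×ˢ Set.univ)
    (measurableSet_Iic.prod MeasurableSet.univ) hm
  rw [pow_two, measureReal_def, measureReal_def, ← ENNReal.toReal_mul]
  refine congrArg _ ?_
  have e1 : twoJumps t = {p : SkipFreePath | firstJump p.1 ≠ ∞ ∧ (firstJump p.1, firstHeight p) ∈
      Set.Iic (t : ℝ≥0∞) ×ˢ (Set.univ : Set ℤ) ∧ shiftPath (firstJump p.1).toNNReal p ∈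
        {p : SkipFreePath | firstJump p.1 ≤ t}} :=
    Set.ext fun p => ⟨fun h => ⟨ne_top_of_le_ne_top ENNReal.coe_ne_top h.1, ⟨h.1, trivial⟩, h.2⟩,
      fun h => ⟨h.2.1.1, h.2.2⟩⟩
  have e2 : {p : SkipFreePath | firstJump p.1 ≤ t} = {p : SkipFreePath | firstJump p.1 ≠ ∞ ∧
      (firstJump p.1, firstHeight p) ∈ Set.Iic (t : ℝ≥0∞) ×ˢ (Set.univ : Set ℤ)} :=
    Set.ext fun p => ⟨fun h => ⟨ne_top_of_le_ne_top ENNReal.coe_ne_top h, ⟨h, trivial⟩⟩,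
      fun h => h.2.1⟩
  rw [← e1, ← e2] at h
  exact h

lemma tendsto_firstJump_le (hU : IsLatticeWalk μ ℱ U) :
    Tendsto (fun t : ℝ => (μ.map U).real {p | firstJump p.1 ≤ t.toNNReal}) (𝓝[≥] 0) (𝓝 0) := by
  have := hU.isProbabilityMeasure
  have hm (t : ℝ) : MeasurableSet {p : SkipFreePath | firstJump p.1 ≤ t.toNNReal} :=
    measurableSet_le measurable_firstJump measurable_const
  have hmono : Monotone fun t : ℝ => {p : SkipFreePath | firstJump p.1 ≤ t.toNNReal} :=
    fun s t hst p (hp : firstJump p.1 ≤ s.toNNReal) =>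
      hp.trans (by exact_mod_cast Real.toNNReal_le_toNNReal hst)
  have hseq : Tendsto (fun n : ℕ => (μ.map U).real
      {p : SkipFreePath | firstJump p.1 ≤ (1 / ((n : ℝ) + 1)).toNNReal}) atTop (𝓝 0) := by
    have h1 := tendsto_measure_iInter_atTop (μ := μ.map U)
      (s := fun n : ℕ => {p : SkipFreePath | firstJump p.1 ≤ (1 / ((n : ℝ) + 1)).toNNReal})
      (fun n => (hm _).nullMeasurableSet)
      (fun m n hmn => hmono (by gcongr)) ⟨0, measure_ne_top _ _⟩
    have h2 : ⋂ n : ℕ, {p : SkipFreePath | firstJump p.1 ≤ (1 / ((n : ℝ) + 1)).toNNReal} = ∅ := by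
      refine Set.eq_empty_of_forall_notMem fun p hp => ?_
      have h3 : Tendsto (fun n : ℕ => ((1 / ((n : ℝ) + 1)).toNNReal : ℝ≥0∞)) atTop
          (𝓝 ((0 : ℝ).toNNReal : ℝ≥0∞)) :=
        ENNReal.tendsto_coe.2 ((continuous_real_toNNReal.tendsto 0).comp
          tendsto_one_div_add_atTop_nhds_zero_nat)
      have h4 := ge_of_tendsto h3 (.of_forall fun n => Set.mem_iInter.1 hp n)
      simp only [Real.toNNReal_zero, ENNReal.coe_zero] at h4
      exact p.2.firstJump_pos.not_ge h4
    rw [h2, measure_empty] at h1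
    have h3 := (ENNReal.tendsto_toReal ENNReal.zero_ne_top).comp h1
    exact h3
  rw [Metric.tendsto_nhdsWithin_nhds]
  intro ε hε
  obtain ⟨n, hn⟩ := (hseq.eventually_lt_const hε).exists
  refine ⟨1 / ((n : ℝ) + 1), by positivity, fun t _ ht => ?_⟩
  rw [Real.dist_eq, sub_zero] at ht ⊢
  rw [abs_of_nonneg measureReal_nonneg]
  exact (measureReal_mono (hmono ((le_abs_self t).trans ht.le))).trans_lt hn

/-- The event of a jump by `t` differs from that of being away from `0` at `t` only on `twoJumps`,
whose probability is the square of the very quantity to be estimated. Smallness of that quantity for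
small `t` closes the circle. -/
lemma deriv_firstJump_le (hU : IsLatticeWalk μ ℱ U) (hΛ : HasJumpIntensity (μ.map U) Λ) :
    HasDerivWithinAt (fun t : ℝ => (μ.map U).real {p | firstJump p.1 ≤ t.toNNReal})
      (Λ.real Set.univ) (Set.Ici 0) 0 := by
  have := hU.isProbabilityMeasure
  set H : ℝ → ℝ := fun t => (μ.map U).real {p | firstJump p.1 ≤ t.toNNReal} with hH
  set k : ℝ → ℝ := fun t => (μ.map U).real {p | p.1 t.toNNReal ∈ ({0} : Set ℤ)ᶜ} with hk
  have hk' : HasDerivWithinAt k (Λ.real Set.univ) (Set.Ici 0) 0 := by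
    refine (hΛ.deriv {0}ᶜ).congr_deriv ?_
    have h1 : Λ ({0}ᶜ) = Λ Set.univ := by
      exact measure_congr (ae_eq_univ.2 (by rw [compl_compl]; exact hΛ.zero))
    simp [measureReal_def, h1]
  have hk0 : k 0 = 0 := by
    simp only [hk, Real.toNNReal_zero]
    rw [measureReal_eq_zero_iff]
    refine measure_mono_null (fun p hp => hp p.2.zero) measure_empty
  -- From `|H - k| ≤ H ^ 2` and `H < 1 / 2` follows `H ≤ 2 k`, hence `|H - k| ≤ 4 k ^ 2`.
  refine hasDerivWithinAt_of_abs_sub_le_sq (C := 4) hk' hk' hk0 ?_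
  filter_upwards [hU.tendsto_firstJump_le.eventually_lt_const
    (show (0 : ℝ) < 1 / 2 by norm_num)] with t ht
  have h1 := abs_measureReal_sub_le (P := μ.map U) (E := twoJumps t.toNNReal)
    fun p hp => firstJump_le_iff_of_notMem_twoJumps hp
  rw [hU.measureReal_twoJumps] at h1
  change |H t - k t| ≤ H t ^ 2 at h1
  change H t < 1 / 2 at ht
  have h2 : 0 ≤ H t := measureReal_nonneg
  have h3 : H t ≤ 2 * k t := by nlinarith [(abs_le.1 h1).2]
  nlinarith

/-- The main tool for rates: an event which is decided by the position at time `t`, up to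
`twoJumps`, has the same derivative at zero as the marginal. -/
lemma deriv_of_iff (hU : IsLatticeWalk μ ℱ U) (hΛ : HasJumpIntensity (μ.map U) Λ) {B : Set ℤ}
    {D : ℝ≥0 → Set SkipFreePath} (hD : ∀ t, ∀ p ∉ twoJumps t, (p ∈ D t ↔ p.1 t ∈ B)) :
    HasDerivWithinAt (fun t : ℝ => (μ.map U).real (D t.toNNReal))
      (Λ.real B - Λ.real Set.univ * B.indicator 1 0) (Set.Ici 0) 0 := by
  have := hU.isProbabilityMeasure
  refine hasDerivWithinAt_of_abs_sub_le_sq (C := 1) (hΛ.deriv B) (hU.deriv_firstJump_le hΛ) ?_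
    (.of_forall fun t => ?_)
  · rw [measureReal_eq_zero_iff]
    refine measure_mono_null (fun p hp => ?_) measure_empty
    rw [Set.mem_ofPred_eq, Real.toNNReal_zero] at hp
    exact p.2.firstJump_pos.not_ge hp
  · rw [one_mul, ← hU.measureReal_twoJumps]
    exact abs_measureReal_sub_le (hD _)

/-- The law of the first jump: its time, its height and the path thereafter. -/
theorem firstJump_law (hU : IsLatticeWalk μ ℱ U) [IsFiniteMeasure Λ]
    (hΛ : HasJumpIntensity (μ.map U) Λ) :
    (μ.map U).map (fun p => (((firstJump p.1).toReal, firstHeight p), tailPath p)) =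
      ((expMeasure (Λ.real Set.univ)).prod (Λ[|Set.univ])).prod (μ.map U) := by
  have hu : Λ Set.univ ≠ 0 := fun h => hΛ.one (measure_mono_null (Set.subset_univ _) h)
  have hpos : 0 < Λ.real Set.univ := ENNReal.toReal_pos hu (measure_ne_top _ _)
  have := cond_isProbabilityMeasure hu
  refine markedTime_firstJump.law hU hpos (hU.deriv_firstJump_le hΛ) fun x => ?_
  have h1 : Λ.real Set.univ * (Λ[|Set.univ]).real {x} = Λ.real {x} := by
    rw [measureReal_def (Λ[|Set.univ]), cond_apply MeasurableSet.univ, Set.univ_inter,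
      ENNReal.toReal_mul, ENNReal.toReal_inv, ← measureReal_def, ← measureReal_def, mul_inv_cancel_left₀ hpos.ne']
  rw [h1]
  -- A jump never has height zero, so this case is trivial; it is separate because staying at `0`
  -- without a jump has positive probability.
  by_cases hx : x = 0
  · subst hx
    rw [measureReal_def, hΛ.zero, ENNReal.toReal_zero]
    refine (hasDerivWithinAt_const (0 : ℝ) (Set.Ici 0) (0 : ℝ)).congr (fun t _ => ?_) ?_
    all_goals
      rw [measureReal_def, measure_mono_null _ measure_empty, ENNReal.toReal_zero]
      rintro p ⟨h2, h3⟩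
      obtain ⟨r, hr⟩ := exists_coe_eq (ne_top_of_le_ne_top ENNReal.coe_ne_top h2)
      rw [firstHeight, hr, ENNReal.toNNReal_coe] at h3
      exact p.2.ne_zero_of_firstJump_eq hr h3
  · refine (hU.deriv_of_iff hΛ (B := {x}) (D := fun t => {p | firstJump p.1 ≤ t ∧
      firstHeight p = x}) fun t p hp => firstHeight_iff_of_notMem_twoJumps hp hx).congr_deriv ?_
    simp [Ne.symm hx]

lemma ae_firstJump_ne_top (hU : IsLatticeWalk μ ℱ U) [IsFiniteMeasure Λ]
    (hΛ : HasJumpIntensity (μ.map U) Λ) : ∀ᵐ p ∂(μ.map U), firstJump p.1 ≠ ∞ :=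
  markedTime_firstJump.ae_ne_top hU (ENNReal.toReal_pos
    (fun h => hΛ.one (measure_mono_null (Set.subset_univ _) h)) (measure_ne_top _ _))
    (hU.deriv_firstJump_le hΛ)

lemma deriv_exStart_le (hU : IsLatticeWalk μ ℱ U) (hΛ : HasJumpIntensity (μ.map U) Λ) :
    HasDerivWithinAt (fun t : ℝ => (μ.map U).real {p | exStart p.1 ≤ t.toNNReal})
      (Λ.real (Set.Iio 0)) (Set.Ici 0) 0 := by
  refine (hU.deriv_of_iff hΛ (B := Set.Iio 0) (D := fun t => {p | exStart p.1 ≤ t})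
    fun t p hp => ?_).congr_deriv ?_
  · rcases exStart_of_notMem_twoJumps hp with h | h
    · simp [h.1, h.2.1]
    · simp [h.1.not_ge, h.2.not_gt]
  · simp

lemma exStart_survival (hU : IsLatticeWalk μ ℱ U) (hΛ : HasJumpIntensity (μ.map U) Λ) (t : ℝ≥0) :
    (μ.map U).real {p | (t : ℝ≥0∞) < exStart p.1} = Real.exp (-(Λ.real (Set.Iio 0) * t)) :=
  markedTime_exStart.survival_eq hU (hU.deriv_exStart_le hΛ) t

lemma ae_exStart_ne_top (hU : IsLatticeWalk μ ℱ U) (hΛ : HasJumpIntensity (μ.map U) Λ)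
    (h0 : 0 < Λ.real (Set.Iio 0)) : ∀ᵐ p ∂(μ.map U), exStart p.1 ≠ ∞ :=
  markedTime_exStart.ae_ne_top hU h0 (hU.deriv_exStart_le hΛ)

/-- The law of the beginning of the first excursion: its time, the initial distance to the
maximum, and the path thereafter. -/
theorem exStart_law (hU : IsLatticeWalk μ ℱ U) [IsFiniteMeasure Λ]
    (hΛ : HasJumpIntensity (μ.map U) Λ) (h0 : 0 < Λ.real (Set.Iio 0)) :
    (μ.map U).map
      (fun p => (((exStart p.1).toReal, exDepth p), shiftPath (exStart p.1).toNNReal p)) =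
      ((expMeasure (Λ.real (Set.Iio 0))).prod ((Λ[|Set.Iio 0]).map Neg.neg)).prod (μ.map U) := by
  have hu : Λ (Set.Iio 0) ≠ 0 := fun h => h0.ne' (by rw [measureReal_def, h, ENNReal.toReal_zero])
  have := cond_isProbabilityMeasure hu
  have hneg : Measurable (Neg.neg : ℤ → ℤ) := measurable_from_top
  have := Measure.isProbabilityMeasure_map (μ := Λ[|Set.Iio 0]) hneg.aemeasurable
  refine markedTime_exStart.law hU h0 (hU.deriv_exStart_le hΛ) fun x => ?_
  have h1 : Λ.real (Set.Iio 0) * ((Λ[|Set.Iio 0]).map Neg.neg).real {x} =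
      Λ.real (Set.Iio 0 ∩ {-x}) := by
    rw [map_measureReal_apply hneg (measurableSet_singleton x),
      measureReal_def (Λ[|Set.Iio 0]), cond_apply measurableSet_Iio, ENNReal.toReal_mul,
      ENNReal.toReal_inv, ← measureReal_def, ← measureReal_def, mul_inv_cancel_left₀ h0.ne']
    congr 2
    ext y; simp
  rw [h1]
  refine (hU.deriv_of_iff hΛ (B := Set.Iio 0 ∩ {-x})
    (D := fun t => {p | exStart p.1 ≤ t ∧ exDepth p = x}) fun t p hp => ?_).congr_deriv ?_
  · rcases exStart_of_notMem_twoJumps hp with h | h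
    · simp [h.1, h.2.1, h.2.2, neg_eq_iff_eq_neg]
    · simp [h.1.not_ge, h.2.not_gt]
  · simp

end IsLatticeWalk

/-! ### Sums of independent exponential random variables -/

section ExpSum

variable {c : ℝ}

lemma expSumLaw_zero : expSumLaw c 0 = Measure.dirac 0 := by
  rw [expSumLaw, Measure.pi_of_empty (fun _ : Fin 0 => expMeasure c) Fin.elim0,
    Measure.map_dirac' (by fun_prop)]
  simp

lemma isProbabilityMeasure_expSumLaw (hc : 0 < c) (k : ℕ) :
    IsProbabilityMeasure (expSumLaw c k) := by
  have := isProbabilityMeasure_expMeasure hc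
  exact Measure.isProbabilityMeasure_map (Measurable.aemeasurable (by fun_prop))

lemma lintegral_expSumLaw_succ (hc : 0 < c) (k : ℕ) {f : ℝ → ℝ≥0∞} (hf : Measurable f) :
    ∫⁻ x, f x ∂(expSumLaw c (k + 1)) = ∫⁻ x, ∫⁻ y, f (x + y) ∂(expSumLaw c k) ∂(expMeasure c) := by
  have := isProbabilityMeasure_expMeasure hc
  have := isProbabilityMeasure_expSumLaw hc k
  have h := (measurePreserving_piFinSuccAbove (fun _ : Fin (k + 1) => expMeasure c) 0)
  have hs : Measurable fun x : Fin k → ℝ => ∑ i, x i := by fun_prop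
  rw [expSumLaw, lintegral_map hf (by fun_prop)]
  have h2 : ∀ x : Fin (k + 1) → ℝ, f (∑ i, x i) =
      (fun z : ℝ × (Fin k → ℝ) => f (z.1 + ∑ i, z.2 i))
        (MeasurableEquiv.piFinSuccAbove (fun _ => ℝ) 0 x) := fun x => by
    rw [Fin.sum_univ_succ]; rfl
  simp only [h2]
  have hm : Measurable fun z : ℝ × (Fin k → ℝ) => f (z.1 + ∑ i, z.2 i) := by fun_prop
  rw [h.lintegral_comp hm, lintegral_prod _ hm.aemeasurable]
  refine lintegral_congr fun x => ?_
  rw [expSumLaw, lintegral_map (by fun_prop) hs]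

lemma expSumLaw_succ_apply (hc : 0 < c) (k : ℕ) {A : Set ℝ} (hA : MeasurableSet A) :
    expSumLaw c (k + 1) A = ∫⁻ x, expSumLaw c k ((fun y => x + y) ⁻¹' A) ∂(expMeasure c) := by
  rw [← lintegral_indicator_one hA, lintegral_expSumLaw_succ hc k (measurable_one.indicator hA)]
  refine lintegral_congr fun x => ?_
  rw [← lintegral_indicator_one (measurable_const_add x hA)]
  rfl

lemma expMeasure_Iic_zero (hc : 0 < c) : expMeasure c (Set.Iic 0) = 0 := by
  have := isProbabilityMeasure_expMeasure hc
  have h := cdf_expMeasure_eq hc 0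
  rwa [cdf_eq_real, if_pos le_rfl, mul_zero, neg_zero, Real.exp_zero, sub_self,
    measureReal_eq_zero_iff] at h

lemma ae_expMeasure_pos (hc : 0 < c) : ∀ᵐ x ∂(expMeasure c), 0 < x := by
  filter_upwards [measure_eq_zero_iff_ae_notMem.1 (expMeasure_Iic_zero hc)] with x hx
  exact not_le.1 hx

lemma ae_expSumLaw_nonneg (hc : 0 < c) (k : ℕ) : ∀ᵐ x ∂(expSumLaw c k), 0 ≤ x := by
  induction k with
  | zero => rw [expSumLaw_zero, ae_dirac_iff measurableSet_Ici]
  | succ k ih =>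
    rw [ae_iff, show {a : ℝ | ¬0 ≤ a} = (Set.Ici 0)ᶜ from rfl,
      expSumLaw_succ_apply hc k measurableSet_Ici.compl, lintegral_eq_zero_of_ae_eq_zero]
    filter_upwards [ae_expMeasure_pos hc] with x hx
    refine measure_mono_null (t := {y : ℝ | ¬ 0 ≤ y}) (fun y hy => ?_) (ae_iff.1 ih)
    exact fun hy0 => hy (add_nonneg hx.le hy0)

lemma expSumLaw_succ_Iic_zero (hc : 0 < c) (k : ℕ) : expSumLaw c (k + 1) (Set.Iic 0) = 0 := by
  rw [expSumLaw_succ_apply hc k measurableSet_Iic, lintegral_eq_zero_of_ae_eq_zero]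
  filter_upwards [ae_expMeasure_pos hc] with x hx
  refine measure_mono_null (t := {y : ℝ | ¬ 0 ≤ y}) (fun y hy hy0 => ?_) (ae_iff.1 (ae_expSumLaw_nonneg hc k))
  exact absurd hy (not_le.2 (add_pos_of_pos_of_nonneg hx hy0))

lemma measurable_gammaPDF (a r : ℝ) : Measurable (gammaPDF a r) :=
  (measurable_gammaPDFReal a r).ennreal_ofReal

lemma lintegral_expMeasure (c : ℝ) {f : ℝ → ℝ≥0∞} (hf : Measurable f) :
    ∫⁻ x, f x ∂(expMeasure c) = ∫⁻ x, gammaPDF 1 c x * f x := by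
  rw [expMeasure, gammaMeasure, lintegral_withDensity_eq_lintegral_mul _
    (measurable_gammaPDF 1 c) hf]
  rfl

lemma lintegral_exp_expMeasure (hc : 0 < c) {θ : ℝ} (hθ : 0 ≤ θ) :
    ∫⁻ x, ENNReal.ofReal (Real.exp (-θ * x)) ∂(expMeasure c) = ENNReal.ofReal (c / (c + θ)) := by
  rw [lintegral_expMeasure c (by fun_prop)]
  -- Exponential tilting: the density of rate `c` times `e^{-θx}` is a multiple of the density of
  -- rate `c + θ`.
  have h1 (x : ℝ) : gammaPDF 1 c x * ENNReal.ofReal (Real.exp (-θ * x)) =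
      ENNReal.ofReal (c / (c + θ)) * gammaPDF 1 (c + θ) x := by
    rcases lt_or_ge x 0 with hx | hx
    · rw [gammaPDF_of_neg hx, gammaPDF_of_neg hx, zero_mul, mul_zero]
    · rw [gammaPDF_of_nonneg hx, gammaPDF_of_nonneg hx, ← ENNReal.ofReal_mul (by positivity),
        ← ENNReal.ofReal_mul (by positivity)]
      congr 1
      have : Real.exp (-((c + θ) * x)) = Real.exp (-(c * x)) * Real.exp (-θ * x) := by
        rw [← Real.exp_add]; ring_nf
      rw [this]
      have : c + θ ≠ 0 := by positivity
      simp only [Real.rpow_one]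
      field_simp
  simp only [h1]
  rw [lintegral_const_mul _ (measurable_gammaPDF 1 _),
    lintegral_gammaPDF_eq_one zero_lt_one (by positivity), mul_one]

lemma lintegral_id_expMeasure (hc : 0 < c) :
    ∫⁻ x, ENNReal.ofReal x ∂(expMeasure c) = ENNReal.ofReal c⁻¹ := by
  rw [lintegral_expMeasure c (by fun_prop)]
  -- Multiplying the exponential density by `x` gives a multiple of the Gamma density of shape two.
  have h1 (x : ℝ) : gammaPDF 1 c x * ENNReal.ofReal x = ENNReal.ofReal c⁻¹ * gammaPDF 2 c x := by
    rcases lt_or_ge x 0 with hx | hx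
    · rw [gammaPDF_of_neg hx, gammaPDF_of_neg hx, zero_mul, mul_zero]
    · rw [gammaPDF_of_nonneg hx, gammaPDF_of_nonneg hx, ← ENNReal.ofReal_mul (by positivity),
        ← ENNReal.ofReal_mul (by positivity)]
      congr 1
      rw [show (2 : ℝ) - 1 = 1 by norm_num, sub_self, Real.rpow_zero, Real.rpow_one, Real.rpow_one,
        Real.Gamma_one, Real.Gamma_two, Real.rpow_two]
      field_simp
  simp only [h1]
  rw [lintegral_const_mul _ (measurable_gammaPDF 2 _),
    lintegral_gammaPDF_eq_one zero_lt_two hc, mul_one]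

lemma lintegral_exp_expSumLaw (hc : 0 < c) {θ : ℝ} (hθ : 0 ≤ θ) (k : ℕ) :
    ∫⁻ x, ENNReal.ofReal (Real.exp (-θ * x)) ∂(expSumLaw c k) =
      ENNReal.ofReal (c / (c + θ)) ^ k := by
  induction k with
  | zero => rw [expSumLaw_zero, lintegral_dirac' _ (by fun_prop)]; simp
  | succ k ih =>
    rw [lintegral_expSumLaw_succ hc k (by fun_prop)]
    have h1 (x y : ℝ) : ENNReal.ofReal (Real.exp (-θ * (x + y))) =
        ENNReal.ofReal (Real.exp (-θ * x)) * ENNReal.ofReal (Real.exp (-θ * y)) := by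
      rw [← ENNReal.ofReal_mul (Real.exp_nonneg _), ← Real.exp_add, mul_add]
    simp only [h1]
    simp_rw [lintegral_const_mul' _ _ ENNReal.ofReal_ne_top, ih]
    rw [lintegral_mul_const _ (by fun_prop), lintegral_exp_expMeasure hc hθ, pow_succ']

lemma lintegral_id_expSumLaw (hc : 0 < c) (k : ℕ) :
    ∫⁻ x, ENNReal.ofReal x ∂(expSumLaw c k) = k * ENNReal.ofReal c⁻¹ := by
  induction k with
  | zero => rw [expSumLaw_zero, lintegral_dirac' _ (by fun_prop)]; simp
  | succ k ih =>
    have := isProbabilityMeasure_expMeasure hc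
    have := isProbabilityMeasure_expSumLaw hc k
    rw [lintegral_expSumLaw_succ hc k (by fun_prop)]
    have h1 : ∀ᵐ x ∂(expMeasure c), ∫⁻ y, ENNReal.ofReal (x + y) ∂(expSumLaw c k) =
        ENNReal.ofReal x + k * ENNReal.ofReal c⁻¹ := by
      filter_upwards [ae_expMeasure_pos hc] with x hx
      have h3 : ∫⁻ y, ENNReal.ofReal (x + y) ∂(expSumLaw c k) =
          ∫⁻ y, (ENNReal.ofReal x + ENNReal.ofReal y) ∂(expSumLaw c k) := by
        refine lintegral_congr_ae ?_
        filter_upwards [ae_expSumLaw_nonneg hc k] with y hy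
        rw [ENNReal.ofReal_add hx.le hy]
      rw [h3, lintegral_add_left (by fun_prop), ih, lintegral_const, measure_univ, mul_one]
    rw [lintegral_congr_ae h1, lintegral_add_left (by fun_prop), lintegral_id_expMeasure hc,
      lintegral_const, measure_univ, mul_one]
    push_cast
    ring

end ExpSum

/-! ### The hitting times of levels -/

/-- Discontinuities are isolated, so compactness leaves finitely many of them on a bounded interval.
-/
lemma finite_not_continuousAt {w : ℝ≥0 → ℤ} (hw : IsSkipFreePath w) (t : ℝ≥0) :
    (Set.Icc 0 t ∩ {s | ¬ ContinuousAt w s}).Finite := by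
  refine (isCompact_Icc (a := (0 : ℝ≥0)) (b := t)).induction_on
    (p := fun A => (A ∩ {s | ¬ ContinuousAt w s}).Finite) (by simp)
    (fun s r hsr hr => hr.subset (Set.inter_subset_inter_left _ hsr))
    (fun s r hs hr => by rw [Set.union_inter_distrib_right]; exact hs.union hr) fun s _ => ?_
  obtain ⟨u, hsu, hu⟩ := hw.right s
  have hright : ∀ r ∈ Set.Ioo s u, ContinuousAt w r := fun r hr =>
    (continuousAt_const (y := w s)).congr (by
      filter_upwards [Ioo_mem_nhds hr.1 hr.2] with v hv using (hu v ⟨hv.1.le, hv.2⟩).symm)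
  have hleft : ∃ V ∈ 𝓝 s, ∀ r ∈ V, r < s → ContinuousAt w r := by
    rcases eq_or_ne s 0 with rfl | hs0
    · exact ⟨Set.univ, univ_mem, fun r _ hr => absurd hr not_lt_zero⟩
    · obtain ⟨k, -, v, hv, h⟩ := hw.left s (pos_iff_ne_zero.2 hs0)
      refine ⟨Set.Ioi v, Ioi_mem_nhds hv, fun r hr hrs => ?_⟩
      refine (continuousAt_const (y := k)).congr ?_
      filter_upwards [Ioo_mem_nhds hr hrs] with x hx using (h x hx).symm
  obtain ⟨V, hV, h⟩ := hleft
  refine ⟨V ∩ Set.Iio u, mem_nhdsWithin_of_mem_nhds (inter_mem hV (Iio_mem_nhds hsu)), ?_⟩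
  refine (Set.finite_singleton s).subset fun r hr => ?_
  rcases lt_trichotomy r s with hlt | heq | hgt
  · exact absurd (h r hr.1.1 hlt) hr.2
  · exact heq
  · exact absurd (hright r ⟨hgt, hr.1.2⟩) hr.2

lemma hitJumps_lt_top {w : ℝ≥0 → ℤ} (hw : IsSkipFreePath w) {l : ℤ} (h : hitTime w l ≠ ∞) :
    hitJumps w l < ⊤ := by
  obtain ⟨r, hr⟩ := exists_coe_eq h
  rw [hitJumps, pathJumps, Set.encard_lt_top_iff]
  refine (finite_not_continuousAt hw r).subset fun t ht => ⟨⟨zero_le, ?_⟩, ht.2.2⟩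
  have := ht.2.1
  rw [hr] at this
  exact_mod_cast this

/-- `P` is the law of a skip-free random walk with jump rate `c` and step distribution `r`. -/
structure IsWalkLaw (P : Measure SkipFreePath) (c : ℝ) (r : Measure ℤ) : Prop where
  prob : IsProbabilityMeasure P
  prob_step : IsProbabilityMeasure r
  rate_pos : 0 < c
  ne_top : ∀ᵐ p ∂P, firstJump p.1 ≠ ∞
  law : P.map (fun p => (((firstJump p.1).toReal, firstHeight p), tailPath p)) =
    ((expMeasure c).prod r).prod P
  step_ne_zero : r {0} = 0
  step_le_one : r (Set.Ici 2) = 0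
  up_ne_zero : r {1} ≠ 0

/-- The event that the level `l` is hit, on precisely the `k`-th jump. -/
def hitEvent (l : ℤ) (k : ℕ) : Set SkipFreePath := {p | hitTime p.1 l ≠ ∞ ∧ hitJumps p.1 l = k}

lemma measurable_hitTime (l : ℤ) : Measurable fun p : SkipFreePath => hitTime p.1 l :=
  measurable_hitTime_comp measurable_id l

lemma measurableSet_hitEvent (l : ℤ) (k : ℕ) : MeasurableSet (hitEvent l k) :=
  (measurable_hitTime l (measurableSet_singleton ∞).compl).inter (measurableSet_hitJumps l k)

lemma hitEvent_zero_zero : hitEvent 0 0 = Set.univ :=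
  Set.eq_univ_of_forall fun p => ⟨by simp [p.2.hitTime_zero], by simp [p.2.hitJumps_zero]⟩

lemma hitEvent_zero_succ (k : ℕ) : hitEvent 0 (k + 1) = ∅ :=
  Set.eq_empty_of_forall_notMem fun p hp => by
    have := hp.2
    rw [p.2.hitJumps_zero] at this
    exact absurd this.symm (by exact_mod_cast Nat.succ_ne_zero k)

lemma hit_eq_tail {p : SkipFreePath} (hp : firstJump p.1 ≠ ∞) {l : ℤ} (hl : l ≠ 0) :
    hitTime p.1 l = firstJump p.1 + hitTime (tailPath p).1 (l - firstHeight p) ∧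
      hitJumps p.1 l = 1 + hitJumps (tailPath p).1 (l - firstHeight p) := by
  obtain ⟨s, hs⟩ := exists_coe_eq hp
  have h1 := IsSkipFreePath.hitTime_eq_add hs hl
  have h2 := p.2.hitJumps_eq_one_add hs hl
  rw [h1, h2, tailPath, firstHeight, hs, ENNReal.toNNReal_coe]
  exact ⟨rfl, rfl⟩

lemma notMem_hitEvent_zero {p : SkipFreePath} (hp : firstJump p.1 ≠ ∞) {l : ℤ} (hl : l ≠ 0) :
    p ∉ hitEvent l 0 := fun h => by
  have h1 := h.2
  rw [(hit_eq_tail hp hl).2] at h1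
  simp at h1

lemma mem_hitEvent_succ {p : SkipFreePath} (hp : firstJump p.1 ≠ ∞) {l : ℤ} (hl : l ≠ 0) {k : ℕ} :
    p ∈ hitEvent l (k + 1) ↔ tailPath p ∈ hitEvent (l - firstHeight p) k := by
  obtain ⟨h1, h2⟩ := hit_eq_tail hp hl
  simp only [hitEvent, Set.mem_ofPred_eq, h1, h2, ne_eq, ENNReal.add_eq_top, hp, false_or]
  refine and_congr_right fun _ => ?_
  push_cast
  rw [add_comm]
  exact (ENat.add_left_injective_of_ne_top (by simp)).eq_iff

/-! ### First-step analysis of hitting times -/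

namespace IsWalkLaw

variable {P : Measure SkipFreePath} {c : ℝ} {r : Measure ℤ}

lemma measure_firstJump (hP : IsWalkLaw P c r) {S : Set ((ℝ × ℤ) × SkipFreePath)}
    (hS : MeasurableSet S) :
    P {p | (((firstJump p.1).toReal, firstHeight p), tailPath p) ∈ S} =
      ∫⁻ x, ∫⁻ s, P {q | ((s, x), q) ∈ S} ∂(expMeasure c) ∂r := by
  have := hP.prob
  have := hP.prob_step
  have := isProbabilityMeasure_expMeasure hP.rate_pos
  have hm : Measurable fun p : SkipFreePath =>
      (((firstJump p.1).toReal, firstHeight p), tailPath p) :=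
    (measurable_firstJump.ennreal_toReal.prodMk measurable_firstHeight).prodMk measurable_tailPath
  have h1 := Measure.map_apply (μ := P) hm hS
  rw [hP.law, Measure.prod_apply hS,
    lintegral_prod_symm' _ (measurable_measure_prodMk_left hS)] at h1
  exact h1.symm

/-- The path after the first jump has law `P` again, so almost sure properties survive the passage
to it. The height may enter the property because it has countably many values. -/
lemma ae_tail (hP : IsWalkLaw P c r) {R : ℤ → SkipFreePath → Prop} (hR : ∀ x, ∀ᵐ q ∂P, R x q) :
    ∀ᵐ p ∂P, R (firstHeight p) (tailPath p) := by
  have := hP.prob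
  have := hP.prob_step
  have := isProbabilityMeasure_expMeasure hP.rate_pos
  have hm : Measurable fun p : SkipFreePath =>
      (((firstJump p.1).toReal, firstHeight p), tailPath p) :=
    (measurable_firstJump.ennreal_toReal.prodMk measurable_firstHeight).prodMk measurable_tailPath
  have h1 : ∀ᵐ z ∂(P.map fun p => (((firstJump p.1).toReal, firstHeight p), tailPath p)),
      ∀ x, R x z.2 := by
    rw [hP.law]
    exact Measure.quasiMeasurePreserving_snd.ae (ae_all_iff.2 hR)
  filter_upwards [ae_of_ae_map hm.aemeasurable h1] with p hp using hp _

/-- The joint law of the hitting time of a level and of the number of jumps until then. -/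
theorem hit_law (hP : IsWalkLaw P c r) (k : ℕ) (l : ℤ) :
    (∀ A : Set ℝ, MeasurableSet A → P (hitEvent l k ∩ {p | (hitTime p.1 l).toReal ∈ A}) =
      P (hitEvent l k) * expSumLaw c k A) := by
  have := hP.prob
  have := hP.prob_step
  have := isProbabilityMeasure_expMeasure hP.rate_pos
  intro A hA
  induction k generalizing l A with
  | zero =>
    by_cases hl : l = 0
    · subst hl
      rw [hitEvent_zero_zero, measure_univ, one_mul, expSumLaw_zero, Measure.dirac_apply' _ hA,
        Set.univ_inter]
      by_cases h0 : (0 : ℝ) ∈ A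
      · rw [Set.indicator_of_mem h0, show {p : SkipFreePath | (hitTime p.1 0).toReal ∈ A} =
          Set.univ from Set.eq_univ_of_forall fun p => by simpa [p.2.hitTime_zero], measure_univ]
        rfl
      · rw [Set.indicator_of_notMem h0, show {p : SkipFreePath | (hitTime p.1 0).toReal ∈ A} = ∅
          from Set.eq_empty_of_forall_notMem fun p => by simpa [p.2.hitTime_zero], measure_empty]
    · have h0 : P (hitEvent l 0) = 0 := by
        rw [measure_eq_zero_iff_ae_notMem]
        filter_upwards [hP.ne_top] with p hp using notMem_hitEvent_zero hp hl
      rw [h0, zero_mul, measure_mono_null Set.inter_subset_left h0]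
  | succ k ih =>
    by_cases hl : l = 0
    · subst hl
      simp [hitEvent_zero_succ]
    · have hmeas (A : Set ℝ) (hA : MeasurableSet A) : MeasurableSet
          {z : (ℝ × ℤ) × SkipFreePath | z.2 ∈ hitEvent (l - z.1.2) k ∧
            z.1.1 + (hitTime z.2.1 (l - z.1.2)).toReal ∈ A} := by
        have : {z : (ℝ × ℤ) × SkipFreePath | z.2 ∈ hitEvent (l - z.1.2) k ∧
            z.1.1 + (hitTime z.2.1 (l - z.1.2)).toReal ∈ A} = ⋃ x : ℤ,
            {z : (ℝ × ℤ) × SkipFreePath | z.1.2 = x ∧ z.2 ∈ hitEvent (l - x) k ∧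
            z.1.1 + (hitTime z.2.1 (l - x)).toReal ∈ A} := by
          refine Set.ext fun z => ?_
          simp
        rw [this]
        refine MeasurableSet.iUnion fun x => ?_
        refine ((measurable_snd.comp measurable_fst) (measurableSet_singleton x)).inter
          ((measurable_snd (measurableSet_hitEvent _ k)).inter ?_)
        have h1 : Measurable fun z : (ℝ × ℤ) × SkipFreePath =>
            z.1.1 + (hitTime z.2.1 (l - x)).toReal :=
          (measurable_fst.comp measurable_fst).add
            ((measurable_hitTime (l - x)).ennreal_toReal.comp measurable_snd)
        exact h1 hA
      -- Hitting on jump `k + 1` means one exponential waiting time followed by a hit of the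
      -- displaced level on jump `k`. The induction hypothesis makes the time factor independent of
      -- the height, so it comes out of the integral.
      have key (A : Set ℝ) (hA : MeasurableSet A) :
          P (hitEvent l (k + 1) ∩ {p | (hitTime p.1 l).toReal ∈ A}) =
          (∫⁻ x, P (hitEvent (l - x) k) ∂r) * expSumLaw c (k + 1) A := by
        have h1 : P (hitEvent l (k + 1) ∩ {p | (hitTime p.1 l).toReal ∈ A}) =
            P {p | (((firstJump p.1).toReal, firstHeight p), tailPath p) ∈
              {z : (ℝ × ℤ) × SkipFreePath | z.2 ∈ hitEvent (l - z.1.2) k ∧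
                z.1.1 + (hitTime z.2.1 (l - z.1.2)).toReal ∈ A}} := by
          refine measure_congr ?_
          filter_upwards [hP.ne_top] with p hp
          refine propext ?_
          change p ∈ hitEvent l (k + 1) ∧ (hitTime p.1 l).toReal ∈ A ↔
            tailPath p ∈ hitEvent (l - firstHeight p) k ∧
              (firstJump p.1).toReal + (hitTime (tailPath p).1 (l - firstHeight p)).toReal ∈ A
          rw [mem_hitEvent_succ hp hl]
          refine and_congr_right fun h => ?_
          rw [(hit_eq_tail hp hl).1, ENNReal.toReal_add hp h.1]
        rw [h1, hP.measure_firstJump (hmeas A hA), ← lintegral_mul_const' _ _ (by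
          have := isProbabilityMeasure_expSumLaw hP.rate_pos (k + 1)
          exact measure_ne_top _ _)]
        refine lintegral_congr fun x => ?_
        rw [expSumLaw_succ_apply hP.rate_pos k hA, ← lintegral_const_mul' _ _ (measure_ne_top _ _)]
        refine lintegral_congr fun s => ?_
        exact ih (l - x) _ (measurable_const_add s hA)
      -- The choice `A = univ` identifies the remaining integral with the probability of the event.
      have h2 := key Set.univ MeasurableSet.univ
      have := isProbabilityMeasure_expSumLaw hP.rate_pos (k + 1)
      rw [measure_univ, mul_one] at h2
      rw [key A hA, ← h2]
      congr 2
      exact Set.inter_eq_left.2 fun p _ => trivial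

lemma measure_hitEvent_zero (hP : IsWalkLaw P c r) {l : ℤ} (hl : l ≠ 0) :
    P (hitEvent l 0) = 0 := by
  rw [measure_eq_zero_iff_ae_notMem]
  filter_upwards [hP.ne_top] with p hp using notMem_hitEvent_zero hp hl

lemma measure_hitEvent_succ (hP : IsWalkLaw P c r) {l : ℤ} (hl : l ≠ 0) (k : ℕ) :
    P (hitEvent l (k + 1)) = ∫⁻ x, P (hitEvent (l - x) k) ∂r := by
  have := isProbabilityMeasure_expMeasure hP.rate_pos
  have hmeas : MeasurableSet {z : (ℝ × ℤ) × SkipFreePath | z.2 ∈ hitEvent (l - z.1.2) k} := by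
    have : {z : (ℝ × ℤ) × SkipFreePath | z.2 ∈ hitEvent (l - z.1.2) k} = ⋃ x : ℤ,
        {z : (ℝ × ℤ) × SkipFreePath | z.1.2 = x ∧ z.2 ∈ hitEvent (l - x) k} := by
      refine Set.ext fun z => ?_
      simp
    rw [this]
    exact MeasurableSet.iUnion fun x => ((measurable_snd.comp measurable_fst)
      (measurableSet_singleton x)).inter (measurable_snd (measurableSet_hitEvent _ k))
  have h1 := hP.measure_firstJump hmeas
  simp only [Set.mem_ofPred_eq, lintegral_const, measure_univ, mul_one] at h1
  refine Eq.trans (measure_congr ?_) h1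
  filter_upwards [hP.ne_top] with p hp
  exact propext (mem_hitEvent_succ hp hl)

/-- A path which never hits the level almost surely never stops jumping: a finite count could be
reduced jump by jump to the absence of any jump. Conversely, a finite time allows only finitely many
jumps. -/
lemma ae_hitTime_eq_top_iff (hP : IsWalkLaw P c r) (l : ℤ) :
    ∀ᵐ p ∂P, (hitTime p.1 l = ∞ ↔ hitJumps p.1 l = ⊤) := by
  have key (k : ℕ) : ∀ l, ∀ᵐ p ∂P, hitTime p.1 l = ∞ → hitJumps p.1 l ≠ k := by
    induction k with
    | zero =>
      intro l
      filter_upwards [hP.ne_top] with p hp h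
      have hl : l ≠ 0 := by rintro rfl; simp [p.2.hitTime_zero] at h
      rw [(hit_eq_tail hp hl).2]
      simp
    | succ k ih =>
      intro l
      filter_upwards [hP.ne_top, hP.ae_tail (fun x => ih (l - x))] with p hp h2 h
      have hl : l ≠ 0 := by rintro rfl; simp [p.2.hitTime_zero] at h
      obtain ⟨h3, h4⟩ := hit_eq_tail hp hl
      rw [h3, ENNReal.add_eq_top] at h
      rw [h4]
      push_cast
      rw [add_comm, ne_eq, (ENat.add_left_injective_of_ne_top (by simp)).eq_iff]
      exact h2 (h.resolve_left hp)
  filter_upwards [ae_all_iff.2 fun k => key k l] with p hp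
  refine ⟨fun h => ?_, fun h => ?_⟩
  · by_contra hne
    obtain ⟨k, hk⟩ := ENat.ne_top_iff_exists.1 hne
    exact hp k h hk.symm
  · by_contra hne
    exact (hitJumps_lt_top p.2 hne).ne h

end IsWalkLaw

/-! ### The array of hitting probabilities -/

/-- The array of the probabilities `H l k` that a random walk with steps `1` (probability `p`) and
`-(m+1)` (probability `q m`) hits the level `l` for the first time at its `k`-th step. -/
structure IsHitArray (p : ℝ≥0∞) (q : ℕ → ℝ≥0∞) (H : ℕ → ℕ → ℝ≥0∞) : Prop where
  zero_zero : H 0 0 = 1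
  zero_succ : ∀ k, H 0 (k + 1) = 0
  succ_zero : ∀ l, H (l + 1) 0 = 0
  succ_succ : ∀ l k, H (l + 1) (k + 1) = p * H l k + ∑' m, q m * H (l + m + 2) k
  total : p + ∑' m, q m = 1

namespace IsHitArray

lemma tsum_add_mul (H : ℕ → ℕ → ℝ≥0∞) (f : ℕ → ℕ → ℝ≥0∞) (l m : ℕ) :
    ∑' n, ∑ ij ∈ Finset.HasAntidiagonal.antidiagonal n, f ij.1 ij.2 * (H l ij.1 * H m ij.2) =
      ∑' i, ∑' j, f i j * (H l i * H m j) := by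
  rw [← ENNReal.tsum_prod, ← Finset.HasAntidiagonal.sigmaAntidiagonalEquivProd.tsum_eq, ENNReal.tsum_sigma']
  refine tsum_congr fun n => ?_
  rw [← Finset.tsum_subtype (Finset.HasAntidiagonal.antidiagonal n)
    fun ij : ℕ × ℕ => f ij.1 ij.2 * (H l ij.1 * H m ij.2)]
  rfl

variable {p : ℝ≥0∞} {q : ℕ → ℝ≥0∞} {H : ℕ → ℕ → ℝ≥0∞} (hH : IsHitArray p q H)
include hH

/-- The walk climbs at most one level per step. -/
lemma eq_zero_of_lt {l k : ℕ} (h : k < l) : H l k = 0 := by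
  induction k generalizing l with
  | zero =>
    obtain ⟨l, rfl⟩ := Nat.exists_eq_succ_of_ne_zero (show l ≠ 0 by omega)
    exact hH.succ_zero l
  | succ k ih =>
    obtain ⟨l, rfl⟩ := Nat.exists_eq_succ_of_ne_zero (show l ≠ 0 by omega)
    rw [Nat.succ_eq_add_one, hH.succ_succ, ih (by omega), mul_zero, zero_add,
      ENNReal.tsum_eq_zero]
    intro m
    rw [ih (by omega), mul_zero]

lemma diag (l : ℕ) : H l l = p ^ l := by
  induction l with
  | zero => rw [hH.zero_zero, pow_zero]
  | succ l ih =>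
    rw [hH.succ_succ, ih, pow_succ', ENNReal.tsum_eq_zero.2, add_zero]
    intro m
    rw [hH.eq_zero_of_lt (by omega), mul_zero]

/-- A single downward step costs at least one extra upward step, so a detour lengthens the way by at
least two. -/
lemma diag_succ (l : ℕ) : H l (l + 1) = 0 := by
  induction l with
  | zero => exact hH.zero_succ 0
  | succ l ih =>
    rw [hH.succ_succ, ih, mul_zero, zero_add, ENNReal.tsum_eq_zero]
    intro m
    rw [hH.eq_zero_of_lt (by omega), mul_zero]

lemma succ_succ_eq_sum (l k : ℕ) :
    H (l + 1) (k + 1) = p * H l k + ∑ m ∈ Finset.range (k - l - 1), q m * H (l + m + 2) k := by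
  rw [hH.succ_succ, tsum_eq_sum]
  intro m hm
  rw [Finset.mem_range] at hm
  rw [hH.eq_zero_of_lt (by omega), mul_zero]

/-- The way to `l + m` leads through `l`, where the walk starts afresh. Here the convolution
identity is derived from the recursion alone, by induction on the number of steps. -/
lemma sum_antidiagonal (l m n : ℕ) :
    ∑ ij ∈ Finset.HasAntidiagonal.antidiagonal n, H l ij.1 * H m ij.2 = H (l + m) n := by
  induction n generalizing l m with
  | zero =>
    rw [Finset.Nat.antidiagonal_zero, Finset.sum_singleton]
    rcases l with _ | l
    · rw [hH.zero_zero, one_mul, zero_add]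
    · rw [hH.succ_zero, zero_mul, show l + 1 + m = l + m + 1 by ring, hH.succ_zero]
  | succ n ih =>
    rw [Finset.Nat.sum_antidiagonal_succ]
    rcases l with _ | l
    · simp [hH.zero_zero, hH.zero_succ]
    · simp only [hH.succ_zero, zero_mul, zero_add, hH.succ_succ]
      rw [show l + 1 + m = l + m + 1 by ring, hH.succ_succ, ← ih l m, Finset.mul_sum]
      simp only [add_mul, Finset.sum_add_distrib]
      congr 1
      · exact Finset.sum_congr rfl fun ij _ => by ring
      · simp only [← ENNReal.tsum_mul_right]
        rw [← Summable.tsum_finsetSum fun _ _ => ENNReal.summable]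
        refine tsum_congr fun i => ?_
        rw [show l + m + i + 2 = l + i + 2 + m by ring, ← ih, Finset.mul_sum]
        exact Finset.sum_congr rfl fun ij _ => by ring

lemma tsum_add (l m : ℕ) : ∑' n, H (l + m) n = (∑' i, H l i) * ∑' j, H m j := by
  have h := tsum_add_mul H (fun _ _ => 1) l m
  simp only [one_mul, hH.sum_antidiagonal, ENNReal.tsum_mul_left, ENNReal.tsum_mul_right] at h
  exact h

lemma tsum_zero : ∑' k, H 0 k = 1 := by
  rw [tsum_eq_zero_add' ENNReal.summable, hH.zero_zero]
  simp [hH.zero_succ]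

lemma tsum_eq_pow (l : ℕ) : ∑' k, H l k = (∑' k, H 1 k) ^ l := by
  induction l with
  | zero => rw [hH.tsum_zero, pow_zero]
  | succ l ih => rw [hH.tsum_add, ih, pow_succ]

lemma tsum_succ (l : ℕ) (f : ℕ → ℝ≥0∞) : ∑' k, f k * H (l + 1) k =
    p * ∑' k, f (k + 1) * H l k + ∑' m, q m * ∑' k, f (k + 1) * H (l + m + 2) k := by
  rw [tsum_eq_zero_add' ENNReal.summable, hH.succ_zero, mul_zero, zero_add]
  simp only [hH.succ_succ, mul_add]
  rw [ENNReal.tsum_add, ← ENNReal.tsum_mul_left]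
  congr 1
  · exact tsum_congr fun k => by ring
  · simp only [← ENNReal.tsum_mul_left]
    rw [ENNReal.tsum_comm]
    exact tsum_congr fun m => tsum_congr fun k => by ring

/-- First-step analysis for level `1`: after a downward step of size `m + 1` there are `m + 2`
levels to climb, each with the same probability. -/
lemma fixed_point : ∑' k, H 1 k = p + ∑' m, q m * (∑' k, H 1 k) ^ (m + 2) := by
  have h := hH.tsum_succ 0 fun _ => 1
  simp only [one_mul, zero_add, hH.tsum_zero, mul_one] at h
  rw [h]
  congr 1
  exact tsum_congr fun m => by rw [hH.tsum_eq_pow, ← h]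

lemma sum_range_succ (l n : ℕ) (f : ℕ → ℝ≥0∞) : ∑ k ∈ Finset.range (n + 1), f k * H (l + 1) k =
    p * ∑ k ∈ Finset.range n, f (k + 1) * H l k +
      ∑' m, q m * ∑ k ∈ Finset.range n, f (k + 1) * H (l + m + 2) k := by
  rw [Finset.sum_range_succ', hH.succ_zero, mul_zero, add_zero]
  simp only [hH.succ_succ, mul_add, Finset.sum_add_distrib, Finset.mul_sum]
  congr 1
  · exact Finset.sum_congr rfl fun k _ => by ring
  · rw [Summable.tsum_finsetSum fun _ _ => ENNReal.summable]
    refine Finset.sum_congr rfl fun k _ => ?_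
    rw [← ENNReal.tsum_mul_left]
    exact tsum_congr fun m => by ring

lemma tsum_zero_mul (f : ℕ → ℝ≥0∞) : ∑' k, f k * H 0 k = f 0 := by
  rw [tsum_eq_zero_add' ENNReal.summable, hH.zero_zero]
  simp [hH.zero_succ]

/-- The probability of hitting within `n` steps stays below every solution of the fixed point
equation, by induction on `n`. The hitting probability is thus the smallest solution. -/
lemma tsum_le_pow {x : ℝ≥0∞} (hx : x = p + ∑' m, q m * x ^ (m + 2)) (l : ℕ) :
    ∑' k, H l k ≤ x ^ l := by
  rw [ENNReal.tsum_eq_iSup_nat]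
  refine iSup_le fun n => ?_
  induction n generalizing l with
  | zero => simp
  | succ n ih =>
    rcases l with _ | l
    · rw [pow_zero, ← hH.tsum_zero]
      exact ENNReal.sum_le_tsum _
    · have h := hH.sum_range_succ l n fun _ => 1
      simp only [one_mul] at h
      rw [h, pow_succ]
      nth_rw 2 [hx]
      rw [mul_add, ← ENNReal.tsum_mul_left, mul_comm (x ^ l)]
      refine add_le_add (by gcongr; exact ih l) (ENNReal.tsum_le_tsum fun m => ?_)
      calc _ ≤ q m * x ^ (l + m + 2) := by gcongr; exact ih _
        _ = _ := by rw [add_assoc, pow_add]; ring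

lemma tsum_one_le : ∑' k, H 1 k ≤ 1 := by
  have h := hH.tsum_le_pow (x := 1) (by simp [hH.total]) 1
  rwa [one_pow] at h

/-- A solution `K` of the first-step equation for the mean bounds the truncated means, by induction
on the truncation. This is needed to know that the mean is finite before the equation is solved by
subtraction. -/
lemma mean_le {K : ℝ≥0∞} (hK : K = 1 + (∑' m : ℕ, q m * (m + 2)) * K) (l : ℕ) :
    ∑' k : ℕ, k * H l k ≤ l * K := by
  rw [ENNReal.tsum_eq_iSup_nat]
  refine iSup_le fun n => ?_
  induction n generalizing l with
  | zero => simp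
  | succ n ih =>
    rcases l with _ | l
    · refine (ENNReal.sum_le_tsum _).trans ?_
      rw [hH.tsum_zero_mul fun k => k]
      simp
    · have h := hH.sum_range_succ l n fun k => k
      have h1 (l : ℕ) : ∑ k ∈ Finset.range n, ((k + 1 : ℕ) : ℝ≥0∞) * H l k ≤ l * K + 1 := by
        simp only [Nat.cast_add, Nat.cast_one, add_mul, one_mul, Finset.sum_add_distrib]
        refine add_le_add (ih l) ((ENNReal.sum_le_tsum _).trans ?_)
        have h2 := hH.tsum_le_pow (x := 1) (by simp [hH.total]) l
        rwa [one_pow] at h2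
      rw [h]
      calc _ ≤ p * (l * K + 1) + ∑' m : ℕ, q m * ((l + m + 2 : ℕ) * K + 1) := by
            gcongr with m
            · exact h1 l
            · exact h1 _
        _ = (p + ∑' m, q m) * (l * K) + ((p + ∑' m, q m) + (∑' m : ℕ, q m * (m + 2)) * K) := by
            have : ∀ m : ℕ, q m * ((l + m + 2 : ℕ) * K + 1) =
                q m * (l * K) + q m + q m * (m + 2) * K := fun m => by push_cast; ring
            simp only [this, ENNReal.tsum_add, ENNReal.tsum_mul_right]
            ring
        _ = _ := by
            rw [hH.total, ← hK]
            push_cast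
            ring

/-- When every level is hit with probability one, the climbs of successive levels are independent
copies and their means add up. -/
lemma mean_eq_mul (h1 : ∑' k, H 1 k = 1) (l : ℕ) :
    ∑' k : ℕ, (k : ℝ≥0∞) * H l k = l * ∑' k : ℕ, (k : ℝ≥0∞) * H 1 k := by
  have hU (l : ℕ) : ∑' k, H l k = 1 := by rw [hH.tsum_eq_pow, h1, one_pow]
  induction l with
  | zero => rw [hH.tsum_zero_mul fun k => k]; simp
  | succ l ih =>
    have h := tsum_add_mul H (fun i j => i + j) l 1
    have h2 (n : ℕ) : ∑ ij ∈ Finset.HasAntidiagonal.antidiagonal n,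
        ((ij.1 : ℝ≥0∞) + ij.2) * (H l ij.1 * H 1 ij.2) = n * H (l + 1) n := by
      rw [← hH.sum_antidiagonal, Finset.mul_sum]
      refine Finset.sum_congr rfl fun ij hij => ?_
      rw [← Nat.cast_add, Finset.HasAntidiagonal.mem_antidiagonal.1 hij]
    simp only [h2] at h
    have h3 (i j : ℕ) : ((i : ℝ≥0∞) + j) * (H l i * H 1 j) =
        i * H l i * H 1 j + H l i * (j * H 1 j) := by ring
    simp only [h3, ENNReal.tsum_add, ENNReal.tsum_mul_left, ENNReal.tsum_mul_right, h1, hU,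
      mul_one, one_mul, ih] at h
    rw [h]
    push_cast
    ring

lemma mean_one (h1 : ∑' k, H 1 k = 1) :
    ∑' k : ℕ, (k : ℝ≥0∞) * H 1 k = (1 - ∑' m : ℕ, q m * (m + 2))⁻¹ := by
  set D := ∑' m : ℕ, q m * ((m : ℝ≥0∞) + 2) with hD
  set M := ∑' k : ℕ, (k : ℝ≥0∞) * H 1 k with hM
  have hU (l : ℕ) : ∑' k, H l k = 1 := by rw [hH.tsum_eq_pow, h1, one_pow]
  have key : M = 1 + D * M := by
    have h := hH.tsum_succ 0 fun k => k
    simp only [zero_add, hH.tsum_zero_mul (fun k => ((k + 1 : ℕ) : ℝ≥0∞)), Nat.cast_one,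
      mul_one] at h
    have h2 (m : ℕ) : ∑' k : ℕ, ((k + 1 : ℕ) : ℝ≥0∞) * H (m + 2) k = (m + 2) * M + 1 := by
      simp only [Nat.cast_add, Nat.cast_one, add_mul, one_mul, ENNReal.tsum_add, hU,
        hH.mean_eq_mul h1 (m + 2)]
      push_cast
      ring
    simp only [h2, mul_add, mul_one, ENNReal.tsum_add] at h
    have h3 : ∀ m : ℕ, q m * ((m + 2) * M) = q m * (m + 2) * M := fun m => by ring
    calc M = _ := h
      _ = _ := by
        rw [tsum_congr h3, ENNReal.tsum_mul_right, ← hD, add_comm _ (∑' m, q m), ← add_assoc,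
          hH.total]
  -- As `p + ∑ q m = 1`, the number `1 - D` is the mean step of the walk when `D` is finite. For
  -- positive drift, `mean_le` with `K = (1 - D)⁻¹` gives finiteness, and the equation `M = 1 + D *
  -- M` can be solved.
  rcases lt_or_ge D 1 with hlt | hge
  · have hK : (1 - D)⁻¹ = 1 + D * (1 - D)⁻¹ := by
      have h0 : 1 - D ≠ 0 := (tsub_pos_of_lt hlt).ne'
      have hf : 1 - D ≠ ∞ := ne_top_of_le_ne_top ENNReal.one_ne_top tsub_le_self
      nth_rw 2 [← ENNReal.mul_inv_cancel h0 hf]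
      rw [← add_mul, tsub_add_cancel_of_le hlt.le, one_mul]
    have hle := hH.mean_le hK 1
    rw [Nat.cast_one, one_mul] at hle
    have hMf : M ≠ ∞ := ne_top_of_le_ne_top (ENNReal.inv_ne_top.2 (tsub_pos_of_lt hlt).ne') hle
    refine ENNReal.eq_inv_of_mul_eq_one_left ?_
    rw [ENNReal.mul_sub (fun _ _ => hMf), mul_one, mul_comm M D]
    nth_rw 1 [key]
    exact ENNReal.add_sub_cancel_right (ENNReal.mul_ne_top hlt.ne_top hMf)
  -- Without positive drift a finite mean would satisfy `M + 1 ≤ M`.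
  · rw [tsub_eq_zero_of_le hge, ENNReal.inv_zero]
    by_contra hMf
    have h2 : M + 1 ≤ M := by
      nth_rw 2 [key]
      rw [add_comm]
      gcongr
      exact le_mul_of_one_le_left zero_le hge
    exact (ENNReal.lt_add_right hMf one_ne_zero).not_ge h2

end IsHitArray

/-! ### The law of an excursion -/

lemma lintegral_int_eq (r : Measure ℤ) (f : ℤ → ℝ≥0∞) :
    ∫⁻ x, f x ∂r = ∑' n : ℕ, r {(n : ℤ)} * f n + ∑' n : ℕ, r {-((n : ℤ) + 1)} * f (-(n + 1)) := by
  rw [lintegral_countable', tsum_of_nat_of_neg_add_one ENNReal.summable ENNReal.summable]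
  simp only [mul_comm (f _)]

namespace IsWalkLaw

variable {P : Measure SkipFreePath} {c : ℝ} {r : Measure ℤ}

lemma lintegral_step (hP : IsWalkLaw P c r) (f : ℤ → ℝ≥0∞) :
    ∫⁻ x, f x ∂r = r {1} * f 1 + ∑' n : ℕ, r {-((n : ℤ) + 1)} * f (-(n + 1)) := by
  rw [lintegral_int_eq, tsum_eq_single 1, Nat.cast_one]
  intro n hn
  have h0 : r {(n : ℤ)} = 0 := by
    rcases Nat.lt_or_ge n 1 with h | h
    · obtain rfl : n = 0 := by omega
      exact hP.step_ne_zero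
    · refine measure_mono_null (Set.singleton_subset_iff.2 ?_) hP.step_le_one
      rw [Set.mem_Ici]
      omega
  rw [h0, zero_mul]

lemma isHitArray (hP : IsWalkLaw P c r) : IsHitArray (r {1}) (fun m => r {-((m : ℤ) + 1)})
    fun l k => P (hitEvent l k) where
  zero_zero := by
    have := hP.prob
    rw [Nat.cast_zero, hitEvent_zero_zero, measure_univ]
  zero_succ k := by rw [Nat.cast_zero, hitEvent_zero_succ, measure_empty]
  succ_zero l := hP.measure_hitEvent_zero (by exact_mod_cast Nat.succ_ne_zero l)
  succ_succ l k := by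
    rw [hP.measure_hitEvent_succ (by exact_mod_cast Nat.succ_ne_zero l), hP.lintegral_step]
    congr 2
    · congr 2; push_cast; ring
    · refine funext fun m => ?_
      congr 3; push_cast; ring
  total := by
    have := hP.prob_step
    have h := hP.lintegral_step 1
    simpa using h.symm

end IsWalkLaw

lemma measurableSet_of_slices {α : Type*} [MeasurableSpace α] {S : Set (ℤ × α)}
    (h : ∀ l, MeasurableSet {q | (l, q) ∈ S}) : MeasurableSet S := by
  have : S = ⋃ l : ℤ, Prod.fst ⁻¹' {l} ∩ Prod.snd ⁻¹' {q | (l, q) ∈ S} := by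
    refine Set.ext fun z => ?_
    simp
  rw [this]
  exact MeasurableSet.iUnion fun l =>
    (measurable_fst (measurableSet_singleton l)).inter (measurable_snd (h l))

/-- The path after the beginning of the first excursion. -/
def exPath (p : SkipFreePath) : SkipFreePath := shiftPath (exStart p.1).toNNReal p

/-- The length of the first excursion. -/
def exLength (p : SkipFreePath) : ℝ≥0∞ := hitTime (exPath p).1 (exDepth p)

/-- The number of jumps of the first excursion, without the jump by which it begins. -/
def exJumps (p : SkipFreePath) : ℕ∞ := hitJumps (exPath p).1 (exDepth p)

lemma measurable_exPath : Measurable exPath :=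
  measurable_shiftPath_comp measurable_id (measurable_exStart_comp measurable_id).ennreal_toNNReal

lemma measurable_exDepth : Measurable exDepth := markedTime_exStart.measurable_mark

lemma measurable_exLength : Measurable exLength := by
  have h := (measurable_from_prod_countable_right
    (f := fun z : ℤ × SkipFreePath => hitTime z.2.1 z.1) fun l => measurable_hitTime l).comp
      (measurable_exDepth.prodMk measurable_exPath)
  simp only [Function.comp_def] at h
  exact h

lemma exEnd_eq (p : SkipFreePath) : exEnd p.1 = exStart p.1 + exLength p := by
  by_cases h : exStart p.1 = ∞
  · rw [exEnd, h, firstTime_top, top_add]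
  · obtain ⟨r, hr⟩ := exists_coe_eq h
    rw [p.2.exEnd_eq_add hr, exLength, exPath, exDepth, hr, ENNReal.toNNReal_coe]
    rfl

lemma pathJumps_exStart_exEnd {p : SkipFreePath} (h : exStart p.1 ≠ ∞) :
    pathJumps p.1 (exStart p.1) (exEnd p.1) = exJumps p := by
  obtain ⟨r, hr⟩ := exists_coe_eq h
  rw [p.2.pathJumps_excursion hr, exJumps, exPath, exDepth, hr, ENNReal.toNNReal_coe]
  rfl

/-- `P` is the law of a skip-free random walk with jump rate `c`, step distribution `r` and with
downward jumps of rate `a > 0` and distribution `ρ` (on the depths). -/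
structure IsExcursionLaw (P : Measure SkipFreePath) (c : ℝ) (r : Measure ℤ) (a : ℝ)
    (ρ : Measure ℤ) : Prop where
  walk : IsWalkLaw P c r
  prob_depth : IsProbabilityMeasure ρ
  rate_pos : 0 < a
  ne_top : ∀ᵐ p ∂P, exStart p.1 ≠ ∞
  law : P.map (fun p => (((exStart p.1).toReal, exDepth p), exPath p)) =
    ((expMeasure a).prod ρ).prod P
  depth_nonpos : ρ (Set.Iic 0) = 0

namespace IsLatticeWalk

variable {Ω : Type*} [mΩ : MeasurableSpace Ω] {μ : Measure Ω} [IsProbabilityMeasure μ]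
  {ℱ : Filtration ℝ≥0 mΩ} {U : Ω → SkipFreePath} {Λ : Measure ℤ} [IsFiniteMeasure Λ]

lemma isWalkLaw (hU : IsLatticeWalk μ ℱ U) (hΛ : HasJumpIntensity (μ.map U) Λ) :
    IsWalkLaw (μ.map U) (Λ.real Set.univ) (Λ[|Set.univ]) where
  prob := hU.isProbabilityMeasure
  prob_step := cond_isProbabilityMeasure fun h =>
    hΛ.one (measure_mono_null (Set.subset_univ _) h)
  rate_pos := ENNReal.toReal_pos
    (fun h => hΛ.one (measure_mono_null (Set.subset_univ _) h)) (measure_ne_top _ _)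
  ne_top := hU.ae_firstJump_ne_top hΛ
  law := hU.firstJump_law hΛ
  step_ne_zero := by rw [cond_apply MeasurableSet.univ, Set.univ_inter, hΛ.zero, mul_zero]
  step_le_one := by rw [cond_apply MeasurableSet.univ, Set.univ_inter, hΛ.two_le, mul_zero]
  up_ne_zero := by
    rw [cond_apply MeasurableSet.univ, Set.univ_inter]
    exact mul_ne_zero (ENNReal.inv_ne_zero.2 (measure_ne_top _ _)) hΛ.one

lemma isExcursionLaw (hU : IsLatticeWalk μ ℱ U) (hΛ : HasJumpIntensity (μ.map U) Λ)
    (h0 : 0 < Λ.real (Set.Iio 0)) :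
    IsExcursionLaw (μ.map U) (Λ.real Set.univ) (Λ[|Set.univ]) (Λ.real (Set.Iio 0))
      ((Λ[|Set.Iio 0]).map Neg.neg) where
  walk := hU.isWalkLaw hΛ
  prob_depth := by
    have := cond_isProbabilityMeasure (μ := Λ) (s := Set.Iio 0)
      fun h => h0.ne' (by rw [measureReal_def, h, ENNReal.toReal_zero])
    exact Measure.isProbabilityMeasure_map (Measurable.of_discrete).aemeasurable
  rate_pos := h0
  ne_top := hU.ae_exStart_ne_top hΛ h0
  law := hU.exStart_law hΛ h0
  depth_nonpos := by
    rw [Measure.map_apply Measurable.of_discrete MeasurableSet.of_discrete,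
      cond_apply measurableSet_Iio]
    have : Set.Iio (0 : ℤ) ∩ Neg.neg ⁻¹' Set.Iic 0 = ∅ := by
      refine Set.eq_empty_of_forall_notMem fun x hx => ?_
      have h1 : x < 0 := hx.1
      have h2 : -x ≤ 0 := hx.2
      omega
    rw [this, measure_empty, mul_zero]

end IsLatticeWalk

/-! ### Length and number of jumps of the first excursion -/

namespace IsExcursionLaw

variable {P : Measure SkipFreePath} {c : ℝ} {r : Measure ℤ} {a : ℝ} {ρ : Measure ℤ}

lemma measure_inter (hP : IsExcursionLaw P c r a ρ) {I : Set ℝ} (hI : MeasurableSet I)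
    {S : Set (ℤ × SkipFreePath)} (hS : MeasurableSet S) :
    P {p | (exStart p.1).toReal ∈ I ∧ (exDepth p, exPath p) ∈ S} =
      expMeasure a I * ∫⁻ l, P {q | (l, q) ∈ S} ∂ρ := by
  have := hP.walk.prob
  have := hP.prob_depth
  have := isProbabilityMeasure_expMeasure hP.rate_pos
  have hm : Measurable fun p : SkipFreePath => (((exStart p.1).toReal, exDepth p), exPath p) :=
    ((measurable_exStart_comp measurable_id).ennreal_toReal.prodMk measurable_exDepth).prodMk
      measurable_exPath
  have h1 := Measure.map_apply (μ := P.map fun p => (((exStart p.1).toReal, exDepth p), exPath p))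
    MeasurableEquiv.prodAssoc.measurable (hI.prod hS)
  rw [hP.law, Measure.prodAssoc_prod, Measure.prod_prod, Measure.prod_apply hS, ← hP.law,
    Measure.map_apply hm (MeasurableEquiv.prodAssoc.measurable (hI.prod hS))] at h1
  exact h1.symm

lemma measure_depth_path (hP : IsExcursionLaw P c r a ρ) {S : Set (ℤ × SkipFreePath)}
    (hS : MeasurableSet S) :
    P {p | (exDepth p, exPath p) ∈ S} = ∫⁻ l, P {q | (l, q) ∈ S} ∂ρ := by
  have := isProbabilityMeasure_expMeasure hP.rate_pos
  have h := hP.measure_inter MeasurableSet.univ hS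
  rw [measure_univ, one_mul] at h
  simpa using h

lemma indep (hP : IsExcursionLaw P c r a ρ) {I : Set ℝ} (hI : MeasurableSet I)
    {S : Set (ℤ × SkipFreePath)} (hS : MeasurableSet S) :
    P {p | (exStart p.1).toReal ∈ I ∧ (exDepth p, exPath p) ∈ S} =
      expMeasure a I * P {p | (exDepth p, exPath p) ∈ S} := by
  rw [hP.measure_inter hI hS, hP.measure_depth_path hS]

lemma lintegral_depth (hP : IsExcursionLaw P c r a ρ) (f : ℤ → ℝ≥0∞) :
    ∫⁻ x, f x ∂ρ = ∑' n : ℕ, ρ {((n + 1 : ℕ) : ℤ)} * f (n + 1 : ℕ) := by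
  rw [lintegral_int_eq, tsum_eq_zero_add' ENNReal.summable]
  have h0 : ρ {((0 : ℕ) : ℤ)} = 0 :=
    measure_mono_null (Set.singleton_subset_iff.2 (by simp)) hP.depth_nonpos
  have h1 (n : ℕ) : ρ {-((n : ℤ) + 1)} = 0 :=
    measure_mono_null (Set.singleton_subset_iff.2 (by rw [Set.mem_Iic]; omega)) hP.depth_nonpos
  have h2 : ∑' n : ℕ, ρ {-((n : ℤ) + 1)} * f (-(n + 1)) = 0 :=
    ENNReal.tsum_eq_zero.2 fun n => by rw [h1, zero_mul]
  rw [h0, zero_mul, zero_add, h2, add_zero]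

/-- The probability that the first excursion is finite, with `k` jumps. -/
lemma measure_exJumps_eq (hP : IsExcursionLaw P c r a ρ) (k : ℕ) :
    P {p | exLength p ≠ ∞ ∧ exJumps p = k} =
      ∑' n : ℕ, ρ {((n + 1 : ℕ) : ℤ)} * P (hitEvent (n + 1 : ℕ) k) := by
  rw [← hP.lintegral_depth fun l => P (hitEvent l k)]
  exact hP.measure_depth_path (S := {z | z.2 ∈ hitEvent z.1 k})
    (measurableSet_of_slices fun l => measurableSet_hitEvent l k)

lemma ae_exLength_eq_top_iff (hP : IsExcursionLaw P c r a ρ) :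
    ∀ᵐ p ∂P, (exLength p = ∞ ↔ exJumps p = ⊤) := by
  have hm : MeasurableSet
      {z : ℤ × SkipFreePath | ¬ (hitTime z.2.1 z.1 = ∞ ↔ hitJumps z.2.1 z.1 = ⊤)} := by
    refine measurableSet_of_slices fun l => ?_
    have h1 : MeasurableSet {q : SkipFreePath | hitTime q.1 l = ∞} :=
      measurable_hitTime l (measurableSet_singleton ∞)
    have h2 : MeasurableSet {q : SkipFreePath | hitJumps q.1 l = ⊤} := by
      have : {q : SkipFreePath | hitJumps q.1 l = ⊤} =
          (⋃ k : ℕ, {q : SkipFreePath | hitJumps q.1 l = k})ᶜ := by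
        refine Set.ext fun q => ?_
        simp only [Set.mem_ofPred_eq, Set.mem_compl_iff, Set.mem_iUnion, not_exists]
        refine ⟨fun h k => by rw [h]; simp, fun h => ?_⟩
        by_contra hne
        obtain ⟨k, hk⟩ := ENat.ne_top_iff_exists.1 hne
        exact h k hk.symm
      rw [this]
      exact (MeasurableSet.iUnion fun k => measurableSet_hitJumps l k).compl
    exact (h1.iff h2).compl
  have h := hP.measure_depth_path hm
  rw [lintegral_eq_zero_of_ae_eq_zero (.of_forall fun l => ?_)] at h
  · exact h
  · exact hP.walk.ae_hitTime_eq_top_iff l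

lemma measure_exJumps_eq' (hP : IsExcursionLaw P c r a ρ) (k : ℕ) :
    P {p | exJumps p = k} = P {p | exLength p ≠ ∞ ∧ exJumps p = k} := by
  refine measure_congr ?_
  filter_upwards [hP.ae_exLength_eq_top_iff] with p hp
  refine propext ⟨fun h => ⟨fun h1 => ?_, h⟩, fun h => h.2⟩
  rw [show exJumps p = k from h] at hp
  simpa using hp.1 h1

lemma measure_exJumps_zero (hP : IsExcursionLaw P c r a ρ) : P {p | exJumps p = 0} = 0 := by
  rw [← Nat.cast_zero, hP.measure_exJumps_eq', hP.measure_exJumps_eq, ENNReal.tsum_eq_zero]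
  intro n
  rw [hP.walk.isHitArray.succ_zero n, mul_zero]

/-- Given `k` jumps, the law of the hitting time does not depend on the level, so averaging over the
initial depth leaves it unchanged. -/
lemma measure_exLength_inter (hP : IsExcursionLaw P c r a ρ) (k : ℕ) {A : Set ℝ}
    (hA : MeasurableSet A) :
    P {p | (exLength p ≠ ∞ ∧ exJumps p = k) ∧ (exLength p).toReal ∈ A} =
      P {p | exJumps p = k} * expSumLaw c k A := by
  have := isProbabilityMeasure_expSumLaw hP.walk.rate_pos k
  have h := hP.measure_depth_path (S := {z | z.2 ∈ hitEvent z.1 k ∧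
    (hitTime z.2.1 z.1).toReal ∈ A}) (measurableSet_of_slices fun l =>
      (measurableSet_hitEvent l k).inter ((measurable_hitTime l).ennreal_toReal hA))
  have h2 := hP.measure_depth_path (S := {z | z.2 ∈ hitEvent z.1 k})
    (measurableSet_of_slices fun l => measurableSet_hitEvent l k)
  rw [hP.measure_exJumps_eq']
  refine h.trans (Eq.trans ?_ (congrArg (· * _) h2.symm))
  rw [← lintegral_mul_const' _ _ (measure_ne_top _ _)]
  exact lintegral_congr fun l => hP.walk.hit_law k l A hA

lemma measurableSet_exJumps (k : ℕ) : MeasurableSet {p | exJumps p = k} :=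
  (measurable_exDepth.prodMk measurable_exPath)
    (measurableSet_of_slices (S := {z : ℤ × SkipFreePath | hitJumps z.2.1 z.1 = k})
      fun l => measurableSet_hitJumps l k)

lemma measurableSet_exLength_ne_top : MeasurableSet {p | exLength p ≠ ∞} :=
  measurable_exLength (measurableSet_singleton ∞).compl

/-- The law of the length of a finite excursion. -/
lemma map_exLength (hP : IsExcursionLaw P c r a ρ) :
    (P.restrict {p | exLength p ≠ ∞}).map (fun p => (exLength p).toReal) =
      Measure.sum fun k : ℕ => P {p | exJumps p = (k + 1 : ℕ)} • expSumLaw c (k + 1) := by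
  refine Measure.ext fun A hA => ?_
  have hm : MeasurableSet ((fun p => (exLength p).toReal) ⁻¹' A) :=
    measurable_exLength.ennreal_toReal hA
  rw [Measure.map_apply measurable_exLength.ennreal_toReal hA, Measure.restrict_apply hm,
    Measure.sum_apply _ hA]
  have h1 : P ((fun p => (exLength p).toReal) ⁻¹' A ∩ {p | exLength p ≠ ∞}) =
      P (⋃ k : ℕ, {p | (exLength p ≠ ∞ ∧ exJumps p = k) ∧ (exLength p).toReal ∈ A}) := by
    refine measure_congr ?_
    filter_upwards [hP.ae_exLength_eq_top_iff] with p hp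
    refine propext ⟨fun h => ?_, fun h => ?_⟩
    · obtain ⟨k, hk⟩ := ENat.ne_top_iff_exists.1 fun h' => h.2 (hp.2 h')
      exact Set.mem_iUnion.2 ⟨k, ⟨h.2, hk.symm⟩, h.1⟩
    · obtain ⟨k, hk⟩ := Set.mem_iUnion.1 h
      exact ⟨hk.2, hk.1.1⟩
  rw [h1, measure_iUnion]
  · simp only [hP.measure_exLength_inter _ hA]
    rw [tsum_eq_zero_add' ENNReal.summable, Nat.cast_zero, hP.measure_exJumps_zero, zero_mul,
      zero_add]
    rfl
  · intro i j hij
    refine Set.disjoint_left.2 fun p h h' => hij ?_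
    have := h.1.2.symm.trans h'.1.2
    exact_mod_cast this
  · exact fun k => (measurableSet_exLength_ne_top.inter (measurableSet_exJumps k)).inter hm

lemma measure_exLength_ne_top (hP : IsExcursionLaw P c r a ρ) :
    P {p | exLength p ≠ ∞} = ∑' k : ℕ, P {p | exJumps p = (k + 1 : ℕ)} := by
  have h := congrArg (fun ν => ν Set.univ) hP.map_exLength
  have h1 (k : ℕ) := (isProbabilityMeasure_expSumLaw hP.walk.rate_pos k).measure_univ
  simpa [Measure.map_apply measurable_exLength.ennreal_toReal, h1] using h

lemma lintegral_exLength (hP : IsExcursionLaw P c r a ρ) {f : ℝ → ℝ≥0∞} (hf : Measurable f) :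
    ∫⁻ p in {p | exLength p ≠ ∞}, f (exLength p).toReal ∂P =
      ∑' k : ℕ, P {p | exJumps p = (k + 1 : ℕ)} * ∫⁻ x, f x ∂(expSumLaw c (k + 1)) := by
  rw [← lintegral_map hf measurable_exLength.ennreal_toReal, hP.map_exLength,
    lintegral_sum_measure]
  simp

end IsExcursionLaw

/-! ### Regeneration at the end of an excursion and at the inverse local times -/

namespace MarkedStop

variable {Ω : Type*} [mΩ : MeasurableSpace Ω] {μ : Measure Ω} [IsProbabilityMeasure μ]
  {ℱ : Filtration ℝ≥0 mΩ} {U : Ω → SkipFreePath} {T : SkipFreePath → ℝ≥0∞} {α : Type*}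
  [MeasurableSpace α] {ξ : SkipFreePath → α}

/-- The strong Markov property for products of a function of the time and a function of the future
path. -/
lemma lintegral_mul (hT : MarkedStop T ξ) (hU : IsLatticeWalk μ ℱ U) {S : Set (ℝ≥0∞ × α)}
    (hS : MeasurableSet S) {f : ℝ≥0∞ → ℝ≥0∞} (hf : Measurable f) {g : SkipFreePath → ℝ≥0∞}
    (hg : Measurable g) :
    ∫⁻ p in {p | T p ≠ ∞ ∧ (T p, ξ p) ∈ S}, f (T p) * g (shiftPath (T p).toNNReal p) ∂(μ.map U) =
      (∫⁻ p in {p | T p ≠ ∞ ∧ (T p, ξ p) ∈ S}, f (T p) ∂(μ.map U)) * ∫⁻ p, g p ∂(μ.map U) := by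
  have := hU.isProbabilityMeasure
  set P := μ.map U
  have hsh : Measurable fun p => shiftPath (T p).toNNReal p :=
    measurable_shiftPath_comp measurable_id hT.measurable_time.ennreal_toNNReal
  set A := {p | T p ≠ ∞ ∧ (T p, ξ p) ∈ S} with hA
  have hAm : MeasurableSet A := (hT.measurable_time (measurableSet_singleton ∞).compl).inter
        ((hT.measurable_time.prodMk hT.measurable_mark) hS)
  have h1 : (P.restrict A).map (fun p => (T p, shiftPath (T p).toNNReal p)) =
      ((P.restrict A).map T).prod P := by
    refine (Measure.prod_eq fun C B hC hB => ?_).symm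
    rw [Measure.map_apply (hT.measurable_time.prodMk hsh) (hC.prod hB),
      Measure.map_apply hT.measurable_time hC,
      Measure.restrict_apply ((hT.measurable_time.prodMk hsh) (hC.prod hB)),
      Measure.restrict_apply (hT.measurable_time hC)]
    have h := hT.strongMarkov hU (S := S ∩ Prod.fst ⁻¹' C) (hS.inter (measurable_fst hC)) hB
    convert h using 2
    · refine Set.ext fun p => ?_
      exact ⟨fun h => ⟨h.2.1, ⟨h.2.2, h.1.1⟩, h.1.2⟩, fun h => ⟨⟨h.2.1.2, h.2.2⟩, h.1, h.2.1.1⟩⟩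
    · refine congrArg _ (Set.ext fun p => ?_)
      exact ⟨fun h => ⟨h.2.1, h.2.2, h.1⟩, fun h => ⟨h.2.2, h.1, h.2.1⟩⟩
  have hm : Measurable fun z : ℝ≥0∞ × SkipFreePath => f z.1 * g z.2 :=
    (hf.comp measurable_fst).mul (hg.comp measurable_snd)
  have h2 := lintegral_map (μ := P.restrict A) hm (hT.measurable_time.prodMk hsh)
  rw [h1, lintegral_prod_mul hf.aemeasurable hg.aemeasurable,
    lintegral_map hf hT.measurable_time] at h2
  exact h2.symm

end MarkedStop

lemma markedStop_exEnd : MarkedStop (fun p => exEnd p.1) fun p => exStart p.1 where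
  measurable_time := measurable_exEnd_comp measurable_id
  measurable_mark := measurable_exStart_comp measurable_id
  le_of_stop t p h := by
    have h1 : exStart (stopPath t p).1 ≤ t := (le_firstTime _ _).trans h
    have h2 := (markedTime_exStart.eq_of_stop t p (markedTime_exStart.le_of_stop t p h1)).1
    obtain ⟨r, hr⟩ := exists_coe_eq (ne_top_of_le_ne_top ENNReal.coe_ne_top h)
    have hrt : r ≤ t := by rw [hr] at h; exact_mod_cast h
    refine le_of_eq_of_le (b := exEnd (stopPath t p).1) ?_ h
    rw [exEnd, ← h2]
    refine firstTime_eq_of_agree (t := t) (fun s hs => ?_)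
      (Or.inr ⟨r, hrt, hr, (stopPath t p).2.pathRefl_exEnd hr⟩)
    rw [Set.mem_ofPred_eq, pathRefl_stopPath hs, Set.mem_ofPred_eq]
  eq_of_stop t p h := by
    have h2 := (markedTime_exStart.eq_of_stop t p ((le_firstTime _ _).trans h)).1
    obtain ⟨r, hr⟩ := exists_coe_eq (ne_top_of_le_ne_top ENNReal.coe_ne_top h)
    have hrt : r ≤ t := by rw [hr] at h; exact_mod_cast h
    refine ⟨?_, h2⟩
    rw [exEnd, h2]
    refine firstTime_eq_of_agree (t := t) (fun s hs => ?_)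
      (Or.inr ⟨r, hrt, hr, p.2.pathRefl_exEnd hr⟩)
    rw [Set.mem_ofPred_eq, Set.mem_ofPred_eq, pathRefl_stopPath hs]

lemma pathLoc_stopPath {t s : ℝ≥0} (h : s ≤ t) (p : SkipFreePath) :
    pathLoc (stopPath t p).1 s = pathLoc p.1 s := by
  rw [pathLoc, pathLoc, occTime, occTime]
  congr 1
  refine Set.ext fun u => ?_
  simp only [Set.mem_ofPred_eq]
  refine and_congr_right fun _ => and_congr_right fun h2 => ?_
  rw [pathRefl_stopPath ((Real.toNNReal_le_iff_le_coe.2 h2).trans h)]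

/-- At a time at the maximum the local time starts to increase at once, so that time is the
right-continuous inverse of its own local time. -/
lemma pathInv_eq_of {p : SkipFreePath} {s r : ℝ≥0} (h1 : pathLoc p.1 r = s)
    (h2 : pathRefl p.1 r = 0) : pathInv p.1 s = r := by
  have h := p.2.pathInv_add h2 h1 0
  rwa [add_zero, (p.2.shift r).pathInv_zero, add_zero] at h

lemma pathInv_stopPath {t s : ℝ≥0} {p : SkipFreePath} (h : pathInv p.1 s ≤ t) :
    pathInv (stopPath t p).1 s = pathInv p.1 s := by
  obtain ⟨r, hr⟩ := exists_coe_eq (ne_top_of_le_ne_top ENNReal.coe_ne_top h)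
  have hrt : r ≤ t := by rw [hr] at h; exact_mod_cast h
  rw [hr]
  refine pathInv_eq_of ?_ ?_
  · rw [pathLoc_stopPath hrt, IsSkipFreePath.pathLoc_pathInv hr]
  · rw [pathRefl_stopPath hrt, p.2.pathRefl_pathInv hr]

/-- The mark is the whole history of the inverse up to `s`; the strong Markov property with this
mark yields independence of the increments from the past. -/
lemma markedStop_pathInv (s : ℝ≥0) : MarkedStop (fun p => pathInv p.1 s)
    fun p => fun r : Set.Iic s => pathInv p.1 r where
  measurable_time := measurable_pathInv_comp measurable_id s
  measurable_mark := measurable_pi_lambda _ fun r => measurable_pathInv_comp measurable_id r.1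
  le_of_stop t p h := by
    obtain ⟨r, hr⟩ := exists_coe_eq (ne_top_of_le_ne_top ENNReal.coe_ne_top h)
    have hrt : r ≤ t := by rw [hr] at h; exact_mod_cast h
    refine le_of_eq_of_le (pathInv_eq_of (r := r) ?_ ?_) (by exact_mod_cast hrt)
    · rw [← pathLoc_stopPath hrt, IsSkipFreePath.pathLoc_pathInv hr]
    · rw [← pathRefl_stopPath hrt, (stopPath t p).2.pathRefl_pathInv hr]
  eq_of_stop t p h := ⟨pathInv_stopPath h, funext fun r =>
    pathInv_stopPath ((pathInv_mono p.1 r.2).trans h)⟩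

/-! ### The Laplace transform of the inverse local time -/

/-- The function `e^{-θ z}` on `[0, ∞]`, with value `0` at `∞`. -/
def expNeg (θ : ℝ) (z : ℝ≥0∞) : ℝ≥0∞ :=
  if z = ∞ then 0 else ENNReal.ofReal (Real.exp (-θ * z.toReal))

@[simp] lemma expNeg_top (θ : ℝ) : expNeg θ ∞ = 0 := if_pos rfl

lemma expNeg_of_ne_top {θ : ℝ} {z : ℝ≥0∞} (h : z ≠ ∞) :
    expNeg θ z = ENNReal.ofReal (Real.exp (-θ * z.toReal)) := if_neg h

@[fun_prop]
lemma measurable_expNeg (θ : ℝ) : Measurable (expNeg θ) :=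
  Measurable.ite (measurableSet_singleton ∞) measurable_const (by fun_prop)

lemma expNeg_add (θ : ℝ) (x y : ℝ≥0∞) : expNeg θ (x + y) = expNeg θ x * expNeg θ y := by
  by_cases hx : x = ∞
  · simp [hx]
  by_cases hy : y = ∞
  · simp [hy]
  rw [expNeg_of_ne_top (ENNReal.add_ne_top.2 ⟨hx, hy⟩), expNeg_of_ne_top hx, expNeg_of_ne_top hy,
    ← ENNReal.ofReal_mul (Real.exp_nonneg _), ← Real.exp_add, ENNReal.toReal_add hx hy, mul_add]

lemma expNeg_anti {θ : ℝ} (hθ : 0 ≤ θ) : Antitone (expNeg θ) := fun x y h => by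
  by_cases hy : y = ∞
  · simp [hy]
  have hx := ne_top_of_le_ne_top hy h
  rw [expNeg_of_ne_top hx, expNeg_of_ne_top hy]
  refine ENNReal.ofReal_le_ofReal (Real.exp_le_exp.2 ?_)
  have := ENNReal.toReal_mono hy h
  nlinarith

lemma expNeg_le_one {θ : ℝ} (hθ : 0 ≤ θ) (z : ℝ≥0∞) : expNeg θ z ≤ 1 :=
  (expNeg_anti hθ zero_le).trans (by simp [expNeg])

lemma expNeg_coe (θ : ℝ) (t : ℝ≥0) : expNeg θ t = ENNReal.ofReal (Real.exp (-θ * t)) := by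
  rw [expNeg_of_ne_top ENNReal.coe_ne_top, ENNReal.coe_toReal]

lemma setLIntegral_expNeg {α : Type*} [MeasurableSpace α] {P : Measure α} {θ : ℝ} {z : α → ℝ≥0∞}
    (hz : Measurable z) : ∫⁻ p, expNeg θ (z p) ∂P =
      ∫⁻ p in {p | z p ≠ ∞}, ENNReal.ofReal (Real.exp (-θ * (z p).toReal)) ∂P := by
  have hm : MeasurableSet {p | z p ≠ ∞} := hz (measurableSet_singleton ∞).compl
  rw [← lintegral_indicator hm]
  refine lintegral_congr fun p => ?_
  by_cases h : z p = ∞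
  · rw [h, expNeg_top, Set.indicator_of_notMem (by simpa using h)]
  · rw [expNeg_of_ne_top h, Set.indicator_of_mem (s := {p | z p ≠ ∞}) h]

/-- The Laplace transform of the inverse local time. -/
def invLaplace (P : Measure SkipFreePath) (θ : ℝ) (t : ℝ≥0) : ℝ≥0∞ :=
  ∫⁻ p, expNeg θ (pathInv p.1 t) ∂P

lemma measurable_pathInv (t : ℝ≥0) : Measurable fun p : SkipFreePath => pathInv p.1 t :=
  measurable_pathInv_comp measurable_id t

section Laplace

variable {Ω : Type*} [mΩ : MeasurableSpace Ω] {μ : Measure Ω} [IsProbabilityMeasure μ]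
  {ℱ : Filtration ℝ≥0 mΩ} {U : Ω → SkipFreePath} {θ : ℝ}

/-- At `pathInv s` the path is at its maximum and starts afresh, so the inverse adds up an
independent copy. Paths with infinite inverse contribute nothing, by the convention for `expNeg` at
`∞`. -/
lemma invLaplace_add (hU : IsLatticeWalk μ ℱ U) (s t : ℝ≥0) :
    invLaplace (μ.map U) θ (s + t) = invLaplace (μ.map U) θ s * invLaplace (μ.map U) θ t := by
  have hm : MeasurableSet {p : SkipFreePath | pathInv p.1 s ≠ ∞} :=
    (measurable_pathInv s) (measurableSet_singleton ∞).compl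
  have h := (markedStop_pathInv s).lintegral_mul hU MeasurableSet.univ (measurable_expNeg θ)
    ((measurable_expNeg θ).comp (measurable_pathInv t))
  simp only [Set.mem_univ, and_true, Function.comp_def] at h
  have key (f : SkipFreePath → ℝ≥0∞) (hf : ∀ p : SkipFreePath, pathInv p.1 s = ∞ → f p = 0) :
      ∫⁻ p, f p ∂(μ.map U) = ∫⁻ p in {p | pathInv p.1 s ≠ ∞}, f p ∂(μ.map U) := by
    rw [← lintegral_indicator hm]
    refine lintegral_congr fun p => ?_
    by_cases h : pathInv p.1 s = ∞
    · rw [hf p h, Set.indicator_of_notMem (by simpa using h)]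
    · rw [Set.indicator_of_mem (s := {p : SkipFreePath | pathInv p.1 s ≠ ∞}) h]
  rw [invLaplace, invLaplace, invLaplace, key (fun p => expNeg θ (pathInv p.1 (s + t))),
    key (fun p => expNeg θ (pathInv p.1 s)), ← h]
  · refine setLIntegral_congr_fun hm fun p hp => ?_
    obtain ⟨r, hr⟩ := exists_coe_eq hp
    rw [← expNeg_add, hr, p.2.pathInv_add_pathInv hr, ENNReal.toNNReal_coe]
    rfl
  · intro p hp
    rw [hp, expNeg_top]
  · intro p hp
    have := pathInv_mono p.1 (show s ≤ s + t from le_self_add)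
    rw [hp, top_le_iff] at this
    rw [this, expNeg_top]

lemma invLaplace_zero (hU : IsLatticeWalk μ ℱ U) : invLaplace (μ.map U) θ 0 = 1 := by
  have := hU.isProbabilityMeasure
  rw [invLaplace, lintegral_congr fun p => by rw [p.2.pathInv_zero], lintegral_const,
    measure_univ, mul_one]
  simp [expNeg]

lemma hasDerivWithinAt_of_squeeze {f lo hi : ℝ → ℝ} {d : ℝ}
    (hlo : HasDerivWithinAt lo d (Set.Ici 0) 0) (hhi : HasDerivWithinAt hi d (Set.Ici 0) 0)
    (h0 : lo 0 = hi 0) (h1 : ∀ t, 0 ≤ t → lo t ≤ f t) (h2 : ∀ t, 0 ≤ t → f t ≤ hi t) :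
    HasDerivWithinAt f d (Set.Ici 0) 0 := by
  have h3 : HasDerivWithinAt (fun t => f t - lo t) 0 (Set.Ici 0) 0 := by
    refine hasDerivWithinAt_zero_of_abs_le (g := fun t => hi t - lo t) (fun t ht => ?_)
      (by simp [h0]) ((hhi.sub hlo).congr_deriv (sub_self d))
    rw [abs_of_nonneg (sub_nonneg.2 (h1 t ht))]
    exact sub_le_sub_right (h2 t ht) _
  refine ((h3.add hlo).congr_deriv (zero_add d)).congr_of_eventuallyEq
    (.of_forall fun t => ?_) ?_ <;> simp

variable {P : Measure SkipFreePath} {c a : ℝ} {r ρ : Measure ℤ}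

lemma measure_exStart_le (hP : IsExcursionLaw P c r a ρ) (t : ℝ≥0) :
    expMeasure a (Set.Iic (t : ℝ)) = ENNReal.ofReal (1 - Real.exp (-(a * t))) := by
  have := isProbabilityMeasure_expMeasure hP.rate_pos
  have h := cdf_expMeasure_eq hP.rate_pos t
  rw [cdf_eq_real, if_pos t.coe_nonneg] at h
  rw [← h, ofReal_measureReal]

/-- The time at which the excursion starts is independent of its depth and of the path thereafter,
hence of its length. -/
lemma setLIntegral_exLength (hP : IsExcursionLaw P c r a ρ) {f : ℝ≥0∞ → ℝ≥0∞}
    (hf : Measurable f) (t : ℝ≥0) :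
    ∫⁻ p in {p | exStart p.1 ≤ t}, f (exLength p) ∂P =
      ENNReal.ofReal (1 - Real.exp (-(a * t))) * ∫⁻ p, f (exLength p) ∂P := by
  have hm : Measurable fun p => (exDepth p, exPath p) :=
    measurable_exDepth.prodMk measurable_exPath
  have hI : MeasurableSet {p : SkipFreePath | (exStart p.1).toReal ∈ Set.Iic (t : ℝ)} :=
    (measurable_exStart_comp measurable_id).ennreal_toReal measurableSet_Iic
  have h1 : (P.restrict {p | (exStart p.1).toReal ∈ Set.Iic (t : ℝ)}).map
      (fun p => (exDepth p, exPath p)) =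
      ENNReal.ofReal (1 - Real.exp (-(a * t))) • P.map fun p => (exDepth p, exPath p) := by
    refine Measure.ext fun S hS => ?_
    rw [Measure.map_apply hm hS, Measure.restrict_apply (hm hS), Measure.smul_apply,
      Measure.map_apply hm hS, smul_eq_mul, ← measure_exStart_le hP, Set.inter_comm]
    exact hP.indep measurableSet_Iic hS
  have hg : Measurable fun z : ℤ × SkipFreePath => f (hitTime z.2.1 z.1) := by
    have h := (measurable_from_prod_countable_right
      (f := fun z : ℤ × SkipFreePath => hitTime z.2.1 z.1) fun l => measurable_hitTime l)
    exact hf.comp h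
  have h2 := lintegral_map (μ := P.restrict
    {p | (exStart p.1).toReal ∈ Set.Iic (t : ℝ)}) hg hm
  rw [h1, lintegral_smul_measure, lintegral_map hg hm] at h2
  refine Eq.trans ?_ h2.symm
  rw [show (fun p => f (exLength p)) = fun p => f (hitTime (exPath p).1 (exDepth p)) from rfl]
  refine setLIntegral_congr ?_
  filter_upwards [hP.ne_top] with p hp
  refine propext ?_
  change exStart p.1 ≤ t ↔ (exStart p.1).toReal ≤ t
  obtain ⟨r, hr⟩ := exists_coe_eq hp
  rw [hr]
  simp

/-- The Laplace transform of the length of an excursion. -/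
def exLaplace (P : Measure SkipFreePath) (θ : ℝ) : ℝ≥0∞ := ∫⁻ p, expNeg θ (exLength p) ∂P

lemma exLaplace_le_one (hU : IsLatticeWalk μ ℱ U) (hθ : 0 ≤ θ) : exLaplace (μ.map U) θ ≤ 1 := by
  have := hU.isProbabilityMeasure
  refine (lintegral_mono fun p => expNeg_le_one hθ (exLength p)).trans ?_
  simp

/-- If no excursion has started by time `t`, the inverse local time at `t` equals `t`. -/
lemma invLaplace_eq_add (hP : IsExcursionLaw P c r a ρ) (t : ℝ≥0) :
    invLaplace P θ t = ENNReal.ofReal (Real.exp (-((a + θ) * t))) +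
      ∫⁻ p in {p | exStart p.1 ≤ t}, expNeg θ (pathInv p.1 t) ∂P := by
  have := hP.walk.prob
  have hm : MeasurableSet {p : SkipFreePath | exStart p.1 ≤ t} :=
    measurableSet_le (measurable_exStart_comp measurable_id) measurable_const
  rw [invLaplace, ← lintegral_add_compl _ hm, add_comm]
  congr 1
  have h1 : ∫⁻ p in {p | exStart p.1 ≤ t}ᶜ, expNeg θ (pathInv p.1 t) ∂P =
      ∫⁻ p in {p : SkipFreePath | exStart p.1 ≤ t}ᶜ, expNeg θ t ∂P :=
    setLIntegral_congr_fun hm.compl fun p hp => by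
      rw [IsSkipFreePath.pathInv_of_lt_exStart (not_le.1 hp)]
  rw [h1, setLIntegral_const, expNeg_coe]
  have h2 := setLIntegral_exLength hP (f := fun _ => 1) measurable_const t
  simp only [lintegral_const, MeasurableSet.univ, Measure.restrict_apply, Set.univ_inter, one_mul,
    measure_univ, mul_one] at h2
  rw [prob_compl_eq_one_sub hm, h2, ← ENNReal.ofReal_one, ← ENNReal.ofReal_sub _ (by
    rw [sub_nonneg, Real.exp_le_one_iff, neg_nonpos]
    exact mul_nonneg hP.rate_pos.le t.coe_nonneg), sub_sub_cancel,
    ← ENNReal.ofReal_mul (Real.exp_nonneg _), ← Real.exp_add]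
  congr 2
  ring

/-- An excursion that starts by local time `t` has been skipped entirely, so the inverse is at least
its length. -/
lemma invLaplace_le (hP : IsExcursionLaw P c r a ρ) (hθ : 0 ≤ θ) (t : ℝ≥0) :
    invLaplace P θ t ≤ ENNReal.ofReal (Real.exp (-((a + θ) * t))) +
      ENNReal.ofReal (1 - Real.exp (-(a * t))) * exLaplace P θ := by
  have hm : MeasurableSet {p : SkipFreePath | exStart p.1 ≤ t} :=
    measurableSet_le (measurable_exStart_comp measurable_id) measurable_const
  rw [invLaplace_eq_add hP, exLaplace, ← setLIntegral_exLength hP (measurable_expNeg θ)]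
  refine add_le_add le_rfl ?_
  refine setLIntegral_mono ((measurable_expNeg θ).comp measurable_exLength) fun p hp => ?_
  obtain ⟨s, hs⟩ := exists_coe_eq (ne_top_of_le_ne_top ENNReal.coe_ne_top hp)
  have hst : s ≤ t := by rw [Set.mem_ofPred_eq, hs] at hp; exact_mod_cast hp
  refine expNeg_anti hθ ?_
  have h1 := exEnd_eq p
  by_cases he : exEnd p.1 = ∞
  · rw [p.2.pathInv_of_exEnd_eq_top hs hst he]
    exact le_top
  · obtain ⟨e, he⟩ := exists_coe_eq he
    rw [p.2.pathInv_of_exStart_le hs hst he, ← he, h1, add_assoc, add_comm (exLength p), ← add_assoc]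
    exact le_add_self

/-- If the first excursion starts by `t`, the inverse is at most `t`, plus its length, plus the
inverse at `t` of the path after the excursion. That path is independent of the past, so the
quantity itself reappears as a factor. -/
lemma le_invLaplace (hU : IsLatticeWalk μ ℱ U) (hP : IsExcursionLaw (μ.map U) c r a ρ)
    (hθ : 0 ≤ θ) (t : ℝ≥0) :
    ENNReal.ofReal (Real.exp (-((a + θ) * t))) + ENNReal.ofReal (Real.exp (-θ * t)) *
      (ENNReal.ofReal (1 - Real.exp (-(a * t))) * exLaplace (μ.map U) θ) *
        invLaplace (μ.map U) θ t ≤ invLaplace (μ.map U) θ t := by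
  have hm : MeasurableSet {p : SkipFreePath | exStart p.1 ≤ t} :=
    measurableSet_le (measurable_exStart_comp measurable_id) measurable_const
  have hm2 : MeasurableSet {p : SkipFreePath | exEnd p.1 ≠ ∞} :=
    markedStop_exEnd.measurable_time (measurableSet_singleton ∞).compl
  have h := markedStop_exEnd.lintegral_mul hU (S := Prod.snd ⁻¹' Set.Iic (t : ℝ≥0∞))
    (measurable_snd measurableSet_Iic) (measurable_expNeg θ)
    ((measurable_expNeg θ).comp (measurable_pathInv t))
  simp only [Function.comp_def] at h
  set A : Set SkipFreePath := {p | exEnd p.1 ≠ ∞ ∧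
    (exEnd p.1, exStart p.1) ∈ Prod.snd ⁻¹' Set.Iic (t : ℝ≥0∞)} with hA
  have hAm : MeasurableSet A := hm2.inter hm
  nth_rw 2 [invLaplace_eq_add hP]
  gcongr
  calc _ ≤ (∫⁻ p in A, expNeg θ (exEnd p.1) ∂(μ.map U)) * invLaplace (μ.map U) θ t := by
        gcongr
        rw [exLaplace, ← setLIntegral_exLength hP (measurable_expNeg θ),
          ← lintegral_const_mul' _ _ ENNReal.ofReal_ne_top, ← lintegral_indicator hm,
          ← lintegral_indicator hAm]
        refine lintegral_mono fun p => ?_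
        by_cases hp : exStart p.1 ≤ t
        · rw [Set.indicator_of_mem (s := {p : SkipFreePath | exStart p.1 ≤ t}) hp, ← expNeg_coe,
            ← expNeg_add]
          by_cases he : exEnd p.1 = ∞
          · have h1 := exEnd_eq p
            rw [he, eq_comm, ENNReal.add_eq_top] at h1
            rw [h1.resolve_left (ne_top_of_le_ne_top ENNReal.coe_ne_top hp), add_top, expNeg_top]
            exact zero_le
          · rw [Set.indicator_of_mem (s := A) ⟨he, hp⟩, exEnd_eq]
            exact expNeg_anti hθ (by gcongr)
        · rw [Set.indicator_of_notMem (s := {p : SkipFreePath | exStart p.1 ≤ t}) hp]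
          exact zero_le
    _ = _ := h.symm
    _ ≤ _ := by
        rw [← lintegral_indicator hm, ← lintegral_indicator hAm]
        refine lintegral_mono fun p => ?_
        by_cases hp : p ∈ A
        · have hp2 : exStart p.1 ≤ t := hp.2
          rw [Set.indicator_of_mem hp, Set.indicator_of_mem
            (s := {p : SkipFreePath | exStart p.1 ≤ t}) hp2, ← expNeg_add]
          refine expNeg_anti hθ ?_
          obtain ⟨s, hs⟩ := exists_coe_eq (ne_top_of_le_ne_top ENNReal.coe_ne_top hp2)
          have hst : s ≤ t := by rw [hs] at hp2; exact_mod_cast hp2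
          obtain ⟨e, he⟩ := exists_coe_eq hp.1
          rw [p.2.pathInv_of_exStart_le hs hst he, he, ENNReal.toNNReal_coe]
          gcongr
          exact pathInv_mono _ tsub_le_self
        · rw [Set.indicator_of_notMem hp]
          exact zero_le

/-- The Laplace transform of the inverse local time. -/
theorem invLaplace_eq (hU : IsLatticeWalk μ ℱ U) (hP : IsExcursionLaw (μ.map U) c r a ρ)
    (hθ : 0 ≤ θ) (t : ℝ≥0) : (invLaplace (μ.map U) θ t).toReal =
      Real.exp (-((θ + a * (1 - (exLaplace (μ.map U) θ).toReal)) * t)) := by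
  have hle (t : ℝ≥0) : invLaplace (μ.map U) θ t ≤ 1 := by
    have := hU.isProbabilityMeasure
    refine (lintegral_mono fun p => expNeg_le_one hθ _).trans ?_
    simp
  have hne (t : ℝ≥0) : invLaplace (μ.map U) θ t ≠ ∞ :=
    ne_top_of_le_ne_top ENNReal.one_ne_top (hle t)
  have hgne : exLaplace (μ.map U) θ ≠ ∞ :=
    ne_top_of_le_ne_top ENNReal.one_ne_top (exLaplace_le_one hU hθ)
  set g := (exLaplace (μ.map U) θ).toReal with hg
  have hg0 : 0 ≤ g := ENNReal.toReal_nonneg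
  have hexp (t : ℝ≥0) : 0 ≤ 1 - Real.exp (-(a * t)) := by
    rw [sub_nonneg, Real.exp_le_one_iff, neg_nonpos]
    exact mul_nonneg hP.rate_pos.le t.coe_nonneg
  refine eq_exp_of_multiplicative (G := fun t => (invLaplace (μ.map U) θ t).toReal)
    (fun s t => by rw [invLaplace_add hU, ENNReal.toReal_mul]) (by rw [invLaplace_zero hU]; rfl)
    ?_ t
  have hup (t : ℝ≥0) : (invLaplace (μ.map U) θ t).toReal ≤
      Real.exp (-((a + θ) * t)) + (1 - Real.exp (-(a * t))) * g := by
    have h := ENNReal.toReal_mono (by finiteness) (invLaplace_le hP hθ t)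
    rwa [ENNReal.toReal_add (by finiteness) (by finiteness), ENNReal.toReal_mul,
      ENNReal.toReal_ofReal (Real.exp_nonneg _), ENNReal.toReal_ofReal (hexp t)] at h
  have hlo (t : ℝ≥0) : Real.exp (-((a + θ) * t)) + Real.exp (-θ * t) *
      ((1 - Real.exp (-(a * t))) * g) * (invLaplace (μ.map U) θ t).toReal ≤
      (invLaplace (μ.map U) θ t).toReal := by
    have h := ENNReal.toReal_mono (hne t) (le_invLaplace hU hP hθ t)
    have := hne t
    rwa [ENNReal.toReal_add (by finiteness) (by finiteness), ENNReal.toReal_mul,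
      ENNReal.toReal_mul, ENNReal.toReal_mul,
      ENNReal.toReal_ofReal (Real.exp_nonneg _), ENNReal.toReal_ofReal (Real.exp_nonneg _),
      ENNReal.toReal_ofReal (hexp t)] at h
  -- The crude lower bound by the first summand is inserted for the factor `invLaplace`, which makes
  -- the bound an explicit function of `t`.
  have hlo2 (t : ℝ≥0) : Real.exp (-((a + θ) * t)) + Real.exp (-θ * t) *
      ((1 - Real.exp (-(a * t))) * g) * Real.exp (-((a + θ) * t)) ≤
      (invLaplace (μ.map U) θ t).toReal := by
    have h0 : 0 ≤ Real.exp (-θ * t) * ((1 - Real.exp (-(a * t))) * g) :=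
      mul_nonneg (Real.exp_nonneg _) (mul_nonneg (hexp t) hg0)
    have h1 : Real.exp (-((a + θ) * t)) ≤ (invLaplace (μ.map U) θ t).toReal :=
      (le_add_of_nonneg_right (mul_nonneg h0 ENNReal.toReal_nonneg)).trans (hlo t)
    exact (add_le_add le_rfl (mul_le_mul_of_nonneg_left h1 h0)).trans (hlo t)
  have he (k : ℝ) : HasDerivAt (fun t : ℝ => Real.exp (-(k * t))) (-k) 0 := by
    refine (((hasDerivAt_id (0 : ℝ)).const_mul k).neg.exp).congr_deriv ?_
    simp
  -- Both explicit bounds equal `1` at zero and have the same derivative `-(θ + a (1 - g))` there.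
  refine hasDerivWithinAt_of_squeeze
    (lo := fun t => Real.exp (-((a + θ) * t)) + Real.exp (-(θ * t)) *
      ((1 - Real.exp (-(a * t))) * g) * Real.exp (-((a + θ) * t)))
    (hi := fun t => Real.exp (-((a + θ) * t)) + (1 - Real.exp (-(a * t))) * g) ?_ ?_
    (by simp) (fun t ht => ?_) (fun t ht => ?_)
  · refine (((he (a + θ)).add (((he θ).mul (((he a).const_sub 1).mul_const g)).mul
      (he (a + θ)))).congr_deriv ?_).hasDerivWithinAt
    simp
    ring
  · refine (((he (a + θ)).add (((he a).const_sub 1).mul_const g)).congr_deriv ?_).hasDerivWithinAt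
    ring
  · have h := hlo2 t.toNNReal
    rw [Real.coe_toNNReal t ht, neg_mul] at h
    exact h
  · have h := hup t.toNNReal
    rwa [Real.coe_toNNReal t ht] at h

end Laplace

/-! ### The sequence of excursions -/

/-- The reflected path as a real process on the space of skip-free paths. -/
def reflPath (t : ℝ≥0) (p : SkipFreePath) : ℝ := pathRefl p.1 t

lemma setOf_reflPath_eq_zero (p : SkipFreePath) :
    {t | reflPath t p = 0} = {t | pathRefl p.1 t = 0} :=
  Set.ext fun t => by simp [reflPath]

lemma setOf_reflPath_ne_zero (p : SkipFreePath) :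
    {t | reflPath t p ≠ 0} = {t | pathRefl p.1 t ≠ 0} :=
  Set.ext fun t => by simp [reflPath]

lemma excursionStart_reflPath_zero (p : SkipFreePath) :
    excursionStart reflPath 0 p = exStart p.1 := by
  rw [excursionStart, setOf_reflPath_ne_zero, exStart]

lemma excursionEnd_reflPath_zero (p : SkipFreePath) : excursionEnd reflPath 0 p = exEnd p.1 := by
  rw [excursionEnd, excursionStart_reflPath_zero, setOf_reflPath_eq_zero, exEnd]

lemma excursionStart_succ {Ω : Type*} (Y : ℝ≥0 → Ω → ℝ) (n : ℕ) (ω : Ω) :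
    excursionStart Y (n + 1) ω = firstTime (excursionEnd Y n ω) {t | Y t ω ≠ 0} := rfl

lemma reflPath_add {p : SkipFreePath} {e : ℝ≥0} (he : exEnd p.1 = e) (t : ℝ≥0) :
    reflPath (e + t) p = reflPath t (shiftPath e p) := by
  rw [reflPath, p.2.pathRefl_add_of_eq_zero (p.2.pathRefl_exEnd he), reflPath]
  rfl

/-- Later excursions are excursions of the path restarted at the end of the first one, where it is
at its maximum. -/
lemma excursionStart_reflPath_succ {p : SkipFreePath} {e : ℝ≥0} (he : exEnd p.1 = e) (n : ℕ) :
    excursionStart reflPath (n + 1) p = e + excursionStart reflPath n (shiftPath e p) ∧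
      excursionEnd reflPath (n + 1) p = e + excursionEnd reflPath n (shiftPath e p) := by
  have key {n : ℕ} (h : excursionStart reflPath (n + 1) p =
      e + excursionStart reflPath n (shiftPath e p)) : excursionEnd reflPath (n + 1) p =
      e + excursionEnd reflPath n (shiftPath e p) := by
    rw [excursionEnd, h, firstTime_add, excursionEnd]
    simp only [Set.mem_ofPred_eq, reflPath_add he]
  induction n with
  | zero =>
    have h : excursionStart reflPath (0 + 1) p = e + excursionStart reflPath 0 (shiftPath e p) := by
      rw [excursionStart_succ, excursionEnd_reflPath_zero, he, firstTime_coe, excursionStart]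
      simp only [Set.mem_ofPred_eq, reflPath_add he]
    exact ⟨h, key h⟩
  | succ n ih =>
    have h : excursionStart reflPath (n + 1 + 1) p =
        e + excursionStart reflPath (n + 1) (shiftPath e p) := by
      rw [excursionStart_succ, ih.2, firstTime_add, excursionStart_succ]
      simp only [Set.mem_ofPred_eq, reflPath_add he]
    exact ⟨h, key h⟩

lemma excursionStart_reflPath_succ_eq_top {p : SkipFreePath} (he : exEnd p.1 = ∞) (n : ℕ) :
    excursionStart reflPath (n + 1) p = ∞ := by
  induction n with
  | zero => rw [excursionStart_succ, excursionEnd_reflPath_zero, he, firstTime_top]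
  | succ n ih => rw [excursionStart_succ, excursionEnd, ih, firstTime_top, firstTime_top]

lemma measurable_excursion_reflPath (n : ℕ) : Measurable (excursionStart reflPath n) ∧
    Measurable (excursionEnd reflPath n) := by
  have hr (t : ℝ≥0) : Measurable fun p : SkipFreePath => pathRefl p.1 t :=
    measurable_pathRefl_comp fun s _ => measurable_path_eval measurable_id s
  have h1 {a : SkipFreePath → ℝ≥0∞} (ha : Measurable a) :
      Measurable fun p => firstTime (a p) {t | reflPath t p ≠ 0} := by
    simp only [setOf_reflPath_ne_zero]
    exact measurable_firstTime ha (fun p => p.2.rightOpen_pathRefl {k | k ≠ 0})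
      fun t => hr t (measurableSet_singleton 0).compl
  have h2 {a : SkipFreePath → ℝ≥0∞} (ha : Measurable a) :
      Measurable fun p => firstTime (a p) {t | reflPath t p = 0} := by
    simp only [setOf_reflPath_eq_zero]
    exact measurable_firstTime ha (fun p => p.2.rightOpen_pathRefl {0})
      fun t => hr t (measurableSet_singleton 0)
  induction n with
  | zero => exact ⟨h1 measurable_const, h2 (h1 measurable_const)⟩
  | succ n ih => exact ⟨h1 ih.2, h2 (h1 ih.2)⟩

lemma measurable_excursionLength_reflPath (n : ℕ) : Measurable (excursionLength reflPath n) :=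
  (measurable_excursion_reflPath n).2.sub (measurable_excursion_reflPath n).1

lemma excursionLength_reflPath_zero {p : SkipFreePath} (h : exStart p.1 ≠ ∞) :
    excursionLength reflPath 0 p = exLength p := by
  rw [excursionLength, excursionEnd_reflPath_zero, excursionStart_reflPath_zero, exEnd_eq,
    ENNReal.add_sub_cancel_left h]

lemma excursionLength_reflPath_succ {p : SkipFreePath} {e : ℝ≥0} (he : exEnd p.1 = e) (n : ℕ) :
    excursionLength reflPath (n + 1) p = excursionLength reflPath n (shiftPath e p) := by
  obtain ⟨h1, h2⟩ := excursionStart_reflPath_succ he n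
  rw [excursionLength, h1, h2, ENNReal.add_sub_add_eq_sub_left ENNReal.coe_ne_top, excursionLength]

/-- From depth `n + 1`, climbing back by `n + 1` consecutive upward jumps has positive probability,
and some depth has positive mass. -/
lemma IsExcursionLaw.measure_exLength_ne_top_pos {P : Measure SkipFreePath} {c a : ℝ} {r ρ : Measure ℤ}
    (hP : IsExcursionLaw P c r a ρ) :
    0 < P {p | exLength p ≠ ∞} := by
  have := hP.prob_depth
  rw [pos_iff_ne_zero, hP.measure_exLength_ne_top]
  intro h0
  have h1 : ∀ n : ℕ, ρ {((n + 1 : ℕ) : ℤ)} = 0 := fun n => by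
    have h2 := ENNReal.tsum_eq_zero.1 h0 n
    rw [hP.measure_exJumps_eq', hP.measure_exJumps_eq, ENNReal.tsum_eq_zero] at h2
    have h3 := h2 n
    rw [hP.walk.isHitArray.diag (n + 1)] at h3
    exact (mul_eq_zero.1 h3).resolve_right (pow_ne_zero _ hP.walk.up_ne_zero)
  have h2 := hP.lintegral_depth 1
  rw [ENNReal.tsum_eq_zero.2 fun n => by rw [h1, zero_mul]] at h2
  simp at h2

section ExcursionLaw

variable {Ω : Type*} [mΩ : MeasurableSpace Ω] {μ : Measure Ω} [IsProbabilityMeasure μ]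
  {ℱ : Filtration ℝ≥0 mΩ} {U : Ω → SkipFreePath} {c a : ℝ} {r ρ : Measure ℤ}

/-- The law of the length of the `n`-th excursion, on the event that this excursion exists. -/
theorem measure_excursionLength (hU : IsLatticeWalk μ ℱ U)
    (hP : IsExcursionLaw (μ.map U) c r a ρ) (n : ℕ) {A : Set ℝ≥0∞} (hA : MeasurableSet A) :
    (μ.map U) (excursionExists reflPath n ∩ {p | excursionLength reflPath n p ∈ A}) =
      (μ.map U) {p | exLength p ≠ ∞} ^ n * (μ.map U) {p | exLength p ∈ A} := by
  have hm (n : ℕ) : MeasurableSet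
      (excursionExists reflPath n ∩ {p | excursionLength reflPath n p ∈ A}) :=
    ((measurable_excursion_reflPath n).1 measurableSet_Iio).inter
      (measurable_excursionLength_reflPath n hA)
  induction n with
  | zero =>
    rw [pow_zero, one_mul]
    refine measure_congr ?_
    filter_upwards [hP.ne_top] with p hp
    refine propext ?_
    change excursionStart reflPath 0 p < ∞ ∧ excursionLength reflPath 0 p ∈ A ↔ exLength p ∈ A
    rw [excursionStart_reflPath_zero, excursionLength_reflPath_zero hp]
    exact and_iff_right hp.lt_top
  | succ n ih =>
    -- Each further excursion costs one factor, the probability that the preceding one is finite;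
    -- after its end the path has its original law.
    have h := markedStop_exEnd.strongMarkov hU (S := Set.univ) MeasurableSet.univ (hm n)
    have e1 : (μ.map U) {p | exEnd p.1 ≠ ∞ ∧ (exEnd p.1, exStart p.1) ∈ Set.univ} =
        (μ.map U) {p | exLength p ≠ ∞} := by
      refine measure_congr ?_
      filter_upwards [hP.ne_top] with p hp
      refine propext ?_
      change exEnd p.1 ≠ ∞ ∧ _ ↔ exLength p ≠ ∞
      rw [exEnd_eq, ne_eq, ENNReal.add_eq_top, not_or]
      simp [hp]
    rw [e1, ih, ← mul_assoc, ← pow_succ'] at h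
    rw [← h]
    refine congrArg _ (Set.ext fun p => ?_)
    simp only [Set.mem_inter_iff, excursionExists, Set.mem_ofPred_eq]
    by_cases he : exEnd p.1 = ∞
    · rw [excursionStart_reflPath_succ_eq_top he]
      simp [he]
    · obtain ⟨e, he⟩ := exists_coe_eq he
      rw [(excursionStart_reflPath_succ he n).1, excursionLength_reflPath_succ he, he,
        ENNReal.toNNReal_coe]
      simp [ENNReal.add_lt_top]

end ExcursionLaw

/-! ### Path functionals of the chain in terms of lattice paths -/

section Transfer

lemma firstTime_zero (A : Set ℝ≥0) : firstTime 0 A = ⨅ (t : ℝ≥0) (_ : t ∈ A), (t : ℝ≥0∞) := by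
  simp only [firstTime, zero_le, and_true]

lemma excursion_congr {Ω Ω' : Type*} {Y : ℝ≥0 → Ω → ℝ} {Y' : ℝ≥0 → Ω' → ℝ} {ω : Ω} {ω' : Ω'}
    (h : ∀ t, Y t ω = 0 ↔ Y' t ω' = 0) (n : ℕ) :
    excursionStart Y n ω = excursionStart Y' n ω' ∧ excursionEnd Y n ω = excursionEnd Y' n ω' := by
  have h1 : excursionStart Y n ω = excursionStart Y' n ω' := by
    induction n with
    | zero => simp only [excursionStart, ne_eq, h]
    | succ n ih => simp only [excursionStart, ne_eq, h, ih]
  exact ⟨h1, by simp only [excursionEnd, h, h1]⟩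

lemma timeAtZero_eq_occTime {Ω : Type*} (Y : ℝ≥0 → Ω → ℝ) (t : ℝ≥0) (ω : Ω) :
    timeAtZero Y t ω = occTime {s | Y s ω = 0} t := rfl

lemma rightInverse_eq_firstTime {Ω : Type*} (L : ℝ≥0 → Ω → ℝ) (t : ℝ≥0) (ω : Ω) :
    rightInverse L t ω = firstTime 0 {s | (t : ℝ) < L s ω} := by
  rw [firstTime_zero]
  rfl

variable {Ω : Type*} {X : ℝ≥0 → Ω → ℝ} {ω : Ω} {w : ℝ≥0 → ℤ} {h : ℝ}

lemma runMax_eq (hh : 0 < h) (hw : IsSkipFreePath w) (hX : ∀ t, X t ω = w t * h) (t : ℝ≥0) :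
    runMax X t ω = pathMax w t * h := by
  obtain ⟨s, hs, h1⟩ := hw.exists_eq_pathMax t
  refine IsGreatest.csSup_eq ⟨⟨s, ⟨zero_le, hs⟩, by simp only [hX, h1]⟩, ?_⟩
  rintro _ ⟨r, hr, rfl⟩
  simp only [hX]
  gcongr
  exact_mod_cast hw.le_pathMax hr.2

lemma reflected_eq (hh : 0 < h) (hw : IsSkipFreePath w) (hX : ∀ t, X t ω = w t * h) (t : ℝ≥0) :
    reflected X t ω = pathRefl w t * h := by
  rw [reflected, runMax_eq hh hw hX, hX, pathRefl]
  push_cast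
  ring

lemma reflectedFrom_eq (hh : 0 < h) (hw : IsSkipFreePath w) (hX : ∀ t, X t ω = w t * h) (k : ℕ)
    (t : ℝ≥0) : reflectedFrom X (k * h) t ω = ((max (k : ℤ) (pathMax w t) - w t : ℤ) : ℝ) * h := by
  rw [reflectedFrom, runMax_eq hh hw hX, hX, ← max_mul_of_nonneg _ _ hh.le]
  push_cast
  ring

lemma reflected_eq_zero_iff (hh : 0 < h) (hw : IsSkipFreePath w) (hX : ∀ t, X t ω = w t * h)
    (t : ℝ≥0) : reflected X t ω = 0 ↔ pathRefl w t = 0 := by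
  rw [reflected_eq hh hw hX, mul_eq_zero, or_iff_left hh.ne', Int.cast_eq_zero]

lemma timeAtZero_eq (hh : 0 < h) (hw : IsSkipFreePath w) (hX : ∀ t, X t ω = w t * h) (t : ℝ≥0) :
    timeAtZero (reflected X) t ω = pathLoc w t := by
  rw [timeAtZero_eq_occTime, pathLoc]
  simp only [reflected_eq_zero_iff hh hw hX]

lemma rightInverse_eq (hh : 0 < h) (hw : IsSkipFreePath w) (hX : ∀ t, X t ω = w t * h)
    (t : ℝ≥0) : rightInverse (timeAtZero (reflected X)) t ω = pathInv w t := by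
  rw [rightInverse_eq_firstTime, pathInv]
  simp only [timeAtZero_eq hh hw hX]

lemma continuousAt_iff (hh : 0 < h) (hX : ∀ t, X t ω = w t * h) (t : ℝ≥0) :
    ContinuousAt (fun s => X s ω) t ↔ ContinuousAt w t := by
  have h1 : Topology.IsEmbedding fun x : ℝ => x * h := (Homeomorph.mulRight₀ h hh.ne').isEmbedding
  rw [(h1.comp Int.isClosedEmbedding_coe_real.isEmbedding).continuousAt_iff (f := w)]
  simp only [hX, Function.comp_def]

lemma jumpCount_eq (hh : 0 < h) (hX : ∀ t, X t ω = w t * h) (a b : ℝ≥0∞) :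
    jumpCount X a b ω = pathJumps w a b := by
  rw [jumpCount, pathJumps]
  simp only [continuousAt_iff hh hX]

lemma excursion_reflected_eq (hh : 0 < h) {p : SkipFreePath} (hX : ∀ t, X t ω = p.1 t * h)
    (n : ℕ) : excursionStart (reflected X) n ω = excursionStart reflPath n p ∧
      excursionEnd (reflected X) n ω = excursionEnd reflPath n p :=
  excursion_congr (fun t => by
    rw [reflected_eq_zero_iff hh p.2 hX, reflPath, Int.cast_eq_zero]) n

lemma excursionLength_reflected_eq (hh : 0 < h) {p : SkipFreePath}
    (hX : ∀ t, X t ω = p.1 t * h) (n : ℕ) :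
    excursionLength (reflected X) n ω = excursionLength reflPath n p := by
  rw [excursionLength, excursionLength, (excursion_reflected_eq hh hX n).1,
    (excursion_reflected_eq hh hX n).2]

lemma returnJumps_eq (hh : 0 < h) {p : SkipFreePath} (hX : ∀ t, X t ω = p.1 t * h)
    (hp : exStart p.1 ≠ ∞) : returnJumps X ω = exJumps p := by
  rw [returnJumps, jumpCount_eq hh hX, (excursion_reflected_eq hh hX 0).1,
    (excursion_reflected_eq hh hX 0).2, excursionStart_reflPath_zero, excursionEnd_reflPath_zero,
    pathJumps_exStart_exEnd hp]

lemma firstTime_level_eq (hh : 0 < h) (hX : ∀ t, X t ω = w t * h) (l : ℕ) :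
    firstTime 0 {t | -(l * h) + X t ω = 0} = hitTime w l := by
  rw [hitTime]
  congr 1
  refine Set.ext fun t => ?_
  rw [Set.mem_ofPred_eq, Set.mem_ofPred_eq, hX, neg_add_eq_zero, mul_left_inj' hh.ne']
  exact ⟨fun h => by exact_mod_cast h.symm, fun h => by rw [h]; simp⟩

end Transfer

/-! ### The right-continuous inverse -/

lemma rightInverse_mono {Ω : Type*} (L : ℝ≥0 → Ω → ℝ) (ω : Ω) :
    Monotone fun t => rightInverse L t ω := fun s t hst => by
  simp only [rightInverse_eq_firstTime]
  exact le_firstTime_iff.2 fun r hr _ =>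
    firstTime_le (lt_of_le_of_lt (NNReal.coe_le_coe.2 hst) hr) zero_le

lemma continuousWithinAt_rightInverse {Ω : Type*} (L : ℝ≥0 → Ω → ℝ) (ω : Ω) (t : ℝ≥0) :
    ContinuousWithinAt (fun t => rightInverse L t ω) (Set.Ici t) t := by
  refine tendsto_order.2 ⟨fun a ha => ?_, fun a ha => ?_⟩
  · filter_upwards [self_mem_nhdsWithin] with s hs
    exact ha.trans_le (rightInverse_mono L ω hs)
  · simp only [rightInverse_eq_firstTime] at ha ⊢
    obtain ⟨r, hr, -, hra⟩ := firstTime_lt_iff.1 ha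
    obtain ⟨c, hc1, hc2⟩ := exists_between (show (t : ℝ) < L r ω from hr)
    have hc0 : 0 ≤ c := t.coe_nonneg.trans hc1.le
    filter_upwards [mem_nhdsWithin_of_mem_nhds
      (Iio_mem_nhds (show t < ⟨c, hc0⟩ from hc1))] with s hs
    have h1 : (s : ℝ) < L r ω := lt_trans (show (s : ℝ) < c from hs) hc2
    exact (firstTime_le h1 zero_le).trans_lt hra

/-! ### The support of the local time -/

/-- The Stieltjes measure is Lebesgue measure restricted to the set of times at the maximum. Each
such time is followed by an interval of such times, so every neighbourhood of it is charged and the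
support is the full closure. -/
lemma IsSkipFreePath.exists_stieltjes {w : ℝ≥0 → ℤ} (hw : IsSkipFreePath w) :
    ∃ F : StieltjesFunction ℝ, (∀ t : ℝ, F t = pathLoc w t.toNNReal) ∧
      F.measure.support = closure {t : ℝ | 0 ≤ t ∧ pathRefl w t.toNNReal = 0} := by
  set Z : Set ℝ := {t : ℝ | 0 ≤ t ∧ pathRefl w t.toNNReal = 0} with hZ
  have hcont : Continuous fun t : ℝ => pathLoc w t.toNNReal :=
    (continuous_occTime _).comp continuous_real_toNNReal
  let F : StieltjesFunction ℝ :=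
    { toFun := fun t => pathLoc w t.toNNReal
      mono' := fun s t hst => occTime_mono _ (Real.toNNReal_mono hst)
      right_continuous' := fun t => hcont.continuousWithinAt }
  have hZm : MeasurableSet Z := measurableSet_Ici.inter
    ((hw.measurableSet_pathRefl_eq_zero).preimage measurable_real_toNNReal)
  have hloc (t : ℝ) : pathLoc w t.toNNReal = volume.real (Z ∩ Set.Iic t) := by
    rw [pathLoc, occTime]
    rcases le_or_gt 0 t with ht | ht
    · rw [Real.coe_toNNReal t ht]
      congr 1
      refine Set.ext fun s => ?_
      exact ⟨fun h => ⟨⟨h.1, h.2.2⟩, h.2.1⟩, fun h => ⟨h.1.1, h.2, h.1.2⟩⟩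
    · rw [Real.toNNReal_of_nonpos ht.le]
      have e1 : Z ∩ Set.Iic t = ∅ := Set.eq_empty_of_forall_notMem fun s hs =>
        (hs.1.1.trans hs.2).not_gt ht
      rw [e1, measureReal_empty, measureReal_eq_zero_iff (occTime_set_ne_top _ 0)]
      refine measure_mono_null (occTime_set_subset _ 0) ?_
      simp
  have hfin (t : ℝ) : volume (Z ∩ Set.Iic t) ≠ ∞ :=
    ne_top_of_le_ne_top (measure_Icc_lt_top (a := (0 : ℝ)) (b := t)).ne
      (measure_mono fun s hs => ⟨hs.1.1, hs.2⟩)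
  have hm : F.measure = volume.restrict Z := by
    refine Measure.ext_of_Ioc _ _ fun a b hab => ?_
    rw [F.measure_Ioc, Measure.restrict_apply measurableSet_Ioc]
    change ENNReal.ofReal (pathLoc w b.toNNReal - pathLoc w a.toNNReal) = _
    have e1 : Z ∩ Set.Iic b = (Z ∩ Set.Iic a) ∪ (Set.Ioc a b ∩ Z) := by
      rw [← Set.Iic_union_Ioc_eq_Iic hab.le, Set.inter_union_distrib_left,
        Set.inter_comm Z (Set.Ioc a b)]
    have hf2 : volume (Set.Ioc a b ∩ Z) ≠ ∞ :=
      ne_top_of_le_ne_top (hfin b) (measure_mono (e1 ▸ Set.subset_union_right))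
    rw [hloc, hloc, e1, measureReal_union (Set.disjoint_left.2 fun s h1 h2 =>
      h2.1.1.not_ge h1.2) (measurableSet_Ioc.inter hZm) (hfin a) hf2, add_sub_cancel_left,
      ofReal_measureReal hf2]
  refine ⟨F, fun t => rfl, ?_⟩
  rw [hm]
  apply Set.Subset.antisymm
  · intro t ht
    by_contra hc
    refine Measure.notMem_support_iff_exists.2 ⟨(closure Z)ᶜ,
      isClosed_closure.isOpen_compl.mem_nhds hc, ?_⟩ ht
    rw [Measure.restrict_apply isClosed_closure.isOpen_compl.measurableSet]
    rw [Set.disjoint_iff_inter_eq_empty.1 (Set.disjoint_left.2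
      fun s (h1 : s ∈ (closure Z)ᶜ) h2 => h1 (subset_closure h2)), measure_empty]
  · refine closure_minimal (fun t ht => ?_) Measure.isClosed_support
    rw [Measure.mem_support_iff_forall]
    intro V hV
    obtain ⟨u, htu, hu⟩ := hw.rightOpen_pathRefl {0} t.toNNReal ht.2
    obtain ⟨l, v, htlv, hlv⟩ := mem_nhds_iff_exists_Ioo_subset.1 hV
    have htu' : t < u := by
      have := NNReal.coe_lt_coe.2 htu
      rwa [Real.coe_toNNReal t ht.1] at this
    refine lt_of_lt_of_le ?_ (Measure.le_restrict_apply Z V)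
    refine lt_of_lt_of_le ?_ (measure_mono (show Set.Ico t (min u v) ⊆ V ∩ Z from ?_))
    · rw [Real.volume_Ico]
      exact ENNReal.ofReal_pos.2 (sub_pos.2 (lt_min htu' htlv.2))
    · intro s hs
      refine ⟨hlv ⟨htlv.1.trans_le hs.1, hs.2.trans_le (min_le_right _ _)⟩, ht.1.trans hs.1,
        hu ⟨Real.toNNReal_mono hs.1, ?_⟩⟩
      exact (Real.toNNReal_lt_iff_lt_coe (ht.1.trans hs.1)).2 (hs.2.trans_le (min_le_left _ _))

/-! ### Local time at the maximum -/

lemma measurable_of_ae_eq {Ω β : Type*} [mΩ : MeasurableSpace Ω] [MeasurableSpace β]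
    {μ : Measure Ω} {m : MeasurableSpace Ω} (hm : ∀ N : Set Ω, μ N = 0 → MeasurableSet[m] N)
    {f g : Ω → β} (hfg : f =ᵐ[μ] g) (hg : Measurable[m] g) : Measurable[m] f := fun B hB => by
  have h1 : MeasurableSet[m] {ω | f ω ≠ g ω} := hm _ hfg
  have h2 : MeasurableSet[m] (f ⁻¹' B ∩ {ω | f ω ≠ g ω}) :=
    hm _ (measure_mono_null Set.inter_subset_right hfg)
  have h3 : f ⁻¹' B = (g ⁻¹' B \ {ω | f ω ≠ g ω}) ∪ (f ⁻¹' B ∩ {ω | f ω ≠ g ω}) := by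
    refine Set.ext fun ω => ?_
    by_cases h : f ω = g ω <;> simp [h]
  rw [h3]
  exact ((hg hB).diff h1).union h2

/-- The random skip-free path `U`, rescaled by `h`, is a version of the process `X`. -/
structure IsPathVersion {Ω : Type*} [mΩ : MeasurableSpace Ω] (μ : Measure Ω)
    (ℱ : Filtration ℝ≥0 mΩ) (X : ℝ≥0 → Ω → ℝ) (h : ℝ) (U : Ω → SkipFreePath) : Prop where
  usual : UsualConditions μ ℱ
  h_pos : 0 < h
  walk : IsLatticeWalk μ ℱ U
  ae_eq : ∀ᵐ ω ∂μ, ∀ t, X t ω = (U ω).1 t * h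

namespace IsPathVersion

variable {Ω : Type*} [mΩ : MeasurableSpace Ω] {μ : Measure Ω} {ℱ : Filtration ℝ≥0 mΩ}
  {X : ℝ≥0 → Ω → ℝ} {h : ℝ} {U : Ω → SkipFreePath}

lemma measurableSet_of_null (hM : IsPathVersion μ ℱ X h U) (t : ℝ≥0) (N : Set Ω) (hN : μ N = 0) :
    MeasurableSet[ℱ t] N := ℱ.mono zero_le _ (hM.usual.null_mem N hN)

/-- Events that depend on the path of `X` only are events for the random lattice path. -/
lemma measure_eq (hM : IsPathVersion μ ℱ X h U) {D : Set Ω} {S : Set SkipFreePath}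
    (hS : MeasurableSet S) (hDS : ∀ ω p, (∀ t, X t ω = p.1 t * h) → (ω ∈ D ↔ p ∈ S)) :
    μ D = (μ.map U) S := by
  rw [Measure.map_apply hM.walk.measurable hS]
  refine measure_congr ?_
  filter_upwards [hM.ae_eq] with ω hω
  exact propext (hDS ω (U ω) hω)

lemma isHoldingPointZero (hM : IsPathVersion μ ℱ X h U) :
    IsHoldingPointZero μ (reflected X) := by
  filter_upwards [hM.ae_eq] with ω hω
  refine ⟨(reflected_eq_zero_iff hM.h_pos (U ω).2 hω 0).2 (U ω).2.pathRefl_zero, ?_⟩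
  simp only [ne_eq, reflected_eq_zero_iff hM.h_pos (U ω).2 hω]
  exact (U ω).2.exStart_pos

/-- The triple is a measurable functional `Ψ` of the lattice path, and at a time at the maximum its
increments are the same functional of the shifted path. -/
lemma regenerative [IsProbabilityMeasure μ] (hM : IsPathVersion μ ℱ X h U) (T : Ω → WithTop ℝ≥0)
    (hT : IsStoppingTime ℱ T)
    (hTX : ∀ᵐ ω ∂μ, T ω < ⊤ → runMax X ((T ω).untopD 0) ω = X ((T ω).untopD 0) ω)
    (A : Set Ω) (hA : MeasurableSet[hT.measurableSpace] A)
    (B : Set (ℝ≥0 → ℝ × ℝ × ℝ)) (hB : MeasurableSet B) :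
    μ (A ∩ {ω | T ω < ⊤} ∩
      {ω | (fun t : ℝ≥0 =>
        (X ((T ω).untopD 0 + t) ω - X ((T ω).untopD 0) ω,
          reflected X ((T ω).untopD 0 + t) ω,
          timeAtZero (reflected X) ((T ω).untopD 0 + t) ω -
            timeAtZero (reflected X) ((T ω).untopD 0) ω)) ∈ B}) =
    μ (A ∩ {ω | T ω < ⊤}) *
      μ {ω | (fun t : ℝ≥0 => (X t ω, reflected X t ω, timeAtZero (reflected X) t ω)) ∈ B} := by
  let Ψ : SkipFreePath → ℝ≥0 → ℝ × ℝ × ℝ := fun p t =>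
    ((p.1 t : ℝ) * h, (pathRefl p.1 t : ℝ) * h, pathLoc p.1 t)
  have hscale : Measurable fun k : ℤ => (k : ℝ) * h := measurable_of_countable _
  have hΨ : Measurable Ψ := measurable_pi_lambda _ fun t =>
    (hscale.comp (measurable_path_eval measurable_id t)).prodMk
      ((hscale.comp (measurable_pathRefl_comp fun s _ => measurable_path_eval measurable_id s)).prodMk
        (measurable_pathLoc_comp fun s _ => measurable_path_eval measurable_id s))
  have e1 : μ {ω | (fun t : ℝ≥0 => (X t ω, reflected X t ω, timeAtZero (reflected X) t ω)) ∈ B} =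
      (μ.map U) (Ψ ⁻¹' B) := hM.measure_eq (hΨ hB) fun ω p hω => by
    rw [Set.mem_ofPred_eq, Set.mem_preimage]
    simp only [Ψ, hω, reflected_eq hM.h_pos p.2 hω, timeAtZero_eq hM.h_pos p.2 hω]
  rw [e1, ← hM.walk.strongMarkov (T := T) (A := A ∩ {ω | T ω < ⊤}) (fun i => ?_)
      (fun ω hω => ne_of_lt hω.2) (hΨ hB)]
  · refine measure_congr ?_
    filter_upwards [hM.ae_eq, hTX] with ω hω hTω
    refine propext (and_congr_right fun hfin => ?_)
    have h1 := hTω hfin.2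
    rw [← sub_eq_zero] at h1
    have h2 : pathRefl (U ω).1 ((T ω).untopD 0) = 0 :=
      (reflected_eq_zero_iff hM.h_pos (U ω).2 hω _).1 h1
    change _ ∈ B ↔ Ψ (shiftPath ((T ω).untopD 0) (U ω)) ∈ B
    refine iff_of_eq (congrArg (· ∈ B) (funext fun t => ?_))
    simp only [Ψ, hω, reflected_eq hM.h_pos (U ω).2 hω, timeAtZero_eq hM.h_pos (U ω).2 hω,
      (U ω).2.pathRefl_add_of_eq_zero h2, (U ω).2.pathLoc_add h2, add_sub_cancel_left, shiftPath]
    rw [pathShift, Int.cast_sub, sub_mul]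
  · have h1 := ((hT.measurableSet A).1 hA).2 i
    convert h1 using 1
    refine Set.ext fun ω => ?_
    exact ⟨fun hω => ⟨hω.1.1, hω.2⟩,
      fun hω => ⟨⟨hω.1, lt_of_le_of_lt hω.2 (WithTop.coe_lt_top i)⟩, hω.2⟩⟩

theorem isLocalTimeAtMax [IsProbabilityMeasure μ] (hM : IsPathVersion μ ℱ X h U) :
    IsLocalTimeAtMax μ ℱ X (timeAtZero (reflected X)) where
  continuous ω := by
    simp only [timeAtZero_eq_occTime]
    exact continuous_occTime _
  monotone ω := by
    simp only [timeAtZero_eq_occTime]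
    exact occTime_mono _
  nonneg t ω := measureReal_nonneg
  adapted t := by
    refine measurable_of_ae_eq (μ := μ) (hM.measurableSet_of_null t)
      (g := fun ω => pathLoc (U ω).1 t) ?_ ?_
    · filter_upwards [hM.ae_eq] with ω hω using timeAtZero_eq hM.h_pos (U ω).2 hω t
    · exact @measurable_pathLoc_comp Ω (ℱ t) U t fun s hs => hM.walk.adapted_le hs
  support_eq := by
    filter_upwards [hM.ae_eq] with ω hω
    obtain ⟨F, hF1, hF2⟩ := (U ω).2.exists_stieltjes
    refine ⟨F, fun t => by rw [hF1, timeAtZero_eq hM.h_pos (U ω).2 hω], ?_⟩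
    rw [hF2]
    simp only [← reflected_eq_zero_iff hM.h_pos (U ω).2 hω, reflected, sub_eq_zero]
  regenerative := hM.regenerative

/-! ### The inverse local time -/

lemma measurable_rightInverse (hM : IsPathVersion μ ℱ X h U) (t : ℝ≥0) :
    Measurable (rightInverse (timeAtZero (reflected X)) t) := by
  refine measurable_of_ae_eq (μ := μ) (fun N hN => ℱ.le 0 _ (hM.measurableSet_of_null 0 N hN))
    (g := fun ω => pathInv (U ω).1 t) ?_ (measurable_pathInv_comp hM.walk.measurable t)
  filter_upwards [hM.ae_eq] with ω hω using rightInverse_eq hM.h_pos (U ω).2 hω t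

lemma rightInverse_increments [IsProbabilityMeasure μ] (hM : IsPathVersion μ ℱ X h U) (s t : ℝ≥0)
    (A : Set Ω) (hA : MeasurableSet[⨆ r : Set.Iic s, MeasurableSpace.comap
      (rightInverse (timeAtZero (reflected X)) r) inferInstance] A)
    (B : Set ℝ≥0∞) (hB : MeasurableSet B) :
    μ (A ∩ {ω | rightInverse (timeAtZero (reflected X)) s ω < ∞} ∩
        {ω | rightInverse (timeAtZero (reflected X)) (s + t) ω -
          rightInverse (timeAtZero (reflected X)) s ω ∈ B}) =
      μ (A ∩ {ω | rightInverse (timeAtZero (reflected X)) s ω < ∞}) *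
        μ {ω | rightInverse (timeAtZero (reflected X)) t ω ∈ B} := by
  -- The past of the inverse is generated by its whole history up to `s`, which is the mark carried
  -- by `markedStop_pathInv`.
  have h1 : (⨆ r : Set.Iic s, MeasurableSpace.comap
      (rightInverse (timeAtZero (reflected X)) r) inferInstance) =
      MeasurableSpace.comap
        (fun ω => fun r : Set.Iic s => rightInverse (timeAtZero (reflected X)) r ω)
        MeasurableSpace.pi := by
    rw [MeasurableSpace.pi, MeasurableSpace.comap_iSup]
    simp only [MeasurableSpace.comap_comp, Function.comp_def]
  rw [h1] at hA
  obtain ⟨C, hC, rfl⟩ := hA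
  have hm : Measurable fun p : SkipFreePath =>
      (pathInv p.1 s, fun r : Set.Iic s => pathInv p.1 r) :=
    (measurable_pathInv s).prodMk (measurable_pi_lambda _ fun r => measurable_pathInv r.1)
  have hS : MeasurableSet (Set.univ ×ˢ C : Set (ℝ≥0∞ × (Set.Iic s → ℝ≥0∞))) :=
    MeasurableSet.univ.prod hC
  have hD : MeasurableSet {p : SkipFreePath | pathInv p.1 t ∈ B} := measurable_pathInv t hB
  have hI : MeasurableSet {p : SkipFreePath | pathInv p.1 s ≠ ∞} :=
    measurable_pathInv s (measurableSet_singleton ∞).compl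
  have h2 := (markedStop_pathInv s).strongMarkov hM.walk hS hD
  have e1 : μ {ω | rightInverse (timeAtZero (reflected X)) t ω ∈ B} =
      (μ.map U) {p | pathInv p.1 t ∈ B} := hM.measure_eq hD fun ω p hω => by
    rw [Set.mem_ofPred_eq, rightInverse_eq hM.h_pos p.2 hω, Set.mem_ofPred_eq]
  rw [e1]
  refine Eq.trans ?_ (h2.trans (congrArg (· * _) (Eq.symm ?_)))
  · refine hM.measure_eq (hI.inter ((hm hS).inter (measurable_shiftPath_comp measurable_id
      (measurable_pathInv s).ennreal_toNNReal hD))) fun ω p hω => ?_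
    simp only [Set.mem_inter_iff, Set.mem_preimage, Set.mem_ofPred_eq,
      rightInverse_eq hM.h_pos p.2 hω, Set.mem_prod, Set.mem_univ, true_and, lt_top_iff_ne_top]
    rw [and_comm (b := pathInv p.1 s ≠ ∞), and_assoc]
    refine and_congr_right fun hs => and_congr_right fun _ => ?_
    obtain ⟨r, hr⟩ := exists_coe_eq hs
    rw [p.2.pathInv_add_pathInv hr, hr, ENNReal.add_sub_cancel_left ENNReal.coe_ne_top,
      ENNReal.toNNReal_coe]
    rfl
  · refine hM.measure_eq (hI.inter (hm hS)) fun ω p hω => ?_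
    simp only [Set.mem_inter_iff, Set.mem_preimage, Set.mem_ofPred_eq,
      rightInverse_eq hM.h_pos p.2 hω, Set.mem_prod, Set.mem_univ, true_and, lt_top_iff_ne_top]
    exact and_comm

lemma setIntegral_exp_rightInverse (hM : IsPathVersion μ ℱ X h U) (t : ℝ≥0) (θ : ℝ) :
    ∫ ω in {ω | rightInverse (timeAtZero (reflected X)) t ω < ∞},
      Real.exp (-θ * (rightInverse (timeAtZero (reflected X)) t ω).toReal) ∂μ =
      (invLaplace (μ.map U) θ t).toReal := by
  have hm := hM.measurable_rightInverse t
  rw [integral_eq_lintegral_of_nonneg_ae (.of_forall fun ω => Real.exp_nonneg _)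
    (hm.ennreal_toReal.const_mul (-θ)).exp.aestronglyMeasurable]
  simp only [lt_top_iff_ne_top]
  have h1 := lintegral_map (μ := μ)
    ((measurable_expNeg θ).comp (measurable_pathInv t)) hM.walk.measurable
  simp only [Function.comp_def] at h1
  rw [← setLIntegral_expNeg hm, invLaplace, h1]
  refine congrArg _ (lintegral_congr_ae ?_)
  filter_upwards [hM.ae_eq] with ω hω
  rw [rightInverse_eq hM.h_pos (U ω).2 hω]

lemma isKilledCompoundPoissonSubordinator [IsProbabilityMeasure μ]
    (hM : IsPathVersion μ ℱ X h U) {q : ℝ} {Pi : Measure ℝ} (hq : 0 ≤ q) (hfin : IsFiniteMeasure Pi)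
    (hPi : Pi (Set.Iic 0) = 0) (hL : ∀ (t : ℝ≥0) (θ : ℝ), 0 ≤ θ →
      (invLaplace (μ.map U) θ t).toReal =
        Real.exp (-(t * (q + 1 * θ + ∫ x, (1 - Real.exp (-θ * x)) ∂Pi)))) :
    IsKilledCompoundPoissonSubordinator μ (rightInverse (timeAtZero (reflected X))) q 1 Pi where
  measurable := hM.measurable_rightInverse
  zero := by
    filter_upwards [hM.ae_eq] with ω hω
    rw [rightInverse_eq hM.h_pos (U ω).2 hω, (U ω).2.pathInv_zero]
  monotone := rightInverse_mono _
  rightCont := continuousWithinAt_rightInverse _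
  increments := hM.rightInverse_increments
  killing_nonneg := hq
  drift_nonneg := zero_le_one
  finite := hfin
  positive := hPi
  laplace t θ hθ := by rw [hM.setIntegral_exp_rightInverse, hL t θ hθ]

end IsPathVersion

/-- The law of the length of a finite excursion. -/
def exLengthLaw (P : Measure SkipFreePath) : Measure ℝ :=
  (P[|{p | exLength p ≠ ∞}]).map fun p => (exLength p).toReal

section ExLengthLaw

variable {P : Measure SkipFreePath} {c a : ℝ} {r ρ : Measure ℤ}

lemma isProbabilityMeasure_exLengthLaw (hP : IsExcursionLaw P c r a ρ) :
    IsProbabilityMeasure (exLengthLaw P) := by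
  have := hP.walk.prob
  have := cond_isProbabilityMeasure hP.measure_exLength_ne_top_pos.ne'
  exact Measure.isProbabilityMeasure_map measurable_exLength.ennreal_toReal.aemeasurable

lemma exLengthLaw_eq (hP : IsExcursionLaw P c r a ρ) :
    exLengthLaw P = (P {p | exLength p ≠ ∞})⁻¹ • Measure.sum fun k : ℕ =>
      P {p | exJumps p = (k + 1 : ℕ)} • expSumLaw c (k + 1) := by
  rw [exLengthLaw, ProbabilityTheory.cond, Measure.map_smul, hP.map_exLength]

lemma exLengthLaw_Iic_zero (hP : IsExcursionLaw P c r a ρ) : exLengthLaw P (Set.Iic 0) = 0 := by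
  rw [exLengthLaw_eq hP, Measure.smul_apply, Measure.sum_apply _ measurableSet_Iic]
  simp [expSumLaw_succ_Iic_zero hP.walk.rate_pos]

lemma integral_exLengthLaw (hP : IsExcursionLaw P c r a ρ) {θ : ℝ} (hθ : 0 ≤ θ) :
    P.real {p | exLength p ≠ ∞} * ∫ x, (1 - Real.exp (-θ * x)) ∂(exLengthLaw P) =
      P.real {p | exLength p ≠ ∞} - (exLaplace P θ).toReal := by
  have := hP.walk.prob
  have := isProbabilityMeasure_exLengthLaw hP
  have h0 : ∀ᵐ x ∂(exLengthLaw P), 0 < x := by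
    rw [ae_iff]
    simp only [not_lt]
    exact exLengthLaw_Iic_zero hP
  have hint : Integrable (fun x => Real.exp (-θ * x)) (exLengthLaw P) := by
    refine Integrable.of_bound (by fun_prop) 1 ?_
    filter_upwards [h0] with x hx
    rw [Real.norm_of_nonneg (Real.exp_nonneg _), Real.exp_le_one_iff]
    nlinarith
  rw [integral_sub (integrable_const 1) hint, integral_const, probReal_univ, one_smul, mul_sub,
    mul_one]
  congr 1
  rw [integral_eq_lintegral_of_nonneg_ae (.of_forall fun x => Real.exp_nonneg _) (by fun_prop),
    measureReal_def, ← ENNReal.toReal_mul, exLengthLaw,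
    lintegral_map (by fun_prop) measurable_exLength.ennreal_toReal, ProbabilityTheory.cond, lintegral_smul_measure,
    smul_eq_mul, ← mul_assoc, ENNReal.mul_inv_cancel hP.measure_exLength_ne_top_pos.ne'
      (measure_ne_top _ _), one_mul, exLaplace, setLIntegral_expNeg measurable_exLength]

end ExLengthLaw

section InvLaplace

variable {Ω : Type*} [mΩ : MeasurableSpace Ω] {μ : Measure Ω} [IsProbabilityMeasure μ]
  {ℱ : Filtration ℝ≥0 mΩ} {X : ℝ≥0 → Ω → ℝ} {h : ℝ} {U : Ω → SkipFreePath} {c a : ℝ}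
  {r ρ : Measure ℤ}

/-- With `m` the probability of a finite excursion and `g` the Laplace transform of the length, `a
(1 - g) = a (1 - m) + a (m - g)`: the first part is killing, the second the integral against the law
of finite lengths. -/
theorem IsPathVersion.isSubordinator_of_pos (hM : IsPathVersion μ ℱ X h U)
    (hP : IsExcursionLaw (μ.map U) c r a ρ) :
    IsKilledCompoundPoissonSubordinator μ (rightInverse (timeAtZero (reflected X)))
      (a * (1 - (μ.map U).real {p | exLength p ≠ ∞})) 1
      (ENNReal.ofReal (a * (μ.map U).real {p | exLength p ≠ ∞}) • exLengthLaw (μ.map U)) := by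
  have := hP.walk.prob
  have := isProbabilityMeasure_exLengthLaw hP
  have ha := hP.rate_pos
  set m := (μ.map U).real {p | exLength p ≠ ∞} with hm
  have hm1 : m ≤ 1 := measureReal_le_one
  refine hM.isKilledCompoundPoissonSubordinator (mul_nonneg ha.le (sub_nonneg.2 hm1)) ?_ ?_
    fun t θ hθ => ?_
  · exact Measure.smul_finite _ ENNReal.ofReal_ne_top
  · rw [Measure.smul_apply, exLengthLaw_Iic_zero hP, smul_zero]
  · rw [invLaplace_eq hM.walk hP hθ, integral_smul_measure,
      ENNReal.toReal_ofReal (mul_nonneg ha.le measureReal_nonneg), smul_eq_mul, mul_assoc,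
      integral_exLengthLaw hP hθ, ← hm]
    congr 1
    ring

/-- Without downward jumps no excursion ever starts, and the inverse local time is the identity. -/
theorem IsPathVersion.isSubordinator_of_eq_zero (hM : IsPathVersion μ ℱ X h U) {Λ : Measure ℤ}
    [IsFiniteMeasure Λ] (hΛ : HasJumpIntensity (μ.map U) Λ) (h0 : Λ.real (Set.Iio 0) = 0) :
    IsKilledCompoundPoissonSubordinator μ (rightInverse (timeAtZero (reflected X))) 0 1 0 := by
  have := hM.walk.isProbabilityMeasure
  have h1 : ∀ᵐ p ∂(μ.map U), ∀ n : ℕ, ((n : ℝ≥0) : ℝ≥0∞) < exStart p.1 := by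
    refine ae_all_iff.2 fun n => ?_
    have h2 := hM.walk.exStart_survival hΛ n
    rw [h0, zero_mul, neg_zero, Real.exp_zero] at h2
    have h3 : MeasurableSet {p : SkipFreePath | ((n : ℝ≥0) : ℝ≥0∞) < exStart p.1} :=
      measurableSet_lt measurable_const (measurable_exStart_comp measurable_id)
    rw [measureReal_def, ENNReal.toReal_eq_one_iff] at h2
    exact (prob_compl_eq_zero_iff h3).2 h2
  refine hM.isKilledCompoundPoissonSubordinator le_rfl inferInstance rfl fun t θ hθ => ?_
  have h2 : invLaplace (μ.map U) θ t = expNeg θ t := by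
    rw [invLaplace, lintegral_congr_ae (g := fun _ => expNeg θ t), lintegral_const, measure_univ,
      mul_one]
    filter_upwards [h1] with p hp
    obtain ⟨n, hn⟩ := exists_nat_ge t
    rw [IsSkipFreePath.pathInv_of_lt_exStart (lt_of_le_of_lt (by exact_mod_cast hn) (hp n))]
  rw [h2, expNeg_coe, ENNReal.toReal_ofReal (Real.exp_nonneg _), integral_zero_measure]
  congr 1
  ring

end InvLaplace

/-! ### The reflected chain -/

/-- The path reflected at its running maximum, issued from the level `k`. -/
def reflFrom (k : ℕ) (p : SkipFreePath) (t : ℝ≥0) : ℕ := (max (k : ℤ) (pathMax p.1 t) - p.1 t).toNat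

lemma coe_reflFrom (k : ℕ) (p : SkipFreePath) (t : ℝ≥0) :
    (reflFrom k p t : ℤ) = max (k : ℤ) (pathMax p.1 t) - p.1 t := by
  have h1 := p.2.le_pathMax (le_refl t)
  rw [reflFrom, Int.toNat_of_nonneg]
  omega

lemma reflFrom_zero_time (k : ℕ) (p : SkipFreePath) : reflFrom k p 0 = k := by
  have h1 := coe_reflFrom k p 0
  rw [p.2.pathMax_zero, p.2.zero] at h1
  omega

lemma coe_reflFrom_zero (p : SkipFreePath) (t : ℝ≥0) : (reflFrom 0 p t : ℤ) = pathRefl p.1 t := by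
  have h1 := p.2.pathMax_nonneg t
  rw [coe_reflFrom, pathRefl]
  omega

/-- A flow property: the reflected path at `s` is all that the later reflected path retains of the
past. -/
lemma reflFrom_add (k : ℕ) (p : SkipFreePath) (s t : ℝ≥0) :
    reflFrom k p (s + t) = reflFrom (reflFrom k p s) (shiftPath s p) t := by
  have h1 := coe_reflFrom k p (s + t)
  have h2 := coe_reflFrom k p s
  have h3 := coe_reflFrom (reflFrom k p s) (shiftPath s p) t
  have h4 := p.2.pathMax_add s t
  change _ = max (_ : ℤ) (pathMax (pathShift s p.1) t) - pathShift s p.1 t at h3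
  simp only [pathShift, pathRefl] at *
  omega

lemma measurable_reflFrom_comp {α : Type*} [MeasurableSpace α] {U : α → SkipFreePath} {t : ℝ≥0}
    (hU : ∀ s ≤ t, Measurable fun x => (U x).1 s) (k : ℕ) :
    Measurable fun x => reflFrom k (U x) t :=
  (measurable_of_countable fun z : ℤ × ℤ => (max (k : ℤ) z.1 - z.2).toNat).comp
    ((measurable_pathMax_comp hU).prodMk (hU t le_rfl))

lemma measurable_reflFrom (k : ℕ) (t : ℝ≥0) : Measurable fun p => reflFrom k p t :=
  measurable_reflFrom_comp (fun s _ => measurable_path_eval measurable_id s) k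

/-- The transition probabilities of the reflected path. -/
def reflTransition (P : Measure SkipFreePath) (t : ℝ≥0) (k l : ℕ) : ℝ :=
  P.real {p | reflFrom k p t = l}

lemma hasSum_measureReal_inter {α : Type*} [MeasurableSpace α] {P : Measure α}
    [IsFiniteMeasure P] {f : α → ℕ} (hf : Measurable f) {S : Set α} (hS : MeasurableSet S) :
    HasSum (fun l => P.real (S ∩ {x | f x = l})) (P.real S) := by
  have h1 : ∑' l, P (S ∩ {x | f x = l}) = P S := by
    rw [← measure_iUnion]
    · congr 1
      refine Set.ext fun x => ?_
      simp
    · intro i j hij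
      exact Set.disjoint_left.2 fun x h1 h2 => hij (h1.2.symm.trans h2.2)
    · exact fun l => hS.inter (hf (measurableSet_singleton l))
  have h2 := ENNReal.hasSum_toReal (f := fun l => P (S ∩ {x | f x = l}))
    (h1 ▸ measure_ne_top P S)
  rwa [← ENNReal.tsum_toReal_eq fun l => measure_ne_top _ _, h1] at h2

lemma max_eq_of_notMem_twoJumps {t : ℝ≥0} {p : SkipFreePath} (h : p ∉ twoJumps t) :
    pathMax p.1 t = max 0 (p.1 t) ∧ p.1 t ≤ 1 := by
  rcases eq_zero_or_of_notMem_twoJumps h with ⟨-, h1⟩ | ⟨r, hrt, hr, -, h1⟩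
  · have h2 : pathMax p.1 t = 0 := le_antisymm (p.2.pathMax_le fun s hs => (h1 s hs).le)
      (p.2.pathMax_nonneg t)
    simp [h1 t le_rfl, h2]
  · have h2 := p.2.le_one_of_firstJump_eq hr
    rw [h1 t hrt le_rfl]
    refine ⟨le_antisymm (p.2.pathMax_le fun s hs => ?_)
      (max_le (p.2.pathMax_nonneg t) (p.2.le_pathMax hrt)), h2⟩
    rcases lt_or_ge s r with hsr | hsr
    · rw [IsSkipFreePath.eq_zero_of_lt_firstJump (w := p.1) (t := s)
        (by rw [hr]; exact_mod_cast hsr)]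
      exact le_max_left _ _
    · rw [h1 s hsr hs]
      exact le_max_right _ _

/-! ### Markov property and generator of the reflected lattice walk -/

section Walk

variable {Ω : Type*} [mΩ : MeasurableSpace Ω] {μ : Measure Ω} [IsProbabilityMeasure μ]
  {ℱ : Filtration ℝ≥0 mΩ} {U : Ω → SkipFreePath}

lemma reflTransition_markov (hU : IsLatticeWalk μ ℱ U) (s t : ℝ≥0) {A : Set Ω}
    (hA : MeasurableSet[ℱ s] A) (i k l : ℕ) :
    μ.real (A ∩ {ω | reflFrom i (U ω) s = k} ∩ {ω | reflFrom i (U ω) (s + t) = l}) =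
      μ.real (A ∩ {ω | reflFrom i (U ω) s = k}) * reflTransition (μ.map U) t k l := by
  have h1 : Measurable[ℱ s] fun ω => reflFrom i (U ω) s :=
    @measurable_reflFrom_comp Ω (ℱ s) U s (fun r hr => hU.adapted_le hr) i
  have h2 := hU.markov s (hA.inter (h1 (measurableSet_singleton k)))
    (measurable_reflFrom k t (measurableSet_singleton l))
  rw [reflTransition, measureReal_def, measureReal_def, measureReal_def, ← ENNReal.toReal_mul]
  refine congrArg _ (Eq.trans (congrArg _ (Set.ext fun ω => ?_)) h2)
  refine and_congr_right fun hω => ?_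
  have h3 : reflFrom i (U ω) s = k := hω.2
  rw [Set.mem_ofPred_eq, reflFrom_add, h3]
  rfl

lemma reflTransition_semigroup (hU : IsLatticeWalk μ ℱ U) (s t : ℝ≥0) (k l : ℕ) :
    HasSum (fun i => reflTransition (μ.map U) s k i * reflTransition (μ.map U) t i l)
      (reflTransition (μ.map U) (s + t) k l) := by
  have hm (r : ℝ≥0) (i : ℕ) : Measurable fun ω => reflFrom i (U ω) r :=
    measurable_reflFrom_comp (fun s _ => measurable_path_eval hU.measurable s) i
  have hr (r : ℝ≥0) (i j : ℕ) : reflTransition (μ.map U) r i j =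
      μ.real {ω | reflFrom i (U ω) r = j} := by
    exact congrArg ENNReal.toReal (Measure.map_apply hU.measurable
      (measurable_reflFrom i r (measurableSet_singleton j)))
  rw [hr (s + t)]
  refine (hasSum_measureReal_inter (hm s k) (hm (s + t) k (measurableSet_singleton l))).congr_fun
    fun i => ?_
  have h1 := reflTransition_markov hU s t MeasurableSet.univ k i l
  rw [Set.univ_inter, ← hr] at h1
  rw [← h1, Set.inter_comm]
  rfl

variable {Λ : Measure ℤ} [IsFiniteMeasure Λ]

lemma reflTransition_deriv (hU : IsLatticeWalk μ ℱ U) (hΛ : HasJumpIntensity (μ.map U) Λ)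
    (k l : ℕ) : HasDerivWithinAt (fun t : ℝ => reflTransition (μ.map U) t.toNNReal k l)
      (if k = 0 ∧ l = 0 then - Λ.real (Set.Iio 0) else
        Λ.real {(k : ℤ) - l} - if k = l then Λ.real Set.univ else 0) (Set.Ici 0) 0 := by
  by_cases h : k = 0 ∧ l = 0
  · rw [if_pos h]
    -- From `0`, an upward jump raises the maximum along with the path, so staying at `0` means not
    -- having jumped downward. This accounts for the exceptional entry of the generator.
    refine (hU.deriv_of_iff hΛ (B := Set.Ici 0) (D := fun t => {p | reflFrom k p t = l})
      fun t p hp => ?_).congr_deriv ?_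
    · have h1 := max_eq_of_notMem_twoJumps hp
      have h2 := coe_reflFrom k p t
      rw [Set.mem_ofPred_eq, Set.mem_Ici]
      omega
    · have h1 := measureReal_add_measureReal_compl (μ := Λ) (s := Set.Iio (0 : ℤ))
        MeasurableSet.of_discrete
      rw [Set.compl_Iio] at h1
      rw [Set.indicator_of_mem (by simp), Pi.one_apply]
      linarith
  · rw [if_neg h]
    refine (hU.deriv_of_iff hΛ (B := {(k : ℤ) - l}) (D := fun t => {p | reflFrom k p t = l})
      fun t p hp => ?_).congr_deriv ?_
    · have h1 := max_eq_of_notMem_twoJumps hp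
      have h2 := coe_reflFrom k p t
      rw [Set.mem_ofPred_eq, Set.mem_singleton_iff]
      omega
    · congr 1
      by_cases hkl : k = l
      · simp [hkl]
      · have : (0 : ℤ) ≠ k - l := by omega
        simp [hkl, this]

end Walk

/-- The lattice `{0, h, 2h, …}` is indexed by the natural numbers. -/
def latticeEquiv {h : ℝ} (hh : 0 < h) : ℕ ≃ ZhPlus h :=
  Equiv.ofBijective (fun k => ⟨k * h, k, rfl⟩)
    ⟨fun k l hkl => by
      have h1 := congrArg Subtype.val hkl
      have h2 : (k : ℝ) = l := mul_right_cancel₀ hh.ne' h1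
      exact_mod_cast h2, fun ⟨_, k, hk⟩ => ⟨k, Subtype.ext hk.symm⟩⟩

lemma coe_latticeEquiv {h : ℝ} (hh : 0 < h) (k : ℕ) : (latticeEquiv hh k : ℝ) = k * h := rfl

section Chain

variable {Ω : Type*} [mΩ : MeasurableSpace Ω] {μ : Measure Ω} {ℱ : Filtration ℝ≥0 mΩ}
  {X : ℝ≥0 → Ω → ℝ} {h : ℝ} {U : Ω → SkipFreePath}

/-- The transition function of the reflected process on `{0, h, 2h, …}`. -/
def latticeTransition (P : Measure SkipFreePath) (hh : 0 < h) (t : ℝ≥0) (x y : ZhPlus h) : ℝ :=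
  reflTransition P t ((latticeEquiv hh).symm x) ((latticeEquiv hh).symm y)

lemma jumpMeasure_Iio {lam : Measure ℝ} (hX : IsUpwardsSkipFreeLevyChain μ ℱ X lam h) :
    jumpMeasure lam h (Set.Iio 0) = lam (Set.Iio 0) := by
  rw [hX.jumpMeasure_apply]
  refine measure_congr ?_
  filter_upwards [hX.ae_mem_Zh] with x hx
  obtain ⟨k, rfl⟩ := hx
  refine propext ⟨fun ⟨m, hm, hmk⟩ => ?_, fun hk => ⟨k, ?_, rfl⟩⟩
  · change (k : ℝ) * h < 0
    rw [hmk]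
    exact mul_neg_of_neg_of_pos (by exact_mod_cast hm) hX.h_pos
  · have hk' : (k : ℝ) * h < 0 := hk
    have : (k : ℝ) < 0 := by
      by_contra hc
      exact hk'.not_ge (mul_nonneg (not_lt.1 hc) hX.h_pos.le)
    exact_mod_cast this

variable [IsProbabilityMeasure μ]

lemma isTransitionFunction_latticeTransition (hU : IsLatticeWalk μ ℱ U) (hh : 0 < h) :
    IsTransitionFunction (ZhPlus h) (latticeTransition (μ.map U) hh) where
  nonneg t x y := measureReal_nonneg
  row_sum t x := by
    have := hU.isProbabilityMeasure
    have h1 := hasSum_measureReal_inter (P := μ.map U)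
      (measurable_reflFrom ((latticeEquiv hh).symm x) t) MeasurableSet.univ
    simp only [Set.univ_inter, probReal_univ] at h1
    exact (Equiv.hasSum_iff (latticeEquiv hh).symm (f := fun l =>
      reflTransition (μ.map U) t ((latticeEquiv hh).symm x) l)).2 h1
  initial_same x := by
    have := hU.isProbabilityMeasure
    simp [latticeTransition, reflTransition, reflFrom_zero_time]
  semigroup s t x y := (Equiv.hasSum_iff (latticeEquiv hh).symm (f := fun i =>
      reflTransition (μ.map U) s ((latticeEquiv hh).symm x) i *
        reflTransition (μ.map U) t i ((latticeEquiv hh).symm y))).2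
    (reflTransition_semigroup hU s t _ _)

lemma IsPathVersion.isMarkovChain (hM : IsPathVersion μ ℱ X h U) (i : ℕ) {Y : ℝ≥0 → Ω → ℝ}
    (hY : ∀ᵐ ω ∂μ, ∀ t, Y t ω = reflFrom i (U ω) t * h) :
    IsMarkovChain μ ℱ (ZhPlus h) (latticeTransition (μ.map U) hM.h_pos) (i * h) Y where
  adapted t := by
    refine measurable_of_ae_eq (μ := μ) (hM.measurableSet_of_null t)
      (g := fun ω => (reflFrom i (U ω) t : ℝ) * h) ?_ ?_
    · filter_upwards [hY] with ω hω using hω t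
    · have h1 : Measurable[ℱ t] fun ω => reflFrom i (U ω) t :=
        @measurable_reflFrom_comp Ω (ℱ t) U t (fun s hs => hM.walk.adapted_le hs) i
      exact (measurable_of_countable fun k : ℕ => (k : ℝ) * h).comp h1
  mem := by
    filter_upwards [hY] with ω hω t using ⟨_, hω t⟩
  initial := by
    filter_upwards [hY] with ω hω
    rw [hω, reflFrom_zero_time]
  markov s t A hA x y := by
    obtain ⟨k, rfl⟩ := (latticeEquiv hM.h_pos).surjective x
    obtain ⟨l, rfl⟩ := (latticeEquiv hM.h_pos).surjective y
    have h1 := reflTransition_markov hM.walk s t hA i k l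
    have h2 (ω : Ω) (hω : ∀ t, Y t ω = reflFrom i (U ω) t * h) (r : ℝ≥0) (j : ℕ) :
        Y r ω = latticeEquiv hM.h_pos j ↔ reflFrom i (U ω) r = j := by
      rw [hω, coe_latticeEquiv, mul_left_inj' hM.h_pos.ne', Nat.cast_inj]
    rw [latticeTransition, Equiv.symm_apply_apply, Equiv.symm_apply_apply]
    convert h1 using 1
    · refine measureReal_congr ?_
      filter_upwards [hY] with ω hω
      exact propext (and_congr (and_congr_right fun _ => h2 ω hω s k) (h2 ω hω (s + t) l))
    · refine congrArg (· * _) (measureReal_congr ?_)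
      filter_upwards [hY] with ω hω
      exact propext (and_congr_right fun _ => h2 ω hω s k)

theorem IsPathVersion.exists_transitionFunction {lam : Measure ℝ}
    (hM : IsPathVersion μ ℱ X h U) (hX : IsUpwardsSkipFreeLevyChain μ ℱ X lam h)
    (hΛ : HasJumpIntensity (μ.map U) (jumpMeasure lam h)) :
    ∃ P : ℝ≥0 → ZhPlus h → ZhPlus h → ℝ,
      IsTransitionFunction (ZhPlus h) P ∧
      IsMarkovChain μ ℱ (ZhPlus h) P 0 (reflected X) ∧
      (∀ s ∈ ZhPlus h, IsMarkovChain μ ℱ (ZhPlus h) P s (reflectedFrom X s)) ∧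
      IsGeneratorMatrix (ZhPlus h) P (reflectedGenerator lam h) := by
  have := hX.finite
  have : IsFiniteMeasure (jumpMeasure lam h) := by
    rw [jumpMeasure]
    infer_instance
  refine ⟨latticeTransition (μ.map U) hM.h_pos,
    isTransitionFunction_latticeTransition hM.walk hM.h_pos, ?_, ?_, fun x y => ?_⟩
  · have h1 := hM.isMarkovChain (Y := reflected X) 0 ?_
    · rwa [Nat.cast_zero, zero_mul] at h1
    · filter_upwards [hM.ae_eq] with ω hω t
      rw [reflected_eq hM.h_pos (U ω).2 hω, ← coe_reflFrom_zero, Int.cast_natCast]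
  · rintro _ ⟨k, rfl⟩
    refine hM.isMarkovChain k ?_
    filter_upwards [hM.ae_eq] with ω hω t
    rw [reflectedFrom_eq hM.h_pos (U ω).2 hω, ← coe_reflFrom, Int.cast_natCast]
  · obtain ⟨k, rfl⟩ := (latticeEquiv hM.h_pos).surjective x
    obtain ⟨l, rfl⟩ := (latticeEquiv hM.h_pos).surjective y
    refine HasDerivWithinAt.congr_deriv (f := fun t : ℝ => latticeTransition (μ.map U) hM.h_pos
      t.toNNReal (latticeEquiv hM.h_pos k) (latticeEquiv hM.h_pos l))
      (by
        simp only [latticeTransition, Equiv.symm_apply_apply]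
        exact reflTransition_deriv hM.walk hΛ k l) ?_
    have h1 (j : ℕ) : (j : ℝ) * h = 0 ↔ j = 0 := by
      rw [mul_eq_zero, or_iff_left hM.h_pos.ne', Nat.cast_eq_zero]
    rw [reflectedGenerator, coe_latticeEquiv, coe_latticeEquiv]
    simp only [h1, mul_left_inj' hM.h_pos.ne', Nat.cast_inj, measureReal_def,
      jumpMeasure_Iio hX, hX.jumpMeasure_singleton,
      IsUpwardsSkipFreeLevyChain.jumpMeasure_univ]
    push_cast
    rw [sub_mul]

end Chain

/-! ### Probability of a finite excursion and mean length of an excursion -/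

/-- Bernoulli's inequality `1 - u ^ n ≤ n (1 - u)`, written without subtraction of the power. -/
lemma one_le_pow_add_mul {u : ℝ≥0∞} (hu : u ≤ 1) (n : ℕ) : 1 ≤ u ^ n + n * (1 - u) := by
  induction n with
  | zero => simp
  | succ n ih =>
    calc (1 : ℝ≥0∞) ≤ u ^ n + n * (1 - u) := ih
      _ = u ^ n * (u + (1 - u)) + n * (1 - u) := by rw [add_tsub_cancel_of_le hu, mul_one]
      _ ≤ u ^ (n + 1) + 1 * (1 - u) + n * (1 - u) := by
        rw [mul_add, ← pow_succ]
        gcongr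
        exact pow_le_one₀ zero_le hu
      _ = u ^ (n + 1) + (n + 1 : ℕ) * (1 - u) := by push_cast; ring

/-- Bernoulli's inequality in the fixed point equation gives `1 - u ≤ D (1 - u)`, and `1 - u` can be
cancelled when `u < 1`. So failure to hit forces a nonpositive drift. -/
lemma IsHitArray.one_le_drift {p : ℝ≥0∞} {q : ℕ → ℝ≥0∞} {H : ℕ → ℕ → ℝ≥0∞}
    (hH : IsHitArray p q H) (h1 : ∑' k, H 1 k ≠ 1) : 1 ≤ ∑' m : ℕ, q m * ((m : ℝ≥0∞) + 2) := by
  set u := ∑' k, H 1 k with hu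
  have hu1 : u ≤ 1 := hH.tsum_one_le
  have h2 : 1 ≤ u + (∑' m : ℕ, q m * ((m : ℝ≥0∞) + 2)) * (1 - u) := by
    nth_rw 1 [hu]
    rw [hH.fixed_point, ← hu, ← ENNReal.tsum_mul_right, add_assoc, ← ENNReal.tsum_add]
    nth_rw 1 [← hH.total]
    gcongr with m
    have h3 := one_le_pow_add_mul hu1 (m + 2)
    calc q m = q m * 1 := (mul_one _).symm
      _ ≤ q m * (u ^ (m + 2) + (m + 2 : ℕ) * (1 - u)) := by gcongr
      _ = _ := by push_cast; ring
  have h3 : 1 - u ≤ (∑' m : ℕ, q m * ((m : ℝ≥0∞) + 2)) * (1 - u) := tsub_le_iff_left.2 h2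
  have h4 : 1 - u ≠ 0 := (tsub_pos_of_lt (lt_of_le_of_ne hu1 h1)).ne'
  have h5 : 1 - u ≠ ∞ := ne_top_of_le_ne_top ENNReal.one_ne_top tsub_le_self
  exact (ENNReal.mul_le_mul_iff_left h4 h5).1 (by rwa [one_mul])

namespace HasJumpIntensity

variable {P : Measure SkipFreePath} {Λ : Measure ℤ}

lemma lintegral_eq (hΛ : HasJumpIntensity P Λ) (f : ℤ → ℝ≥0∞) :
    ∫⁻ x, f x ∂Λ = Λ {1} * f 1 + ∑' n : ℕ, Λ {-((n : ℤ) + 1)} * f (-(n + 1)) := by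
  rw [lintegral_int_eq, tsum_eq_single 1, Nat.cast_one]
  intro n hn
  have h0 : Λ {(n : ℤ)} = 0 := by
    rcases Nat.lt_or_ge n 1 with h | h
    · obtain rfl : n = 0 := by omega
      exact hΛ.zero
    · refine measure_mono_null (Set.singleton_subset_iff.2 ?_) hΛ.two_le
      rw [Set.mem_Ici]
      omega
  rw [h0, zero_mul]

lemma measure_Iio (hΛ : HasJumpIntensity P Λ) :
    Λ (Set.Iio 0) = ∑' n : ℕ, Λ {-((n : ℤ) + 1)} := by
  have h1 := hΛ.lintegral_eq ((Set.Iio 0).indicator 1)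
  rw [lintegral_indicator_one MeasurableSet.of_discrete] at h1
  rw [h1, Set.indicator_of_notMem (by simp), mul_zero, zero_add]
  refine tsum_congr fun n => ?_
  rw [Set.indicator_of_mem (by rw [Set.mem_Iio]; omega), Pi.one_apply, mul_one]

lemma measure_univ (hΛ : HasJumpIntensity P Λ) : Λ Set.univ = Λ {1} + Λ (Set.Iio 0) := by
  have h1 := hΛ.lintegral_eq 1
  simp only [Pi.one_apply, lintegral_const, one_mul, mul_one, ← hΛ.measure_Iio] at h1
  exact h1

lemma univ_ne_zero (hΛ : HasJumpIntensity P Λ) : Λ Set.univ ≠ 0 := fun h =>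
  hΛ.one (measure_mono_null (Set.subset_univ _) h)

end HasJumpIntensity

lemma mul_cond_apply {α : Type*} [MeasurableSpace α] {μ : Measure α} [IsFiniteMeasure μ]
    {s t : Set α} (hs : MeasurableSet s) (h0 : μ s ≠ 0) (hst : t ⊆ s) : μ s * μ[|s] t = μ t := by
  rw [cond_apply hs, ← mul_assoc, ENNReal.mul_inv_cancel h0 (measure_ne_top _ _), one_mul,
    Set.inter_eq_right.2 hst]

/-- The probability of ever hitting the level `1`. -/
def hitRoot (P : Measure SkipFreePath) : ℝ≥0∞ := ∑' k, P (hitEvent 1 k)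

/-! ### The probability of ever reaching the next level -/

section Root

variable {P : Measure SkipFreePath} {Λ : Measure ℤ}

lemma hitRoot_le_one (hP : IsWalkLaw P (Λ.real Set.univ) (Λ[|Set.univ])) : hitRoot P ≤ 1 :=
  hP.isHitArray.tsum_one_le

lemma Iio_ne_zero (hP : IsExcursionLaw P (Λ.real Set.univ) (Λ[|Set.univ]) (Λ.real (Set.Iio 0))
    ((Λ[|Set.Iio 0]).map Neg.neg)) : Λ (Set.Iio 0) ≠ 0 := fun h => by
  have h1 := hP.rate_pos
  rw [measureReal_def, h] at h1
  exact lt_irrefl _ h1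

variable [IsFiniteMeasure Λ]

lemma univ_mul_step (hΛ : HasJumpIntensity P Λ) (k : ℤ) :
    Λ Set.univ * (Λ[|Set.univ]) {k} = Λ {k} :=
  mul_cond_apply MeasurableSet.univ hΛ.univ_ne_zero (Set.subset_univ _)

lemma univ_mul_tsum (hΛ : HasJumpIntensity P Λ) (f : ℕ → ℝ≥0∞) :
    Λ Set.univ * ∑' n : ℕ, (Λ[|Set.univ]) {-((n : ℤ) + 1)} * f n =
      ∑' n : ℕ, Λ {-((n : ℤ) + 1)} * f n := by
  rw [← ENNReal.tsum_mul_left]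
  simp only [← mul_assoc, univ_mul_step hΛ]

/-- Both sides are the positive part of the drift per lattice step; the finite mass of the downward
jumps cancels between `n + 2` and `n + 1`. -/
lemma univ_mul_one_sub_drift (hΛ : HasJumpIntensity P Λ) :
    Λ Set.univ * (1 - ∑' m : ℕ, (Λ[|Set.univ]) {-((m : ℤ) + 1)} * ((m : ℝ≥0∞) + 2)) =
      Λ {1} - ∑' n : ℕ, Λ {-((n : ℤ) + 1)} * ((n : ℝ≥0∞) + 1) := by
  rw [ENNReal.mul_sub fun _ _ => measure_ne_top _ _, mul_one, univ_mul_tsum hΛ, hΛ.measure_univ]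
  have h1 : ∑' n : ℕ, Λ {-((n : ℤ) + 1)} * ((n : ℝ≥0∞) + 2) =
      ∑' n : ℕ, Λ {-((n : ℤ) + 1)} * ((n : ℝ≥0∞) + 1) + Λ (Set.Iio 0) := by
    rw [hΛ.measure_Iio, ← ENNReal.tsum_add]
    exact tsum_congr fun n => by ring
  rw [h1, ENNReal.add_sub_add_eq_sub_right (measure_ne_top _ _)]

lemma univ_mul_hitRoot (hΛ : HasJumpIntensity P Λ)
    (hP : IsWalkLaw P (Λ.real Set.univ) (Λ[|Set.univ])) :
    Λ Set.univ * hitRoot P =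
      Λ {1} + ∑' n : ℕ, Λ {-((n : ℤ) + 1)} * hitRoot P ^ (n + 2) := by
  rw [← univ_mul_tsum hΛ, ← univ_mul_step hΛ 1, ← mul_add]
  congr 1
  exact hP.isHitArray.fixed_point

lemma hitRoot_le (hΛ : HasJumpIntensity P Λ)
    (hP : IsWalkLaw P (Λ.real Set.univ) (Λ[|Set.univ])) {x : ℝ≥0∞}
    (hx : Λ Set.univ * x = Λ {1} + ∑' n : ℕ, Λ {-((n : ℤ) + 1)} * x ^ (n + 2)) :
    hitRoot P ≤ x := by
  rw [← univ_mul_tsum hΛ, ← univ_mul_step hΛ 1, ← mul_add,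
    ENNReal.mul_right_inj hΛ.univ_ne_zero (measure_ne_top _ _)] at hx
  simpa [hitRoot] using hP.isHitArray.tsum_le_pow hx 1

lemma hitRoot_ne_zero (hΛ : HasJumpIntensity P Λ)
    (hP : IsWalkLaw P (Λ.real Set.univ) (Λ[|Set.univ])) : hitRoot P ≠ 0 := fun h0 => by
  have h1 := univ_mul_hitRoot hΛ hP
  rw [h0, mul_zero] at h1
  exact hΛ.one (add_eq_zero.1 h1.symm).1

end Root

/-! ### Finiteness and mean length of the first excursion -/

section Mean

variable {P : Measure SkipFreePath} {Λ : Measure ℤ} [IsFiniteMeasure Λ]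

lemma mul_depth_apply (h0 : Λ (Set.Iio 0) ≠ 0) (n : ℕ) :
    Λ (Set.Iio 0) * ((Λ[|Set.Iio 0]).map Neg.neg) {((n + 1 : ℕ) : ℤ)} = Λ {-((n : ℤ) + 1)} := by
  rw [Measure.map_apply Measurable.of_discrete MeasurableSet.of_discrete]
  have : (Neg.neg ⁻¹' {((n + 1 : ℕ) : ℤ)} : Set ℤ) = {-((n : ℤ) + 1)} := by
    refine Set.ext fun x => ?_
    simp only [Set.mem_preimage, Set.mem_singleton_iff]
    omega
  rw [this]
  exact mul_cond_apply MeasurableSet.of_discrete h0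
    (Set.singleton_subset_iff.2 (by rw [Set.mem_Iio]; omega))

variable (hP : IsExcursionLaw P (Λ.real Set.univ) (Λ[|Set.univ]) (Λ.real (Set.Iio 0))
    ((Λ[|Set.Iio 0]).map Neg.neg)) (hΛ : HasJumpIntensity P Λ)
include hP

lemma Iio_mul_tsum_exJumps (f : ℕ → ℝ≥0∞) :
    Λ (Set.Iio 0) * ∑' k : ℕ, P {p | exJumps p = (k + 1 : ℕ)} * f (k + 1) =
      ∑' n : ℕ, Λ {-((n : ℤ) + 1)} * ∑' k : ℕ, f k * P (hitEvent (n + 1 : ℕ) k) := by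
  have h1 := tsum_eq_zero_add' (f := fun k : ℕ => P {p | exJumps p = k} * f k) ENNReal.summable
  rw [Nat.cast_zero, hP.measure_exJumps_zero, zero_mul, zero_add] at h1
  rw [← h1]
  simp only [hP.measure_exJumps_eq', hP.measure_exJumps_eq, ← ENNReal.tsum_mul_right]
  rw [ENNReal.tsum_comm, ← ENNReal.tsum_mul_left]
  refine tsum_congr fun n => ?_
  rw [← mul_depth_apply (Iio_ne_zero hP) n, mul_assoc, ← ENNReal.tsum_mul_left,
    ← ENNReal.tsum_mul_left, ← ENNReal.tsum_mul_left]
  exact tsum_congr fun k => by ring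

lemma Iio_mul_measure_exLength_ne_top : Λ (Set.Iio 0) * P {p | exLength p ≠ ∞} =
    ∑' n : ℕ, Λ {-((n : ℤ) + 1)} * hitRoot P ^ (n + 1) := by
  have h1 := Iio_mul_tsum_exJumps hP fun _ => 1
  simp only [mul_one, one_mul, ← hP.measure_exLength_ne_top] at h1
  rw [h1]
  exact tsum_congr fun n => by rw [hP.walk.isHitArray.tsum_eq_pow (n + 1)]; rfl

include hΛ

/-- An excursion from depth `n + 1` is finite with probability `u ^ (n + 1)`; one more factor `u`
turns the sum over depths into that of the fixed point equation. -/
lemma finite_excursion_eq : Λ (Set.Iio 0) * P {p | exLength p ≠ ∞} * hitRoot P + Λ {1} =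
    Λ Set.univ * hitRoot P := by
  rw [Iio_mul_measure_exLength_ne_top hP, univ_mul_hitRoot hΛ hP.walk, ← ENNReal.tsum_mul_right,
    add_comm]
  congr 1
  exact tsum_congr fun n => by ring

lemma measureReal_exLength_ne_top_eq : 1 - P.real {p | exLength p ≠ ∞} =
    Λ.real {1} / Λ.real (Set.Iio 0) * ((hitRoot P).toReal⁻¹ - 1) := by
  have := hP.walk.prob
  have hu : hitRoot P ≠ ∞ := ne_top_of_le_ne_top ENNReal.one_ne_top (hitRoot_le_one hP.walk)
  have hu0 : (hitRoot P).toReal ≠ 0 :=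
    ENNReal.toReal_ne_zero.2 ⟨hitRoot_ne_zero hΛ hP.walk, hu⟩
  have h1 := congrArg ENNReal.toReal (finite_excursion_eq hP hΛ)
  have h2 := congrArg ENNReal.toReal hΛ.measure_univ
  rw [ENNReal.toReal_add (by finiteness) (by finiteness)] at h1 h2
  simp only [ENNReal.toReal_mul, ← measureReal_def] at h1 h2
  have h3 := hP.rate_pos.ne'
  rw [h2] at h1
  field_simp
  linarith

lemma hitRoot_eq_one_of_ae (h1 : P {p | exLength p ≠ ∞} = 1) : hitRoot P = 1 := by
  have h2 := finite_excursion_eq hP hΛ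
  rw [h1, mul_one, hΛ.measure_univ, add_mul, add_comm,
    ENNReal.add_left_inj (by
      exact ENNReal.mul_ne_top (measure_ne_top _ _)
        (ne_top_of_le_ne_top ENNReal.one_ne_top (hitRoot_le_one hP.walk)))] at h2
  have h3 : Λ {1} * hitRoot P = Λ {1} * 1 := by rw [mul_one, ← h2]
  exact (ENNReal.mul_right_inj hΛ.one (measure_ne_top _ _)).1 h3

/-- The expected length of an excursion. -/
theorem lintegral_exLength_eq : ∫⁻ p, exLength p ∂P =
    (∑' n : ℕ, Λ {-((n : ℤ) + 1)} * ((n : ℝ≥0∞) + 1)) /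
      ((Λ {1} - ∑' n : ℕ, Λ {-((n : ℤ) + 1)} * ((n : ℝ≥0∞) + 1)) * Λ (Set.Iio 0)) := by
  have := hP.walk.prob
  have ha := Iio_ne_zero hP
  have hC := hΛ.univ_ne_zero
  have hCt : Λ Set.univ ≠ ∞ := measure_ne_top _ _
  set A := ∑' n : ℕ, Λ {-((n : ℤ) + 1)} * ((n : ℝ≥0∞) + 1) with hA
  have hB := univ_mul_one_sub_drift hΛ
  rw [← hA] at hB
  have hc : ENNReal.ofReal (Λ.real Set.univ)⁻¹ = (Λ Set.univ)⁻¹ := by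
    rw [ENNReal.ofReal_inv_of_pos hP.walk.rate_pos, ofReal_measureReal]
  by_cases h1 : P {p | exLength p ≠ ∞} = 1
  -- If excursions are almost surely finite, every level is hit. The mean number of jumps from depth
  -- `n + 1` is then `n + 1` times that from depth `1`, and each jump takes mean time `(Λ univ)⁻¹`.
  · have hu := hitRoot_eq_one_of_ae hP hΛ h1
    have h2 : ∀ᵐ p ∂P, exLength p ≠ ∞ :=
      (prob_compl_eq_zero_iff IsExcursionLaw.measurableSet_exLength_ne_top).2 h1
    have h3 : ∫⁻ p, exLength p ∂P =
        ∫⁻ p in {p | exLength p ≠ ∞}, ENNReal.ofReal (exLength p).toReal ∂P := by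
      rw [Measure.restrict_eq_self_of_ae_mem (s := {p | exLength p ≠ ∞}) h2]
      refine lintegral_congr_ae ?_
      filter_upwards [h2] with p hp
      rw [ENNReal.ofReal_toReal hp]
    have h4 := Iio_mul_tsum_exJumps hP fun k => k * (Λ Set.univ)⁻¹
    have h5 : ∫⁻ p, exLength p ∂P = ∑' k : ℕ, P {p | exJumps p = (k + 1 : ℕ)} *
        ((k + 1 : ℕ) * (Λ Set.univ)⁻¹) := by
      rw [h3, hP.lintegral_exLength ENNReal.measurable_ofReal]
      refine tsum_congr fun k => ?_
      rw [lintegral_id_expSumLaw hP.walk.rate_pos, hc]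
    rw [← h5] at h4
    have h6 : Λ (Set.Iio 0) * ∫⁻ p, exLength p ∂P =
        A * (Λ {1} - A)⁻¹ := by
      rw [h4, ← hB, hA, ← ENNReal.tsum_mul_right]
      refine tsum_congr fun n => ?_
      have h7 := hP.walk.isHitArray.mean_eq_mul hu (n + 1)
      rw [hP.walk.isHitArray.mean_one hu] at h7
      rw [ENNReal.mul_inv (Or.inl hC) (Or.inl hCt), mul_assoc]
      congr 1
      have h8 : ∑' k : ℕ, (k : ℝ≥0∞) * (Λ Set.univ)⁻¹ * P (hitEvent ((n + 1 : ℕ) : ℤ) k) =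
          (Λ Set.univ)⁻¹ * ∑' k : ℕ, (k : ℝ≥0∞) * P (hitEvent ((n + 1 : ℕ) : ℤ) k) := by
        rw [← ENNReal.tsum_mul_left]
        exact tsum_congr fun k => by ring
      rw [h8, h7]
      push_cast
      ring
    rw [div_eq_mul_inv, ENNReal.mul_inv (Or.inr (measure_ne_top _ _)) (Or.inr ha), ← mul_assoc,
      ← h6, mul_right_comm, ENNReal.mul_inv_cancel ha (measure_ne_top _ _), one_mul]
  -- If infinite excursions have positive probability, the mean is infinite and the drift is
  -- nonpositive, so the truncated difference in the denominator vanishes. The numerator is at least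
  -- the mass of the downward jumps, hence not zero.
  · have h2 : P {p | exLength p = ∞} ≠ 0 := fun h => h1
      ((prob_compl_eq_zero_iff IsExcursionLaw.measurableSet_exLength_ne_top).1 (by
        rw [Set.compl_ofPred]; simpa using h))
    rw [lintegral_eq_top_of_measure_eq_top_ne_zero measurable_exLength.aemeasurable h2]
    have hu : hitRoot P ≠ 1 := fun hu => h1 (by
      have h3 := finite_excursion_eq hP hΛ
      rw [hu, mul_one, mul_one, hΛ.measure_univ, add_comm,
        ENNReal.add_right_inj (measure_ne_top _ _)] at h3
      exact (ENNReal.mul_right_inj ha (measure_ne_top _ _)).1 (by rw [h3, mul_one]))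
    have h3 := hP.walk.isHitArray.one_le_drift hu
    rw [tsub_eq_zero_of_le h3, mul_zero] at hB
    rw [← hB, zero_mul, ENNReal.div_zero]
    refine fun h0 => ha (le_antisymm ?_ zero_le)
    rw [hΛ.measure_Iio, ← h0, hA]
    exact ENNReal.tsum_le_tsum fun n => le_mul_of_one_le_right zero_le le_add_self

end Mean

/-! ### The Laplace exponent of the chain -/

lemma tendsto_exp_sub_one_div (y : ℝ) :
    Tendsto (fun β : ℝ => (Real.exp (β * y) - 1) / β) (𝓝[>] 0) (𝓝 y) := by
  have h1 : HasDerivAt (fun β : ℝ => Real.exp (β * y)) y 0 := by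
    simpa using ((hasDerivAt_id (0 : ℝ)).mul_const y).exp
  have h2 := (hasDerivAt_iff_tendsto_slope_zero.1 h1).mono_left
    (nhdsWithin_mono 0 fun x (hx : 0 < x) => hx.ne')
  refine h2.congr fun β => ?_
  simp [div_eq_inv_mul]

/-- Finite partial sums give the lower bound and `g` itself the upper one, so the limit may be
infinite. -/
lemma tendsto_tsum_of_le {ι : Type*} {l : Filter ι} {f : ι → ℕ → ℝ≥0∞} {g : ℕ → ℝ≥0∞}
    (hle : ∀ᶠ i in l, ∀ n, f i n ≤ g n) (hf : ∀ n, Tendsto (fun i => f i n) l (𝓝 (g n))) :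
    Tendsto (fun i => ∑' n, f i n) l (𝓝 (∑' n, g n)) := by
  refine tendsto_order.2 ⟨fun a ha => ?_, fun a ha => ?_⟩
  · rw [ENNReal.tsum_eq_iSup_nat, lt_iSup_iff] at ha
    obtain ⟨N, hN⟩ := ha
    have h1 := tendsto_finsetSum (Finset.range N) fun n _ => hf n
    filter_upwards [h1.eventually_const_lt hN] with i hi
    exact hi.trans_le (ENNReal.sum_le_tsum _)
  · filter_upwards [hle] with i hi
    exact (ENNReal.tsum_le_tsum hi).trans_lt ha

lemma toENNReal_sub_sub_self (x : ℝ) (L : ℝ≥0∞) :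
    ((x : EReal) - ((x : EReal) - (L : EReal))).toENNReal = L := by
  by_cases hL : L = ∞
  · rw [hL, EReal.coe_ennreal_top, EReal.sub_top, EReal.coe_sub_bot, EReal.toENNReal_top]
  · obtain ⟨l, rfl⟩ := exists_coe_eq hL
    rw [EReal.coe_nnreal_eq_coe_real, ← EReal.coe_sub, ← EReal.coe_sub, sub_sub_cancel,
      EReal.toENNReal_of_ne_top (EReal.coe_ne_top _), EReal.toReal_coe, ENNReal.ofReal_coe_nnreal]

section Chain

variable {Ω : Type*} [mΩ : MeasurableSpace Ω] {μ : Measure Ω} {ℱ : Filtration ℝ≥0 mΩ}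
  {X : ℝ≥0 → Ω → ℝ} {lam : Measure ℝ} {h : ℝ} {P : Measure SkipFreePath}

lemma lintegral_levyMeasure (hX : IsUpwardsSkipFreeLevyChain μ ℱ X lam h)
    (hΛ : HasJumpIntensity P (jumpMeasure lam h)) {f : ℝ → ℝ≥0∞} :
    ∫⁻ x, f x ∂lam = jumpMeasure lam h {1} * f h +
      ∑' n : ℕ, jumpMeasure lam h {-((n : ℤ) + 1)} * f (-((n + 1) * h)) := by
  have h1 := hΛ.lintegral_eq fun k => f (k * h)
  nth_rw 1 [jumpMeasure] at h1
  rw [lintegral_map (measurable_of_countable _) (measurable_latticeIndex h)] at h1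
  push_cast at h1
  simp only [one_mul, neg_mul] at h1
  rw [← h1]
  refine lintegral_congr_ae ?_
  filter_upwards [hX.ae_mem_Zh] with x hx
  obtain ⟨k, rfl⟩ := hx
  rw [round_mul_div hX.h_pos]

/-- The moment generating function of the Lévy measure. -/
def levyMgf (lam : Measure ℝ) (β : ℝ) : ℝ≥0∞ := ∫⁻ x, ENNReal.ofReal (Real.exp (β * x)) ∂lam

lemma levyMgf_eq (hX : IsUpwardsSkipFreeLevyChain μ ℱ X lam h)
    (hΛ : HasJumpIntensity P (jumpMeasure lam h)) (β : ℝ) :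
    levyMgf lam β = jumpMeasure lam h {1} * ENNReal.ofReal (Real.exp (β * h)) +
      ∑' n : ℕ, jumpMeasure lam h {-((n : ℤ) + 1)} *
        ENNReal.ofReal (Real.exp (-(β * h))) ^ (n + 1) := by
  rw [levyMgf, lintegral_levyMeasure hX hΛ]
  congr 1
  refine tsum_congr fun n => ?_
  rw [← ENNReal.ofReal_pow (Real.exp_nonneg _), ← Real.exp_nat_mul]
  congr 3
  push_cast
  ring

lemma levyMgf_ne_top (hX : IsUpwardsSkipFreeLevyChain μ ℱ X lam h) {β : ℝ} (hβ : 0 ≤ β) :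
    levyMgf lam β ≠ ∞ := by
  have := hX.finite
  refine ne_top_of_le_ne_top (b := ENNReal.ofReal (Real.exp (β * h)) * lam Set.univ)
    (by finiteness) ?_
  rw [← lintegral_const]
  refine lintegral_mono_ae ?_
  filter_upwards [hX.ae_le] with x hx
  refine ENNReal.ofReal_le_ofReal (Real.exp_le_exp.2 ?_)
  have := hX.h_pos
  have : x ≤ h := by rcases hx with hx | hx <;> linarith
  gcongr

lemma psi_eq (hX : IsUpwardsSkipFreeLevyChain μ ℱ X lam h) {β : ℝ} (hβ : 0 ≤ β) :
    psi lam β = (levyMgf lam β).toReal - lam.real Set.univ := by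
  have := hX.finite
  have h1 : Measurable fun x : ℝ => Real.exp (β * x) := by fun_prop
  have h2 : Integrable (fun x : ℝ => Real.exp (β * x)) lam := by
    refine (lintegral_ofReal_ne_top_iff_integrable h1.aestronglyMeasurable
      (.of_forall fun x => Real.exp_nonneg _)).1 (levyMgf_ne_top hX hβ)
  rw [psi, integral_sub h2 (integrable_const 1), integral_const, smul_eq_mul, mul_one,
    integral_eq_lintegral_of_nonneg_ae (.of_forall fun x => Real.exp_nonneg _)
      h1.aestronglyMeasurable, levyMgf]

lemma psi_zero (lam : Measure ℝ) : psi lam 0 = 0 := by simp [psi]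

/-- Multiplying `psi lam β = 0` by `x = e^{-βh}` turns it into the fixed point equation satisfied by
the hitting probability. -/
lemma psi_eq_zero_iff (hX : IsUpwardsSkipFreeLevyChain μ ℱ X lam h)
    (hΛ : HasJumpIntensity P (jumpMeasure lam h)) {β : ℝ} (hβ : 0 ≤ β) :
    psi lam β = 0 ↔ jumpMeasure lam h Set.univ * ENNReal.ofReal (Real.exp (-(β * h))) =
      jumpMeasure lam h {1} + ∑' n : ℕ, jumpMeasure lam h {-((n : ℤ) + 1)} *
        ENNReal.ofReal (Real.exp (-(β * h))) ^ (n + 2) := by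
  have := hX.finite
  set x := ENNReal.ofReal (Real.exp (-(β * h))) with hx
  have hx0 : x ≠ 0 := (ENNReal.ofReal_pos.2 (Real.exp_pos _)).ne'
  have hxt : x ≠ ∞ := ENNReal.ofReal_ne_top
  have h1 : levyMgf lam β * x = jumpMeasure lam h {1} +
      ∑' n : ℕ, jumpMeasure lam h {-((n : ℤ) + 1)} * x ^ (n + 2) := by
    rw [levyMgf_eq hX hΛ, ← hx, add_mul, ← ENNReal.tsum_mul_right, mul_assoc, hx,
      ← ENNReal.ofReal_mul (Real.exp_nonneg _), ← Real.exp_add, add_neg_cancel, Real.exp_zero,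
      ENNReal.ofReal_one, mul_one]
    congr 1
    exact tsum_congr fun n => by ring
  rw [← h1, ENNReal.mul_left_inj hx0 hxt, psi_eq hX hβ, sub_eq_zero, measureReal_def,
    ENNReal.toReal_eq_toReal_iff' (levyMgf_ne_top hX hβ) (measure_ne_top _ _),
    IsUpwardsSkipFreeLevyChain.jumpMeasure_univ, eq_comm]

/-- `Φ(0)` in terms of the probability of ever hitting the next level. -/
theorem exp_phiZero (hX : IsUpwardsSkipFreeLevyChain μ ℱ X lam h)
    (hΛ : HasJumpIntensity P (jumpMeasure lam h))
    (hP : IsWalkLaw P ((jumpMeasure lam h).real Set.univ) ((jumpMeasure lam h)[|Set.univ])) :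
    Real.exp (phiZero lam * h) = (hitRoot P).toReal⁻¹ := by
  have := hX.finite
  have : IsFiniteMeasure (jumpMeasure lam h) := by
    rw [jumpMeasure]
    infer_instance
  have hh := hX.h_pos
  have hu1 := hitRoot_le_one hP
  have hut : hitRoot P ≠ ∞ := ne_top_of_le_ne_top ENNReal.one_ne_top hu1
  set u := (hitRoot P).toReal with hu
  have hu0 : 0 < u := ENNReal.toReal_pos (hitRoot_ne_zero hΛ hP) hut
  have hu1' : u ≤ 1 := ENNReal.toReal_mono ENNReal.one_ne_top hu1
  have h1 : Real.exp (-(-Real.log u / h * h)) = u := by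
    rw [div_mul_cancel₀ _ hh.ne', neg_neg, Real.exp_log hu0]
  have hpos : 0 ≤ -Real.log u / h := div_nonneg (neg_nonneg.2 (Real.log_nonpos hu0.le hu1')) hh.le
  -- The map `β ↦ e^{-βh}` is decreasing, so the smallest fixed point `u` corresponds to the largest
  -- root `-log u / h`.
  have h2 : IsGreatest {β | 0 ≤ β ∧ psi lam β = 0} (-Real.log u / h) := by
    refine ⟨⟨hpos, ?_⟩, fun β hβ => ?_⟩
    · rw [psi_eq_zero_iff hX hΛ hpos, h1, ENNReal.ofReal_toReal hut]
      exact univ_mul_hitRoot hΛ hP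
    · have h3 := hitRoot_le hΛ hP ((psi_eq_zero_iff hX hΛ hβ.1).1 hβ.2)
      have h4 := ENNReal.toReal_mono ENNReal.ofReal_ne_top h3
      rw [ENNReal.toReal_ofReal (Real.exp_nonneg _), ← hu] at h4
      have h5 := (Real.le_log_iff_exp_le (Real.exp_pos (-(β * h)))).2 (le_refl _)
      have h6 := Real.log_le_log hu0 h4
      rw [Real.log_exp] at h6
      rw [le_div_iff₀ hh]
      linarith
  rw [phiZero, h2.csSup_eq, ← inv_inv (Real.exp _), ← Real.exp_neg, h1]

/-- The mean downward displacement per unit of time. -/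
def downDrift (lam : Measure ℝ) (h : ℝ) : ℝ≥0∞ :=
  ∑' n : ℕ, jumpMeasure lam h {-((n : ℤ) + 1)} * ((n : ℝ≥0∞) + 1)

/-- The upward and the downward contributions are kept apart, the latter as a sum of nonnegative
terms, because the mean downward jump may be infinite in the limit. -/
lemma psi_div_eq (hX : IsUpwardsSkipFreeLevyChain μ ℱ X lam h)
    (hΛ : HasJumpIntensity P (jumpMeasure lam h)) {β : ℝ} (hβ : 0 < β) :
    (((psi lam β - psi lam 0) / β : ℝ) : EReal) =
      (((jumpMeasure lam h).real {1} * ((Real.exp (β * h) - 1) / β) : ℝ) : EReal) -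
      ((∑' n : ℕ, jumpMeasure lam h {-((n : ℤ) + 1)} *
        ENNReal.ofReal ((1 - Real.exp (-(β * h)) ^ (n + 1)) / β) : ℝ≥0∞) : EReal) := by
  have := hX.finite
  have : IsFiniteMeasure (jumpMeasure lam h) := by
    rw [jumpMeasure]
    infer_instance
  set V := ∑' n : ℕ, jumpMeasure lam h {-((n : ℤ) + 1)} *
    ENNReal.ofReal ((1 - Real.exp (-(β * h)) ^ (n + 1)) / β) with hV
  have hx1 (n : ℕ) : Real.exp (-(β * h)) ^ (n + 1) ≤ 1 :=
    pow_le_one₀ (Real.exp_nonneg _) (Real.exp_le_one_iff.2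
      (neg_nonpos.2 (mul_nonneg hβ.le hX.h_pos.le)))
  have h1 : levyMgf lam β + ENNReal.ofReal β * V =
      jumpMeasure lam h {1} * ENNReal.ofReal (Real.exp (β * h)) +
        jumpMeasure lam h (Set.Iio 0) := by
    rw [levyMgf_eq hX hΛ, add_assoc, hV, ← ENNReal.tsum_mul_left, ← ENNReal.tsum_add,
      hΛ.measure_Iio]
    congr 1
    refine tsum_congr fun n => ?_
    rw [mul_left_comm, ← mul_add, ← ENNReal.ofReal_mul hβ.le, mul_div_cancel₀ _ hβ.ne',
      ← ENNReal.ofReal_pow (Real.exp_nonneg _), ← ENNReal.ofReal_add (by positivity)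
        (sub_nonneg.2 (hx1 n)), add_sub_cancel, ENNReal.ofReal_one, mul_one]
  have hVt : V ≠ ∞ := fun hV' => by
    rw [hV', ENNReal.mul_top (ENNReal.ofReal_pos.2 hβ).ne', add_top] at h1
    exact (by finiteness : jumpMeasure lam h {1} * ENNReal.ofReal (Real.exp (β * h)) +
        jumpMeasure lam h (Set.Iio 0) ≠ ∞) h1.symm
  have h2 := congrArg ENNReal.toReal h1
  rw [ENNReal.toReal_add (levyMgf_ne_top hX hβ.le) (by finiteness),
    ENNReal.toReal_add (by finiteness) (by finiteness), ENNReal.toReal_mul, ENNReal.toReal_mul,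
    ENNReal.toReal_ofReal hβ.le, ENNReal.toReal_ofReal (Real.exp_nonneg _), ← measureReal_def,
    ← measureReal_def] at h2
  have h3 := congrArg ENNReal.toReal hΛ.measure_univ
  rw [ENNReal.toReal_add (by finiteness) (by finiteness),
    IsUpwardsSkipFreeLevyChain.jumpMeasure_univ] at h3
  simp only [← measureReal_def] at h3
  have h4 : (V : EReal) = (V.toReal : EReal) := by
    rw [EReal.coe_ennreal_toReal hVt]
  rw [h4, ← EReal.coe_sub, psi_zero, sub_zero, psi_eq hX hβ.le, EReal.coe_eq_coe_iff]
  field_simp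
  linarith

/-- The right derivative of the Laplace exponent at `0`. -/
theorem psiDerivZero_eq (hX : IsUpwardsSkipFreeLevyChain μ ℱ X lam h)
    (hΛ : HasJumpIntensity P (jumpMeasure lam h)) :
    psiDerivZero lam = (((jumpMeasure lam h).real {1} * h : ℝ) : EReal) -
      ((ENNReal.ofReal h * downDrift lam h : ℝ≥0∞) : EReal) := by
  have hh := hX.h_pos
  refine Tendsto.limUnder_eq ?_
  have h1 : Tendsto (fun β : ℝ => (((jumpMeasure lam h).real {1} *
      ((Real.exp (β * h) - 1) / β) : ℝ) : EReal)) (𝓝[>] 0)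
      (𝓝 (((jumpMeasure lam h).real {1} * h : ℝ) : EReal)) :=
    EReal.tendsto_coe.2 ((tendsto_exp_sub_one_div h).const_mul _)
  have h2 : Tendsto (fun β : ℝ => ∑' n : ℕ, jumpMeasure lam h {-((n : ℤ) + 1)} *
      ENNReal.ofReal ((1 - Real.exp (-(β * h)) ^ (n + 1)) / β)) (𝓝[>] 0)
      (𝓝 (ENNReal.ofReal h * downDrift lam h)) := by
    have h3 (n : ℕ) (β : ℝ) : (1 - Real.exp (-(β * h)) ^ (n + 1)) / β =
        -((Real.exp (β * -((n + 1) * h)) - 1) / β) := by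
      rw [← Real.exp_nat_mul, ← neg_div, neg_sub]
      congr 3
      push_cast
      ring
    have h4 : ENNReal.ofReal h * downDrift lam h = ∑' n : ℕ,
        jumpMeasure lam h {-((n : ℤ) + 1)} * ENNReal.ofReal ((n + 1) * h) := by
      rw [downDrift, ← ENNReal.tsum_mul_left]
      refine tsum_congr fun n => ?_
      rw [ENNReal.ofReal_mul (by positivity), ENNReal.ofReal_add (by positivity) zero_le_one,
        ENNReal.ofReal_natCast, ENNReal.ofReal_one]
      ring
    rw [h4]
    -- The quotients `(1 - e^{-βy}) / β` are bounded by their limit `y`, since `e^{-z} ≥ 1 - z`.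
    refine tendsto_tsum_of_le ?_ fun n => ?_
    · filter_upwards [self_mem_nhdsWithin] with β (hβ : 0 < β) n
      gcongr
      rw [h3, ← neg_div, div_le_iff₀ hβ]
      have := Real.add_one_le_exp (β * -((n + 1) * h))
      linarith
    · refine ENNReal.Tendsto.const_mul (ENNReal.tendsto_ofReal ?_) (Or.inr ?_)
      · simp only [h3]
        have h5 := (tendsto_exp_sub_one_div (-((n + 1) * h))).neg
        rwa [neg_neg] at h5
      · have := hX.finite
        rw [jumpMeasure]
        exact measure_ne_top _ _
  -- Addition of extended reals is continuous here because the upward contribution is finite.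
  have h3 : Tendsto (fun p : EReal × EReal => p.1 + p.2)
      (𝓝 ((((jumpMeasure lam h).real {1} * h : ℝ) : EReal),
        -((ENNReal.ofReal h * downDrift lam h : ℝ≥0∞) : EReal)))
      (𝓝 ((((jumpMeasure lam h).real {1} * h : ℝ) : EReal) -
        ((ENNReal.ofReal h * downDrift lam h : ℝ≥0∞) : EReal))) :=
    EReal.continuousAt_add (Or.inl (EReal.coe_ne_top _)) (Or.inl (EReal.coe_ne_bot _))
  have h4 := h3.comp (h1.prodMk_nhds
    (((continuous_coe_ennreal_ereal.tendsto _).comp h2).neg))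
  refine h4.congr' ?_
  filter_upwards [self_mem_nhdsWithin] with β (hβ : 0 < β)
  rw [psi_div_eq hX hΛ hβ]
  rfl

lemma meanExcursionLength_eq (hX : IsUpwardsSkipFreeLevyChain μ ℱ X lam h)
    (hΛ : HasJumpIntensity P (jumpMeasure lam h)) :
    meanExcursionLength lam h = downDrift lam h /
      ((jumpMeasure lam h {1} - downDrift lam h) * jumpMeasure lam h (Set.Iio 0)) := by
  have := hX.finite
  have : IsFiniteMeasure (jumpMeasure lam h) := by
    rw [jumpMeasure]
    infer_instance
  have hh := hX.h_pos
  have h1 : lam.real {h} = (jumpMeasure lam h).real {1} := by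
    rw [measureReal_def, measureReal_def, hX.jumpMeasure_singleton, Int.cast_one, one_mul]
  -- Conversion to `[0, ∞]` already truncates at zero, so the maximum is absorbed; the common factor
  -- `h` cancels afterwards.
  have h2 : (max (psiDerivZero lam) 0).toENNReal = (psiDerivZero lam).toENNReal := by
    rcases le_total (psiDerivZero lam) 0 with h | h
    · rw [max_eq_right h, EReal.toENNReal_of_nonpos h, EReal.toENNReal_zero]
    · rw [max_eq_left h]
  have h3 : (((jumpMeasure lam h).real {1} * h : ℝ) : EReal).toENNReal =
      ENNReal.ofReal h * jumpMeasure lam h {1} := by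
    rw [EReal.toENNReal_of_ne_top (EReal.coe_ne_top _), EReal.toReal_coe,
      ENNReal.ofReal_mul measureReal_nonneg, ofReal_measureReal, mul_comm]
  rw [meanExcursionLength, h2, h1, psiDerivZero_eq hX hΛ, toENNReal_sub_sub_self,
    EReal.toENNReal_sub (EReal.coe_ennreal_nonneg _), h3, EReal.toENNReal_coe,
    ← ENNReal.mul_sub fun _ _ => ENNReal.ofReal_ne_top, mul_assoc,
    ENNReal.mul_div_mul_left _ _ (ENNReal.ofReal_pos.2 hh).ne' ENNReal.ofReal_ne_top,
    jumpMeasure_Iio hX]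

end Chain

/-! ### Excursions of the chain -/

section Coefficients

variable {Ω : Type*} [mΩ : MeasurableSpace Ω] {μ : Measure Ω} {ℱ : Filtration ℝ≥0 mΩ}
  {X : ℝ≥0 → Ω → ℝ} {lam : Measure ℝ} {h : ℝ}

lemma isFiniteMeasure_jumpMeasure (hX : IsUpwardsSkipFreeLevyChain μ ℱ X lam h) :
    IsFiniteMeasure (jumpMeasure lam h) := by
  have := hX.finite
  rw [jumpMeasure]
  infer_instance

lemma jumpMeasure_real_univ (lam : Measure ℝ) (h : ℝ) :
    (jumpMeasure lam h).real Set.univ = lam.real Set.univ :=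
  congrArg ENNReal.toReal (IsUpwardsSkipFreeLevyChain.jumpMeasure_univ lam h)

lemma jumpMeasure_real_Iio (hX : IsUpwardsSkipFreeLevyChain μ ℱ X lam h) :
    (jumpMeasure lam h).real (Set.Iio 0) = lam.real (Set.Iio 0) :=
  congrArg ENNReal.toReal (jumpMeasure_Iio hX)

lemma jumpMeasure_real_singleton (hX : IsUpwardsSkipFreeLevyChain μ ℱ X lam h) (k : ℤ) :
    (jumpMeasure lam h).real {k} = lam.real {(k : ℝ) * h} :=
  congrArg ENNReal.toReal (hX.jumpMeasure_singleton k)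

lemma toReal_cond_univ_singleton (hX : IsUpwardsSkipFreeLevyChain μ ℱ X lam h) (k : ℤ) :
    ((jumpMeasure lam h)[|Set.univ] {k}).toReal =
      lam.real {(k : ℝ) * h} / lam.real Set.univ := by
  rw [cond_apply MeasurableSet.univ, Set.univ_inter, ENNReal.toReal_mul, ENNReal.toReal_inv,
    ← measureReal_def, ← measureReal_def, jumpMeasure_real_univ, jumpMeasure_real_singleton hX,
    div_eq_inv_mul]

lemma toReal_step_one (hX : IsUpwardsSkipFreeLevyChain μ ℱ X lam h) :
    ((jumpMeasure lam h)[|Set.univ] {1}).toReal = pCoef lam h := by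
  rw [toReal_cond_univ_singleton hX, Int.cast_one, one_mul, pCoef]

lemma toReal_step_neg (hX : IsUpwardsSkipFreeLevyChain μ ℱ X lam h) (n : ℕ) :
    ((jumpMeasure lam h)[|Set.univ] {-((n : ℤ) + 1)}).toReal = qCoef lam h (n + 1) := by
  rw [toReal_cond_univ_singleton hX, qCoef]
  push_cast
  rw [neg_mul]

lemma IsPathVersion.exists_of_chain [IsProbabilityMeasure μ]
    (hX : IsUpwardsSkipFreeLevyChain μ ℱ X lam h) (hℱ : UsualConditions μ ℱ) :
    ∃ U, IsPathVersion μ ℱ X h U ∧ HasJumpIntensity (μ.map U) (jumpMeasure lam h) := by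
  obtain ⟨U, hU, hXU, hD⟩ := IsUpwardsSkipFreeLevyChain.exists_latticeWalk hX hℱ
  refine ⟨U, ⟨hℱ, hX.h_pos, hU, hXU⟩, ⟨hX.jumpMeasure_zero, hX.jumpMeasure_Ici_two,
    hX.jumpMeasure_one_ne_zero, fun B => ?_⟩⟩
  convert hD B using 2 with t
  exact congrArg ENNReal.toReal (Measure.map_apply hU.measurable
    (measurable_path_eval measurable_id t.toNNReal MeasurableSet.of_discrete))

lemma IsPathVersion.exists_isSubordinator [IsProbabilityMeasure μ] {U : Ω → SkipFreePath}
    (hM : IsPathVersion μ ℱ X h U) (hX : IsUpwardsSkipFreeLevyChain μ ℱ X lam h)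
    (hΛ : HasJumpIntensity (μ.map U) (jumpMeasure lam h)) :
    ∃ (q : ℝ) (Pi : Measure ℝ), IsKilledCompoundPoissonSubordinator μ
      (rightInverse (timeAtZero (reflected X))) q 1 Pi := by
  have := isFiniteMeasure_jumpMeasure hX
  rcases (measureReal_nonneg (μ := jumpMeasure lam h) (s := Set.Iio 0)).eq_or_lt with h0 | h0
  · exact ⟨_, _, hM.isSubordinator_of_eq_zero hΛ h0.symm⟩
  · exact ⟨_, _, hM.isSubordinator_of_pos (hM.walk.isExcursionLaw hΛ h0)⟩

end Coefficients

namespace IsPathVersion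

variable {Ω : Type*} [mΩ : MeasurableSpace Ω] {μ : Measure Ω} {ℱ : Filtration ℝ≥0 mΩ}
  {X : ℝ≥0 → Ω → ℝ} {h : ℝ} {U : Ω → SkipFreePath}

lemma measure_eq_of_ae (hM : IsPathVersion μ ℱ X h U) {D : Set Ω} {S : Set SkipFreePath}
    (hS : MeasurableSet S) (hDS : ∀ᵐ ω ∂μ, (ω ∈ D ↔ U ω ∈ S)) : μ D = (μ.map U) S := by
  rw [Measure.map_apply hM.walk.measurable hS]
  refine measure_congr ?_
  filter_upwards [hDS] with ω hω using propext hω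

/-- Completeness of `μ` makes an event measurable as soon as it agrees almost surely with one of the
lattice path. -/
lemma measurableSet_of_ae (hM : IsPathVersion μ ℱ X h U) {D : Set Ω} {S : Set SkipFreePath}
    (hS : MeasurableSet S) (hDS : ∀ᵐ ω ∂μ, (ω ∈ D ↔ U ω ∈ S)) : MeasurableSet D := by
  have : μ.IsComplete := hM.usual.complete
  refine NullMeasurableSet.measurable_of_complete (μ := μ)
    ((hM.walk.measurable hS).nullMeasurableSet.congr ?_)
  filter_upwards [hDS] with ω hω using propext hω.symm

lemma ae_excursion (hM : IsPathVersion μ ℱ X h U) (n : ℕ) : ∀ᵐ ω ∂μ,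
    excursionStart (reflected X) n ω = excursionStart reflPath n (U ω) ∧
      excursionLength (reflected X) n ω = excursionLength reflPath n (U ω) := by
  filter_upwards [hM.ae_eq] with ω hω
  exact ⟨(excursion_reflected_eq hM.h_pos hω n).1, excursionLength_reflected_eq hM.h_pos hω n⟩

lemma measurableSet_excursion (hM : IsPathVersion μ ℱ X h U) (n : ℕ) {A : Set ℝ≥0∞}
    (hA : MeasurableSet A) :
    MeasurableSet (excursionExists (reflected X) n ∩
      {ω | excursionLength (reflected X) n ω ∈ A}) := by
  refine hM.measurableSet_of_ae (S := excursionExists reflPath n ∩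
    {p | excursionLength reflPath n p ∈ A})
    (((measurable_excursion_reflPath n).1 measurableSet_Iio).inter
      (measurable_excursionLength_reflPath n hA)) ?_
  filter_upwards [hM.ae_excursion n] with ω hω
  simp only [excursionExists, Set.mem_inter_iff, Set.mem_ofPred_eq, hω.1, hω.2]

lemma measurable_excursionLength (hM : IsPathVersion μ ℱ X h U) (n : ℕ) :
    Measurable (excursionLength (reflected X) n) := by
  refine measurable_of_ae_eq (μ := μ) (fun N hN => ℱ.le 0 _ (hM.measurableSet_of_null 0 N hN))
    (g := fun ω => excursionLength reflPath n (U ω)) ?_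
    ((measurable_excursionLength_reflPath n).comp hM.walk.measurable)
  filter_upwards [hM.ae_excursion n] with ω hω using hω.2

lemma hitProb_eq (hM : IsPathVersion μ ℱ X h U) (l k : ℕ) :
    hitProb μ X h l k = ((μ.map U) (hitEvent l k)).toReal := by
  rw [hitProb, measureReal_def]
  refine congrArg _ (hM.measure_eq (measurableSet_hitEvent l k) fun ω p hω => ?_)
  simp only [Set.mem_ofPred_eq, firstTime_level_eq hM.h_pos hω, jumpCount_eq hM.h_pos hω,
    lt_top_iff_ne_top]
  rfl

variable {c a : ℝ} {r ρ : Measure ℤ}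

lemma ae_returnJumps (hM : IsPathVersion μ ℱ X h U) (hP : IsExcursionLaw (μ.map U) c r a ρ) :
    ∀ᵐ ω ∂μ, returnJumps X ω = exJumps (U ω) := by
  filter_upwards [hM.ae_eq, ae_of_ae_map hM.walk.measurable.aemeasurable hP.ne_top] with ω hω h1
    using returnJumps_eq hM.h_pos hω h1

lemma measure_returnJumps (hM : IsPathVersion μ ℱ X h U)
    (hP : IsExcursionLaw (μ.map U) c r a ρ) (k : ℕ) :
    μ {ω | returnJumps X ω = k} = (μ.map U) {p | exJumps p = k} := by
  refine hM.measure_eq_of_ae (IsExcursionLaw.measurableSet_exJumps k) ?_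
  filter_upwards [hM.ae_returnJumps hP] with ω hω
  rw [hω]

lemma ae_one_le_returnJumps (hM : IsPathVersion μ ℱ X h U)
    (hP : IsExcursionLaw (μ.map U) c r a ρ) : ∀ᵐ ω ∂μ, 1 ≤ returnJumps X ω := by
  have h1 := hM.measure_returnJumps hP 0
  rw [Nat.cast_zero, hP.measure_exJumps_zero] at h1
  filter_upwards [measure_eq_zero_iff_ae_notMem.1 h1] with ω hω
  exact Order.one_le_iff_ne_zero.2 hω

lemma exLengthLaw_eq_randomExpSumLaw (hM : IsPathVersion μ ℱ X h U)
    (hP : IsExcursionLaw (μ.map U) c r a ρ) :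
    exLengthLaw (μ.map U) = randomExpSumLaw μ (returnJumps X) c := by
  have hae : ∀ᵐ ω ∂μ, (ω ∈ {ω | returnJumps X ω < ⊤} ↔ U ω ∈ {p | exLength p ≠ ∞}) := by
    filter_upwards [hM.ae_returnJumps hP,
      ae_of_ae_map hM.walk.measurable.aemeasurable hP.ae_exLength_eq_top_iff] with ω h1 h2
    rw [h1, lt_top_iff_ne_top, ne_eq, ne_eq, h2]
  have hm := hM.measurableSet_of_ae IsExcursionLaw.measurableSet_exLength_ne_top hae
  have h1 := hM.measure_eq_of_ae IsExcursionLaw.measurableSet_exLength_ne_top hae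
  rw [exLengthLaw_eq hP, randomExpSumLaw]
  refine Measure.ext fun A hA => ?_
  rw [Measure.smul_apply, Measure.sum_apply _ hA, Measure.sum_apply _ hA, smul_eq_mul,
    ← ENNReal.tsum_mul_left]
  refine tsum_congr fun k => ?_
  rw [Measure.smul_apply, Measure.smul_apply, cond_apply hm, h1, smul_eq_mul, smul_eq_mul,
    ← hM.measure_returnJumps hP, mul_assoc]
  congr 3
  refine Set.ext fun ω => ⟨fun hω => ⟨?_, hω⟩, fun hω => hω.2⟩
  have h2 : returnJumps X ω = ((k + 1 : ℕ) : ℕ∞) := hω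
  rw [Set.mem_ofPred_eq, h2]
  exact ENat.natCast_lt_top _

variable [IsProbabilityMeasure μ]

lemma measure_excursion (hM : IsPathVersion μ ℱ X h U)
    (hP : IsExcursionLaw (μ.map U) c r a ρ) (n : ℕ) {A : Set ℝ≥0∞} (hA : MeasurableSet A) :
    μ (excursionExists (reflected X) n ∩ {ω | excursionLength (reflected X) n ω ∈ A}) =
      (μ.map U) {p | exLength p ≠ ∞} ^ n * (μ.map U) {p | exLength p ∈ A} := by
  rw [← measure_excursionLength hM.walk hP n hA]
  refine hM.measure_eq_of_ae (((measurable_excursion_reflPath n).1 measurableSet_Iio).inter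
      (measurable_excursionLength_reflPath n hA)) ?_
  filter_upwards [hM.ae_excursion n] with ω hω
  simp only [excursionExists, Set.mem_inter_iff, Set.mem_ofPred_eq, hω.1, hω.2]

lemma measure_excursionExists (hM : IsPathVersion μ ℱ X h U)
    (hP : IsExcursionLaw (μ.map U) c r a ρ) (n : ℕ) :
    μ (excursionExists (reflected X) n) = (μ.map U) {p | exLength p ≠ ∞} ^ n := by
  have := hP.walk.prob
  have h1 := hM.measure_excursion hP n MeasurableSet.univ
  simpa using h1

/-- The conditional law of the length of an excursion, given that it exists. -/
lemma map_excursionLength_cond (hM : IsPathVersion μ ℱ X h U)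
    (hP : IsExcursionLaw (μ.map U) c r a ρ) (n : ℕ) :
    (μ[|excursionExists (reflected X) n]).map (excursionLength (reflected X) n) =
      (μ.map U).map exLength := by
  have := hP.walk.prob
  have hm : MeasurableSet (excursionExists (reflected X) n) := by
    simpa using hM.measurableSet_excursion n MeasurableSet.univ
  refine Measure.ext fun A hA => ?_
  rw [Measure.map_apply (hM.measurable_excursionLength n) hA, Measure.map_apply measurable_exLength
    hA, cond_apply hm]
  refine (congrArg (_ * ·) (hM.measure_excursion hP n hA)).trans ?_
  rw [hM.measure_excursionExists hP, ← mul_assoc, ENNReal.inv_mul_cancel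
    (pow_ne_zero _ hP.measure_exLength_ne_top_pos.ne') (ENNReal.pow_ne_top (measure_ne_top _ _)),
    one_mul]
  rfl

lemma lintegral_excursionLength_cond (hM : IsPathVersion μ ℱ X h U)
    (hP : IsExcursionLaw (μ.map U) c r a ρ) (n : ℕ) :
    ∫⁻ ω, excursionLength (reflected X) n ω ∂(μ[|excursionExists (reflected X) n]) =
      ∫⁻ p, exLength p ∂(μ.map U) := by
  have h1 := lintegral_map (μ := μ[|excursionExists (reflected X) n]) measurable_id
    (hM.measurable_excursionLength n)
  have h2 := lintegral_map (μ := μ.map U) measurable_id measurable_exLength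
  rw [hM.map_excursionLength_cond hP] at h1
  exact h1.symm.trans h2

lemma measureReal_excursionLength_cond (hM : IsPathVersion μ ℱ X h U)
    (hP : IsExcursionLaw (μ.map U) c r a ρ) (n : ℕ) :
    (μ[|excursionExists (reflected X) n]).real {ω | excursionLength (reflected X) n ω = ∞} =
      1 - (μ.map U).real {p | exLength p ≠ ∞} := by
  have := hP.walk.prob
  have h1 := congrArg (fun ν => ν {∞}) (hM.map_excursionLength_cond hP n)
  simp only [Measure.map_apply (hM.measurable_excursionLength n) (measurableSet_singleton _),
    Measure.map_apply measurable_exLength (measurableSet_singleton _)] at h1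
  rw [← probReal_compl_eq_one_sub IsExcursionLaw.measurableSet_exLength_ne_top]
  refine (congrArg ENNReal.toReal h1).trans (congrArg _ (congrArg _ (Set.ext fun p => ?_)))
  simp

lemma measure_excursion_finite (hM : IsPathVersion μ ℱ X h U)
    (hP : IsExcursionLaw (μ.map U) c r a ρ) (n : ℕ) :
    μ (excursionExists (reflected X) n ∩ {ω | excursionLength (reflected X) n ω < ∞}) =
      (μ.map U) {p | exLength p ≠ ∞} ^ (n + 1) := by
  have h1 := hM.measure_excursion hP n measurableSet_Iio (A := Set.Iio ∞)
  simp only [Set.mem_Iio, lt_top_iff_ne_top] at h1 ⊢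
  rw [h1, pow_succ]

/-- The conditional law of the length of an excursion, given that it is finite. -/
lemma map_excursionLength_cond_finite (hM : IsPathVersion μ ℱ X h U)
    (hP : IsExcursionLaw (μ.map U) c r a ρ) (n : ℕ) :
    (μ[|excursionExists (reflected X) n ∩ {ω | excursionLength (reflected X) n ω < ∞}]).map
      (fun ω => (excursionLength (reflected X) n ω).toReal) = exLengthLaw (μ.map U) := by
  have := hP.walk.prob
  have hm : MeasurableSet (excursionExists (reflected X) n ∩
      {ω | excursionLength (reflected X) n ω < ∞}) :=
    hM.measurableSet_excursion n measurableSet_Iio (A := Set.Iio ∞)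
  have hm0 := hP.measure_exLength_ne_top_pos.ne'
  refine Measure.ext fun A hA => ?_
  rw [Measure.map_apply (hM.measurable_excursionLength n).ennreal_toReal hA, cond_apply hm,
    exLengthLaw, Measure.map_apply measurable_exLength.ennreal_toReal hA,
    cond_apply IsExcursionLaw.measurableSet_exLength_ne_top]
  have h1 := hM.measure_excursion hP n
    (measurableSet_Iio.inter (ENNReal.measurable_toReal hA)) (A := Set.Iio ∞ ∩ ENNReal.toReal ⁻¹' A)
  have e1 : {p | exLength p ≠ ∞} ∩ (fun p => (exLength p).toReal) ⁻¹' A =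
      {p | exLength p ∈ Set.Iio ∞ ∩ ENNReal.toReal ⁻¹' A} := by
    refine Set.ext fun p => ?_
    simp [lt_top_iff_ne_top]
  have e2 : μ (excursionExists (reflected X) n ∩ {ω | excursionLength (reflected X) n ω < ∞}) = _ :=
    hM.measure_excursion_finite hP n
  rw [e1, Set.inter_assoc]
  refine (congrArg₂ (fun x y => x⁻¹ * y) e2 h1).trans ?_
  rw [pow_succ, ENNReal.mul_inv (Or.inr (measure_ne_top _ _)) (Or.inr hm0), mul_mul_mul_comm,
    ENNReal.inv_mul_cancel (pow_ne_zero _ hm0) (ENNReal.pow_ne_top (measure_ne_top _ _)), one_mul]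

/-! ### The number of jumps of an excursion -/

/-- The Laplace transform of the length of an excursion in terms of its number of jumps. -/
lemma hasSum_exLaplace (hM : IsPathVersion μ ℱ X h U) (hP : IsExcursionLaw (μ.map U) c r a ρ)
    {θ : ℝ} (hθ : 0 ≤ θ) :
    HasSum (fun k : ℕ => μ.real {ω | returnJumps X ω = (k + 1 : ℕ)} * (c / (c + θ)) ^ (k + 1))
      (exLaplace (μ.map U) θ).toReal := by
  have hc := hP.walk.rate_pos
  have h1 : exLaplace (μ.map U) θ = ∑' k : ℕ, μ {ω | returnJumps X ω = (k + 1 : ℕ)} *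
      ENNReal.ofReal (c / (c + θ)) ^ (k + 1) := by
    rw [exLaplace, setLIntegral_expNeg measurable_exLength,
      hP.lintegral_exLength (f := fun x => ENNReal.ofReal (Real.exp (-θ * x))) (by fun_prop)]
    refine tsum_congr fun k => ?_
    rw [hM.measure_returnJumps hP, lintegral_exp_expSumLaw hc hθ]
  have h2 : exLaplace (μ.map U) θ ≠ ∞ :=
    ne_top_of_le_ne_top ENNReal.one_ne_top (exLaplace_le_one hM.walk hθ)
  rw [h1] at h2 ⊢
  have h3 := ENNReal.hasSum_toReal h2
  rw [← ENNReal.tsum_toReal_eq fun k => ENNReal.ne_top_of_tsum_ne_top h2 k] at h3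
  refine h3.congr_fun fun k => ?_
  rw [ENNReal.toReal_mul, ENNReal.toReal_pow, ENNReal.toReal_ofReal (by positivity),
    measureReal_def]

end IsPathVersion

/-! ### The recursion for the hitting probabilities -/

lemma sum_Icc_one (f : ℕ → ℝ) (N : ℕ) : ∑ m ∈ Finset.Icc 1 N, f m =
    ∑ m ∈ Finset.range N, f (m + 1) := by
  induction N with
  | zero => simp
  | succ N ih => rw [Finset.sum_Icc_succ_top (by omega), Finset.sum_range_succ, ih]

section Recursion

variable {Ω : Type*} [mΩ : MeasurableSpace Ω] {μ : Measure Ω} [IsProbabilityMeasure μ]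
  {ℱ : Filtration ℝ≥0 mΩ} {X : ℝ≥0 → Ω → ℝ} {lam : Measure ℝ} {h : ℝ} {U : Ω → SkipFreePath}
  (hM : IsPathVersion μ ℱ X h U) (hX : IsUpwardsSkipFreeLevyChain μ ℱ X lam h)
  (hΛ : HasJumpIntensity (μ.map U) (jumpMeasure lam h))
include hM hX hΛ

lemma isHitArray_chain : IsHitArray ((jumpMeasure lam h)[|Set.univ] {1})
    (fun m => (jumpMeasure lam h)[|Set.univ] {-((m : ℤ) + 1)})
    fun l k => (μ.map U) (hitEvent l k) := by
  have := isFiniteMeasure_jumpMeasure hX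
  exact (hM.walk.isWalkLaw hΛ).isHitArray

lemma hitProb_eq_zero_of_lt {l k : ℕ} (hlk : k < l) : hitProb μ X h l k = 0 := by
  rw [hM.hitProb_eq, (isHitArray_chain hM hX hΛ).eq_zero_of_lt hlk, ENNReal.toReal_zero]

lemma hitProb_diag (l : ℕ) : hitProb μ X h l l = pCoef lam h ^ l := by
  rw [hM.hitProb_eq, (isHitArray_chain hM hX hΛ).diag l, ENNReal.toReal_pow, toReal_step_one hX]

lemma hitProb_diag_succ (l : ℕ) : hitProb μ X h l (l + 1) = 0 := by
  rw [hM.hitProb_eq, (isHitArray_chain hM hX hΛ).diag_succ l, ENNReal.toReal_zero]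

lemma hitProb_zero_succ (k : ℕ) : hitProb μ X h 0 (k + 1) = 0 := by
  rw [hM.hitProb_eq, (isHitArray_chain hM hX hΛ).zero_succ k, ENNReal.toReal_zero]

/-- The sum over downward steps is finite because a level above `k` cannot be reached in `k` jumps.
-/
lemma hitProb_succ_succ (l k : ℕ) : hitProb μ X h (l + 1) (k + 1) =
    pCoef lam h * hitProb μ X h l k +
      ∑ m ∈ Finset.Icc 1 (k - l - 1), qCoef lam h m * hitProb μ X h (l + m + 1) k := by
  have := isFiniteMeasure_jumpMeasure hX
  have := hM.walk.isProbabilityMeasure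
  have h1 := congrArg ENNReal.toReal ((isHitArray_chain hM hX hΛ).succ_succ_eq_sum l k)
  rw [ENNReal.toReal_add (by finiteness) (ENNReal.sum_ne_top.2 fun m _ => by finiteness),
    ENNReal.toReal_sum fun m _ => by finiteness, ENNReal.toReal_mul, toReal_step_one hX] at h1
  simp only [ENNReal.toReal_mul, toReal_step_neg hX, ← hM.hitProb_eq] at h1
  rw [h1, sum_Icc_one]
  rfl

/-- The excursion begins at depth `l` with probability `q_l / (1 - p)`, the law of a jump given that
it is downward; afterwards it has to climb `l` levels in `k` jumps, which requires `l ≤ k`. -/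
lemma measureReal_returnJumps (h0 : 0 < lam.real (Set.Iio 0)) (k : ℕ) :
    μ.real {ω | returnJumps X ω = k} =
      ∑ l ∈ Finset.Icc 1 k, qCoef lam h l / (1 - pCoef lam h) * hitProb μ X h l k := by
  have := isFiniteMeasure_jumpMeasure hX
  have := hX.finite
  have := hM.walk.isProbabilityMeasure
  have hP := hM.walk.isExcursionLaw hΛ (by rwa [jumpMeasure_real_Iio hX])
  have hρ := hP.prob_depth
  have h1 : (1 - pCoef lam h) = lam.real (Set.Iio 0) / lam.real Set.univ := by
    have h2 := congrArg ENNReal.toReal hΛ.measure_univ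
    rw [ENNReal.toReal_add (by finiteness) (by finiteness)] at h2
    simp only [← measureReal_def, jumpMeasure_real_univ, jumpMeasure_real_Iio hX,
      jumpMeasure_real_singleton hX, Int.cast_one, one_mul] at h2
    have h3 : lam.real Set.univ ≠ 0 := by
      have := measureReal_nonneg (μ := lam) (s := {h})
      linarith
    rw [pCoef, eq_div_iff h3, sub_mul, one_mul, div_mul_cancel₀ _ h3]
    linarith
  have h2 (n : ℕ) : (((jumpMeasure lam h)[|Set.Iio 0]).map Neg.neg {((n + 1 : ℕ) : ℤ)}).toReal =
      qCoef lam h (n + 1) / (1 - pCoef lam h) := by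
    have h3 := congrArg ENNReal.toReal (mul_depth_apply (Iio_ne_zero hP) n)
    have h4 : lam.real Set.univ ≠ 0 := fun h4 => by
      have h5 := measureReal_mono (μ := lam) (Set.subset_univ (Set.Iio 0))
      linarith
    rw [ENNReal.toReal_mul, ← measureReal_def, jumpMeasure_real_Iio hX,
      ← measureReal_def (jumpMeasure lam h), jumpMeasure_real_singleton hX] at h3
    rw [h1, qCoef, div_div_div_cancel_right₀ h4, eq_div_iff h0.ne', mul_comm, h3]
    push_cast
    rw [neg_mul]
  rw [measureReal_def, hM.measure_returnJumps hP, hP.measure_exJumps_eq', hP.measure_exJumps_eq,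
    tsum_eq_sum (s := Finset.range k), ENNReal.toReal_sum fun n _ => by finiteness, sum_Icc_one]
  · refine Finset.sum_congr rfl fun n _ => ?_
    rw [ENNReal.toReal_mul, h2, hM.hitProb_eq]
  · intro n hn
    rw [Finset.mem_range] at hn
    rw [(isHitArray_chain hM hX hΛ).eq_zero_of_lt (l := n + 1) (by omega), mul_zero]

end Recursion

end SkipFree

end

/-! ### Assembly of the four statements -/

theorem mainTheorem8 {Ω : Type*} [mΩ : MeasurableSpace Ω] (μ : Measure Ω) [IsProbabilityMeasure μ]
    (ℱ : Filtration ℝ≥0 mΩ) (hℱ : UsualConditions μ ℱ) (X : ℝ≥0 → Ω → ℝ) (lam : Measure ℝ) (h : ℝ)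
    (hX : IsUpwardsSkipFreeLevyChain μ ℱ X lam h) :
    -- (i) the reflected process is Markov, with the stated generator matrix
    (∃ P : ℝ≥0 → ZhPlus h → ZhPlus h → ℝ,
      IsTransitionFunction (ZhPlus h) P ∧
      IsMarkovChain μ ℱ (ZhPlus h) P 0 (reflected X) ∧
      (∀ s ∈ ZhPlus h, IsMarkovChain μ ℱ (ZhPlus h) P s (reflectedFrom X s)) ∧
      IsGeneratorMatrix (ZhPlus h) P (reflectedGenerator lam h)) ∧
    -- (ii) holding point, local time at the maximum, and its inverse
    (IsHoldingPointZero μ (reflected X) ∧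
      IsLocalTimeAtMax μ ℱ X (timeAtZero (reflected X)) ∧
      ∃ (q : ℝ) (Pi : Measure ℝ), IsKilledCompoundPoissonSubordinator μ
        (rightInverse (timeAtZero (reflected X))) q 1 Pi) ∧
    -- (iii) expected length of an excursion, probability of an infinite excursion
    (0 < lam (Set.Iio 0) →
      μ (excursionExists (reflected X) 0) = 1 ∧
      ∀ n : ℕ, 0 < μ (excursionExists (reflected X) n) ∧
        ∫⁻ ω, excursionLength (reflected X) n ω ∂(μ[|excursionExists (reflected X) n]) =
          meanExcursionLength lam h ∧
        (μ[|excursionExists (reflected X) n]).real {ω | excursionLength (reflected X) n ω = ∞} =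
          pStar lam h) ∧
    -- (iv) the law of the inverse local time
    (0 < lam (Set.Iio 0) →
      (∀ᵐ ω ∂μ, 1 ≤ returnJumps X ω) ∧
      (∀ θ : ℝ, 0 ≤ θ →
        0 < ∫ ω in {ω | rightInverse (timeAtZero (reflected X)) 1 ω < ∞},
          Real.exp (-θ * (rightInverse (timeAtZero (reflected X)) 1 ω).toReal) ∂μ ∧
        Summable (fun k : ℕ => μ.real {ω | returnJumps X ω = (k + 1 : ℕ)} *
          (lam.real Set.univ / (lam.real Set.univ + θ)) ^ (k + 1)) ∧
        -Real.log (∫ ω in {ω | rightInverse (timeAtZero (reflected X)) 1 ω < ∞},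
            Real.exp (-θ * (rightInverse (timeAtZero (reflected X)) 1 ω).toReal) ∂μ) =
          θ + lam.real (Set.Iio 0) *
            (1 - ∑' k : ℕ, μ.real {ω | returnJumps X ω = (k + 1 : ℕ)} *
              (lam.real Set.univ / (lam.real Set.univ + θ)) ^ (k + 1))) ∧
      -- killing rate, Lévy mass and jump law of the inverse local time
      (∃ J : Measure ℝ, IsProbabilityMeasure J ∧ J (Set.Iic 0) = 0 ∧
        0 < 1 - pStar lam h ∧
        IsKilledCompoundPoissonSubordinator μ (rightInverse (timeAtZero (reflected X)))
          (lam.real (Set.Iio 0) * pStar lam h) 1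
          (ENNReal.ofReal (lam.real (Set.Iio 0) * (1 - pStar lam h)) • J) ∧
        (∀ n : ℕ,
          0 < μ (excursionExists (reflected X) n ∩ {ω | excursionLength (reflected X) n ω < ∞}) ∧
          (μ[|excursionExists (reflected X) n ∩
              {ω | excursionLength (reflected X) n ω < ∞}]).map
            (fun ω => (excursionLength (reflected X) n ω).toReal) = J) ∧
        J = randomExpSumLaw μ (returnJumps X) (lam.real Set.univ)) ∧
      -- the law of the number of jumps, and the recursion
      (∀ k : ℕ, 1 ≤ k → μ.real {ω | returnJumps X ω = k} =
        ∑ l ∈ Finset.Icc 1 k, qCoef lam h l / (1 - pCoef lam h) * hitProb μ X h l k) ∧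
      (∀ l : ℕ, 1 ≤ l → hitProb μ X h l 1 = if l = 1 then pCoef lam h else 0) ∧
      (∀ l k : ℕ, 1 ≤ l → 1 ≤ k →
        (l = k ∨ k + 1 < l → hitProb μ X h l (k + 1) = 0) ∧
        (l = 1 → hitProb μ X h l (k + 1) =
          ∑ m ∈ Finset.Icc 1 (k - 1), qCoef lam h m * hitProb μ X h (m + 1) k) ∧
        (l = k + 1 → hitProb μ X h l (k + 1) = pCoef lam h ^ (k + 1)) ∧
        (1 < l ∧ l < k → hitProb μ X h l (k + 1) =
          pCoef lam h * hitProb μ X h (l - 1) k +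
            ∑ m ∈ Finset.Icc 1 (k - l), qCoef lam h m * hitProb μ X h (m + l) k))) :=  by
  obtain ⟨U, hM, hΛ⟩ := IsPathVersion.exists_of_chain hX hℱ
  have hlam := hX.finite
  have hJ := isFiniteMeasure_jumpMeasure hX
  have hprob := hM.walk.isProbabilityMeasure
  refine ⟨hM.exists_transitionFunction hX hΛ, ⟨hM.isHoldingPointZero, hM.isLocalTimeAtMax,
    hM.exists_isSubordinator hX hΛ⟩, fun h0 => ?_, fun h0 => ?_⟩
  all_goals
    have h1 : 0 < (jumpMeasure lam h).real (Set.Iio 0) := by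
      rw [jumpMeasure_real_Iio hX]
      exact ENNReal.toReal_pos h0.ne' (measure_ne_top _ _)
    have hP := hM.walk.isExcursionLaw hΛ h1
    have hm0 := hP.measure_exLength_ne_top_pos
    have hm : 0 < (μ.map U).real {p | exLength p ≠ ∞} :=
      ENNReal.toReal_pos hm0.ne' (measure_ne_top _ _)
    -- The probability of an infinite excursion is expressed through the hitting probability `u` of
    -- the next level, and `u⁻¹ = e^{Φ(0)h}`.
    have hstar : 1 - (μ.map U).real {p | exLength p ≠ ∞} = pStar lam h := by
      rw [measureReal_exLength_ne_top_eq hP hΛ, pStar, exp_phiZero hX hΛ hP.walk,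
        jumpMeasure_real_Iio hX, jumpMeasure_real_singleton hX, Int.cast_one, one_mul]
  -- Excursions are numbered from zero: existence of the one with index `n` requires `n` finite ones
  -- before it, and for `n = 0` nothing.
  · refine ⟨by rw [hM.measure_excursionExists hP, pow_zero], fun n => ⟨?_, ?_, ?_⟩⟩
    · rw [hM.measure_excursionExists hP]
      exact ENNReal.pow_pos hm0 n
    · rw [hM.lintegral_excursionLength_cond hP, lintegral_exLength_eq hP hΛ,
        meanExcursionLength_eq hX hΛ, downDrift]
    · rw [hM.measureReal_excursionLength_cond hP, hstar]
  · have hsub : 1 - pStar lam h = (μ.map U).real {p | exLength p ≠ ∞} := by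
      rw [← hstar, sub_sub_cancel]
    refine ⟨hM.ae_one_le_returnJumps hP, fun θ hθ => ?_,
      ⟨exLengthLaw (μ.map U), isProbabilityMeasure_exLengthLaw hP, exLengthLaw_Iic_zero hP,
        by rwa [hsub], ?_, fun n => ⟨?_, hM.map_excursionLength_cond_finite hP n⟩, ?_⟩,
      fun k _ => ?_, fun l hl => ?_, fun l k hl hk => ⟨?_, ?_, ?_, ?_⟩⟩
    · have h2 := hM.hasSum_exLaplace hP hθ
      rw [jumpMeasure_real_univ] at h2
      rw [hM.setIntegral_exp_rightInverse, invLaplace_eq hM.walk hP hθ, jumpMeasure_real_Iio hX,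
        h2.tsum_eq, Real.log_exp]
      exact ⟨Real.exp_pos _, h2.summable, by simp⟩
    · rw [hsub, ← hstar, ← jumpMeasure_real_Iio hX]
      exact hM.isSubordinator_of_pos hP
    · rw [hM.measure_excursion_finite hP]
      exact ENNReal.pow_pos hm0 (n + 1)
    · rw [hM.exLengthLaw_eq_randomExpSumLaw hP, jumpMeasure_real_univ]
    · exact measureReal_returnJumps hM hX hΛ (by rwa [← jumpMeasure_real_Iio hX]) k
    · split_ifs with h2
      · rw [h2, hitProb_diag hM hX hΛ, pow_one]
      · exact hitProb_eq_zero_of_lt hM hX hΛ (by omega)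
    · rintro (rfl | h2)
      · exact hitProb_diag_succ hM hX hΛ l
      · exact hitProb_eq_zero_of_lt hM hX hΛ h2
    · rintro rfl
      obtain ⟨k, rfl⟩ := Nat.exists_eq_add_of_le' hk
      -- For level `1` an upward first step already hits the target, so it contributes nothing to
      -- hitting on jump `k + 1` with `k ≥ 1`.
      have h2 := hitProb_succ_succ hM hX hΛ 0 (k + 1)
      rw [hitProb_zero_succ hM hX hΛ, mul_zero, zero_add] at h2
      simpa only [zero_add, tsub_zero] using h2
    · rintro rfl
      exact hitProb_diag hM hX hΛ (k + 1)
    · rintro ⟨h2, h3⟩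
      obtain ⟨l, rfl⟩ := Nat.exists_eq_add_of_le' hl
      rw [hitProb_succ_succ hM hX hΛ, add_tsub_cancel_right, Nat.sub_sub]
      refine congrArg _ (Finset.sum_congr rfl fun m _ => ?_)
      rw [show l + m + 1 = m + (l + 1) by ring]
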